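/- **Setting.** Let $b:\mathbb R^q\to\mathbb R^q$ and $\sigma:\mathbb R^q\to\mathcal M_{q,\ell}(\mathbb R)$ be Lipschitz continuous, and let $\mathcal A g(y)=\langle\nabla g(y),b(y)\rangle+\frac12\mathrm{Tr}\big(\sigma(y)^*D^2g(y)\sigma(y)\big)$ be the generator of the diffusion $dY_t=b(Y_t)dt+\sigma(Y_t)dW_t$. Assume that there is $V\in\mathcal C^2(\mathbb R^q,[1,+\infty))$ with $\lim_{|y|\to\infty}V(y)=+\infty$ and $\mathcal AV\le-\alpha V+\beta$ for some $\alpha>0$, $\beta\ge0$, that $V$ is sub-quadratic ($|\nabla V|^2=O(V)$ and $D^2V$ is bounded), that $|b|^2+\mathrm{Tr}(\sigma\sigma^*)=O(V)$, and that the diffusion has a unique invariant distribution $\nu$. Let $(U_n)_{n\ge1}$ be an i.i.d. sequence of centered $\mathbb R^\ell$-valued random vectors with identity covariance matrix on a probability space $(\Omega,\mathcal F,\mathbb P)$, and $\bar Y_0$ an $\mathbb R^q$-valued random vector independent of it. Let $\bar\gamma=(\bar\gamma_n)_{n\ge1}$ be a non-increasing sequence of nonnegative numbers with $\bar\gamma_n\to0$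 and $\sum_n\bar\gamma_n=+\infty$ (hence $\bar\gamma_n>0$), and let $$\bar Y_{n+1}=\bar Y_n+\bar\gamma_{n+1}b(\bar Y_n)+\sqrt{\bar\gamma_{n+1}}\,\sigma(\bar Y_n)U_{n+1},\qquad n\ge0 .$$ Write $\Delta a_n=a_n-a_{n-1}$ ($n\ge2$) and $\bar\Gamma^{(\beta)}_n=\sum_{k=1}^n\bar\gamma_k^\beta$. A couple $(\bar\gamma,\eta)$ of nonnegative sequences with divergent sums is called averaging if, with $H_n=\sum_{k=1}^n\eta_k$, $\bar\gamma_n\to0$, $\sum_n\frac1{H_n}\big(\Delta\frac{\eta_n}{\bar\gamma_n}\big)_+<\infty$ and $\sum_n\big(\frac{\eta_n}{H_n\sqrt{\bar\gamma_n}}\big)^2<\infty$. Assume that $(\bar\gamma,1)$ and $(\bar\gamma,\frac1{\bar\gamma})$ are averaging. Let $p\ge2$ be an integer with $U_1\in L^{2(p+1)}$, and let $W$ be one of the following functions: (a) $W=V^{p+1}$, where $\mathbb E\,V(\bar Y_0)^{p+1}<\infty$ and either $\mathrm{Tr}(\sigma\sigma^*)=o(V)$ as $|y|\to\infty$, or the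 Euler scheme is strongly stable for $W$: there are $n_0\ge0$, $\alpha'>0$, $\beta'\ge0$ with $\mathbb E[W(\bar Y_{n+1})\mid\bar Y_0,\dots,\bar Y_n]\le(1-\alpha'\bar\gamma_{n+1})W(\bar Y_n)+\beta'\bar\gamma_{n+1}$ a.s. for all $n\ge n_0$; (b) $W=\exp(\lambda V^\zeta)$ with $0<\zeta\le1$ and $0<\lambda\le\lambda_0(\zeta)$, where $U_1$ is sub-normal ($\mathbb E\,e^{\langle h,U_1\rangle}\le e^{\kappa|h|^2/2}$ for some $\kappa\geq 0$ and all $h\in\mathbb R^\ell$), $\mathrm{Tr}(\sigma\sigma^*)\le C V^{1-\zeta}$ for some $C$, and $\mathbb E\,e^{cV(\bar Y_0)^\zeta}<\infty$ for some $c>0$; here $\lambda_0(\zeta)>0$ is a threshold that does not depend on $p$, nor on the functions $f$ and $\varphi$ below. Let $f:\mathbb R^q\to\mathbb R$ and let $\varphi\in\mathcal C^p(\mathbb R^q,\mathbb R)$ solve $\mathcal A\varphi=-(f-\nu(f))$ on $\mathbb R^q$, where $|D^j\varphi(y)|^2=o\big(W(y)/V(y)^j\big)$ as $|y|\to\infty$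 for $0\le j\le p$ (i.e. $\varphi\in\mathcal E_{p,W}$), and $D^p\varphi$ is Lipschitz. For $3\le r\le p$ put $$D_r(y)=\sum_{r/2\le j\le r}\frac{\binom{j}{r-j}}{j!}\,D^j\varphi(y)\cdot\Big(b(y)^{\otimes(r-j)},\ \mathbb E\big[(\sigma(y)U_1)^{\otimes(2j-r)}\big]\Big),$$ and let $q^*=\min\big(\{r\in\{3,\dots,p\}:D_r\not\equiv0\}\cup\{p+1\}\big)$. **Theorem.** There is a choice of the thresholds $\lambda_0(\zeta)>0$ such that the following holds for all $p,W,f,\varphi$ as above. Assume that $q^*\le p$, that $$\frac{\bar\Gamma_n^{(q^*/2-1)}}{\sqrt{\bar\Gamma_n^{(-1)}}}\xrightarrow[n\to\infty]{}\xi\in(0,+\infty],\qquad\Big(\big(\bar\Gamma_n^{(q^*/2-1)}\bar\gamma_n\big)^{-1}\Big)_{n\ge1}\ \text{is non-increasing},$$ $$\sum_{n}\frac1{\bar\Gamma_n^{(q^*/2-1)}}\Big|\Delta\frac1{\bar\gamma_n}\Big|<\infty\quad\text{and}\quad\sum_{n\ge1}\frac1{\bar\gamma_n\big(\bar\Gamma_n^{(q^*/2-1)}\big)^2}<\infty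 .$$ Then, with $\varepsilon_n=\bar\Gamma_n^{(q^*/2-1)}/n$, one has $\varepsilon_n\to0$ and $f\in\mathcal V_{\varepsilon_n,2}$, that is, $f\in L^2(\nu)$ and $$\frac1n\sum_{k=0}^{n-1}f(\bar Y_k)-\int f\,d\nu=O(\varepsilon_n)\quad\text{both }\mathbb P\text{-a.s. and in }L^2(\mathbb P).$$ -/

import Mathlib

open MeasureTheory ProbabilityTheory Filter Topology Asymptotics
open scoped NNReal ENNReal

noncomputable section

namespace StableEuler

/-- The Euclidean space `ℝ^q`. -/
abbrev Vec (q : ℕ) := EuclideanSpace ℝ (Fin q)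

/-! ### The diffusion `dY = b(Y) dt + σ(Y) dW`

The `q × ℓ` matrix `σ(y)` is represented by the linear map `ℝ^ℓ → ℝ^q` that it defines. -/

/-- `Tr(σσ*)` of a `q × ℓ` matrix: the sum of the squared norms of its columns. -/
def traceSq {q ℓ : ℕ} (s : Vec ℓ →L[ℝ] Vec q) : ℝ :=
  ∑ i : Fin ℓ, ‖s (EuclideanSpace.single i 1)‖ ^ 2

/-- The infinitesimal generator
`𝒜 g (y) = ⟨∇ g(y), b(y)⟩ + (1/2) Tr (σ(y)* D²g(y) σ(y))`. -/
def generator {q ℓ : ℕ} (b : Vec q → Vec q) (σ : Vec q → Vec ℓ →L[ℝ] Vec q)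
    (g : Vec q → ℝ) (y : Vec q) : ℝ :=
  fderiv ℝ g y (b y) + (1 / 2) * ∑ i : Fin ℓ,
    iteratedFDeriv ℝ 2 g y
      ![σ y (EuclideanSpace.single i 1), σ y (EuclideanSpace.single i 1)]

/-- `X` is a diffusion process with coefficients `b, σ` under `Q`: a continuous process that
solves the martingale problem for the generator on smooth compactly supported functions. -/
structure IsDiffusion {q ℓ : ℕ} (b : Vec q → Vec q) (σ : Vec q → Vec ℓ →L[ℝ] Vec q)
    {Ω : Type*} [MeasurableSpace Ω] (Q : Measure Ω) (X : ℝ≥0 → Ω → Vec q) : Prop where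
  stronglyMeasurable : ∀ t, StronglyMeasurable (X t)
  continuous_paths : ∀ ω, Continuous fun t => X t ω
  martingale : ∀ g : Vec q → ℝ, ContDiff ℝ ((⊤ : ℕ∞) : WithTop ℕ∞) g → HasCompactSupport g →
    Martingale
      (fun (t : ℝ≥0) ω => g (X t ω) - g (X 0 ω)
        - ∫ s in (0 : ℝ)..t, generator b σ g (X s.toNNReal ω))
      (Filtration.natural X stronglyMeasurable) Q

/-- `ν` is an invariant distribution of the diffusion: a probability measure such that the
diffusion started with law `ν` has law `ν` at every time, i.e. `ν P_t = ν` for all `t ≥ 0`.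
(For Lipschitz coefficients the law of the diffusion started from `ν` is unique.) -/
def IsInvariant {q ℓ : ℕ} (b : Vec q → Vec q) (σ : Vec q → Vec ℓ →L[ℝ] Vec q)
    (ν : Measure (Vec q)) : Prop :=
  IsProbabilityMeasure ν ∧
    ∃ (Ω : Type) (_ : MeasurableSpace Ω) (Q : Measure Ω) (X : ℝ≥0 → Ω → Vec q),
      IsProbabilityMeasure Q ∧ IsDiffusion b σ Q X ∧ ∀ t, Q.map (X t) = ν

/-- Strong stability of the diffusion with Lyapunov function `V`. -/
structure IsStronglyStable {q ℓ : ℕ} (b : Vec q → Vec q) (σ : Vec q → Vec ℓ →L[ℝ] Vec q)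
    (V : Vec q → ℝ) : Prop where
  contDiff : ContDiff ℝ 2 V
  one_le : ∀ y, 1 ≤ V y
  tendsto : Tendsto V (cocompact (Vec q)) atTop
  drift : ∃ α > (0 : ℝ), ∃ β ≥ (0 : ℝ), ∀ y, generator b σ V y ≤ -α * V y + β

/-- `V` is (essentially) sub-quadratic: `|∇V|² = O(V)` and `D²V` is bounded. -/
def IsSubquadratic {q : ℕ} (V : Vec q → ℝ) : Prop :=
  ∃ C : ℝ, ∀ y, ‖fderiv ℝ V y‖ ^ 2 ≤ C * V y ∧ ‖iteratedFDeriv ℝ 2 V y‖ ≤ C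

/-! ### The innovations and the Euler scheme -/

/-- `(U_n)_{n ≥ 1}` is a normalized white noise: i.i.d., square integrable, centered, with
identity covariance matrix. The value `U 0` plays no role. -/
structure IsWhiteNoise {ℓ : ℕ} {Ω : Type*} [MeasurableSpace Ω] (P : Measure Ω)
    (U : ℕ → Ω → Vec ℓ) : Prop where
  measurable : ∀ n ≥ 1, Measurable (U n)
  indep : iIndepFun (fun n => U (n + 1)) P
  identDistrib : ∀ n ≥ 1, IdentDistrib (U n) (U 1) P P
  memLp : MemLp (U 1) 2 P
  mean : ∀ i, ∫ ω, U 1 ω i ∂P = 0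
  cov : ∀ i j, ∫ ω, U 1 ω i * U 1 ω j ∂P = if i = j then 1 else 0

/-- The random vector `u` is sub-normal (sub-Gaussian): for some `κ`, all `h`,
`E exp⟨h, u⟩ ≤ exp (κ |h|² / 2)`. -/
def IsSubnormal {ℓ : ℕ} {Ω : Type*} [MeasurableSpace Ω] (P : Measure Ω)
    (u : Ω → Vec ℓ) : Prop :=
  ∃ κ : ℝ≥0, ∀ h : Vec ℓ, HasSubgaussianMGF (fun ω => inner ℝ h (u ω)) (κ * ‖h‖₊ ^ 2) P

/-- The Euler scheme with steps `γ_1, γ_2, …`: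
`Y_{n+1} = Y_n + γ_{n+1} b(Y_n) + √γ_{n+1} σ(Y_n) U_{n+1}`. -/
def eulerScheme {q ℓ : ℕ} (b : Vec q → Vec q) (σ : Vec q → Vec ℓ →L[ℝ] Vec q)
    (γ : ℕ → ℝ) {Ω : Type*} (U : ℕ → Ω → Vec ℓ) (Y₀ : Ω → Vec q) : ℕ → Ω → Vec q
  | 0, ω => Y₀ ω
  | n + 1, ω => eulerScheme b σ γ U Y₀ n ω + γ (n + 1) • b (eulerScheme b σ γ U Y₀ n ω)
      + √(γ (n + 1)) • σ (eulerScheme b σ γ U Y₀ n ω) (U (n + 1) ω)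

/-- Strong stability of type `(W, n₀)`, for some `n₀`, of a chain `Y` with steps `γ`:
`E[W(Y_{n+1}) | Y_0, …, Y_n] ≤ (1 - α γ_{n+1}) W(Y_n) + β γ_{n+1}` for `n ≥ n₀`. -/
def IsStableScheme {q : ℕ} {Ω : Type*} [MeasurableSpace Ω] (P : Measure Ω)
    (γ : ℕ → ℝ) (Y : ℕ → Ω → Vec q) (W : Vec q → ℝ) : Prop :=
  ∃ n₀ : ℕ, ∃ α > (0 : ℝ), ∃ β ≥ (0 : ℝ), ∀ n ≥ n₀,
    P[fun ω => W (Y (n + 1) ω) |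
        ⨆ k ∈ Set.Iic n, MeasurableSpace.comap (Y k) inferInstance]
      ≤ᵐ[P] fun ω => (1 - α * γ (n + 1)) * W (Y n ω) + β * γ (n + 1)

/-! ### Steps and weights, all indexed by `n ≥ 1` -/

/-- `Γ_n^{(β)} = ∑_{k=1}^n γ_k^β`. -/
def stepSum (γ : ℕ → ℝ) (β : ℝ) (n : ℕ) : ℝ := ∑ k ∈ Finset.Icc 1 n, γ k ^ β

/-- `(γ, η)` is an averaging step-weight system. The increments `Δ a_n = a_n - a_{n-1}` make
sense for `n ≥ 2`; they are indexed here by `n + 2`, `n ≥ 0`. -/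
structure IsAveraging (γ η : ℕ → ℝ) : Prop where
  step_nonneg : ∀ n ≥ 1, 0 ≤ γ n
  weight_nonneg : ∀ n ≥ 1, 0 ≤ η n
  step_sum : Tendsto (fun n => ∑ k ∈ Finset.Icc 1 n, γ k) atTop atTop
  weight_sum : Tendsto (fun n => ∑ k ∈ Finset.Icc 1 n, η k) atTop atTop
  step_tendsto : Tendsto γ atTop (𝓝 0)
  summable_increments : Summable fun n : ℕ =>
    1 / (∑ k ∈ Finset.Icc 1 (n + 2), η k) *
      max (η (n + 2) / γ (n + 2) - η (n + 1) / γ (n + 1)) 0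
  summable_squares : Summable fun n : ℕ =>
    (η (n + 1) / ((∑ k ∈ Finset.Icc 1 (n + 1), η k) * √(γ (n + 1)))) ^ 2

/-! ### The Poisson equation and the error expansion -/

/-- The class `ℰ_{p,W}` (relative to `V`): `C^p` functions such that
`|D^j φ(y)|² = o (W(y) / V(y)^j)` as `|y| → ∞`, for `0 ≤ j ≤ p`. -/
def poissonClass {q : ℕ} (V W : Vec q → ℝ) (p : ℕ) : Set (Vec q → ℝ) :=
  {φ | ContDiff ℝ p φ ∧ ∀ j ≤ p,
    (fun y => ‖iteratedFDeriv ℝ j φ y‖ ^ 2) =o[cocompact (Vec q)] fun y => W y / V y ^ j}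

/-- The function
`D_r(y) = ∑_{r/2 ≤ j ≤ r} (C(j, r-j) / j!) D^jφ(y) · (b(y)^{⊗(r-j)}, E (σ(y)U_1)^{⊗(2j-r)})`.
The `j`-linear form `D^jφ(y)` takes `r - j` times the argument `b(y)` and `2j - r` times the
argument `σ(y) U_1`; by linearity the expectation is taken outside. -/
def errorTerm {q ℓ : ℕ} (b : Vec q → Vec q) (σ : Vec q → Vec ℓ →L[ℝ] Vec q)
    {Ω : Type*} [MeasurableSpace Ω] (P : Measure Ω) (u : Ω → Vec ℓ)
    (φ : Vec q → ℝ) (r : ℕ) (y : Vec q) : ℝ :=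
  ∑ j ∈ (Finset.range (r + 1)).filter (fun j => r ≤ 2 * j),
    ((j.choose (r - j) : ℝ) / (j.factorial : ℝ)) *
      ∫ ω, iteratedFDeriv ℝ j φ y
        (fun i : Fin j => if (i : ℕ) < r - j then b y else σ y (u ω)) ∂P

/-- `q* = min {r ∈ {3, …, p} : D_r ≠ 0} ∧ (p + 1)`. -/
def qStar {q ℓ : ℕ} (b : Vec q → Vec q) (σ : Vec q → Vec ℓ →L[ℝ] Vec q)
    {Ω : Type*} [MeasurableSpace Ω] (P : Measure Ω) (u : Ω → Vec ℓ)
    (φ : Vec q → ℝ) (p : ℕ) : ℕ :=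
  sInf ({r | 3 ≤ r ∧ r ≤ p ∧ errorTerm b σ P u φ r ≠ 0} ∪ {p + 1})

/-- The conditions on the steps, in terms of the exponent `β = q*/2 - 1`. -/
structure StepConditions (γ : ℕ → ℝ) (β : ℝ) : Prop where
  /-- `Γ_n^{(β)} / √Γ_n^{(-1)}` tends to some `ξ ∈ (0, +∞]`. -/
  ratio : (∃ ξ > (0 : ℝ),
      Tendsto (fun n => stepSum γ β n / √(stepSum γ (-1) n)) atTop (𝓝 ξ)) ∨
    Tendsto (fun n => stepSum γ β n / √(stepSum γ (-1) n)) atTop atTop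
  /-- `((Γ_n^{(β)} γ_n)^{-1})_{n ≥ 1}` is non-increasing. -/
  antitone : ∀ n ≥ 1, (stepSum γ β (n + 1) * γ (n + 1))⁻¹ ≤ (stepSum γ β n * γ n)⁻¹
  summable_increments : Summable fun n : ℕ =>
    1 / stepSum γ β (n + 2) * |1 / γ (n + 2) - 1 / γ (n + 1)|
  summable_squares : Summable fun n : ℕ =>
    1 / (γ (n + 1) * stepSum γ β (n + 1) ^ 2)

/-! ### The functions with averaging rate `ε` -/

/-- The class `𝒱_{ε_n,r}`: the functions `f ∈ L^r(ν)` such that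
`(1/n) ∑_{k<n} f(Y_k) - ∫ f dν` is `O(ε_n)` almost surely and in `L^r(P)`. -/
def rateClass {q : ℕ} {Ω : Type*} [MeasurableSpace Ω] (P : Measure Ω)
    (Y : ℕ → Ω → Vec q) (ν : Measure (Vec q)) (ε : ℕ → ℝ) (r : ℝ≥0∞) :
    Set (Vec q → ℝ) :=
  {f | MemLp f r ν ∧
    (∀ᵐ ω ∂P, (fun n : ℕ => (1 / (n : ℝ)) * ∑ k ∈ Finset.range n, f (Y k ω) - ∫ y, f y ∂ν)
      =O[atTop] ε) ∧
    ∃ C : ℝ, ∀ n : ℕ, 1 ≤ n →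
      eLpNorm (fun ω => (1 / (n : ℝ)) * ∑ k ∈ Finset.range n, f (Y k ω) - ∫ y, f y ∂ν) r P
        ≤ ENNReal.ofReal (C * ε n)}

/-- The Lyapunov functions `W` of the Euler scheme that are used at order `p`:

* `W = V^{p+1}`, with `V(Y_0)^{p+1}` integrable, when `Tr(σσ*) = o(V)` or, more generally,
  the scheme is strongly stable with respect to `V^{p+1}`;
* `W = exp(λ V^ζ)`, `0 < ζ ≤ 1`, when `U_1` is sub-normal, `Tr(σσ*) ≤ C V^{1-ζ}`,
  `exp(c V(Y_0)^ζ)` is integrable for some `c > 0`, and `0 < λ ≤ lam₀ ζ`. -/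
def IsAdmissible {q ℓ : ℕ} (b : Vec q → Vec q) (σ : Vec q → Vec ℓ →L[ℝ] Vec q)
    (V : Vec q → ℝ) {Ω : Type*} [MeasurableSpace Ω] (P : Measure Ω)
    (γ : ℕ → ℝ) (U : ℕ → Ω → Vec ℓ) (Y₀ : Ω → Vec q) (p : ℕ) (lam₀ : ℝ → ℝ)
    (W : Vec q → ℝ) : Prop :=
  ((∀ y, W y = V y ^ (p + 1)) ∧
    Integrable (fun ω => V (Y₀ ω) ^ (p + 1)) P ∧
    ((fun y => traceSq (σ y)) =o[cocompact (Vec q)] V ∨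
      IsStableScheme P γ (eulerScheme b σ γ U Y₀) (fun y => V y ^ (p + 1)))) ∨
  ∃ ζ lam : ℝ, 0 < ζ ∧ ζ ≤ 1 ∧ 0 < lam ∧ lam ≤ lam₀ ζ ∧
    (∀ y, W y = Real.exp (lam * V y ^ ζ)) ∧
    IsSubnormal P (U 1) ∧
    (∃ C : ℝ, ∀ y, traceSq (σ y) ≤ C * V y ^ (1 - ζ)) ∧
    ∃ c > (0 : ℝ), Integrable (fun ω => Real.exp (c * V (Y₀ ω) ^ ζ)) P

end StableEuler

end

open StableEuler

/-!
The sum of `f - ν(f)` along the scheme is read off from the increments of `φ`. Expand `φ` along one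
step `γ b + √γ σ U` by Taylor's formula and sort the mean of the expansion by powers of `√γ`
(`exists_abs_integral_step_sub_le`): the coefficient of `√γ` vanishes because the innovations are
centred, the one of `γ` is `𝒜φ` because their covariance is the identity, and those of
`√γ ^ r`, `3 ≤ r < q*`, vanish by definition of `q*`. The mean increment of `φ` is thus
`γ 𝒜φ + O(γ^{q*/2} w)` with `w = √W`. Dividing by `γ_{k+1}` and using `𝒜φ = -(f - ν(f))`, the sum of
`f - ν(f)` is a sum of three parts: increments of `φ` weighted by `1 / γ_{k+1}`, treated by Abel
summation; a martingale, whose `L²` norm is of order `√Γ_n^{(-1)}`; and errors of order `γ^β w` with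
`β = q*/2 - 1`. The step conditions make each part `O(Γ_n^{(β)})`
(`IsLyapunovSequence.sum_rate`, `mem_rateClass`).

This needs control of `w` along the scheme, in mean and almost surely, which rests on a contraction
of `W` in mean over one step. It follows from the mean reversion of `V`: for powers of `V` the noise
must be small with respect to `V` (`exists_integral_pow_step_le`), and for `exp (λ V^ζ)` the
sub-normality of the innovations turns the noise into a term of order `λ² V^ζ` in the exponent,
dominated by the mean reversion `λ V^ζ` for small `λ` (`exists_integral_exp_step_le`). The threshold
on `λ` is also limited by the exponential moment of the initial value and by the first steps, to
which the contraction does not apply; it depends on `ζ`, not on `p`, `f` or `φ`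
(`exists_threshold`).

That `f` belongs to `L²(ν)` requires in addition `∫ W dν < ∞`, although `ν` is only known to be the
unique invariant distribution. An invariant distribution that integrates `W` is built from the
scheme. Time averages of the laws of its shifted paths, at rational times, are tight; a limit is
stationary, integrates `W`, and solves the martingale problem up to small errors
(`exists_stationary_limit`, `IsEulerChain.exists_isRationalSolution`). The fourth moments of the
increments pass to the limit, so that Kolmogorov's criterion gives a continuous modification
(`IsRationalSolution.ae_mem_regularPaths`, `continuous_extension`), which solves the martingale
problem exactly (`martingale_of_local`). Its marginal is invariant (`IsRationalSolution.isInvariant`)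
and equals `ν` by uniqueness (`IsSchemeLyapunov.integrable_invariant`).
-/

noncomputable section

namespace StableEuler


/-! ### Taylor expansion along a segment and symmetry of higher derivatives -/

section Taylor

variable {E F : Type*} [NormedAddCommGroup E] [NormedSpace ℝ E]
  [NormedAddCommGroup F] [NormedSpace ℝ F]

/-- Exchanging two neighbouring arguments does not change an iterated derivative. The first two
arguments are exchanged by the symmetry of second derivatives, the others by induction. -/
theorem iteratedFDeriv_comp_swap {k : ℕ} (i : Fin k) {f : E → F}
    (hf : ContDiff ℝ ((k + 1 : ℕ) : WithTop ℕ∞) f) (x : E) (v : Fin (k + 1) → E) :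
    iteratedFDeriv ℝ (k + 1) f x (v ∘ Equiv.swap i.castSucc i.succ)
      = iteratedFDeriv ℝ (k + 1) f x v := by
  induction k generalizing x with
  | zero => exact i.elim0
  | succ k ih =>
    have hd : Differentiable ℝ (iteratedFDeriv ℝ (k + 1) f) :=
      hf.differentiable_iteratedFDeriv (by exact_mod_cast Nat.lt_succ_self _)
    have key : ∀ v : Fin (k + 2) → E, iteratedFDeriv ℝ (k + 2) f x v
        = fderiv ℝ (fun y => iteratedFDeriv ℝ (k + 1) f y (Fin.tail v)) x (v 0) := by
      intro v
      rw [iteratedFDeriv_succ_apply_left]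
      rw [fderiv_continuousMultilinear_apply_const_apply (hd x)]
    refine Fin.cases ?_ (fun j => ?_) i
    · have hd0 : Differentiable ℝ (fderiv ℝ (iteratedFDeriv ℝ k f)) := by
        have h2 : ContDiff ℝ 2 (iteratedFDeriv ℝ k f) := by
          refine ContDiff.iteratedFDeriv_right (m := 2) hf ?_
          norm_cast
          omega
        exact (h2.fderiv_right (m := 1) (by norm_num)).differentiable (by norm_num)
      have key2 : ∀ v : Fin (k + 2) → E, iteratedFDeriv ℝ (k + 2) f x v
        = fderiv ℝ (fderiv ℝ (iteratedFDeriv ℝ k f)) x (v 0) (v 1) (Fin.tail (Fin.tail v)) := by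
        intro v
        rw [key]
        have : (fun y => iteratedFDeriv ℝ (k + 1) f y (Fin.tail v))
            = fun y => (fderiv ℝ (iteratedFDeriv ℝ k f) y (v 1)) (Fin.tail (Fin.tail v)) := by
          ext y
          rw [iteratedFDeriv_succ_apply_left]
          rfl
        rw [this]
        have hd1 : DifferentiableAt ℝ (fun y => fderiv ℝ (iteratedFDeriv ℝ k f) y (v 1)) x :=
          (hd0 x).clm_apply (differentiableAt_const _)
        rw [fderiv_continuousMultilinear_apply_const_apply hd1,
          fderiv_clm_apply (hd0 x) (differentiableAt_const _)]
        simp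
      have hs : IsSymmSndFDerivAt ℝ (iteratedFDeriv ℝ k f) x := by
        have h2 : ContDiff ℝ 2 (iteratedFDeriv ℝ k f) := by
          refine ContDiff.iteratedFDeriv_right (m := 2) hf ?_
          norm_cast
          omega
        exact h2.contDiffAt.isSymmSndFDerivAt (by simp)
      rw [key2, key2, hs.eq]
      have e0 : (v ∘ Equiv.swap (Fin.castSucc (0 : Fin (k + 1))) (Fin.succ 0)) 0 = v 1 := by
        simp
      have e1 : (v ∘ Equiv.swap (Fin.castSucc (0 : Fin (k + 1))) (Fin.succ 0)) 1 = v 0 := by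
        simp
      have e2 : Fin.tail (Fin.tail (v ∘ Equiv.swap (Fin.castSucc (0 : Fin (k + 1))) (Fin.succ 0)))
          = Fin.tail (Fin.tail v) := by
        ext j
        simp only [Fin.tail, Function.comp]
        rw [Equiv.swap_apply_of_ne_of_ne]
        · simp [Fin.ext_iff]
        · simp [Fin.ext_iff]
      rw [e0, e1, e2]
    · rw [key, key]
      have e0 : (v ∘ Equiv.swap (Fin.castSucc j.succ) (Fin.succ j.succ)) 0 = v 0 := by
        simp only [Function.comp]
        rw [Equiv.swap_apply_of_ne_of_ne]
        · simp [Fin.ext_iff]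
        · simp [Fin.ext_iff]
      have e1 : Fin.tail (v ∘ Equiv.swap (Fin.castSucc j.succ) (Fin.succ j.succ))
          = Fin.tail v ∘ Equiv.swap j.castSucc j.succ := by
        ext l
        simp only [Fin.tail, Function.comp]
        congr 1
        rw [← Fin.succ_castSucc]
        exact ((Fin.succ_injective _).swap_apply _ _ _).symm ▸ rfl
      rw [e0, e1]
      congr 2
      ext y
      exact ih j (hf.of_le (by exact_mod_cast Nat.le_succ _)) y _

/-- The `n`-th derivative of a `C^n` function is symmetric. -/
theorem iteratedFDeriv_comp_perm {n : ℕ} {f : E → F}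
    (hf : ContDiff ℝ (n : WithTop ℕ∞) f) (x : E) (v : Fin n → E) (σ : Equiv.Perm (Fin n)) :
    iteratedFDeriv ℝ n f x (v ∘ σ) = iteratedFDeriv ℝ n f x v := by
  cases n with
  | zero => congr 1; ext i; exact i.elim0
  | succ k =>
    have hσ : σ ∈ Submonoid.closure
        (Set.range fun i : Fin k => Equiv.swap i.castSucc i.succ) := by
      rw [Equiv.Perm.mclosure_swap_castSucc_succ]; trivial
    induction hσ using Submonoid.closure_induction generalizing v with
    | mem τ hτ => obtain ⟨i, rfl⟩ := hτ; exact iteratedFDeriv_comp_swap i hf x v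
    | one => rfl
    | mul a b _ _ ha hb =>
      have : v ∘ (a * b : Equiv.Perm (Fin (k + 1))) = (v ∘ a) ∘ b := rfl
      rw [this, hb, ha]

/-- Binomial formula for a symmetric multilinear form. -/
theorem map_add_eq_sum_choose {n : ℕ} (L : ContinuousMultilinearMap ℝ (fun _ : Fin n => E) F)
    (hL : ∀ (v : Fin n → E) (σ : Equiv.Perm (Fin n)), L (v ∘ σ) = L v) (a c : E) :
    L (fun _ => a + c) = ∑ i ∈ Finset.range (n + 1),
      n.choose i • L (fun k : Fin n => if (k : ℕ) < i then a else c) := by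
  have h1 : L (fun _ => a + c)
      = ∑ s : Finset (Fin n), L (s.piecewise (fun _ => a) (fun _ => c)) := by
    rw [← L.map_add_univ]; rfl
  have h2 : ∀ s : Finset (Fin n), L (s.piecewise (fun _ => a) (fun _ => c))
      = L (fun k : Fin n => if (k : ℕ) < s.card then a else c) := by
    intro s
    have hcard : s.card = (Finset.univ.filter fun k : Fin n => (k : ℕ) < s.card).card := by
      have : s.card ≤ n := by simpa using s.card_le_univ
      rw [Fin.card_filter_val_lt]; omega
    obtain ⟨σ, hσ⟩ : ∃ σ : Equiv.Perm (Fin n), ∀ k, σ k ∈ s ↔ (k : ℕ) < s.card := by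
      obtain ⟨e⟩ : Nonempty ({k : Fin n // (k : ℕ) < s.card} ≃ {k // k ∈ s}) := by
        refine ⟨Fintype.equivOfCardEq ?_⟩
        rw [Fintype.card_subtype, Fintype.card_coe]
        exact hcard.symm
      exact ⟨e.extendSubtype, fun k => ⟨fun h => by
        by_contra hk; exact e.extendSubtype_not_mem k hk h, fun h => e.extendSubtype_mem k h⟩⟩
    rw [← hL _ σ]
    congr 1
    ext k
    simp [Finset.piecewise, hσ]
  rw [h1, Finset.sum_congr rfl fun s _ => h2 s]
  have := Finset.sum_powerset_apply_card
    (fun i => L (fun k : Fin n => if (k : ℕ) < i then a else c)) (x := (Finset.univ : Finset (Fin n)))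
  rw [Finset.powerset_univ] at this
  rw [this]
  simp

/-- The iterated derivatives of `t ↦ f (x + t h)`. -/
theorem iteratedDeriv_comp_line {n : ℕ} {f : E → F} (hf : ContDiff ℝ (n : WithTop ℕ∞) f)
    (x h : E) (t : ℝ) :
    iteratedDeriv n (fun t : ℝ => f (x + t • h)) t
      = iteratedFDeriv ℝ n f (x + t • h) (fun _ => h) := by
  have h1 := ContinuousLinearMap.iteratedFDeriv_comp_right
    (ContinuousLinearMap.toSpanSingleton ℝ h) (f := fun z => f (x + z))
    (hf.comp (contDiff_const.add contDiff_id)) t (i := n) le_rfl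
  rw [iteratedDeriv_eq_iteratedFDeriv]
  have h2 : (fun t : ℝ => f (x + t • h))
    = (fun z => f (x + z)) ∘ (ContinuousLinearMap.toSpanSingleton ℝ h) := by
    ext t; simp
  rw [h2, h1]
  simp [ContinuousLinearMap.toSpanSingleton_apply, iteratedFDeriv_comp_add_left]

/-- Taylor's formula with Lagrange remainder on the segment `[x, x + h]`. -/
theorem exists_taylor_segment {n : ℕ} {f : E → ℝ}
    (hf : ContDiff ℝ ((n + 1 : ℕ) : WithTop ℕ∞) f) (x h : E) :
    ∃ t ∈ Set.Ioo (0 : ℝ) 1, f (x + h)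
      = ∑ j ∈ Finset.range (n + 1), (1 / (j.factorial : ℝ)) * iteratedFDeriv ℝ j f x (fun _ => h)
        + (1 / ((n + 1).factorial : ℝ)) * iteratedFDeriv ℝ (n + 1) f (x + t • h) (fun _ => h) := by
  set g : ℝ → ℝ := fun t => f (x + t • h) with hg
  have hgc : ContDiff ℝ ((n + 1 : ℕ) : WithTop ℕ∞) g :=
    hf.comp (contDiff_const.add (contDiff_id.smul contDiff_const))
  obtain ⟨t, ht, he⟩ := taylor_mean_remainder_lagrange_iteratedDeriv (f := g) (x₀ := 0) (x := 1)
    (n := n) (by norm_num) (by exact_mod_cast hgc.contDiffOn)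
  rw [Set.uIoo_of_le zero_le_one] at ht
  refine ⟨t, ht, ?_⟩
  have e1 : taylorWithinEval g n (Set.uIcc 0 1) 0 1
      = ∑ j ∈ Finset.range (n + 1),
        (1 / (j.factorial : ℝ)) * iteratedFDeriv ℝ j f x (fun _ => h) := by
    rw [taylor_within_apply]
    refine Finset.sum_congr rfl fun j hj => ?_
    have hj' : j ≤ n + 1 := (Finset.mem_range.1 hj).le
    have hcj : ContDiff ℝ (j : WithTop ℕ∞) g := hgc.of_le (by exact_mod_cast hj')
    rw [iteratedDerivWithin_eq_iteratedDeriv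
      (by rw [Set.uIcc_of_le zero_le_one]; exact uniqueDiffOn_Icc zero_lt_one)
      hcj.contDiffAt (by simp), hg,
      iteratedDeriv_comp_line (hf.of_le (by exact_mod_cast hj'))]
    simp
  rw [e1, iteratedDeriv_comp_line hf] at he
  have e2 : g 1 = f (x + h) := by simp [hg]
  rw [e2] at he
  rw [sub_eq_iff_eq_add'.1 he]
  ring

/-- Taylor expansion of order `p` when the `p`-th derivative is Lipschitz. -/
theorem abs_taylor_remainder_le {p : ℕ} (hp : 1 ≤ p) {f : E → ℝ} {K : ℝ≥0}
    (hf : ContDiff ℝ (p : WithTop ℕ∞) f) (hK : LipschitzWith K (iteratedFDeriv ℝ p f)) (x h : E) :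
    |f (x + h) - ∑ j ∈ Finset.range (p + 1),
      (1 / (j.factorial : ℝ)) * iteratedFDeriv ℝ j f x (fun _ => h)| ≤ K * ‖h‖ ^ (p + 1) := by
  obtain ⟨n, rfl⟩ : ∃ n, p = n + 1 := ⟨p - 1, by omega⟩
  obtain ⟨t, ht, he⟩ := exists_taylor_segment hf x h
  rw [Finset.sum_range_succ, he]
  have e : ∀ S A B c : ℝ, S + c * A - (S + c * B) = c * (A - B) := by intros; ring
  rw [e, abs_mul]
  have h1 : |1 / ((n + 1).factorial : ℝ)| ≤ 1 := by
    rw [abs_of_nonneg (by positivity), div_le_one (by positivity)]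
    exact_mod_cast Nat.one_le_iff_ne_zero.2 (Nat.factorial_ne_zero _)
  have h2 : |iteratedFDeriv ℝ (n + 1) f (x + t • h) (fun _ => h)
      - iteratedFDeriv ℝ (n + 1) f x (fun _ => h)| ≤ K * ‖h‖ * ‖h‖ ^ (n + 1) := by
    rw [← sub_apply, ← Real.norm_eq_abs]
    refine (ContinuousMultilinearMap.le_opNorm _ _).trans ?_
    simp only [Finset.prod_const, Finset.card_univ, Fintype.card_fin]
    gcongr
    have := hK.dist_le_mul (x + t • h) x
    rw [dist_eq_norm, dist_eq_norm] at this
    refine this.trans ?_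
    gcongr
    rw [add_sub_cancel_left, norm_smul, Real.norm_eq_abs, abs_of_pos ht.1]
    exact mul_le_of_le_one_left (norm_nonneg _) ht.2.le
  calc _ ≤ 1 * (K * ‖h‖ * ‖h‖ ^ (n + 1)) := mul_le_mul h1 h2 (abs_nonneg _) zero_le_one
    _ = _ := by ring

/-- Second order expansion when the second derivative is bounded. -/
theorem abs_sub_sub_fderiv_le {f : E → ℝ} (hf : ContDiff ℝ 2 f) {C : ℝ}
    (hC : ∀ y, ‖iteratedFDeriv ℝ 2 f y‖ ≤ C) (x h : E) :
    |f (x + h) - f x - fderiv ℝ f x h| ≤ C * ‖h‖ ^ 2 := by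
  obtain ⟨t, -, he⟩ := exists_taylor_segment (n := 1) (by exact_mod_cast hf) x h
  have h2 : |iteratedFDeriv ℝ 2 f (x + t • h) (fun _ => h)| ≤ C * ‖h‖ ^ 2 := by
    rw [← Real.norm_eq_abs]
    refine (ContinuousMultilinearMap.le_opNorm _ _).trans ?_
    simp only [Finset.prod_const, Finset.card_univ, Fintype.card_fin]
    gcongr
    exact hC _
  simp only [Finset.sum_range_succ, Finset.sum_range_zero, Nat.factorial, iteratedFDeriv_zero_apply,
    iteratedFDeriv_one_apply] at he
  rw [he]
  have e : ∀ a b c : ℝ, 0 + 1 / ((1 : ℕ) : ℝ) * a + 1 / (((0 + 1) * 1 : ℕ) : ℝ) * b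
      + 1 / (((1 + 1) * ((0 + 1) * 1) : ℕ) : ℝ) * c - a - b = (1 / 2) * c := by
    intros; push_cast; ring
  rw [e, abs_mul]
  calc _ ≤ 1 * (C * ‖h‖ ^ 2) :=
      mul_le_mul (by rw [abs_of_nonneg] <;> norm_num) h2 (abs_nonneg _) zero_le_one
    _ = _ := one_mul _

end Taylor


/-! ### The Euler scheme as a Markov chain -/

section Freezing

variable {Ω E F : Type*} {m mΩ : MeasurableSpace Ω} {P : Measure Ω}
  [MeasurableSpace E] [MeasurableSpace F]

/-- If `Z` is `m`-measurable and `u` is independent of `m`, the conditional expectation of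
`h (Z, u)` given `m` is obtained by integrating `u` out with `Z` frozen. -/
theorem condExp_freeze [IsProbabilityMeasure P] (hm : m ≤ mΩ) {Z : Ω → E} {u : Ω → F}
    (hZ : Measurable[m] Z) (hu : Measurable u)
    (hind : Indep m (MeasurableSpace.comap u inferInstance) P) {h : E → F → ℝ}
    (hh : Measurable (Function.uncurry h)) (hint : Integrable (fun ω => h (Z ω) (u ω)) P) :
    P[fun ω => h (Z ω) (u ω) | m] =ᵐ[P] fun ω => ∫ ω', h (Z ω) (u ω') ∂P := by
  have hZ' : Measurable Z := hZ.mono hm le_rfl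
  have hinner : ∀ y, ∫ ω', h y (u ω') ∂P = ∫ v, h y v ∂(P.map u) := fun y => by
    rw [integral_map hu.aemeasurable]
    exact (hh.comp measurable_prodMk_left).aestronglyMeasurable
  have hsm : StronglyMeasurable fun y => ∫ v, h y v ∂(P.map u) := by
    have : IsProbabilityMeasure (P.map u) := Measure.isProbabilityMeasure_map hu.aemeasurable
    exact (hh.stronglyMeasurable).integral_prod_right
  simp only [hinner]
  have hindT : ∀ {G : Type _} [MeasurableSpace G] (T : Ω → G), Measurable[m] T →
      P.map (fun ω => (T ω, u ω)) = (P.map T).prod (P.map u) := by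
    intro G _ T hT
    refine (indepFun_iff_map_prod_eq_prod_map_map (hT.mono hm le_rfl).aemeasurable
      hu.aemeasurable).1 ?_
    rw [IndepFun_iff_Indep]
    exact indep_of_indep_of_le_left hind hT.comap_le
  have : IsProbabilityMeasure (P.map u) := Measure.isProbabilityMeasure_map hu.aemeasurable
  have : IsProbabilityMeasure (P.map Z) := Measure.isProbabilityMeasure_map hZ'.aemeasurable
  have hintZ : Integrable (fun ω => ∫ v, h (Z ω) v ∂(P.map u)) P := by
    have h1 : Integrable (Function.uncurry h) ((P.map Z).prod (P.map u)) := by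
      rw [← hindT Z hZ, integrable_map_measure hh.aestronglyMeasurable
        (hZ'.prodMk hu).aemeasurable]
      exact hint
    have h2 := h1.integral_prod_left
    exact (integrable_map_measure h2.aestronglyMeasurable hZ'.aemeasurable).1 h2
  refine (ae_eq_condExp_of_forall_setIntegral_eq hm hint (fun s _ _ => hintZ.integrableOn) ?_
    (hsm.measurable.comp hZ).stronglyMeasurable.aestronglyMeasurable).symm
  intro s hs _
  have hs' := hm s hs
  -- The indicator of `s` joins the frozen variable, so that both sides are integrals over the
  -- product of two laws.
  set T : Ω → ℝ × E := fun ω => (s.indicator (fun _ => (1 : ℝ)) ω, Z ω) with hT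
  have hTm : Measurable[m] T := (measurable_const.indicator hs).prodMk hZ
  have hTm' : Measurable T := hTm.mono hm le_rfl
  have : IsProbabilityMeasure (P.map T) := Measure.isProbabilityMeasure_map hTm'.aemeasurable
  set H : (ℝ × E) × F → ℝ := fun z => z.1.1 * h z.1.2 z.2 with hH
  have hHm : Measurable H :=
    (measurable_fst.fst).mul (hh.comp ((measurable_fst.snd).prodMk measurable_snd))
  have e : ∀ ω (x : ℝ), s.indicator (fun _ => (1 : ℝ)) ω * x = s.indicator (fun _ => x) ω := by
    intro ω x
    by_cases hω : ω ∈ s <;> simp [hω]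
  have hHint : Integrable H ((P.map T).prod (P.map u)) := by
    rw [← hindT T hTm, integrable_map_measure hHm.aestronglyMeasurable
      (hTm'.prodMk hu).aemeasurable]
    have : (H ∘ fun ω => (T ω, u ω)) = s.indicator (fun ω => h (Z ω) (u ω)) := by
      ext ω
      simp only [hH, hT, Function.comp]
      by_cases hω : ω ∈ s <;> simp [hω]
    rw [this]
    exact hint.indicator hs'
  have l1 : ∫ ω in s, h (Z ω) (u ω) ∂P = ∫ z, H z ∂((P.map T).prod (P.map u)) := by
    rw [← hindT T hTm, integral_map (hTm'.prodMk hu).aemeasurable hHm.aestronglyMeasurable,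
      ← integral_indicator hs']
    congr 1
    ext ω
    simp only [hH, hT]
    by_cases hω : ω ∈ s <;> simp [hω]
  have l2 : ∫ ω in s, (∫ v, h (Z ω) v ∂(P.map u)) ∂P
      = ∫ t, (∫ v, H (t, v) ∂(P.map u)) ∂(P.map T) := by
    rw [integral_map hTm'.aemeasurable, ← integral_indicator hs']
    · congr 1
      ext ω
      simp only [hH, hT, integral_const_mul]
      by_cases hω : ω ∈ s <;> simp [hω]
    · exact hHm.stronglyMeasurable.integral_prod_right'.aestronglyMeasurable
  rw [l1, l2, integral_prod _ hHint]

/-- A product bound on `h (Z, u)` with independent `Z` and `u` gives integrability and a bound of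
the integral. -/
theorem integrable_of_le_mul_of_indep {Z : Ω → E} {u : Ω → F}
    (hZ : Measurable[m] Z)
    (hind : Indep m (MeasurableSpace.comap u inferInstance) P) {X : Ω → ℝ}
    (hX : AEStronglyMeasurable X P) {A : E → ℝ} {B : F → ℝ} (hA : Measurable A) (hB : Measurable B)
    (hAi : Integrable (fun ω => A (Z ω)) P) (hBi : Integrable (fun ω => B (u ω)) P)
    (hle : ∀ ω, |X ω| ≤ A (Z ω) * B (u ω)) :
    Integrable X P ∧ ∫ ω, |X ω| ∂P ≤ (∫ ω, A (Z ω) ∂P) * ∫ ω, B (u ω) ∂P := by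
  have hi : IndepFun (fun ω => A (Z ω)) (fun ω => B (u ω)) P := by
    have : IndepFun Z u P := by
      rw [IndepFun_iff_Indep]
      exact indep_of_indep_of_le_left hind hZ.comap_le
    exact this.comp hA hB
  have hAB := hi.integrable_mul hAi hBi
  have hXi : Integrable X P := hAB.mono' hX (ae_of_all _ fun ω => by
    rw [Real.norm_eq_abs]; exact hle ω)
  refine ⟨hXi, ?_⟩
  rw [← hi.integral_fun_mul_eq_mul_integral hAi.aestronglyMeasurable hBi.aestronglyMeasurable]
  exact integral_mono hXi.abs hAB hle

/-- Tonelli for a pair of independent variables: a bound `A` on the partial means of `h` bounds its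
mean. -/
theorem integrable_of_integral_le_of_indep [IsProbabilityMeasure P] (hm : m ≤ mΩ) {Z : Ω → E}
    {u : Ω → F} (hZ : Measurable[m] Z) (hu : Measurable u)
    (hind : Indep m (MeasurableSpace.comap u inferInstance) P) {h : E → F → ℝ}
    (hh : Measurable (Function.uncurry h)) (h0 : ∀ e v, 0 ≤ h e v) {A : E → ℝ}
    (hi : ∀ e, Integrable (fun ω => h e (u ω)) P) (hle : ∀ e, ∫ ω, h e (u ω) ∂P ≤ A e)
    (hA : Integrable (fun ω => A (Z ω)) P) :
    Integrable (fun ω => h (Z ω) (u ω)) P ∧ ∫ ω, h (Z ω) (u ω) ∂P ≤ ∫ ω, A (Z ω) ∂P := by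
  have hZ' : Measurable Z := hZ.mono hm le_rfl
  have hind' : IndepFun Z u P := by
    rw [IndepFun_iff_Indep]
    exact indep_of_indep_of_le_left hind hZ.comap_le
  have hprod := (indepFun_iff_map_prod_eq_prod_map_map hZ'.aemeasurable hu.aemeasurable).1 hind'
  have : IsProbabilityMeasure (P.map u) := Measure.isProbabilityMeasure_map hu.aemeasurable
  have : IsProbabilityMeasure (P.map Z) := Measure.isProbabilityMeasure_map hZ'.aemeasurable
  have hmeas : Measurable fun z : E × F => ENNReal.ofReal (h z.1 z.2) :=
    ENNReal.measurable_ofReal.comp hh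
  have key : ∫⁻ ω, ENNReal.ofReal (h (Z ω) (u ω)) ∂P ≤ ∫⁻ ω, ENNReal.ofReal (A (Z ω)) ∂P := by
    calc ∫⁻ ω, ENNReal.ofReal (h (Z ω) (u ω)) ∂P
        = ∫⁻ z, ENNReal.ofReal (h z.1 z.2) ∂(P.map (fun ω => (Z ω, u ω))) := by
          rw [lintegral_map hmeas (hZ'.prodMk hu)]
      _ = ∫⁻ e, ∫⁻ v, ENNReal.ofReal (h e v) ∂(P.map u) ∂(P.map Z) := by
          rw [hprod, lintegral_prod _ hmeas.aemeasurable]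
      _ = ∫⁻ ω, ∫⁻ v, ENNReal.ofReal (h (Z ω) v) ∂(P.map u) ∂P :=
          lintegral_map hmeas.lintegral_prod_right' hZ'
      _ ≤ ∫⁻ ω, ENNReal.ofReal (A (Z ω)) ∂P := by
          refine lintegral_mono fun ω => ?_
          have hmω : Measurable fun v : F => ENNReal.ofReal (h (Z ω) v) :=
            ENNReal.measurable_ofReal.comp (hh.comp (measurable_prodMk_left (x := Z ω)))
          rw [lintegral_map hmω hu]
          have h1 := ofReal_integral_eq_lintegral_ofReal (hi (Z ω))
            (ae_of_all P fun ω' => h0 (Z ω) (u ω'))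
          exact h1.symm.le.trans (ENNReal.ofReal_le_ofReal (hle (Z ω)))
  have hint : Integrable (fun ω => h (Z ω) (u ω)) P := by
    refine ⟨(hh.comp (hZ'.prodMk hu)).aestronglyMeasurable, ?_⟩
    rw [hasFiniteIntegral_iff_ofReal (ae_of_all _ fun ω => h0 _ _)]
    exact key.trans_lt hA.lintegral_lt_top
  have hA0 : ∀ e, 0 ≤ A e := fun e => (integral_nonneg fun ω => h0 e (u ω)).trans (hle e)
  refine ⟨hint, ?_⟩
  rw [← ofReal_integral_eq_lintegral_ofReal hint (ae_of_all _ fun ω => h0 _ _),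
    ← ofReal_integral_eq_lintegral_ofReal hA (ae_of_all _ fun ω => hA0 _)] at key
  exact (ENNReal.ofReal_le_ofReal_iff (integral_nonneg fun ω => hA0 _)).1 key

end Freezing

section Chain

variable {q ℓ : ℕ} {Ω : Type*} {mΩ : MeasurableSpace Ω}

/-- One step of the Euler scheme, of size `g`, from `y` with innovation `u`. -/
def stepMap (b : Vec q → Vec q) (σ : Vec q → Vec ℓ →L[ℝ] Vec q) (g : ℝ) (y : Vec q)
    (u : Vec ℓ) : Vec q := y + g • b y + √g • σ y u

/-- The `σ`-algebra generated by `Y_0, …, Y_n`. -/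
abbrev hist (Y : ℕ → Ω → Vec q) (n : ℕ) : MeasurableSpace Ω :=
  ⨆ k ∈ Set.Iic n, MeasurableSpace.comap (Y k) inferInstance

theorem measurable_hist (Y : ℕ → Ω → Vec q) {k n : ℕ} (h : k ≤ n) : Measurable[hist Y n] (Y k) :=
  Measurable.of_comap_le
    (le_iSup₂_of_le (f := fun k (_ : k ∈ Set.Iic n) => MeasurableSpace.comap (Y k) inferInstance)
      k h le_rfl)

theorem hist_mono (Y : ℕ → Ω → Vec q) : Monotone (hist Y) := fun _ _ h =>
  iSup₂_le fun _ hk => (measurable_hist Y (le_trans hk h)).comap_le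

/-- `Y` is an Euler scheme whose innovation `U_{n+1}` is independent of `Y_0, …, Y_n`. -/
structure IsEulerChain (P : Measure Ω) (b : Vec q → Vec q) (σ : Vec q → Vec ℓ →L[ℝ] Vec q)
    (γ : ℕ → ℝ) (U : ℕ → Ω → Vec ℓ) (Y : ℕ → Ω → Vec q) : Prop where
  continuous_drift : Continuous b
  continuous_diffusion : Continuous σ
  measurable : ∀ n, Measurable (Y n)
  measurable_innov : ∀ n, Measurable (U (n + 1))
  succ : ∀ n ω, Y (n + 1) ω = stepMap b σ (γ (n + 1)) (Y n ω) (U (n + 1) ω)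
  indep : ∀ n, Indep (hist Y n) (MeasurableSpace.comap (U (n + 1)) inferInstance) P
  ident : ∀ n, IdentDistrib (U (n + 1)) (U 1) P P

theorem continuous_stepMap {b : Vec q → Vec q} {σ : Vec q → Vec ℓ →L[ℝ] Vec q}
    (hb : Continuous b) (hσ : Continuous σ) (g : ℝ) :
    Continuous (Function.uncurry (stepMap b σ g)) := by
  unfold stepMap Function.uncurry
  have : Continuous fun z : Vec q × Vec ℓ => σ z.1 z.2 :=
    (hσ.comp continuous_fst).clm_apply continuous_snd
  have h2 : Continuous fun z : Vec q × Vec ℓ => b z.1 := hb.comp continuous_fst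
  fun_prop

variable {P : Measure Ω} {b : Vec q → Vec q} {σ : Vec q → Vec ℓ →L[ℝ] Vec q}
  {γ : ℕ → ℝ} {U : ℕ → Ω → Vec ℓ} {Y : ℕ → Ω → Vec q}

namespace IsEulerChain

theorem hist_le (hc : IsEulerChain P b σ γ U Y) (n : ℕ) : hist Y n ≤ mΩ :=
  iSup₂_le fun k _ => (hc.measurable k).comap_le

/-- The natural filtration of the chain. -/
def filtration (hc : IsEulerChain P b σ γ U Y) : Filtration ℕ mΩ where
  seq := hist Y
  mono' := hist_mono Y
  le' := hc.hist_le

/-- The Markov property: the conditional mean of a function of `(Y_n, Y_{n+1})` given the past is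
its mean over one step started at the frozen value `Y_n`. -/
theorem condExp_step [IsProbabilityMeasure P] (hc : IsEulerChain P b σ γ U Y) (n : ℕ)
    {h : Vec q → Vec q → ℝ} (hh : Measurable (Function.uncurry h))
    (hint : Integrable (fun ω => h (Y n ω) (Y (n + 1) ω)) P) :
    P[fun ω => h (Y n ω) (Y (n + 1) ω) | hist Y n] =ᵐ[P]
      fun ω => ∫ ω', h (Y n ω) (stepMap b σ (γ (n + 1)) (Y n ω) (U 1 ω')) ∂P := by
  have hm : Measurable (Function.uncurry fun y u => h y (stepMap b σ (γ (n + 1)) y u)) :=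
    hh.comp (measurable_fst.prodMk
      (continuous_stepMap hc.continuous_drift hc.continuous_diffusion _).measurable)
  simp only [hc.succ n] at hint ⊢
  have := condExp_freeze (hc.hist_le n) (measurable_hist Y le_rfl) (hc.measurable_innov n)
    (hc.indep n) hm hint
  refine this.trans (ae_of_all _ fun ω => ?_)
  exact ((hc.ident n).comp (hm.comp measurable_prodMk_left)).integral_eq

/-- A variable bounded by a product of functions of `Y_n` and of the innovation `U_{n+1}` is
integrable when both factors are, because these are independent. -/
theorem integrable_of_le_mul (hc : IsEulerChain P b σ γ U Y) (n : ℕ)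
    {X : Ω → ℝ} (hX : AEStronglyMeasurable X P) {A : Vec q → ℝ} {B : Vec ℓ → ℝ}
    (hA : Measurable A) (hB : Measurable B) (hAi : Integrable (fun ω => A (Y n ω)) P)
    (hBi : Integrable (fun ω => B (U 1 ω)) P)
    (hle : ∀ ω, |X ω| ≤ A (Y n ω) * B (U (n + 1) ω)) :
    Integrable X P ∧ ∫ ω, |X ω| ∂P ≤ (∫ ω, A (Y n ω) ∂P) * ∫ ω, B (U 1 ω) ∂P := by
  have hid := (hc.ident n).comp hB
  have := integrable_of_le_mul_of_indep (measurable_hist Y le_rfl) (hc.indep n) hX hA hB hAi (hid.integrable_iff.2 hBi) hle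
  refine ⟨this.1, this.2.trans (le_of_eq ?_)⟩
  congr 1
  exact hid.integral_eq

end IsEulerChain

/-- The Euler scheme driven by a white noise that is independent of the initial value. -/
theorem isEulerChain_eulerScheme [IsProbabilityMeasure P] (hb : Continuous b) (hσ : Continuous σ)
    (hU : IsWhiteNoise P U) {Y₀ : Ω → Vec q} (hY₀ : Measurable Y₀)
    (hindep : IndepFun Y₀ (fun ω (n : ℕ) => U (n + 1) ω) P) :
    IsEulerChain P b σ γ U (eulerScheme b σ γ U Y₀) := by
  have hUm : ∀ n, Measurable (U (n + 1)) := fun n => hU.measurable _ (by omega)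
  have hsucc : ∀ n ω, eulerScheme b σ γ U Y₀ (n + 1) ω
    = stepMap b σ (γ (n + 1)) (eulerScheme b σ γ U Y₀ n ω) (U (n + 1) ω) := fun n ω => rfl
  have hstep : ∀ {m : MeasurableSpace Ω} n, Measurable[m] (eulerScheme b σ γ U Y₀ n) →
      Measurable[m] (U (n + 1)) → Measurable[m] (eulerScheme b σ γ U Y₀ (n + 1)) := by
    intro m n h1 h2
    exact (continuous_stepMap hb hσ (γ (n + 1))).measurable.comp (h1.prodMk h2)
  have hmeas : ∀ n, Measurable (eulerScheme b σ γ U Y₀ n) := by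
    intro n
    induction n with
    | zero => exact hY₀
    | succ n ih => exact hstep n ih (hUm n)
  refine ⟨hb, hσ, hmeas, hUm, hsucc, fun n => ?_, fun n => hU.identDistrib _ (by omega)⟩
  -- `Y_0, …, Y_n` are functions of `(Y₀, U_1, …, U_n)`, which is independent of `U_{n+1}`.
  set B : Ω → (Finset.range n → Vec ℓ) := fun ω i => U ((i : ℕ) + 1) ω with hB
  have hBm : Measurable B := measurable_pi_iff.2 fun i => hUm _
  have hBC : IndepFun B (U (n + 1)) P := by
    have := hU.indep.indepFun_finset (Finset.range n) {n} (by simp) hUm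
    exact this.comp (φ := id) (ψ := fun x : ({n} : Finset ℕ) → Vec ℓ => x ⟨n, by simp⟩) measurable_id
      (by fun_prop)
  have hABC : IndepFun Y₀ (fun ω => (B ω, U (n + 1) ω)) P := by
    refine hindep.comp (φ := id)
      (ψ := fun x : ℕ → Vec ℓ => ((fun i : Finset.range n => x i), x n)) measurable_id ?_
    exact (measurable_pi_iff.2 fun i => measurable_pi_apply _).prodMk (measurable_pi_apply _)
  have hAB : IndepFun Y₀ B P := hABC.comp (φ := id) (ψ := Prod.fst) measurable_id measurable_fst
  have hAB_C : IndepFun (fun ω => (Y₀ ω, B ω)) (U (n + 1)) P := by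
    have := Measure.isProbabilityMeasure_map (μ := P) hY₀.aemeasurable
    have := Measure.isProbabilityMeasure_map (μ := P) hBm.aemeasurable
    have := Measure.isProbabilityMeasure_map (μ := P) (hUm n).aemeasurable
    rw [indepFun_iff_map_prod_eq_prod_map_map (hY₀.prodMk hBm).aemeasurable (hUm n).aemeasurable,
      (indepFun_iff_map_prod_eq_prod_map_map hY₀.aemeasurable hBm.aemeasurable).1 hAB]
    have h1 := (indepFun_iff_map_prod_eq_prod_map_map hY₀.aemeasurable
      (hBm.prodMk (hUm n)).aemeasurable).1 hABC
    rw [(indepFun_iff_map_prod_eq_prod_map_map hBm.aemeasurable (hUm n).aemeasurable).1 hBC] at h1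
    have h2 := (measurePreserving_prodAssoc (P.map Y₀) (P.map B) (P.map (U (n + 1)))).symm.map_eq
    rw [← h2, ← h1, Measure.map_map (MeasurableEquiv.measurable _)
      (hY₀.prodMk (hBm.prodMk (hUm n)))]
    rfl
  rw [IndepFun_iff_Indep] at hAB_C
  refine indep_of_indep_of_le_left hAB_C (iSup₂_le fun k hk => ?_)
  set m := MeasurableSpace.comap (fun ω => (Y₀ ω, B ω)) inferInstance with hm
  have hmm : Measurable[m] fun ω => (Y₀ ω, B ω) := comap_measurable _
  have : ∀ k ≤ n, Measurable[m] (eulerScheme b σ γ U Y₀ k) := by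
    intro k hk
    induction k with
    | zero => exact measurable_fst.comp hmm
    | succ k ih =>
      refine hstep k (ih (by omega)) ?_
      exact (measurable_pi_apply (⟨k, by simpa using hk⟩ : Finset.range n)).comp
        (measurable_snd.comp hmm)
  exact (this k hk).comap_le

end Chain


/-! ### One step of the scheme -/

section OneStep

variable {q ℓ : ℕ} {Ω : Type*} {mΩ : MeasurableSpace Ω}

theorem opNorm_le_sqrt_traceSq (s : Vec ℓ →L[ℝ] Vec q) : ‖s‖ ≤ √(traceSq s) := by
  refine s.opNorm_le_bound (Real.sqrt_nonneg _) fun u => ?_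
  have h1 : s u = ∑ i, u i • s (EuclideanSpace.single i 1) := by
    conv_lhs => rw [← (EuclideanSpace.basisFun (Fin ℓ) ℝ).sum_repr u]
    simp [map_sum]
  rw [h1]
  calc ‖∑ i, u i • s (EuclideanSpace.single i 1)‖
      ≤ ∑ i, ‖s (EuclideanSpace.single i 1)‖ * ‖u i‖ :=
        (norm_sum_le _ _).trans (Finset.sum_le_sum fun i _ => by rw [norm_smul, mul_comm])
    _ ≤ √(∑ i, ‖s (EuclideanSpace.single i 1)‖ ^ 2) * √(∑ i, ‖u i‖ ^ 2) :=
        Real.sum_mul_le_sqrt_mul_sqrt _ _ _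
    _ = √(traceSq s) * ‖u‖ := by rw [traceSq, EuclideanSpace.norm_eq]

/-- The coefficients have at most the growth of `√V`, and `V ≥ 1`. -/
structure HasSqrtGrowth (b : Vec q → Vec q) (σ : Vec q → Vec ℓ →L[ℝ] Vec q) (V : Vec q → ℝ)
    (c : ℝ) : Prop where
  one_le : ∀ y, 1 ≤ V y
  drift : ∀ y, ‖b y‖ ≤ c * √(V y)
  diffusion : ∀ y, ‖σ y‖ ≤ c * √(V y)

theorem exists_hasSqrtGrowth {b : Vec q → Vec q} {σ : Vec q → Vec ℓ →L[ℝ] Vec q} {V : Vec q → ℝ}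
    (hV : ∀ y, 1 ≤ V y) (h : ∃ C : ℝ, ∀ y, ‖b y‖ ^ 2 + traceSq (σ y) ≤ C * V y) :
    ∃ c, HasSqrtGrowth b σ V c := by
  obtain ⟨C, hC⟩ := h
  have ht : ∀ y, 0 ≤ traceSq (σ y) := fun y => Finset.sum_nonneg fun _ _ => sq_nonneg _
  have hVC : ∀ y, √(C * V y) = √C * √(V y) := fun y =>
    Real.sqrt_mul' _ (zero_le_one.trans (hV y))
  refine ⟨√C, hV, fun y => ?_, fun y => ?_⟩
  · rw [← hVC]
    exact Real.le_sqrt_of_sq_le (by linarith [hC y, ht y])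
  · rw [← hVC]
    exact (opNorm_le_sqrt_traceSq _).trans (Real.sqrt_le_sqrt (by nlinarith [hC y, norm_nonneg (b y)]))

variable {b : Vec q → Vec q} {σ : Vec q → Vec ℓ →L[ℝ] Vec q} {V w : Vec q → ℝ} {c : ℝ}

theorem HasSqrtGrowth.nonneg (h : HasSqrtGrowth b σ V c) : 0 ≤ c := by
  have h1 := (norm_nonneg _).trans (h.drift 0)
  have h2 : 0 < √(V 0) := Real.sqrt_pos.2 (zero_lt_one.trans_le (h.one_le 0))
  exact nonneg_of_mul_nonneg_left h1 h2

theorem HasSqrtGrowth.norm_increment_le (h : HasSqrtGrowth b σ V c) {g G : ℝ}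
    (hg : 0 ≤ g) (hgG : g ≤ G) (y : Vec q) (u : Vec ℓ) :
    ‖g • b y + √g • σ y u‖ ≤ √g * ((1 + √G) * c * √(V y) * (1 + ‖u‖)) := by
  have hc := h.nonneg
  have e : g = √g * √g := (Real.mul_self_sqrt hg).symm
  have hs : √g ≤ √G := Real.sqrt_le_sqrt hgG
  have hx : 0 ≤ c * √(V y) := by positivity
  calc ‖g • b y + √g • σ y u‖ ≤ ‖g • b y‖ + ‖√g • σ y u‖ := norm_add_le _ _
    _ = g * ‖b y‖ + √g * ‖σ y u‖ := by
        rw [norm_smul, norm_smul, Real.norm_of_nonneg hg, Real.norm_of_nonneg (Real.sqrt_nonneg _)]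
    _ ≤ (√g * √G) * (c * √(V y)) + √g * (c * √(V y) * ‖u‖) := by
        gcongr
        · nth_rw 1 [e]; gcongr
        · exact h.drift y
        · exact ((σ y).le_opNorm u).trans (by gcongr; exact h.diffusion y)
    _ ≤ _ := by
        have h0 : 0 ≤ √g * (c * √(V y)) := by positivity
        have : 0 ≤ √g * (c * √(V y)) * (1 + √G * ‖u‖) := by positivity
        nlinarith [this]

/-- The growth of the derivatives of `φ` in the class `ℰ_{p,W}`, in the form in which it is used,
with `w = √W`. -/
def HasDerivGrowth (V w φ : Vec q → ℝ) (p : ℕ) (K : ℝ) : Prop :=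
  ∀ j ≤ p, ∀ y, ‖iteratedFDeriv ℝ j φ y‖ * √(V y) ^ j ≤ K * w y

/-- The bounds `o(W / V^j)` at infinity become global bounds, the derivatives being continuous and
thus bounded on compact sets. -/
theorem exists_hasDerivGrowth {W φ : Vec q → ℝ} {p : ℕ} (hVc : Continuous V) (hV : ∀ y, 1 ≤ V y)
    (hW : ∀ y, 1 ≤ W y) (hφ : φ ∈ poissonClass V W p) :
    ∃ K, 0 ≤ K ∧ HasDerivGrowth V (fun y => √(W y)) φ p K := by
  have key : ∀ j ≤ p, ∃ K, 0 ≤ K ∧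
      ∀ y, ‖iteratedFDeriv ℝ j φ y‖ * √(V y) ^ j ≤ K * √(W y) := by
    intro j hj
    have h1 := (hφ.2 j hj).def zero_lt_one
    rw [Filter.eventually_iff, Filter.mem_cocompact] at h1
    obtain ⟨S, hS, hSc⟩ := h1
    have hc : Continuous fun y => ‖iteratedFDeriv ℝ j φ y‖ * √(V y) ^ j :=
      ((hφ.1.continuous_iteratedFDeriv (m := j) (by exact_mod_cast hj)).norm).mul
        (hVc.sqrt.pow j)
    obtain ⟨B, hB⟩ := hS.exists_bound_of_continuousOn hc.continuousOn
    refine ⟨max 1 B, by positivity, fun y => ?_⟩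
    have hw1 : 1 ≤ √(W y) := Real.one_le_sqrt.2 (hW y)
    have hVp : 0 < V y := zero_lt_one.trans_le (hV y)
    by_cases hy : y ∈ S
    · have := (le_abs_self _).trans (hB y hy)
      calc _ ≤ B := this
        _ ≤ max 1 B * 1 := by rw [mul_one]; exact le_max_right _ _
        _ ≤ _ := by gcongr
    · have h2 := hSc hy
      simp only [Set.mem_ofPred_eq, one_mul, norm_pow, norm_norm] at h2
      have hq : 0 ≤ W y / V y ^ j := by
        have := hW y
        positivity
      rw [Real.norm_of_nonneg hq, le_div_iff₀ (by positivity)] at h2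
      have h3 : ‖iteratedFDeriv ℝ j φ y‖ * √(V y) ^ j ≤ √(W y) := by
        refine Real.le_sqrt_of_sq_le ?_
        rw [mul_pow, ← pow_mul, mul_comm j 2, pow_mul, Real.sq_sqrt hVp.le]
        exact h2
      calc _ ≤ 1 * √(W y) := by rw [one_mul]; exact h3
        _ ≤ _ := by gcongr; exact le_max_left _ _
  choose! K hK0 hK using key
  refine ⟨∑ j ∈ Finset.range (p + 1), K j,
    Finset.sum_nonneg fun j hj => hK0 j (by simpa [Nat.lt_succ_iff] using hj), fun j hj y => ?_⟩
  refine (hK j hj y).trans ?_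
  gcongr
  exact Finset.single_le_sum (f := K) (fun j hj => hK0 j (by simpa [Nat.lt_succ_iff] using hj))
    (by simpa [Nat.lt_succ_iff] using hj)

variable {φ : Vec q → ℝ} {p : ℕ} {K : ℝ} {L : ℝ≥0}

theorem HasDerivGrowth.nonneg (hK : HasDerivGrowth V w φ p K) (hw : ∀ y, 1 ≤ w y) : 0 ≤ K :=
  nonneg_of_mul_nonneg_left ((mul_nonneg (norm_nonneg _) (pow_nonneg (Real.sqrt_nonneg _) _)).trans
    (hK 0 (Nat.zero_le _) 0)) (zero_lt_one.trans_le (hw 0))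

/-- The increment of `φ` over one step of size `g` is of order `√g`. -/
theorem exists_abs_increment_le (h : HasSqrtGrowth b σ V c) (hw : ∀ y, 1 ≤ w y) (hp : 1 ≤ p)
    (hφ : ContDiff ℝ (p : WithTop ℕ∞) φ) (hL : LipschitzWith L (iteratedFDeriv ℝ p φ))
    (hK : HasDerivGrowth V w φ p K) (hVw : ∀ y, √(V y) ^ (p + 1) ≤ K * w y) (G : ℝ) :
    ∃ C, 0 ≤ C ∧ ∀ g, 0 ≤ g → g ≤ G → ∀ y u,
      |φ (stepMap b σ g y u) - φ y| ≤ C * √g * (w y * (1 + ‖u‖) ^ (p + 1)) := by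
  set a : ℝ := (1 + √G) * (1 + c) with ha
  have hc := h.nonneg
  have ha1 : 1 ≤ a := by nlinarith [Real.sqrt_nonneg G]
  have hK0 : 0 ≤ K := hK.nonneg hw
  set R : ℝ := (1 + √G) ^ (p + 1) * a ^ (p + 1) with hR
  have hR0 : 0 ≤ R := by positivity
  refine ⟨L * R * K + p * (R * K), by positivity, fun g hg hgG y u => ?_⟩
  set d := g • b y + √g • σ y u with hd
  have hx : ‖d‖ ≤ √g * (a * √(V y) * (1 + ‖u‖)) := by
    refine (h.norm_increment_le hg hgG y u).trans ?_
    gcongr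
    rw [ha]; gcongr; linarith
  have hs : √g ≤ 1 + √G := (Real.sqrt_le_sqrt hgG).trans (by linarith)
  have hpow : ∀ j, 1 ≤ j → j ≤ p + 1 →
      ‖d‖ ^ j ≤ √g * R * √(V y) ^ j * (1 + ‖u‖) ^ (p + 1) := by
    intro j hj1 hjp
    obtain ⟨i, rfl⟩ : ∃ i, j = i + 1 := ⟨j - 1, by omega⟩
    have e1 : √g ^ i ≤ (1 + √G) ^ (p + 1) :=
      (pow_le_pow_left₀ (Real.sqrt_nonneg _) hs i).trans
        (pow_le_pow_right₀ (by linarith [Real.sqrt_nonneg G]) (by omega))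
    have e2 : a ^ (i + 1) ≤ a ^ (p + 1) := pow_le_pow_right₀ ha1 hjp
    have e3 : (1 + ‖u‖) ^ (i + 1) ≤ (1 + ‖u‖) ^ (p + 1) :=
      pow_le_pow_right₀ (by linarith [norm_nonneg u]) hjp
    calc ‖d‖ ^ (i + 1) ≤ (√g * (a * √(V y) * (1 + ‖u‖))) ^ (i + 1) := by gcongr
      _ = √g * √g ^ i * a ^ (i + 1) * √(V y) ^ (i + 1) * (1 + ‖u‖) ^ (i + 1) := by
          simp only [mul_pow, pow_succ]; ring
      _ ≤ √g * (1 + √G) ^ (p + 1) * a ^ (p + 1) * √(V y) ^ (i + 1) * (1 + ‖u‖) ^ (p + 1) := by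
          gcongr
      _ = _ := by rw [hR]; ring
  have hstep : stepMap b σ g y u = y + d := by rw [stepMap, hd, add_assoc]
  -- Every Taylor term, and the remainder, carries at least one factor `√g`; the other ones are
  -- bounded through `g ≤ G`.
  have hT := abs_taylor_remainder_le hp hφ hL y d
  rw [Finset.sum_range_succ'] at hT
  simp only [iteratedFDeriv_zero_apply, Nat.factorial_zero, Nat.cast_one, div_one, one_mul] at hT
  have hterm : ∀ j ∈ Finset.range p, |(1 / ((j + 1).factorial : ℝ)) *
      iteratedFDeriv ℝ (j + 1) φ y (fun _ => d)| ≤ √g * (R * (K * w y) * (1 + ‖u‖) ^ (p + 1)) := by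
    intro j hj
    have hj' : j + 1 ≤ p := Finset.mem_range.1 hj
    rw [abs_mul]
    have h1 : |1 / ((j + 1).factorial : ℝ)| ≤ 1 := by
      rw [abs_of_nonneg (by positivity), div_le_one (by positivity)]
      exact_mod_cast Nat.one_le_iff_ne_zero.2 (Nat.factorial_ne_zero _)
    have h2 : |iteratedFDeriv ℝ (j + 1) φ y (fun _ => d)|
        ≤ ‖iteratedFDeriv ℝ (j + 1) φ y‖ * ‖d‖ ^ (j + 1) := by
      rw [← Real.norm_eq_abs]
      refine (ContinuousMultilinearMap.le_opNorm _ _).trans ?_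
      simp
    calc _ ≤ 1 * (‖iteratedFDeriv ℝ (j + 1) φ y‖ * ‖d‖ ^ (j + 1)) :=
          mul_le_mul h1 h2 (abs_nonneg _) zero_le_one
      _ ≤ 1 * (‖iteratedFDeriv ℝ (j + 1) φ y‖ *
            (√g * R * √(V y) ^ (j + 1) * (1 + ‖u‖) ^ (p + 1))) := by
          gcongr
          exact hpow _ (by omega) (by omega)
      _ = √g * (R * (‖iteratedFDeriv ℝ (j + 1) φ y‖ * √(V y) ^ (j + 1)) * (1 + ‖u‖) ^ (p + 1)) := by
          ring
      _ ≤ _ := by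
          have := hK _ hj' y
          gcongr
  have hsum := (Finset.abs_sum_le_sum_abs _ _).trans (Finset.sum_le_sum hterm)
  rw [Finset.sum_const, Finset.card_range, nsmul_eq_mul] at hsum
  have hrem : (L : ℝ) * ‖d‖ ^ (p + 1) ≤ √g * (L * R * (K * w y) * (1 + ‖u‖) ^ (p + 1)) :=
    calc (L : ℝ) * ‖d‖ ^ (p + 1)
        ≤ L * (√g * R * √(V y) ^ (p + 1) * (1 + ‖u‖) ^ (p + 1)) := by
          gcongr
          exact hpow _ (by omega) le_rfl
      _ ≤ L * (√g * R * (K * w y) * (1 + ‖u‖) ^ (p + 1)) := by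
          gcongr
          exact hVw y
      _ = _ := by ring
  rw [hstep]
  have habs : |φ (y + d) - φ y| ≤ √g * (L * R * (K * w y) * (1 + ‖u‖) ^ (p + 1))
      + p * (√g * (R * (K * w y) * (1 + ‖u‖) ^ (p + 1))) := by
    rw [abs_le] at hT hsum ⊢
    constructor <;> linarith [hT.1, hT.2, hsum.1, hsum.2]
  exact habs.trans (le_of_eq (by ring))

end OneStep


section WeakError

variable {q ℓ : ℕ} {Ω : Type*} {mΩ : MeasurableSpace Ω} {P : Measure Ω}

/-- A centered random vector of `ℝ^ℓ` with identity covariance matrix and a moment of order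
`2 (p + 1)`. -/
structure IsNormalized (P : Measure Ω) (u : Ω → Vec ℓ) (p : ℕ) : Prop where
  measurable : Measurable u
  moment : Integrable (fun ω => (1 + ‖u ω‖) ^ (2 * (p + 1))) P
  mean : ∀ i, ∫ ω, u ω i ∂P = 0
  cov : ∀ i j, ∫ ω, u ω i * u ω j ∂P = if i = j then 1 else 0

theorem IsNormalized.integrable_pow {u : Ω → Vec ℓ} {p : ℕ} (hu : IsNormalized P u p) {k : ℕ}
    (hk : k ≤ 2 * (p + 1)) : Integrable (fun ω => (1 + ‖u ω‖) ^ k) P := by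
  refine hu.moment.mono' (((hu.measurable.norm).const_add 1).pow_const k).aestronglyMeasurable
    (ae_of_all _ fun ω => ?_)
  have : 1 ≤ 1 + ‖u ω‖ := by linarith [norm_nonneg (u ω)]
  rw [Real.norm_of_nonneg (by positivity)]
  exact pow_le_pow_right₀ this hk

theorem IsNormalized.mono {u : Ω → Vec ℓ} {p r : ℕ} (hu : IsNormalized P u p) (h : r ≤ p) :
    IsNormalized P u r :=
  ⟨hu.measurable, hu.integrable_pow (by omega), hu.mean, hu.cov⟩

variable {b : Vec q → Vec q} {σ : Vec q → Vec ℓ →L[ℝ] Vec q} {V w φ : Vec q → ℝ} {c K : ℝ}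
  {p : ℕ} {L : ℝ≥0} {u : Ω → Vec ℓ}

/-- The value of `D^jφ(y)` with `i` arguments `b(y)` followed by `j - i` arguments `σ(y) v`. -/
def mixedForm (b : Vec q → Vec q) (σ : Vec q → Vec ℓ →L[ℝ] Vec q) (φ : Vec q → ℝ) (j i : ℕ)
    (y : Vec q) (v : Vec ℓ) : ℝ :=
  iteratedFDeriv ℝ j φ y (fun k : Fin j => if (k : ℕ) < i then b y else σ y v)

theorem continuous_mixedForm (j i : ℕ) (y : Vec q) : Continuous (mixedForm b σ φ j i y) := by
  refine (iteratedFDeriv ℝ j φ y).cont.comp (continuous_pi fun k => ?_)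
  by_cases h : (k : ℕ) < i
  · simpa [h] using continuous_const
  · simpa [h] using (σ y).continuous

theorem abs_mixedForm_le (h : HasSqrtGrowth b σ V c) (hw : ∀ y, 1 ≤ w y)
    (hK : HasDerivGrowth V w φ p K) {j i : ℕ} (hj : j ≤ p) (y : Vec q) (v : Vec ℓ) :
    |mixedForm b σ φ j i y v| ≤ (1 + c) ^ p * K * w y * (1 + ‖v‖) ^ p := by
  have hc := h.nonneg
  have hK0 := hK.nonneg hw
  have hw0 := zero_le_one.trans (hw y)
  have harg : ∀ k : Fin j, ‖(if (k : ℕ) < i then b y else σ y v)‖ ≤ c * √(V y) * (1 + ‖v‖) := by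
    intro k
    have h0 : 0 ≤ c * √(V y) := by positivity
    split_ifs
    · nlinarith [h.drift y, norm_nonneg v, mul_nonneg h0 (norm_nonneg v)]
    · calc ‖σ y v‖ ≤ c * √(V y) * ‖v‖ := ((σ y).le_opNorm v).trans (by gcongr; exact h.diffusion y)
        _ ≤ _ := by gcongr; linarith
  have hc1 : c ^ j ≤ (1 + c) ^ p :=
    (pow_le_pow_left₀ hc (by linarith) j).trans (pow_le_pow_right₀ (by linarith) hj)
  have hv1 : (1 + ‖v‖) ^ j ≤ (1 + ‖v‖) ^ p := pow_le_pow_right₀ (by linarith [norm_nonneg v]) hj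
  have hKy := hK j hj y
  calc |mixedForm b σ φ j i y v|
      ≤ ‖iteratedFDeriv ℝ j φ y‖ * ∏ k : Fin j, ‖(if (k : ℕ) < i then b y else σ y v)‖ := by
        rw [mixedForm, ← Real.norm_eq_abs]
        exact ContinuousMultilinearMap.le_opNorm _ _
    _ ≤ ‖iteratedFDeriv ℝ j φ y‖ * (c * √(V y) * (1 + ‖v‖)) ^ j := by
        gcongr
        refine (Finset.prod_le_prod (fun _ _ => norm_nonneg _) fun k _ => harg k).trans ?_
        simp
    _ = c ^ j * (‖iteratedFDeriv ℝ j φ y‖ * √(V y) ^ j) * (1 + ‖v‖) ^ j := by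
        simp only [mul_pow]; ring
    _ ≤ (1 + c) ^ p * (K * w y) * (1 + ‖v‖) ^ p := by gcongr
    _ = _ := by ring

theorem integrable_mixedForm (h : HasSqrtGrowth b σ V c) (hw : ∀ y, 1 ≤ w y)
    (hK : HasDerivGrowth V w φ p K) (hu : IsNormalized P u p) {j i : ℕ} (hj : j ≤ p) (y : Vec q) :
    Integrable (fun ω => mixedForm b σ φ j i y (u ω)) P := by
  refine ((hu.integrable_pow (k := p) (by omega)).const_mul ((1 + c) ^ p * K * w y)).mono'
    ((continuous_mixedForm j i y).measurable.comp hu.measurable).aestronglyMeasurable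
    (ae_of_all _ fun ω => ?_)
  rw [Real.norm_eq_abs]
  exact abs_mixedForm_le h hw hK hj y _

theorem abs_integral_mixedForm_le (h : HasSqrtGrowth b σ V c) (hw : ∀ y, 1 ≤ w y)
    (hK : HasDerivGrowth V w φ p K) (hu : IsNormalized P u p) {j i : ℕ} (hj : j ≤ p) (y : Vec q) :
    |∫ ω, mixedForm b σ φ j i y (u ω) ∂P|
      ≤ (1 + c) ^ p * K * (∫ ω, (1 + ‖u ω‖) ^ p ∂P) * w y := by
  calc _ ≤ ∫ ω, |mixedForm b σ φ j i y (u ω)| ∂P := abs_integral_le_integral_abs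
    _ ≤ ∫ ω, (1 + c) ^ p * K * w y * (1 + ‖u ω‖) ^ p ∂P :=
        integral_mono (integrable_mixedForm h hw hK hu hj y).abs
          ((hu.integrable_pow (k := p) (by omega)).const_mul _)
          fun ω => abs_mixedForm_le h hw hK hj y _
    _ = _ := by rw [integral_const_mul]; ring

/-- The `j`-th Taylor term of `φ` over one step, ordered by powers of `√g`. -/
theorem iteratedFDeriv_increment_eq (hφ : ContDiff ℝ (p : WithTop ℕ∞) φ) {j : ℕ} (hj : j ≤ p)
    {g : ℝ} (hg : 0 ≤ g) (y : Vec q) (v : Vec ℓ) :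
    iteratedFDeriv ℝ j φ y (fun _ => g • b y + √g • σ y v)
      = ∑ i ∈ Finset.range (j + 1), (j.choose i : ℝ) * (√g ^ (i + j) * mixedForm b σ φ j i y v) := by
  rw [map_add_eq_sum_choose _ (iteratedFDeriv_comp_perm (hφ.of_le (by exact_mod_cast hj)) y)]
  refine Finset.sum_congr rfl fun i hi => ?_
  have hi' : i ≤ j := Nat.lt_succ_iff.1 (Finset.mem_range.1 hi)
  have h1 : (fun k : Fin j => if (k : ℕ) < i then g • b y else √g • σ y v)
      = fun k : Fin j => (if (k : ℕ) < i then g else √g) • (if (k : ℕ) < i then b y else σ y v) := by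
    ext k : 1
    split_ifs <;> rfl
  have h2 : ∏ k : Fin j, (if (k : ℕ) < i then g else √g) = √g ^ (i + j) := by
    rw [Finset.prod_ite, Finset.prod_const, Finset.prod_const]
    have e1 : (Finset.univ.filter fun k : Fin j => (k : ℕ) < i).card = i := by
      rw [Fin.card_filter_val_lt]; omega
    have e2 : (Finset.univ.filter fun k : Fin j => ¬ (k : ℕ) < i).card = j - i := by
      have := Finset.card_filter_add_card_filter_not (s := Finset.univ)
        (fun k : Fin j => (k : ℕ) < i)
      rw [e1, Finset.card_univ, Fintype.card_fin] at this
      omega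
    rw [e1, e2]
    nth_rw 1 [← Real.sq_sqrt hg]
    rw [← pow_mul, ← pow_add]
    congr 1
    omega
  rw [h1, ContinuousMultilinearMap.map_smul_univ, h2, nsmul_eq_mul, smul_eq_mul]
  rfl

theorem errorTerm_eq_sum (r : ℕ) (y : Vec q) :
    errorTerm b σ P u φ r y = ∑ j ∈ (Finset.range (r + 1)).filter (fun j => r ≤ 2 * j),
      ((j.choose (r - j) : ℝ) / (j.factorial : ℝ)) *
        ∫ ω, mixedForm b σ φ j (r - j) y (u ω) ∂P := rfl

theorem apply_eq_sum (s : Vec ℓ →L[ℝ] Vec q) (v : Vec ℓ) :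
    s v = ∑ i, v i • s (EuclideanSpace.single i 1) := by
  conv_lhs => rw [← (EuclideanSpace.basisFun (Fin ℓ) ℝ).sum_repr v]
  simp [map_sum]

theorem IsNormalized.integrable_apply (hu : IsNormalized P u p) (i : Fin ℓ) :
    Integrable (fun ω => u ω i) P := by
  refine (hu.integrable_pow (k := 1) (by omega)).mono'
    (by have := hu.measurable; exact (by fun_prop : Measurable fun ω => u ω i).aestronglyMeasurable)
    (ae_of_all _ fun ω => ?_)
  have := PiLp.norm_apply_le (u ω) i
  rw [pow_one]
  linarith

theorem IsNormalized.integrable_mul (hu : IsNormalized P u p) (i j : Fin ℓ) :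
    Integrable (fun ω => u ω i * u ω j) P := by
  refine (hu.integrable_pow (k := 2) (by omega)).mono'
    (by have := hu.measurable
        exact (by fun_prop : Measurable fun ω => u ω i * u ω j).aestronglyMeasurable)
    (ae_of_all _ fun ω => ?_)
  have h1 := PiLp.norm_apply_le (u ω) i
  have h2 := PiLp.norm_apply_le (u ω) j
  rw [norm_mul]
  nlinarith [norm_nonneg (u ω i), norm_nonneg (u ω j), norm_nonneg (u ω)]

theorem errorTerm_zero [IsProbabilityMeasure P] (y : Vec q) : errorTerm b σ P u φ 0 y = φ y := by
  simp [errorTerm]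

/-- The coefficient of `√γ` vanishes because the innovations are centred. -/
theorem errorTerm_one (hu : IsNormalized P u p) (y : Vec q) :
    errorTerm b σ P u φ 1 y = 0 := by
  have : (Finset.range (1 + 1)).filter (fun j => 1 ≤ 2 * j) = {1} := by decide
  rw [errorTerm, this]
  simp only [Finset.sum_singleton, iteratedFDeriv_one_apply]
  have h1 : ∀ ω, fderiv ℝ φ y (σ y (u ω))
      = ∑ i, u ω i * fderiv ℝ φ y (σ y (EuclideanSpace.single i 1)) := by
    intro ω
    rw [apply_eq_sum (σ y) (u ω), map_sum]
    simp
  simp only [lt_self_iff_false, tsub_self, Fin.val_eq_zero, if_false, h1]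
  rw [integral_finsetSum _ fun i _ => (hu.integrable_apply i).mul_const _]
  simp [integral_mul_const, hu.mean]

/-- The coefficient of `γ` is the generator because the innovations have the identity as covariance
matrix. -/
theorem errorTerm_two [IsProbabilityMeasure P] (hu : IsNormalized P u p) (y : Vec q) :
    errorTerm b σ P u φ 2 y = generator b σ φ y := by
  have : (Finset.range (2 + 1)).filter (fun j => 2 ≤ 2 * j) = {1, 2} := by decide
  rw [errorTerm, this, Finset.sum_pair (by norm_num), generator]
  congr 1
  · simp [iteratedFDeriv_one_apply]
  · have h1 : ∀ ω, iteratedFDeriv ℝ 2 φ y (fun _ => σ y (u ω))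
        = ∑ i, ∑ j, (u ω i * u ω j) * iteratedFDeriv ℝ 2 φ y
          ![σ y (EuclideanSpace.single i 1), σ y (EuclideanSpace.single j 1)] := by
      intro ω
      simp only [iteratedFDeriv_two_apply]
      simp only [Matrix.cons_val_zero, Matrix.cons_val_one]
      rw [apply_eq_sum (σ y) (u ω)]
      simp only [map_sum, map_smul, sum_apply, smul_eq_mul,
        smul_apply, Finset.mul_sum]
      rw [Finset.sum_comm]
      refine Finset.sum_congr rfl fun i _ => Finset.sum_congr rfl fun j _ => ?_
      ring
    simp only [tsub_self, not_lt_zero, if_false, h1]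
    rw [integral_finsetSum _ fun i _ => integrable_finsetSum _ fun j _ =>
      (hu.integrable_mul i j).mul_const _]
    have h2 : ∀ i, ∫ ω, ∑ j, (u ω i * u ω j) * iteratedFDeriv ℝ 2 φ y
          ![σ y (EuclideanSpace.single i 1), σ y (EuclideanSpace.single j 1)] ∂P
        = iteratedFDeriv ℝ 2 φ y
          ![σ y (EuclideanSpace.single i 1), σ y (EuclideanSpace.single i 1)] := by
      intro i
      rw [integral_finsetSum _ fun j _ => (hu.integrable_mul i j).mul_const _]
      simp [integral_mul_const, hu.cov]
    simp only [h2]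
    norm_num [Nat.factorial]

/-- The means of the Taylor monomials, of degree `i` in the drift and `j - i` in the noise, regrouped
by the power `i + j` of `s = √γ` that they carry. -/
theorem sum_errorTerm_eq {m : ℕ} (hm : m ≤ p + 1) (s : ℝ) (y : Vec q) :
    ∑ r ∈ Finset.range m, s ^ r * errorTerm b σ P u φ r y
      = ∑ j ∈ Finset.range (p + 1), ∑ i ∈ (Finset.range (j + 1)).filter (fun i => i + j < m),
        s ^ (i + j) * (((j.choose i : ℝ) / (j.factorial : ℝ)) *
          ∫ ω, mixedForm b σ φ j i y (u ω) ∂P) := by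
  simp only [errorTerm_eq_sum, Finset.mul_sum]
  rw [Finset.sum_sigma', Finset.sum_sigma']
  refine Finset.sum_nbij' (fun x => ⟨x.2, x.1 - x.2⟩) (fun x => ⟨x.2 + x.1, x.1⟩) ?_ ?_ ?_ ?_ ?_
  · rintro ⟨r, j⟩ h
    simp only [Finset.mem_sigma, Finset.mem_range, Finset.mem_filter] at h ⊢
    omega
  · rintro ⟨j, i⟩ h
    simp only [Finset.mem_sigma, Finset.mem_range, Finset.mem_filter] at h ⊢
    omega
  · rintro ⟨r, j⟩ h
    simp only [Finset.mem_sigma, Finset.mem_range, Finset.mem_filter] at h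
    simp only [Sigma.mk.injEq, heq_eq_eq, and_true]
    omega
  · rintro ⟨j, i⟩ h
    simp
  · rintro ⟨r, j⟩ h
    simp only [Finset.mem_sigma, Finset.mem_range, Finset.mem_filter] at h
    have : r - j + j = r := by omega
    simp only [this]

/-- If the error terms of orders `3, …, m - 1` vanish, the mean increment of `φ` over one step of
size `g` is `g 𝒜φ` up to an error of order `g^{m/2}`. -/
theorem exists_abs_integral_step_sub_le [IsProbabilityMeasure P] (h : HasSqrtGrowth b σ V c)
    (hw : ∀ y, 1 ≤ w y) (hu : IsNormalized P u p)
    (hφ : ContDiff ℝ (p : WithTop ℕ∞) φ) (hL : LipschitzWith L (iteratedFDeriv ℝ p φ))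
    (hK : HasDerivGrowth V w φ p K) (hVw : ∀ y, √(V y) ^ (p + 1) ≤ K * w y)
    {m : ℕ} (hm3 : 3 ≤ m) (hmp : m ≤ p + 1)
    (herr : ∀ r, 3 ≤ r → r < m → errorTerm b σ P u φ r = 0) (G : ℝ) :
    ∃ C, 0 ≤ C ∧ ∀ g, 0 ≤ g → g ≤ G → ∀ y,
      |∫ ω, φ (stepMap b σ g y (u ω)) ∂P - φ y - g * generator b σ φ y| ≤ C * √g ^ m * w y := by
  have hp : 1 ≤ p := by omega
  have hc := h.nonneg
  have hK0 := hK.nonneg hw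
  set M := ∫ ω, (1 + ‖u ω‖) ^ p ∂P with hM
  set M1 := ∫ ω, (1 + ‖u ω‖) ^ (p + 1) ∂P with hM1
  have hM0 : 0 ≤ M := integral_nonneg fun ω => by positivity
  have hM10 : 0 ≤ M1 := integral_nonneg fun ω => by positivity
  set H := (1 + √G) ^ (2 * p + 1) with hH
  set a := ((1 + √G) * c) ^ (p + 1) with ha
  set T : ℝ := ∑ j ∈ Finset.range (p + 1), ∑ i ∈ Finset.range (j + 1),
    ((j.choose i : ℝ) / (j.factorial : ℝ)) with hT
  have hT0 : 0 ≤ T := Finset.sum_nonneg fun _ _ => Finset.sum_nonneg fun _ _ => by positivity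
  refine ⟨L * a * K * H * M1 + T * H * ((1 + c) ^ p * K * M), by positivity, fun g hg hgG y => ?_⟩
  have hw0 := zero_le_one.trans (hw y)
  have hs0 : 0 ≤ √g := Real.sqrt_nonneg g
  have hs : √g ≤ 1 + √G := (Real.sqrt_le_sqrt hgG).trans (by linarith)
  have hspow : ∀ k, m ≤ k → k ≤ 2 * p + 1 → √g ^ k ≤ √g ^ m * H := by
    intro k hk1 hk2
    obtain ⟨i, rfl⟩ := Nat.exists_eq_add_of_le hk1
    rw [pow_add]
    gcongr
    exact (pow_le_pow_left₀ hs0 hs i).trans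
      (pow_le_pow_right₀ (by linarith [Real.sqrt_nonneg G]) (by omega))
  have hstep : ∀ v, stepMap b σ g y v = y + (g • b y + √g • σ y v) := fun v => by
    rw [stepMap, add_assoc]
  -- `S` is the Taylor polynomial of the step, expanded in powers of `√g`.
  set S : Ω → ℝ := fun ω => ∑ j ∈ Finset.range (p + 1), ∑ i ∈ Finset.range (j + 1),
    (j.choose i : ℝ) / (j.factorial : ℝ) * √g ^ (i + j) * mixedForm b σ φ j i y (u ω) with hS
  have hSi : Integrable S P := integrable_finsetSum _ fun j hj => integrable_finsetSum _ fun i _ =>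
    (integrable_mixedForm h hw hK hu (Nat.lt_succ_iff.1 (Finset.mem_range.1 hj)) y).const_mul _
  have hrem : ∀ ω, |φ (stepMap b σ g y (u ω)) - S ω|
      ≤ √g ^ m * (L * a * K * H * w y) * (1 + ‖u ω‖) ^ (p + 1) := by
    intro ω
    have h1 := abs_taylor_remainder_le hp hφ hL y (g • b y + √g • σ y (u ω))
    have h2 : ∑ j ∈ Finset.range (p + 1), (1 / (j.factorial : ℝ)) *
        iteratedFDeriv ℝ j φ y (fun _ => g • b y + √g • σ y (u ω)) = S ω := by
      refine Finset.sum_congr rfl fun j hj => ?_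
      rw [iteratedFDeriv_increment_eq hφ (Nat.lt_succ_iff.1 (Finset.mem_range.1 hj)) hg,
        Finset.mul_sum]
      exact Finset.sum_congr rfl fun i _ => by ring
    rw [h2, ← hstep] at h1
    refine h1.trans ?_
    have h3 := pow_le_pow_left₀ (norm_nonneg _) (h.norm_increment_le hg hgG y (u ω)) (p + 1)
    calc (L : ℝ) * ‖g • b y + √g • σ y (u ω)‖ ^ (p + 1)
        ≤ L * (√g * ((1 + √G) * c * √(V y) * (1 + ‖u ω‖))) ^ (p + 1) := by gcongr
      _ = L * (√g ^ (p + 1) * (a * √(V y) ^ (p + 1) * (1 + ‖u ω‖) ^ (p + 1))) := by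
          rw [ha]; simp only [mul_pow]
      _ ≤ L * ((√g ^ m * H) * (a * (K * w y) * (1 + ‖u ω‖) ^ (p + 1))) := by
          have h5 := hspow (p + 1) hmp (by omega)
          have h6 := hVw y
          gcongr
      _ = _ := by ring
  have hRi : Integrable (fun ω => φ (stepMap b σ g y (u ω)) - S ω) P := by
    refine ((hu.integrable_pow (k := p + 1) (by omega)).const_mul _).mono' ?_
      (ae_of_all _ fun ω => by rw [Real.norm_eq_abs]; exact hrem ω)
    refine AEStronglyMeasurable.sub ?_ hSi.aestronglyMeasurable
    have : Continuous fun v => φ (stepMap b σ g y v) := by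
      simp only [hstep]
      exact hφ.continuous.comp (by fun_prop)
    exact (this.measurable.comp hu.measurable).aestronglyMeasurable
  have e1 : ∫ ω, φ (stepMap b σ g y (u ω)) ∂P
      = ∫ ω, (φ (stepMap b σ g y (u ω)) - S ω) ∂P + ∫ ω, S ω ∂P := by
    rw [← integral_add hRi hSi]
    simp
  have b1 : |∫ ω, (φ (stepMap b σ g y (u ω)) - S ω) ∂P|
      ≤ √g ^ m * (L * a * K * H * w y) * M1 := by
    refine abs_integral_le_integral_abs.trans ?_
    rw [hM1, ← integral_const_mul]
    exact integral_mono hRi.abs ((hu.integrable_pow (k := p + 1) (by omega)).const_mul _) hrem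
  set F : ℕ → ℕ → ℝ := fun j i => √g ^ (i + j) * (((j.choose i : ℝ) / (j.factorial : ℝ)) *
          ∫ ω, mixedForm b σ φ j i y (u ω) ∂P) with hF
  have e2 : ∫ ω, S ω ∂P = ∑ j ∈ Finset.range (p + 1), ∑ i ∈ Finset.range (j + 1), F j i := by
    rw [hS, integral_finsetSum _ fun j hj => integrable_finsetSum _ fun i _ =>
      (integrable_mixedForm h hw hK hu (Nat.lt_succ_iff.1 (Finset.mem_range.1 hj)) y).const_mul _]
    refine Finset.sum_congr rfl fun j hj => ?_
    rw [integral_finsetSum _ fun i _ =>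
      (integrable_mixedForm h hw hK hu (Nat.lt_succ_iff.1 (Finset.mem_range.1 hj)) y).const_mul _]
    refine Finset.sum_congr rfl fun i _ => ?_
    rw [integral_const_mul]
    simp only [hF]
    ring
  -- The terms with `i + j < m` sum to `φ + g 𝒜φ`, since the error terms of order `3, …, m - 1`
  -- vanish; all the others carry `√g ^ m`.
  have e3 : ∑ j ∈ Finset.range (p + 1), ∑ i ∈ Finset.range (j + 1), F j i
      = (φ y + g * generator b σ φ y)
        + ∑ j ∈ Finset.range (p + 1), ∑ i ∈ (Finset.range (j + 1)).filter (fun i => ¬ i + j < m),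
          F j i := by
    have h1 : φ y + g * generator b σ φ y
        = ∑ r ∈ Finset.range m, √g ^ r * errorTerm b σ P u φ r y := by
      have : ∑ r ∈ Finset.range m, √g ^ r * errorTerm b σ P u φ r y
          = ∑ r ∈ Finset.range 3, √g ^ r * errorTerm b σ P u φ r y := by
        refine (Finset.sum_subset (by simpa using hm3) fun r hr hr' => ?_).symm
        rw [herr r (by simpa using hr') (by simpa using hr)]
        simp
      rw [this]
      simp only [Finset.sum_range_succ, Finset.sum_range_zero, errorTerm_zero, errorTerm_one hu,
        errorTerm_two hu, Real.sq_sqrt hg]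
      ring
    rw [h1, sum_errorTerm_eq hmp, ← Finset.sum_add_distrib]
    exact Finset.sum_congr rfl fun j _ => (Finset.sum_filter_add_sum_filter_not _ _ _).symm
  have b2 : |∑ j ∈ Finset.range (p + 1),
      ∑ i ∈ (Finset.range (j + 1)).filter (fun i => ¬ i + j < m), F j i|
      ≤ T * (√g ^ m * H * ((1 + c) ^ p * K * M * w y)) := by
    refine (Finset.abs_sum_le_sum_abs _ _).trans ?_
    rw [hT, Finset.sum_mul]
    refine Finset.sum_le_sum fun j hj => (Finset.abs_sum_le_sum_abs _ _).trans ?_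
    rw [Finset.sum_mul]
    refine (Finset.sum_le_sum (g := fun i => ((j.choose i : ℝ) / (j.factorial : ℝ)) *
      (√g ^ m * H * ((1 + c) ^ p * K * M * w y))) fun i hi => ?_).trans
      (Finset.sum_le_sum_of_subset_of_nonneg (Finset.filter_subset _ _)
        fun i _ _ => by positivity)
    simp only [Finset.mem_filter, Finset.mem_range, not_lt] at hi hj
    have h1 := abs_integral_mixedForm_le h hw hK hu (i := i) (Nat.lt_succ_iff.1 hj) y
    have h2 := hspow (i + j) hi.2 (by omega)
    simp only [hF]
    rw [abs_mul, abs_mul, abs_of_nonneg (by positivity : (0 : ℝ) ≤ √g ^ (i + j)),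
      abs_of_nonneg (by positivity : (0 : ℝ) ≤ (j.choose i : ℝ) / (j.factorial : ℝ))]
    calc _ ≤ (√g ^ m * H) * ((j.choose i : ℝ) / (j.factorial : ℝ) *
          ((1 + c) ^ p * K * M * w y)) := by gcongr
      _ = _ := by ring
  rw [e1, e2, e3]
  have e4 : ∀ x f a z : ℝ, x + (f + a + z) - f - a = x + z := by intros; ring
  rw [e4]
  refine (abs_add_le _ _).trans ((add_le_add b1 b2).trans (le_of_eq ?_))
  ring

end WeakError


/-! ### Sums of martingale increments -/

section Martingales

variable {Ω : Type*} {m mΩ : MeasurableSpace Ω} {P : Measure Ω}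

theorem integral_sub_condExp_sq_le [IsProbabilityMeasure P] (hm : m ≤ mΩ) {X : Ω → ℝ}
    (hX : MemLp X 2 P) : ∫ ω, (X ω - P[X|m] ω) ^ 2 ∂P ≤ ∫ ω, X ω ^ 2 ∂P := by
  have h1 := condVar_ae_le_condExp_sq hm hX
  have hXi : Integrable ((X - P[X|m]) ^ 2) P := (hX.sub (hX.condExp one_le_two)).integrable_sq
  calc ∫ ω, (X ω - P[X|m] ω) ^ 2 ∂P = ∫ ω, Var[X; P | m] ω ∂P := by
        have := setIntegral_condVar (hm := hm) hXi (s := Set.univ) MeasurableSet.univ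
        simpa using this.symm
    _ ≤ ∫ ω, P[X ^ 2|m] ω ∂P := integral_mono_ae integrable_condVar integrable_condExp h1
    _ = _ := by rw [integral_condExp hm]; rfl

variable {𝓕 : Filtration ℕ mΩ}

/-- Second moments and almost sure behaviour of weighted sums of square integrable martingale
increments `N_k`. -/
theorem martingale_weighted_sum [IsProbabilityMeasure P] {N : ℕ → Ω → ℝ}
    (hm : ∀ k, StronglyMeasurable[𝓕 (k + 1)] (N k))
    (h2 : ∀ k, MemLp (N k) 2 P) (h0 : ∀ k, P[N k|𝓕 k] =ᵐ[P] 0) (c : ℕ → ℝ) :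
    Martingale (fun n ω => ∑ k ∈ Finset.range n, c k * N k ω) 𝓕 P ∧
    (∀ n, MemLp (fun ω => ∑ k ∈ Finset.range n, c k * N k ω) 2 P) ∧
    ∀ n, ∫ ω, (∑ k ∈ Finset.range n, c k * N k ω) ^ 2 ∂P
      = ∑ k ∈ Finset.range n, c k ^ 2 * ∫ ω, N k ω ^ 2 ∂P := by
  have had : ∀ n, StronglyMeasurable[𝓕 n] (fun ω => ∑ k ∈ Finset.range n, c k * N k ω) :=
    fun n => Finset.stronglyMeasurable_fun_sum _ fun k hk =>
      ((hm k).mono (𝓕.mono (Finset.mem_range.1 hk))).const_mul _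
  have hL : ∀ n, MemLp (fun ω => ∑ k ∈ Finset.range n, c k * N k ω) 2 P := fun n =>
    memLp_finsetSum _ fun k _ => (h2 k).const_mul _
  have hLi : ∀ n, Integrable (fun ω => ∑ k ∈ Finset.range n, c k * N k ω) P := fun n =>
    (hL n).integrable one_le_two
  refine ⟨martingale_of_condExp_sub_eq_zero_nat had hLi fun i => ?_, hL, fun n => ?_⟩
  · have : (fun ω => ∑ k ∈ Finset.range (i + 1), c k * N k ω)
        - (fun ω => ∑ k ∈ Finset.range i, c k * N k ω) = c i • N i := by
      ext ω
      simp [Finset.sum_range_succ]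
    rw [this]
    filter_upwards [condExp_smul (μ := P) (c i) (N i) (𝓕 i), h0 i] with ω h1 h2
    rw [h1]
    simp [h2]
  · induction n with
    | zero => simp
    | succ n ih =>
      have hcross : ∫ ω, (∑ k ∈ Finset.range n, c k * N k ω) * N n ω ∂P = 0 := by
        have hi : Integrable ((fun ω => ∑ k ∈ Finset.range n, c k * N k ω) * N n) P :=
          (hL n).integrable_mul (h2 n)
        have h3 := condExp_mul_of_stronglyMeasurable_left (had n) hi
          ((h2 n).integrable one_le_two)
        have h4 : P[(fun ω => ∑ k ∈ Finset.range n, c k * N k ω) * N n|𝓕 n] =ᵐ[P] 0 := by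
          filter_upwards [h3, h0 n] with ω h5 h6
          rw [h5, Pi.mul_apply, h6]
          simp
        have h5 := integral_condExp (μ := P) (f := (fun ω => ∑ k ∈ Finset.range n, c k * N k ω) * N n)
          (𝓕.le n)
        rw [integral_congr_ae h4] at h5
        simpa using h5.symm
      have e : ∀ ω, (∑ k ∈ Finset.range (n + 1), c k * N k ω) ^ 2
          = ((∑ k ∈ Finset.range n, c k * N k ω) ^ 2
            + (2 * c n) * ((∑ k ∈ Finset.range n, c k * N k ω) * N n ω)) + c n ^ 2 * N n ω ^ 2 := by
        intro ω
        rw [Finset.sum_range_succ]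
        ring
      have i1 : Integrable (fun ω => (∑ k ∈ Finset.range n, c k * N k ω) ^ 2) P :=
        (hL n).integrable_sq
      have i2 : Integrable (fun ω => (2 * c n) * ((∑ k ∈ Finset.range n, c k * N k ω) * N n ω)) P :=
        ((hL n).integrable_mul (h2 n)).const_mul _
      have i3 : Integrable (fun ω => c n ^ 2 * N n ω ^ 2) P := ((h2 n).integrable_sq).const_mul _
      have i12 : Integrable (fun ω => (∑ k ∈ Finset.range n, c k * N k ω) ^ 2
          + (2 * c n) * ((∑ k ∈ Finset.range n, c k * N k ω) * N n ω)) P := i1.add i2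
      simp only [e]
      rw [integral_add i12 i3, integral_add i1 i2, ih, integral_const_mul, hcross,
        integral_const_mul, Finset.sum_range_succ]
      ring

theorem eLpNorm_two_le_of_integral_sq_le [IsProbabilityMeasure P] {X : Ω → ℝ} (hX : MemLp X 2 P)
    {R : ℝ} (hR : 0 ≤ R) (h : ∫ ω, X ω ^ 2 ∂P ≤ R ^ 2) : eLpNorm X 2 P ≤ ENNReal.ofReal R := by
  rw [hX.eLpNorm_eq_integral_rpow_norm (by norm_num) (by norm_num)]
  refine ENNReal.ofReal_le_ofReal ?_
  have e : ∀ ω, ‖X ω‖ ^ (2 : ℝ≥0∞).toReal = X ω ^ 2 := fun ω => by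
    simp
  simp only [e]
  have : (2 : ℝ≥0∞).toReal⁻¹ = (1 / 2 : ℝ) := by norm_num
  rw [this, ← Real.sqrt_eq_rpow]
  exact Real.sqrt_le_iff.2 ⟨hR, h⟩

theorem exists_forall_abs_le_of_tendsto {x : ℕ → ℝ} {l : ℝ} (h : Tendsto x atTop (𝓝 l)) :
    ∃ C, ∀ n, |x n| ≤ C := by
  obtain ⟨C, hC⟩ := h.abs.bddAbove_range
  exact ⟨C, fun n => hC ⟨n, rfl⟩⟩

/-- An `L²`-bounded sum of martingale increments is almost surely bounded. -/
theorem ae_bounded_martingale_sum [IsProbabilityMeasure P] {N : ℕ → Ω → ℝ}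
    (hm : ∀ k, StronglyMeasurable[𝓕 (k + 1)] (N k))
    (h2 : ∀ k, MemLp (N k) 2 P) (h0 : ∀ k, P[N k|𝓕 k] =ᵐ[P] 0) {c : ℕ → ℝ}
    (hc : Summable fun k => c k ^ 2 * ∫ ω, N k ω ^ 2 ∂P) :
    ∀ᵐ ω ∂P, ∃ C, ∀ n, |∑ k ∈ Finset.range n, c k * N k ω| ≤ C := by
  obtain ⟨hM, hL, hE⟩ := martingale_weighted_sum hm h2 h0 c
  set R := ∑' k, c k ^ 2 * ∫ ω, N k ω ^ 2 ∂P with hR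
  have hnn : ∀ k, 0 ≤ c k ^ 2 * ∫ ω, N k ω ^ 2 ∂P := fun k =>
    mul_nonneg (sq_nonneg _) (integral_nonneg fun ω => sq_nonneg _)
  have hR0 : 0 ≤ R := tsum_nonneg hnn
  have hb : ∀ n, eLpNorm (fun ω => ∑ k ∈ Finset.range n, c k * N k ω) 1 P
      ≤ ((√R).toNNReal : ℝ≥0∞) := by
    intro n
    refine (eLpNorm_le_eLpNorm_of_exponent_le one_le_two (hL n).aestronglyMeasurable).trans ?_
    refine eLpNorm_two_le_of_integral_sq_le (hL n) (Real.sqrt_nonneg _) ?_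
    rw [hE, Real.sq_sqrt hR0]
    exact hc.sum_le_tsum _ fun k _ => hnn k
  filter_upwards [hM.submartingale.exists_ae_tendsto_of_bdd hb] with ω ⟨l, hl⟩
  exact exists_forall_abs_le_of_tendsto hl

/-- The filtration `n ↦ 𝓕_{n + N}`. -/
def shiftFiltration (𝓕 : Filtration ℕ mΩ) (N : ℕ) : Filtration ℕ mΩ where
  seq n := 𝓕 (n + N)
  mono' _ _ h := 𝓕.mono (by omega)
  le' n := 𝓕.le _

/-- If `E[X_{n+1} | 𝓕_n] ≤ X_n + δ_{n+1}` from some rank on, with `X ≥ 0` bounded in `L¹` and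
`∑ δ < ∞`, then `X` is almost surely bounded. -/
theorem ae_bounded_of_almost_supermartingale [IsProbabilityMeasure P] {X : ℕ → Ω → ℝ} {δ : ℕ → ℝ}
    (hm : ∀ k, StronglyMeasurable[𝓕 k] (X k)) (hX0 : ∀ k ω, 0 ≤ X k ω)
    (hXi : ∀ k, Integrable (X k) P) {B : ℝ} (hB : ∀ k, ∫ ω, X k ω ∂P ≤ B)
    (hδ0 : ∀ k, 0 ≤ δ k) (hδ : Summable δ) {n₀ : ℕ}
    (hstep : ∀ n ≥ n₀, P[X (n + 1)|𝓕 n] ≤ᵐ[P] fun ω => X n ω + δ n) :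
    ∀ᵐ ω ∂P, ∃ C, ∀ n, X n ω ≤ C := by
  set T := ∑' k, δ k with hT
  have hTs : ∀ n, ∑ k ∈ Finset.range n, δ k ≤ T := fun n => hδ.sum_le_tsum _ fun k _ => hδ0 k
  -- Adding the part of `∑ δ` still to come turns `X` into a nonnegative supermartingale.
  set S : ℕ → Ω → ℝ := fun n ω => X (n + n₀) ω + (T - ∑ k ∈ Finset.range (n + n₀), δ k) with hS
  have hSi : ∀ n, Integrable (S n) P := fun n => (hXi _).add (integrable_const _)
  have hsup : Supermartingale S (shiftFiltration 𝓕 n₀) P := by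
    refine supermartingale_nat (fun n => (hm _).add stronglyMeasurable_const) hSi fun n => ?_
    have e : S (n + 1) = X (n + n₀ + 1)
        + fun _ => (T - ∑ k ∈ Finset.range (n + n₀ + 1), δ k) := by
      ext ω
      simp only [hS, Pi.add_apply]
      have : n + 1 + n₀ = n + n₀ + 1 := by omega
      rw [this]
    have h1 := condExp_add (hXi (n + n₀ + 1))
      (integrable_const (μ := P) (T - ∑ k ∈ Finset.range (n + n₀ + 1), δ k))
      (shiftFiltration 𝓕 n₀ n)
    have h2 := condExp_const (μ := P) ((shiftFiltration 𝓕 n₀).le n)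
      (T - ∑ k ∈ Finset.range (n + n₀ + 1), δ k)
    rw [e]
    filter_upwards [h1, hstep (n + n₀) (by omega)] with ω h3 h4
    rw [h3, Pi.add_apply, h2]
    simp only [hS]
    rw [Finset.sum_range_succ]
    have : P[X (n + n₀ + 1)|shiftFiltration 𝓕 n₀ n] ω ≤ X (n + n₀) ω + δ (n + n₀) := h4
    linarith
  have hS0 : ∀ n ω, 0 ≤ S n ω := fun n ω => by
    have := hX0 (n + n₀) ω
    have := hTs (n + n₀)
    simp only [hS]
    linarith
  have hbd : ∀ n, eLpNorm ((-S) n) 1 P ≤ ((B + T).toNNReal : ℝ≥0∞) := by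
    intro n
    rw [Pi.neg_apply, eLpNorm_neg, eLpNorm_one_eq_lintegral_enorm, ← ofReal_integral_norm_eq_lintegral_enorm (hSi n)]
    refine ENNReal.ofReal_le_ofReal ?_
    have : ∀ ω, ‖S n ω‖ = S n ω := fun ω => Real.norm_of_nonneg (hS0 n ω)
    simp only [this]
    simp only [hS]
    rw [integral_add (hXi _) (integrable_const _)]
    have h0 : 0 ≤ ∑ k ∈ Finset.range (n + n₀), δ k := Finset.sum_nonneg fun k _ => hδ0 k
    simp only [integral_const, probReal_univ, smul_eq_mul, one_mul]
    linarith [hB (n + n₀)]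
  filter_upwards [hsup.neg.exists_ae_tendsto_of_bdd hbd] with ω ⟨l, hl⟩
  obtain ⟨C, hC⟩ := exists_forall_abs_le_of_tendsto hl
  have hsum0 : 0 ≤ ∑ k ∈ Finset.range n₀, X k ω := Finset.sum_nonneg fun k _ => hX0 k ω
  have hC0 : 0 ≤ C := (abs_nonneg _).trans (hC 0)
  refine ⟨C + ∑ k ∈ Finset.range n₀, X k ω, fun n => ?_⟩
  by_cases hn : n < n₀
  · have : X n ω ≤ ∑ k ∈ Finset.range n₀, X k ω :=
      Finset.single_le_sum (f := fun k => X k ω) (fun k _ => hX0 k ω) (Finset.mem_range.2 hn)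
    linarith
  · obtain ⟨i, rfl⟩ := Nat.exists_eq_add_of_le (not_lt.1 hn)
    have h1 := hC i
    have h2 := hTs (i + n₀)
    simp only [Pi.neg_apply, abs_neg, abs_of_nonneg (hS0 i ω)] at h1
    simp only [hS] at h1
    rw [add_comm n₀ i]
    linarith

/-- A series of nonnegative functions with bounded integrals and summable weights has almost
surely bounded partial sums. -/
theorem ae_bounded_sum_of_summable {X : ℕ → Ω → ℝ} {d : ℕ → ℝ}
    (hX0 : ∀ k ω, 0 ≤ X k ω) (hXi : ∀ k, Integrable (X k) P) {B : ℝ}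
    (hB : ∀ k, ∫ ω, X k ω ∂P ≤ B) (hd0 : ∀ k, 0 ≤ d k) (hd : Summable d) :
    ∀ᵐ ω ∂P, ∃ C, ∀ n, ∑ k ∈ Finset.range n, d k * X k ω ≤ C := by
  have h1 : ∑' k, ∫⁻ ω, ENNReal.ofReal (d k * X k ω) ∂P ≠ ∞ := by
    have h2 : ∀ k, ∫⁻ ω, ENNReal.ofReal (d k * X k ω) ∂P ≤ ENNReal.ofReal (d k * B) := by
      intro k
      rw [← ofReal_integral_eq_lintegral_ofReal ((hXi k).const_mul _)
        (ae_of_all _ fun ω => mul_nonneg (hd0 k) (hX0 k ω)), integral_const_mul]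
      exact ENNReal.ofReal_le_ofReal (mul_le_mul_of_nonneg_left (hB k) (hd0 k))
    have hB0 : 0 ≤ B := (integral_nonneg (hX0 0)).trans (hB 0)
    refine ne_top_of_le_ne_top ?_ (ENNReal.tsum_le_tsum h2)
    exact (hd.mul_right B).tsum_ofReal_ne_top
  have hae : ∀ k, AEMeasurable (fun ω => ENNReal.ofReal (d k * X k ω)) P := fun k =>
    (((hXi k).const_mul _).aestronglyMeasurable.aemeasurable).ennreal_ofReal
  rw [← lintegral_tsum hae] at h1
  filter_upwards [ae_lt_top' (AEMeasurable.tsum hae) h1] with ω hω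
  refine ⟨(∑' k, ENNReal.ofReal (d k * X k ω)).toReal, fun n => ?_⟩
  have hnn : ∀ k ∈ Finset.range n, 0 ≤ d k * X k ω := fun k _ => mul_nonneg (hd0 k) (hX0 k ω)
  rw [← ENNReal.ofReal_le_iff_le_toReal hω.ne, ENNReal.ofReal_sum_of_nonneg hnn]
  exact ENNReal.sum_le_tsum _

end Martingales

/-! ### Abel summation -/

section Abel

/-- A boundedness version of Kronecker's lemma. -/
theorem abs_sum_le_of_abs_weighted_sum_le {A x : ℕ → ℝ} (hA0 : A 0 = 0) (hA : Monotone A)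
    (hpos : ∀ n, 0 < A (n + 1)) {S : ℝ}
    (h : ∀ n, |∑ k ∈ Finset.range n, (A (k + 1))⁻¹ * x k| ≤ S) (n : ℕ) :
    |∑ k ∈ Finset.range n, x k| ≤ 2 * S * A n := by
  set T : ℕ → ℝ := fun n => ∑ k ∈ Finset.range n, (A (k + 1))⁻¹ * x k with hT
  have h1 : ∀ n, |∑ k ∈ Finset.range n, x k - A n * T n| ≤ S * A n := by
    intro n
    induction n with
    | zero => simp [hA0]
    | succ n ih =>
      have e : ∑ k ∈ Finset.range (n + 1), x k - A (n + 1) * T (n + 1)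
          = (∑ k ∈ Finset.range n, x k - A n * T n) + -((A (n + 1) - A n) * T n) := by
        simp only [hT, Finset.sum_range_succ]
        have := (hpos n).ne'
        field_simp
        ring
      rw [e]
      refine (abs_add_le _ _).trans ?_
      rw [abs_neg, abs_mul, abs_of_nonneg (sub_nonneg.2 (hA n.le_succ))]
      have := mul_le_mul_of_nonneg_left (h n) (sub_nonneg.2 (hA n.le_succ))
      linarith
  have hAn : 0 ≤ A n := by rw [← hA0]; exact hA (Nat.zero_le n)
  have h2 : |A n * T n| ≤ A n * S := by
    rw [abs_mul, abs_of_nonneg hAn]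
    exact mul_le_mul_of_nonneg_left (h n) hAn
  have h3 := abs_add_le (∑ k ∈ Finset.range n, x k - A n * T n) (A n * T n)
  rw [sub_add_cancel] at h3
  linarith [h1 n]

theorem sum_le_mul_of_weighted_sum_le {A x : ℕ → ℝ} {a S : ℝ} {n : ℕ} (hA : ∀ k < n, A k ≤ a)
    (ha : 0 ≤ a) (hpos : ∀ k, 0 < A k) (hx : ∀ k, 0 ≤ x k)
    (h : ∑ k ∈ Finset.range n, (A k)⁻¹ * x k ≤ S) :
    ∑ k ∈ Finset.range n, x k ≤ a * S := by
  refine le_trans ?_ (mul_le_mul_of_nonneg_left h ha)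
  rw [Finset.mul_sum]
  refine Finset.sum_le_sum fun k hk => ?_
  have h1 : 1 ≤ a * (A k)⁻¹ := by
    rw [← div_eq_mul_inv, one_le_div (hpos k)]
    exact hA k (Finset.mem_range.1 hk)
  nlinarith [hx k]

theorem sum_mul_sub_succ (c x : ℕ → ℝ) (n : ℕ) :
    ∑ k ∈ Finset.range (n + 1), c k * (x k - x (k + 1))
      = c 0 * x 0 + ∑ k ∈ Finset.range n, (c (k + 1) - c k) * x (k + 1) - c n * x (n + 1) := by
  induction n with
  | zero => simp; ring
  | succ n ih =>
    rw [Finset.sum_range_succ, ih, Finset.sum_range_succ]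
    ring

end Abel


/-! ### Rates of convergence from a Lyapunov sequence -/

section Rates

variable {Ω : Type*} {mΩ : MeasurableSpace Ω} {P : Measure Ω} {𝓕 : Filtration ℕ mΩ}
  {γ : ℕ → ℝ} {β : ℝ} {w Φ F : ℕ → Ω → ℝ} {α β' B C : ℝ} {n₀ : ℕ}

/-- Positive non-increasing steps `γ_1 ≥ γ_2 ≥ …`. -/
structure IsStepSequence (γ : ℕ → ℝ) : Prop where
  pos : ∀ n, 0 < γ (n + 1)
  anti : ∀ n, γ (n + 2) ≤ γ (n + 1)

theorem IsStepSequence.le_first (h : IsStepSequence γ) (n : ℕ) : γ (n + 1) ≤ γ 1 := by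
  induction n with
  | zero => exact le_rfl
  | succ n ih => exact (h.anti n).trans ih

theorem stepSum_zero : stepSum γ β 0 = 0 := by simp [stepSum]

theorem stepSum_succ (n : ℕ) : stepSum γ β (n + 1) = stepSum γ β n + γ (n + 1) ^ β := by
  rw [stepSum, stepSum, Finset.sum_Icc_succ_top (by omega)]

theorem stepSum_eq_sum_range (n : ℕ) :
    stepSum γ β n = ∑ k ∈ Finset.range n, γ (k + 1) ^ β := by
  induction n with
  | zero => simp [stepSum]
  | succ n ih => rw [stepSum_succ, ih, Finset.sum_range_succ]

theorem IsStepSequence.monotone_stepSum (h : IsStepSequence γ) : Monotone (stepSum γ β) :=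
  monotone_nat_of_le_succ fun n => by
    rw [stepSum_succ]
    linarith [Real.rpow_nonneg (h.pos n).le β]

theorem IsStepSequence.stepSum_pos (h : IsStepSequence γ) (n : ℕ) : 0 < stepSum γ β (n + 1) := by
  rw [stepSum_succ]
  have h1 := h.monotone_stepSum (β := β) (Nat.zero_le n)
  rw [stepSum_zero] at h1
  linarith [Real.rpow_pos_of_pos (h.pos n) β]

/-- The positive part of the increments of `γ^{β-1}` is controlled by the increments of `γ^{-1}`. -/
theorem max_rpow_sub_le {x y G : ℝ} (hβ : 0 ≤ β) (hy : 0 < y) (hyx : y ≤ x) (hxG : x ≤ G) :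
    max (y ^ (β - 1) - x ^ (β - 1)) 0 ≤ G ^ β * |1 / y - 1 / x| := by
  have hx : 0 < x := hy.trans_le hyx
  have hG : 0 < G := hx.trans_le hxG
  refine max_le ?_ (by positivity)
  have hd : 0 ≤ 1 / y - 1 / x := sub_nonneg.2 (one_div_le_one_div_of_le hy hyx)
  rw [abs_of_nonneg hd]
  rcases le_or_gt 1 β with h1 | h1
  · have := Real.rpow_le_rpow hy.le hyx (by linarith : 0 ≤ β - 1)
    have h2 : 0 ≤ G ^ β * (1 / y - 1 / x) := by positivity
    linarith
  · have h2 := _root_.rpow_one_add_le_one_add_mul_self (s := x / y - 1) (p := 1 - β)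
      (by have : 0 ≤ x / y := by positivity
          linarith) (by linarith) (by linarith)
    rw [add_sub_cancel] at h2
    have hxy : 1 ≤ x / y := (one_le_div hy).2 hyx
    have h3 : (x / y) ^ (1 - β) - 1 ≤ x / y - 1 := by nlinarith
    have e1 : y ^ (β - 1) = x ^ (β - 1) * (x / y) ^ (1 - β) := by
      rw [Real.div_rpow hx.le hy.le, ← mul_div_assoc, ← Real.rpow_add hx, sub_add_sub_cancel,
        sub_self, Real.rpow_zero, one_div, ← Real.rpow_neg hy.le, neg_sub]
    have e2 : x ^ (β - 1) * (x / y - 1) = x ^ β * (1 / y - 1 / x) := by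
      rw [Real.rpow_sub_one hx.ne']
      field_simp
    calc y ^ (β - 1) - x ^ (β - 1) = x ^ (β - 1) * ((x / y) ^ (1 - β) - 1) := by rw [e1]; ring
      _ ≤ x ^ (β - 1) * (x / y - 1) :=
          mul_le_mul_of_nonneg_left h3 (Real.rpow_nonneg hx.le _)
      _ = x ^ β * (1 / y - 1 / x) := e2
      _ ≤ _ := mul_le_mul_of_nonneg_right (Real.rpow_le_rpow hx.le hxG hβ) hd

/-- A sequence `w ≥ 1` such that `w²` is bounded in `L¹` and contracts on average. -/
structure IsLyapunovSequence (P : Measure Ω) (𝓕 : Filtration ℕ mΩ) (γ : ℕ → ℝ)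
    (w : ℕ → Ω → ℝ) (B α β' : ℝ) (n₀ : ℕ) : Prop where
  adapted : ∀ n, StronglyMeasurable[𝓕 n] (w n)
  one_le : ∀ n ω, 1 ≤ w n ω
  memLp : ∀ n, MemLp (w n) 2 P
  bound : ∀ n, ∫ ω, w n ω ^ 2 ∂P ≤ B
  alpha_pos : 0 < α
  beta_nonneg : 0 ≤ β'
  stable : ∀ n ≥ n₀, P[fun ω => w (n + 1) ω ^ 2|𝓕 n]
    ≤ᵐ[P] fun ω => (1 - α * γ (n + 1)) * w n ω ^ 2 + β' * γ (n + 1)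

theorem IsLyapunovSequence.integral_le [IsProbabilityMeasure P]
    (h : IsLyapunovSequence P 𝓕 γ w B α β' n₀) (n : ℕ) : ∫ ω, w n ω ∂P ≤ B := by
  refine (integral_mono ((h.memLp n).integrable one_le_two) (h.memLp n).integrable_sq
    fun ω => ?_).trans (h.bound n)
  have := h.one_le n ω
  show w n ω ≤ w n ω ^ 2
  nlinarith

/-- The contraction of `w²` implies that of `w`. -/
theorem IsLyapunovSequence.condExp_le [IsProbabilityMeasure P]
    (h : IsLyapunovSequence P 𝓕 γ w B α β' n₀) (hγ : IsStepSequence γ) {n : ℕ} (hn : n₀ ≤ n) :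
    P[w (n + 1)|𝓕 n] ≤ᵐ[P] fun ω => w n ω - (α / 2) * γ (n + 1) * w n ω + β' / 2 * γ (n + 1) := by
  have hi1 := (h.memLp (n + 1)).integrable one_le_two
  have hi0 := (h.memLp n).integrable one_le_two
  have hsq := (h.memLp (n + 1)).integrable_sq
  have hginv : StronglyMeasurable[𝓕 n] fun ω => (w n ω)⁻¹ :=
    (h.adapted n).measurable.inv.stronglyMeasurable
  have hgi : Integrable ((fun ω => (w n ω)⁻¹) * fun ω => w (n + 1) ω ^ 2) P := by
    refine hsq.mono (((hginv.mono (𝓕.le n)).aestronglyMeasurable).mul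
      hsq.aestronglyMeasurable) (ae_of_all _ fun ω => ?_)
    have h1 := h.one_le n ω
    rw [Pi.mul_apply, norm_mul, norm_inv, Real.norm_of_nonneg (by linarith : 0 ≤ w n ω)]
    exact mul_le_of_le_one_left (norm_nonneg _) (inv_le_one_of_one_le₀ h1)
  -- the tangent inequality `2 w' ≤ w'² / w + w` replaces the conditional Jensen inequality
  have hle : w (n + 1) ≤ᵐ[P]
      (1 / 2 : ℝ) • (((fun ω => (w n ω)⁻¹) * fun ω => w (n + 1) ω ^ 2) + w n) := by
    refine ae_of_all _ fun ω => ?_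
    have h1 := h.one_le n ω
    have h0 : 0 < w n ω := by linarith
    simp only [Pi.smul_apply, Pi.add_apply, Pi.mul_apply, smul_eq_mul]
    have : (w n ω)⁻¹ * w (n + 1) ω ^ 2 + w n ω - 2 * w (n + 1) ω
        = (w n ω)⁻¹ * (w (n + 1) ω - w n ω) ^ 2 := by field_simp; ring
    have h2 : 0 ≤ (w n ω)⁻¹ * (w (n + 1) ω - w n ω) ^ 2 := by positivity
    linarith
  have c1 := condExp_mono (m := 𝓕 n) hi1 ((hgi.add hi0).smul (1 / 2 : ℝ)) hle
  have c2 := condExp_smul (μ := P) (1 / 2 : ℝ)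
    (((fun ω => (w n ω)⁻¹) * fun ω => w (n + 1) ω ^ 2) + w n) (𝓕 n)
  have c3 := condExp_add hgi hi0 (𝓕 n)
  have c4 := condExp_mul_of_stronglyMeasurable_left hginv hgi hsq
  have c5 := condExp_of_stronglyMeasurable (𝓕.le n) (h.adapted n) hi0
  filter_upwards [c1, c2, c3, c4, h.stable n hn] with ω d1 d2 d3 d4 d6
  have h1 := h.one_le n ω
  have h0 : 0 < w n ω := by linarith
  rw [d2, Pi.smul_apply, d3, Pi.add_apply, d4, Pi.mul_apply, c5, smul_eq_mul] at d1
  refine d1.trans ?_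
  have e : (w n ω)⁻¹ * P[fun ω => w (n + 1) ω ^ 2|𝓕 n] ω
      ≤ (w n ω)⁻¹ * ((1 - α * γ (n + 1)) * w n ω ^ 2 + β' * γ (n + 1)) :=
    mul_le_mul_of_nonneg_left d6 (by positivity)
  have e2 : (w n ω)⁻¹ * ((1 - α * γ (n + 1)) * w n ω ^ 2 + β' * γ (n + 1))
      = (1 - α * γ (n + 1)) * w n ω + (w n ω)⁻¹ * (β' * γ (n + 1)) := by field_simp
  have e3 : (w n ω)⁻¹ * (β' * γ (n + 1)) ≤ 1 * (β' * γ (n + 1)) :=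
    mul_le_mul_of_nonneg_right (inv_le_one_of_one_le₀ h1)
      (mul_nonneg h.beta_nonneg (hγ.pos n).le)
  linarith

theorem memLp_sub_condExp [IsProbabilityMeasure P] {X : Ω → ℝ} {m : MeasurableSpace Ω}
    (hX : MemLp X 2 P) : MemLp (fun ω => X ω - P[X|m] ω) 2 P :=
  hX.sub (hX.condExp one_le_two)

theorem condExp_sub_condExp [IsProbabilityMeasure P] {X : Ω → ℝ} {m : MeasurableSpace Ω}
    (hm : m ≤ mΩ) (hX : Integrable X P) : P[fun ω => X ω - P[X|m] ω|m] =ᵐ[P] 0 := by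
  have h1 := condExp_sub hX (integrable_condExp (m := m) (f := X) (μ := P)) m
  have h2 := condExp_of_stronglyMeasurable hm (stronglyMeasurable_condExp (m := m) (f := X) (μ := P))
    integrable_condExp
  filter_upwards [h1] with ω h3
  have : P[fun ω => X ω - P[X|m] ω|m] ω = P[X - P[X|m]|m] ω := rfl
  rw [this, h3, Pi.sub_apply, h2]
  simp

/-- Almost surely, `∑_{k<n} γ_{k+1}^β w_k = O(Γ_n^{(β)})`. -/
theorem IsLyapunovSequence.ae_weighted_sum_le [IsProbabilityMeasure P]
    (h : IsLyapunovSequence P 𝓕 γ w B α β' n₀) (hγ : IsStepSequence γ) (hβ : 1 / 2 ≤ β)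
    (hs : StepConditions γ β) :
    ∀ᵐ ω ∂P, ∃ C, 0 ≤ C ∧ ∀ n, ∑ k ∈ Finset.range n, γ (k + 1) ^ β * w k ω ≤ C * stepSum γ β n := by
  set A := stepSum γ β with hA
  set c : ℕ → ℝ := fun k => γ (k + 1) ^ (β - 1) with hc
  have hc0 : ∀ k, 0 ≤ c k := fun k => Real.rpow_nonneg (hγ.pos k).le _
  have hB0 : 0 ≤ B := (integral_nonneg fun ω => sq_nonneg (w 0 ω)).trans (h.bound 0)
  have hw0 : ∀ n ω, 0 ≤ w n ω := fun n ω => zero_le_one.trans (h.one_le n ω)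
  set N : ℕ → Ω → ℝ := fun k ω => w (k + 1) ω - P[w (k + 1)|𝓕 k] ω with hN
  have hNm : ∀ k, StronglyMeasurable[𝓕 (k + 1)] (N k) := fun k =>
    (h.adapted (k + 1)).sub (stronglyMeasurable_condExp.mono (𝓕.mono k.le_succ))
  have hN2 : ∀ k, ∫ ω, N k ω ^ 2 ∂P ≤ B := fun k =>
    (integral_sub_condExp_sq_le (𝓕.le k) (h.memLp _)).trans (h.bound _)
  have hmart : ∀ᵐ ω ∂P, ∃ S, ∀ n,
      |∑ k ∈ Finset.range n, ((A (k + 1))⁻¹ * c k) * N k ω| ≤ S := by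
    refine ae_bounded_martingale_sum hNm (fun k => memLp_sub_condExp (h.memLp _))
      (fun k => condExp_sub_condExp (𝓕.le k) ((h.memLp _).integrable one_le_two)) ?_
    refine Summable.of_nonneg_of_le (fun k => mul_nonneg (sq_nonneg _)
      (integral_nonneg fun ω => sq_nonneg _)) (fun k => ?_)
      (hs.summable_squares.mul_left (γ 1 ^ (2 * β - 1) * B))
    have hp := hγ.pos k
    have hAp : 0 < A (k + 1) := hγ.stepSum_pos k
    have e1 : c k ^ 2 = γ (k + 1) ^ (2 * β - 1) * (γ (k + 1))⁻¹ := by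
      simp only [hc]
      rw [← Real.rpow_natCast, ← Real.rpow_mul hp.le, ← Real.rpow_neg_one, ← Real.rpow_add hp]
      congr 1
      push_cast
      ring
    have e2 : γ (k + 1) ^ (2 * β - 1) ≤ γ 1 ^ (2 * β - 1) :=
      Real.rpow_le_rpow hp.le (hγ.le_first k) (by linarith)
    calc ((A (k + 1))⁻¹ * c k) ^ 2 * ∫ ω, N k ω ^ 2 ∂P
        ≤ ((A (k + 1))⁻¹ * c k) ^ 2 * B := mul_le_mul_of_nonneg_left (hN2 k) (sq_nonneg _)
      _ = γ (k + 1) ^ (2 * β - 1) * (B * ((γ (k + 1))⁻¹ * ((A (k + 1))⁻¹) ^ 2)) := by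
          rw [mul_pow, e1]; ring
      _ ≤ γ 1 ^ (2 * β - 1) * (B * ((γ (k + 1))⁻¹ * ((A (k + 1))⁻¹) ^ 2)) :=
          mul_le_mul_of_nonneg_right e2 (by positivity)
      _ = γ 1 ^ (2 * β - 1) * B * (1 / (γ (k + 1) * A (k + 1) ^ 2)) := by
          rw [one_div, mul_inv, inv_pow]; ring
  set d : ℕ → ℝ := fun k => max (c (k + 1) - c k) 0 with hd
  have hd0 : ∀ k, 0 ≤ d k := fun k => le_max_right _ _
  have hincr : ∀ᵐ ω ∂P, ∃ S, ∀ n,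
      ∑ k ∈ Finset.range n, ((A (k + 2))⁻¹ * d k) * w (k + 1) ω ≤ S := by
    refine ae_bounded_sum_of_summable (fun k ω => hw0 _ _)
      (fun k => (h.memLp (k + 1)).integrable one_le_two) (fun k => h.integral_le (k + 1))
      (fun k => mul_nonneg (inv_nonneg.2 (hγ.stepSum_pos _).le) (hd0 k)) ?_
    refine Summable.of_nonneg_of_le
      (fun k => mul_nonneg (inv_nonneg.2 (hγ.stepSum_pos _).le) (hd0 k)) (fun k => ?_)
      (hs.summable_increments.mul_left (γ 1 ^ β))
    have hAp : 0 < A (k + 2) := hγ.stepSum_pos _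
    calc (A (k + 2))⁻¹ * d k
        ≤ (A (k + 2))⁻¹ * (γ 1 ^ β * |1 / γ (k + 2) - 1 / γ (k + 1)|) :=
          mul_le_mul_of_nonneg_left (max_rpow_sub_le (by linarith) (hγ.pos _) (hγ.anti _)
            (hγ.le_first _)) (by positivity)
      _ = _ := by rw [hA]; ring
  have hcond : ∀ᵐ ω ∂P, ∀ n ≥ n₀, P[w (n + 1)|𝓕 n] ω
      ≤ w n ω - (α / 2) * γ (n + 1) * w n ω + β' / 2 * γ (n + 1) := by
    refine ae_all_iff.2 fun n => ?_
    by_cases hn : n₀ ≤ n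
    · filter_upwards [h.condExp_le hγ hn] with ω hω _ using hω
    · exact ae_of_all _ fun ω hn' => absurd hn' hn
  filter_upwards [hmart, hincr, hcond] with ω ⟨S1, hS1⟩ ⟨S2, hS2⟩ hω
  have hα := h.alpha_pos
  have hA1 : 0 < A 1 := hγ.stepSum_pos 0
  -- `D` is the defect of the contraction inequality, multiplied by `c_k = γ_{k+1}^{β-1}`; it is
  -- nonpositive from `n₀` on.
  set D : ℕ → ℝ := fun k => α / 2 * (γ (k + 1) ^ β * w k ω)
    - (c k * (w k ω - w (k + 1) ω) + c k * N k ω + β' / 2 * γ (k + 1) ^ β) with hD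
  set R : ℝ := ∑ k ∈ Finset.range n₀, |D k| with hR
  have hR0 : 0 ≤ R := Finset.sum_nonneg fun k _ => abs_nonneg _
  have hDneg : ∀ k ≥ n₀, D k ≤ 0 := by
    intro k hk
    have e : γ (k + 1) ^ β = c k * γ (k + 1) := by
      simp only [hc]
      rw [← Real.rpow_add_one (hγ.pos k).ne', sub_add_cancel]
    have h1 := mul_le_mul_of_nonneg_left (hω k hk) (hc0 k)
    simp only [hD, hN, e]
    linarith
  have hDsum : ∀ n, ∑ k ∈ Finset.range n, D k ≤ R := by
    intro n
    calc ∑ k ∈ Finset.range n, D k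
        ≤ ∑ k ∈ Finset.range n, if k < n₀ then |D k| else 0 := by
          refine Finset.sum_le_sum fun k _ => ?_
          split_ifs with hk
          · exact le_abs_self _
          · exact hDneg k (not_lt.1 hk)
      _ = ∑ k ∈ (Finset.range n).filter (· < n₀), |D k| := (Finset.sum_filter _ _).symm
      _ ≤ R := by
          refine Finset.sum_le_sum_of_subset_of_nonneg (fun k hk => ?_) fun _ _ _ => abs_nonneg _
          simpa using (Finset.mem_filter.1 hk).2
  have hS1' : ∀ n, |∑ k ∈ Finset.range n, (A (k + 1))⁻¹ * (c k * N k ω)| ≤ S1 := fun n => by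
    simpa only [mul_assoc] using hS1 n
  have hS10 : 0 ≤ S1 := (abs_nonneg _).trans (hS1' 0)
  have hS20 : 0 ≤ S2 := by simpa using hS2 0
  have hc0w : 0 ≤ c 0 * w 0 ω := mul_nonneg (hc0 0) (hw0 0 ω)
  refine ⟨2 / α * ((c 0 * w 0 ω + R) / A 1 + S2 + 2 * S1 + β' / 2),
    mul_nonneg (by positivity) (by have := h.beta_nonneg; positivity), fun n => ?_⟩
  cases n with
  | zero => simp [hA, stepSum_zero]
  | succ n =>
    have hAn : A 1 ≤ A (n + 1) := hγ.monotone_stepSum (by omega)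
    have t1 : ∑ k ∈ Finset.range (n + 1), c k * (w k ω - w (k + 1) ω)
        ≤ c 0 * w 0 ω + A (n + 1) * S2 := by
      rw [sum_mul_sub_succ c (fun k => w k ω)]
      have h1 : ∑ k ∈ Finset.range n, (c (k + 1) - c k) * w (k + 1) ω
          ≤ ∑ k ∈ Finset.range n, d k * w (k + 1) ω :=
        Finset.sum_le_sum fun k _ => mul_le_mul_of_nonneg_right (le_max_left _ _) (hw0 _ _)
      have h2 : ∑ k ∈ Finset.range n, d k * w (k + 1) ω ≤ A (n + 1) * S2 :=
        sum_le_mul_of_weighted_sum_le (A := fun k => A (k + 2))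
          (fun k hk => hγ.monotone_stepSum (by omega)) (hγ.stepSum_pos n).le
          (fun k => hγ.stepSum_pos _) (fun k => mul_nonneg (hd0 k) (hw0 _ _))
          (by simpa only [mul_assoc] using hS2 n)
      have h3 : 0 ≤ c n * w (n + 1) ω := mul_nonneg (hc0 n) (hw0 _ _)
      linarith
    have t2 := abs_sum_le_of_abs_weighted_sum_le (A := A) (x := fun k => c k * N k ω)
      stepSum_zero hγ.monotone_stepSum hγ.stepSum_pos hS1' (n + 1)
    have t3 := hDsum (n + 1)
    have t4 : ∑ k ∈ Finset.range (n + 1), D k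
        = α / 2 * ∑ k ∈ Finset.range (n + 1), γ (k + 1) ^ β * w k ω
          - (∑ k ∈ Finset.range (n + 1), c k * (w k ω - w (k + 1) ω)
            + ∑ k ∈ Finset.range (n + 1), c k * N k ω + β' / 2 * A (n + 1)) := by
      simp only [hD, Finset.sum_sub_distrib, Finset.sum_add_distrib, ← Finset.mul_sum]
      rw [hA, stepSum_eq_sum_range]
    have t5 : c 0 * w 0 ω + R ≤ (c 0 * w 0 ω + R) / A 1 * A (n + 1) := by
      rw [div_mul_eq_mul_div, le_div_iff₀ hA1]
      exact mul_le_mul_of_nonneg_left hAn (by positivity)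
    have t6 := (le_abs_self _).trans t2
    have t7 : α / 2 * ∑ k ∈ Finset.range (n + 1), γ (k + 1) ^ β * w k ω
        ≤ ((c 0 * w 0 ω + R) / A 1 + S2 + 2 * S1 + β' / 2) * A (n + 1) := by
      nlinarith
    calc ∑ k ∈ Finset.range (n + 1), γ (k + 1) ^ β * w k ω
        = 2 / α * (α / 2 * ∑ k ∈ Finset.range (n + 1), γ (k + 1) ^ β * w k ω) := by
          field_simp
      _ ≤ 2 / α * (((c 0 * w 0 ω + R) / A 1 + S2 + 2 * S1 + β' / 2) * A (n + 1)) :=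
          mul_le_mul_of_nonneg_left t7 (by positivity)
      _ = _ := by ring

/-- Almost surely, `w_n = O(Γ_n^{(β)} γ_n)`. -/
theorem IsLyapunovSequence.ae_le_stepSum_mul [IsProbabilityMeasure P]
    (h : IsLyapunovSequence P 𝓕 γ w B α β' n₀) (hγ : IsStepSequence γ)
    (hs : StepConditions γ β) :
    ∀ᵐ ω ∂P, ∃ C, 0 ≤ C ∧ ∀ n, w (n + 1) ω ≤ C * (stepSum γ β (n + 1) * γ (n + 1)) := by
  -- As `a` is non-increasing, `(a w)²` is an almost supermartingale. The maximum with `1` avoids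
  -- the index `0`, where the step sum is empty.
  set a : ℕ → ℝ := fun n => (stepSum γ β (max n 1) * γ (max n 1))⁻¹ with ha
  have hpos : ∀ n, 0 < stepSum γ β (n + 1) * γ (n + 1) := fun n =>
    mul_pos (hγ.stepSum_pos n) (hγ.pos n)
  have ha1 : ∀ n, a (n + 1) = (stepSum γ β (n + 1) * γ (n + 1))⁻¹ := fun n => by
    simp only [ha]
    have : max (n + 1) 1 = n + 1 := by omega
    rw [this]
  have ha0 : ∀ n, 0 ≤ a n := fun n => by
    obtain ⟨i, hi⟩ : ∃ i, max n 1 = i + 1 := ⟨max n 1 - 1, by omega⟩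
    simp only [ha, hi]
    exact inv_nonneg.2 (hpos i).le
  have hanti : ∀ n, a (n + 1) ≤ a n := by
    intro n
    cases n with
    | zero => simp [ha]
    | succ n => rw [ha1, ha1]; exact hs.antitone (n + 1) (by omega)
  have hale : ∀ n, a n ≤ a 0 := fun n => by
    induction n with
    | zero => exact le_rfl
    | succ n ih => exact (hanti n).trans ih
  have hsum : Summable fun n => β' * (γ (n + 1) * a (n + 1) ^ 2) := by
    refine (hs.summable_squares.congr fun n => ?_).mul_left β'
    have := (hγ.pos n).ne'
    have := (hγ.stepSum_pos (β := β) n).ne'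
    rw [ha1]
    field_simp
  have key := ae_bounded_of_almost_supermartingale (𝓕 := 𝓕) (P := P)
    (X := fun n ω => a n ^ 2 * w n ω ^ 2) (δ := fun n => β' * (γ (n + 1) * a (n + 1) ^ 2))
    (n₀ := n₀) (B := a 0 ^ 2 * B)
    (fun k => ((h.adapted k).pow 2).const_mul _) (fun k ω => by positivity)
    (fun k => ((h.memLp k).integrable_sq).const_mul _)
    (fun k => by
      rw [integral_const_mul]
      exact mul_le_mul (pow_le_pow_left₀ (ha0 k) (hale k) 2) (h.bound k)
        (integral_nonneg fun ω => sq_nonneg _) (sq_nonneg _))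
    (fun k => mul_nonneg h.beta_nonneg (mul_nonneg (hγ.pos k).le (sq_nonneg _))) hsum
    (fun n hn => by
      have c1 := condExp_smul (μ := P) (a (n + 1) ^ 2) (fun ω => w (n + 1) ω ^ 2) (𝓕 n)
      filter_upwards [c1, h.stable n hn] with ω d1 d2
      have e : P[fun ω => a (n + 1) ^ 2 * w (n + 1) ω ^ 2|𝓕 n] ω
        = a (n + 1) ^ 2 * P[fun ω => w (n + 1) ω ^ 2|𝓕 n] ω := d1
      rw [e]
      have h1 : a (n + 1) ^ 2 ≤ a n ^ 2 := pow_le_pow_left₀ (ha0 _) (hanti n) 2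
      have h2 : 0 ≤ α * γ (n + 1) * w n ω ^ 2 :=
        mul_nonneg (mul_nonneg h.alpha_pos.le (hγ.pos n).le) (sq_nonneg _)
      calc a (n + 1) ^ 2 * P[fun ω => w (n + 1) ω ^ 2|𝓕 n] ω
          ≤ a (n + 1) ^ 2 * (w n ω ^ 2 + β' * γ (n + 1)) :=
            mul_le_mul_of_nonneg_left (by linarith) (sq_nonneg _)
        _ ≤ _ := by nlinarith [sq_nonneg (w n ω)])
  filter_upwards [key] with ω ⟨C, hC⟩
  refine ⟨√C, Real.sqrt_nonneg _, fun n => ?_⟩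
  have h1 := hC (n + 1)
  rw [← mul_pow, ha1] at h1
  have h2 := Real.le_sqrt_of_sq_le h1
  rwa [inv_mul_le_iff₀ (hpos n), mul_comm] at h2

end Rates


section Expansion

variable {Ω : Type*} {mΩ : MeasurableSpace Ω} {P : Measure Ω} {𝓕 : Filtration ℕ mΩ}
  {γ : ℕ → ℝ} {β : ℝ} {w Φ F : ℕ → Ω → ℝ} {α β' B C : ℝ} {n₀ : ℕ}

/-- Minkowski's inequality, with the uniform bound of the second moments of `w`. -/
theorem IsLyapunovSequence.eLpNorm_le_of_abs_le [IsProbabilityMeasure P]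
    (h : IsLyapunovSequence P 𝓕 γ w B α β' n₀) {s : Finset ℕ} {d : ℕ → ℝ} (hd : ∀ k, 0 ≤ d k)
    {i : ℕ} {X : Ω → ℝ} (hX : ∀ᵐ ω ∂P, |X ω| ≤ ∑ k ∈ s, d k * w (k + i) ω) :
    eLpNorm X 2 P ≤ ENNReal.ofReal ((∑ k ∈ s, d k) * √B) := by
  have hB0 : 0 ≤ B := (integral_nonneg fun ω => sq_nonneg (w 0 ω)).trans (h.bound 0)
  calc eLpNorm X 2 P ≤ eLpNorm (fun ω => ∑ k ∈ s, d k * w (k + i) ω) 2 P :=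
        eLpNorm_mono_ae_real hX
    _ = eLpNorm (∑ k ∈ s, fun ω => d k * w (k + i) ω) 2 P := by
        congr 1; ext ω; simp
    _ ≤ ∑ k ∈ s, eLpNorm (fun ω => d k * w (k + i) ω) 2 P :=
        eLpNorm_sum_le (fun k _ => ((h.memLp _).const_mul _).aestronglyMeasurable) one_le_two
    _ ≤ ∑ k ∈ s, ENNReal.ofReal (d k * √B) := by
        refine Finset.sum_le_sum fun k _ => eLpNorm_two_le_of_integral_sq_le
          ((h.memLp _).const_mul _) (mul_nonneg (hd k) (Real.sqrt_nonneg _)) ?_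
        simp only [mul_pow, integral_const_mul, Real.sq_sqrt hB0]
        exact mul_le_mul_of_nonneg_left (h.bound _) (sq_nonneg _)
    _ = _ := by
        rw [← ENNReal.ofReal_sum_of_nonneg fun k _ => mul_nonneg (hd k) (Real.sqrt_nonneg _),
          Finset.sum_mul]

/-- The positive limit of `Γ_n^{(β)} / √Γ_n^{(-1)}` bounds the martingale rate `√Γ_n^{(-1)}` by
`Γ_n^{(β)}`. -/
theorem exists_sqrt_stepSum_le (hγ : IsStepSequence γ) (hs : StepConditions γ β) :
    ∃ D, 0 ≤ D ∧ ∀ n, √(stepSum γ (-1) (n + 1)) ≤ D * stepSum γ β (n + 1) := by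
  have hpos : ∀ n, 0 < √(stepSum γ (-1) (n + 1)) := fun n => Real.sqrt_pos.2 (hγ.stepSum_pos n)
  have hApos : ∀ n, 0 < stepSum γ β (n + 1) := hγ.stepSum_pos
  obtain ⟨c, hc, hev⟩ : ∃ c : ℝ, 0 < c ∧ ∀ᶠ n in atTop,
      c ≤ stepSum γ β n / √(stepSum γ (-1) n) := by
    rcases hs.ratio with ⟨ξ, hξ, ht⟩ | ht
    · exact ⟨ξ / 2, by positivity, ht.eventually (eventually_ge_nhds (by linarith))⟩
    · exact ⟨1, one_pos, ht.eventually_ge_atTop 1⟩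
  obtain ⟨M, hM⟩ := eventually_atTop.1 hev
  set R : ℕ → ℝ := fun n => √(stepSum γ (-1) (n + 1)) / stepSum γ β (n + 1) with hR
  have hR0 : ∀ n, 0 ≤ R n := fun n => (div_pos (hpos n) (hApos n)).le
  refine ⟨c⁻¹ + ∑ k ∈ Finset.range M, R k,
    add_nonneg (by positivity) (Finset.sum_nonneg fun k _ => hR0 k), fun n => ?_⟩
  rw [← div_le_iff₀ (hApos n)]
  by_cases hn : n < M
  · have := Finset.single_le_sum (f := R) (fun k _ => hR0 k) (Finset.mem_range.2 hn)
    have h2 : (0 : ℝ) ≤ c⁻¹ := by positivity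
    exact this.trans (by linarith)
  · have h1 := hM (n + 1) (by omega)
    have h2 : √(stepSum γ (-1) (n + 1)) / stepSum γ β (n + 1) ≤ c⁻¹ := by
      rw [← inv_div]
      exact inv_anti₀ hc h1
    linarith [Finset.sum_nonneg fun k (_ : k ∈ Finset.range M) => hR0 k]

/-- If the mean increments of `Φ = O(w)` are `-γ F` up to errors of order `γ^{β+1} w`, and its
increments have second moments of order `γ`, then `∑_{k<n} F_k` is of order `Γ_n^{(β)}`, almost
surely and in `L²`. After division by `γ_{k+1}`, the sum of `F` is a sum of `(Φ_k - Φ_{k+1}) / γ_{k+1}`,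
treated by Abel summation, of martingale increments, and of the errors. -/
theorem IsLyapunovSequence.sum_rate [IsProbabilityMeasure P]
    (h : IsLyapunovSequence P 𝓕 γ w B α β' n₀) (hγ : IsStepSequence γ) (hβ : 1 / 2 ≤ β)
    (hs : StepConditions γ β) (hC : 0 ≤ C)
    (hΦm : ∀ n, StronglyMeasurable[𝓕 n] (Φ n)) (hΦ : ∀ n ω, |Φ n ω| ≤ C * w n ω)
    (hΔ : ∀ n, ∫ ω, (Φ (n + 1) ω - Φ n ω) ^ 2 ∂P ≤ C * γ (n + 1))
    (hdrift : ∀ n, ∀ᵐ ω ∂P, |P[fun ω => Φ (n + 1) ω - Φ n ω|𝓕 n] ω + γ (n + 1) * F n ω|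
      ≤ C * γ (n + 1) ^ (β + 1) * w n ω)
    (hFm : ∀ n, AEStronglyMeasurable (F n) P) :
    (∀ᵐ ω ∂P, ∃ R, ∀ n, |∑ k ∈ Finset.range n, F k ω| ≤ R * stepSum γ β n) ∧
    ∃ R, ∀ n, eLpNorm (fun ω => ∑ k ∈ Finset.range n, F k ω) 2 P
      ≤ ENNReal.ofReal (R * stepSum γ β n) := by
  set A := stepSum γ β with hA
  set c : ℕ → ℝ := fun k => 1 / γ (k + 1) with hc
  have hc0 : ∀ k, 0 < c k := fun k => one_div_pos.2 (hγ.pos k)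
  have hcm : ∀ k, c k ≤ c (k + 1) := fun k => one_div_le_one_div_of_le (hγ.pos _) (hγ.anti k)
  have hw0 : ∀ n ω, 0 ≤ w n ω := fun n ω => zero_le_one.trans (h.one_le n ω)
  have hB0 : 0 ≤ B := (integral_nonneg fun ω => sq_nonneg (w 0 ω)).trans (h.bound 0)
  have hΦ2 : ∀ n, MemLp (Φ n) 2 P := fun n =>
    ((h.memLp n).const_mul C).mono ((hΦm n).mono (𝓕.le n)).aestronglyMeasurable
      (ae_of_all _ fun ω => by
        rw [Real.norm_eq_abs, Real.norm_eq_abs, abs_of_nonneg (mul_nonneg hC (hw0 n ω))]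
        exact hΦ n ω)
  set I : ℕ → Ω → ℝ := fun k ω => Φ (k + 1) ω - Φ k ω with hI
  have hI2 : ∀ k, MemLp (I k) 2 P := fun k => (hΦ2 _).sub (hΦ2 _)
  set N : ℕ → Ω → ℝ := fun k ω => I k ω - P[I k|𝓕 k] ω with hN
  have hIm : ∀ k, StronglyMeasurable[𝓕 (k + 1)] (I k) := fun k =>
    (hΦm (k + 1)).sub ((hΦm k).mono (𝓕.mono k.le_succ))
  have hNm : ∀ k, StronglyMeasurable[𝓕 (k + 1)] (N k) := fun k =>
    (hIm k).sub (stronglyMeasurable_condExp.mono (𝓕.mono k.le_succ))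
  have hN2 : ∀ k, MemLp (N k) 2 P := fun k => memLp_sub_condExp (hI2 k)
  have hN0 : ∀ k, P[N k|𝓕 k] =ᵐ[P] 0 := fun k =>
    condExp_sub_condExp (𝓕.le k) ((hI2 k).integrable one_le_two)
  have hNsq : ∀ k, ∫ ω, N k ω ^ 2 ∂P ≤ C * γ (k + 1) := fun k =>
    (integral_sub_condExp_sq_le (𝓕.le k) (hI2 k)).trans (hΔ k)
  -- The error of the drift hypothesis, after division by `γ_{k+1}`.
  set e : ℕ → Ω → ℝ := fun k ω => F k ω + c k * P[I k|𝓕 k] ω with he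
  have hebd : ∀ᵐ ω ∂P, ∀ k, |e k ω| ≤ C * γ (k + 1) ^ β * w k ω := by
    refine ae_all_iff.2 fun k => ?_
    filter_upwards [hdrift k] with ω hω
    have hp := hγ.pos k
    have e1 : e k ω = c k * (P[I k|𝓕 k] ω + γ (k + 1) * F k ω) := by
      simp only [he, hc]
      field_simp
      ring
    rw [e1, abs_mul, abs_of_pos (hc0 k)]
    refine (mul_le_mul_of_nonneg_left hω (hc0 k).le).trans (le_of_eq ?_)
    rw [Real.rpow_add_one hp.ne']
    simp only [hc]
    field_simp
  have hdecomp : ∀ n ω, ∑ k ∈ Finset.range n, F k ω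
      = ∑ k ∈ Finset.range n, c k * (Φ k ω - Φ (k + 1) ω)
        + ∑ k ∈ Finset.range n, c k * N k ω + ∑ k ∈ Finset.range n, e k ω := by
    intro n ω
    rw [← Finset.sum_add_distrib, ← Finset.sum_add_distrib]
    refine Finset.sum_congr rfl fun k _ => ?_
    simp only [he, hN, hI]
    ring
  have habel : ∀ n ω, |∑ k ∈ Finset.range (n + 1), c k * (Φ k ω - Φ (k + 1) ω)|
      ≤ C * (c 0 * w 0 ω + ∑ k ∈ Finset.range n, |c (k + 1) - c k| * w (k + 1) ω
        + c n * w (n + 1) ω) := by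
    intro n ω
    rw [sum_mul_sub_succ c (fun k => Φ k ω)]
    have h1 : |c 0 * Φ 0 ω| ≤ C * (c 0 * w 0 ω) := by
      rw [abs_mul, abs_of_pos (hc0 0)]
      nlinarith [hΦ 0 ω, hc0 0]
    have h2 : |c n * Φ (n + 1) ω| ≤ C * (c n * w (n + 1) ω) := by
      rw [abs_mul, abs_of_pos (hc0 n)]
      nlinarith [hΦ (n + 1) ω, hc0 n]
    have h3 : |∑ k ∈ Finset.range n, (c (k + 1) - c k) * Φ (k + 1) ω|
        ≤ C * ∑ k ∈ Finset.range n, |c (k + 1) - c k| * w (k + 1) ω := by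
      refine (Finset.abs_sum_le_sum_abs _ _).trans ?_
      rw [Finset.mul_sum]
      refine Finset.sum_le_sum fun k _ => ?_
      rw [abs_mul]
      nlinarith [hΦ (k + 1) ω, abs_nonneg (c (k + 1) - c k)]
    rw [abs_le] at h1 h2 h3 ⊢
    constructor <;> linarith [h1.1, h1.2, h2.1, h2.2, h3.1, h3.2]
  refine ⟨?_, ?_⟩
  · have hmart : ∀ᵐ ω ∂P, ∃ S, ∀ n,
        |∑ k ∈ Finset.range n, ((A (k + 1))⁻¹ * c k) * N k ω| ≤ S := by
      refine ae_bounded_martingale_sum hNm hN2 hN0 ?_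
      refine Summable.of_nonneg_of_le (fun k => mul_nonneg (sq_nonneg _)
        (integral_nonneg fun ω => sq_nonneg _)) (fun k => ?_) (hs.summable_squares.mul_left C)
      have hp := hγ.pos k
      have hAp : 0 < A (k + 1) := hγ.stepSum_pos k
      refine (mul_le_mul_of_nonneg_left (hNsq k) (sq_nonneg _)).trans (le_of_eq ?_)
      simp only [hc]
      rw [← hA]
      field_simp
    have hincr : ∀ᵐ ω ∂P, ∃ S, ∀ n,
        ∑ k ∈ Finset.range n, ((A (k + 2))⁻¹ * |c (k + 1) - c k|) * w (k + 1) ω ≤ S := by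
      refine ae_bounded_sum_of_summable (fun k ω => hw0 _ _)
        (fun k => (h.memLp (k + 1)).integrable one_le_two) (fun k => h.integral_le (k + 1))
        (fun k => mul_nonneg (inv_nonneg.2 (hγ.stepSum_pos _).le) (abs_nonneg _)) ?_
      refine hs.summable_increments.congr fun k => ?_
      rw [one_div]
    filter_upwards [hmart, hincr, hebd, h.ae_weighted_sum_le hγ hβ hs, h.ae_le_stepSum_mul hγ hs]
      with ω ⟨S1, hS1⟩ ⟨S2, hS2⟩ heω ⟨S3, hS30, hS3⟩ ⟨S4, hS40, hS4⟩
    have hA1 : 0 < A 1 := hγ.stepSum_pos 0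
    have hc0w : 0 ≤ c 0 * w 0 ω := mul_nonneg (hc0 0).le (hw0 0 ω)
    refine ⟨C * (c 0 * w 0 ω / A 1 + S2 + S4) + 2 * S1 + C * S3, fun n => ?_⟩
    cases n with
    | zero => simp [hA, stepSum_zero]
    | succ n =>
      have hAn : A 1 ≤ A (n + 1) := hγ.monotone_stepSum (by omega)
      have t1 : c 0 * w 0 ω ≤ c 0 * w 0 ω / A 1 * A (n + 1) := by
        refine le_of_le_of_eq ?_ (div_mul_eq_mul_div (c 0 * w 0 ω) (A 1) (A (n + 1))).symm
        exact (le_div_iff₀ hA1).2 (mul_le_mul_of_nonneg_left hAn hc0w)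
      have t2 : ∑ k ∈ Finset.range n, |c (k + 1) - c k| * w (k + 1) ω ≤ A (n + 1) * S2 :=
        sum_le_mul_of_weighted_sum_le (A := fun k => A (k + 2))
          (fun k hk => hγ.monotone_stepSum (by omega)) (hγ.stepSum_pos n).le
          (fun k => hγ.stepSum_pos _) (fun k => mul_nonneg (abs_nonneg _) (hw0 _ _))
          (by simpa only [mul_assoc] using hS2 n)
      have t3 : c n * w (n + 1) ω ≤ S4 * A (n + 1) := by
        have hp := hγ.pos n
        calc c n * w (n + 1) ω ≤ c n * (S4 * (A (n + 1) * γ (n + 1))) :=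
              mul_le_mul_of_nonneg_left (hS4 n) (hc0 n).le
          _ = _ := by simp only [hc]; field_simp
      have t4 := abs_sum_le_of_abs_weighted_sum_le (A := A) (x := fun k => c k * N k ω)
        stepSum_zero hγ.monotone_stepSum hγ.stepSum_pos
        (fun n => by simpa only [mul_assoc] using hS1 n) (n + 1)
      have t5 : |∑ k ∈ Finset.range (n + 1), e k ω| ≤ C * (S3 * A (n + 1)) := by
        refine (Finset.abs_sum_le_sum_abs _ _).trans
          ((Finset.sum_le_sum fun k _ => heω k).trans ?_)
        simp only [mul_assoc]
        rw [← Finset.mul_sum]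
        exact mul_le_mul_of_nonneg_left (hS3 _) hC
      have t6 : C * (c 0 * w 0 ω + ∑ k ∈ Finset.range n, |c (k + 1) - c k| * w (k + 1) ω
          + c n * w (n + 1) ω)
          ≤ C * (c 0 * w 0 ω / A 1 * A (n + 1) + A (n + 1) * S2 + S4 * A (n + 1)) :=
        mul_le_mul_of_nonneg_left (by linarith) hC
      have t7 := (habel n ω).trans t6
      rw [hdecomp]
      refine (abs_add_le _ _).trans ((add_le_add (abs_add_le _ _) le_rfl).trans ?_)
      linarith
  -- In `L²`, the Abel sum is bounded by Minkowski, the martingale by orthogonality of its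
  -- increments, of variance at most `C / γ_{k+1}`.
  · obtain ⟨D, hD0, hD⟩ := exists_sqrt_stepSum_le hγ hs
    set a1 : ℝ := (A 1 * γ 1)⁻¹ with ha1
    have hcn : ∀ n, c n ≤ a1 * A (n + 1) := by
      intro n
      have h1 : ∀ n, (A (n + 1) * γ (n + 1))⁻¹ ≤ a1 := by
        intro n
        induction n with
        | zero => exact le_rfl
        | succ n ih => exact (hs.antitone (n + 1) (by omega)).trans ih
      have hAp : 0 < A (n + 1) := hγ.stepSum_pos n
      have hp := hγ.pos n
      calc c n = (A (n + 1) * γ (n + 1))⁻¹ * A (n + 1) := by simp only [hc]; field_simp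
        _ ≤ _ := mul_le_mul_of_nonneg_right (h1 n) hAp.le
    refine ⟨C * (3 * a1) * √B + √C * D + C * √B, fun n => ?_⟩
    cases n with
    | zero => simp [hA, stepSum_zero]
    | succ n =>
      have hAp : 0 < A (n + 1) := hγ.stepSum_pos n
      have ha10 : 0 ≤ a1 := by
        have := hγ.stepSum_pos (β := β) 0
        have := hγ.pos 0
        simp only [ha1, hA]
        positivity
      have m1 : ∀ n, AEStronglyMeasurable
          (fun ω => ∑ k ∈ Finset.range n, c k * (Φ k ω - Φ (k + 1) ω)) P := fun n =>
        Finset.aestronglyMeasurable_fun_sum _ fun k _ =>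
          (((hΦ2 k).sub (hΦ2 (k + 1))).const_mul _).aestronglyMeasurable
      have m2 : ∀ n, AEStronglyMeasurable (fun ω => ∑ k ∈ Finset.range n, c k * N k ω) P :=
        fun n => Finset.aestronglyMeasurable_fun_sum _ fun k _ =>
          ((hN2 k).const_mul _).aestronglyMeasurable
      have m3 : ∀ n, AEStronglyMeasurable (fun ω => ∑ k ∈ Finset.range n, e k ω) P :=
        fun n => Finset.aestronglyMeasurable_fun_sum _ fun k _ =>
          (hFm k).add (integrable_condExp.const_mul _).aestronglyMeasurable
      -- Abel summation: the weights of the `w_k` telescope to at most `3 / γ_{n+1}`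
      have hcoef : C * c 0 + C * ∑ k ∈ Finset.range n, |c (k + 1) - c k| + C * c n
          ≤ C * (3 * a1) * A (n + 1) := by
        have h1 : ∑ k ∈ Finset.range n, |c (k + 1) - c k| = c n - c 0 := by
          rw [← Finset.sum_range_sub]
          exact Finset.sum_congr rfl fun k _ => abs_of_nonneg (sub_nonneg.2 (hcm k))
        have h2 : C * c n ≤ C * (a1 * A (n + 1)) := mul_le_mul_of_nonneg_left (hcn n) hC
        rw [h1]
        nlinarith [mul_nonneg hC (mul_nonneg ha10 hAp.le)]
      have l1 : eLpNorm (fun ω => ∑ k ∈ Finset.range (n + 1), c k * (Φ k ω - Φ (k + 1) ω)) 2 P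
          ≤ ENNReal.ofReal (C * (3 * a1) * √B * A (n + 1)) := by
        set X1 : Ω → ℝ := fun ω => C * c 0 * w 0 ω with hX1
        set X2 : Ω → ℝ := fun ω => ∑ k ∈ Finset.range n, (C * |c (k + 1) - c k|) * w (k + 1) ω
          with hX2
        set X3 : Ω → ℝ := fun ω => C * c n * w (n + 1) ω with hX3
        have y1 : eLpNorm X1 2 P ≤ ENNReal.ofReal ((∑ k ∈ {0}, C * c k) * √B) :=
          h.eLpNorm_le_of_abs_le (i := 0) (fun k => mul_nonneg hC (hc0 k).le)
            (ae_of_all _ fun ω => by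
              rw [abs_of_nonneg (mul_nonneg (mul_nonneg hC (hc0 0).le) (hw0 _ _))]; simp)
        have y2 : eLpNorm X2 2 P
            ≤ ENNReal.ofReal ((∑ k ∈ Finset.range n, C * |c (k + 1) - c k|) * √B) :=
          h.eLpNorm_le_of_abs_le (i := 1) (fun k => mul_nonneg hC (abs_nonneg _))
            (ae_of_all _ fun ω => by
              rw [abs_of_nonneg (Finset.sum_nonneg fun k _ =>
                mul_nonneg (mul_nonneg hC (abs_nonneg _)) (hw0 _ _))])
        have y3 : eLpNorm X3 2 P ≤ ENNReal.ofReal ((∑ k ∈ {n}, C * c k) * √B) :=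
          h.eLpNorm_le_of_abs_le (i := 1) (fun k => mul_nonneg hC (hc0 k).le)
            (ae_of_all _ fun ω => by
              rw [abs_of_nonneg (mul_nonneg (mul_nonneg hC (hc0 n).le) (hw0 _ _))]; simp)
        have q1 : AEStronglyMeasurable X1 P := ((h.memLp 0).const_mul _).aestronglyMeasurable
        have q2 : AEStronglyMeasurable X2 P := Finset.aestronglyMeasurable_fun_sum _ fun k _ =>
          ((h.memLp (k + 1)).const_mul _).aestronglyMeasurable
        have q3 : AEStronglyMeasurable X3 P := ((h.memLp (n + 1)).const_mul _).aestronglyMeasurable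
        calc _ ≤ eLpNorm (X1 + X2 + X3) 2 P := by
              refine eLpNorm_mono_ae_real (ae_of_all _ fun ω => ?_)
              rw [Real.norm_eq_abs]
              refine (habel n ω).trans (le_of_eq ?_)
              simp only [hX1, hX2, hX3, Pi.add_apply, mul_add, Finset.mul_sum, mul_assoc]
          _ ≤ eLpNorm X1 2 P + eLpNorm X2 2 P + eLpNorm X3 2 P :=
              (eLpNorm_add_le (q1.add q2) q3 one_le_two).trans
                (add_le_add (eLpNorm_add_le q1 q2 one_le_two) le_rfl)
          _ ≤ _ := add_le_add (add_le_add y1 y2) y3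
          _ ≤ _ := by
              simp only [Finset.sum_singleton, ← Finset.mul_sum]
              have z1 : 0 ≤ C * c 0 * √B := mul_nonneg (mul_nonneg hC (hc0 0).le) (Real.sqrt_nonneg _)
              have z2 : 0 ≤ C * (∑ k ∈ Finset.range n, |c (k + 1) - c k|) * √B :=
                mul_nonneg (mul_nonneg hC (Finset.sum_nonneg fun k _ => abs_nonneg _))
                  (Real.sqrt_nonneg _)
              have z3 : 0 ≤ C * c n * √B := mul_nonneg (mul_nonneg hC (hc0 n).le) (Real.sqrt_nonneg _)
              rw [← ENNReal.ofReal_add z1 z2, ← ENNReal.ofReal_add (add_nonneg z1 z2) z3]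
              refine ENNReal.ofReal_le_ofReal ?_
              have := mul_le_mul_of_nonneg_right hcoef (Real.sqrt_nonneg B)
              linarith
      have l2 : eLpNorm (fun ω => ∑ k ∈ Finset.range (n + 1), c k * N k ω) 2 P
          ≤ ENNReal.ofReal (√C * D * A (n + 1)) := by
        obtain ⟨-, hL, hE⟩ := martingale_weighted_sum hNm hN2 hN0 c
        refine eLpNorm_two_le_of_integral_sq_le (hL _) (by positivity) ?_
        rw [hE]
        calc ∑ k ∈ Finset.range (n + 1), c k ^ 2 * ∫ ω, N k ω ^ 2 ∂P
            ≤ ∑ k ∈ Finset.range (n + 1), C * γ (k + 1) ^ (-1 : ℝ) := by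
              refine Finset.sum_le_sum fun k _ => ?_
              refine (mul_le_mul_of_nonneg_left (hNsq k) (sq_nonneg _)).trans (le_of_eq ?_)
              have hp := hγ.pos k
              rw [Real.rpow_neg_one]
              simp only [hc]
              field_simp
          _ = C * (√(stepSum γ (-1) (n + 1))) ^ 2 := by
              rw [Real.sq_sqrt (hγ.stepSum_pos n).le, stepSum_eq_sum_range, Finset.mul_sum]
          _ ≤ C * (D * A (n + 1)) ^ 2 :=
              mul_le_mul_of_nonneg_left (pow_le_pow_left₀ (Real.sqrt_nonneg _) (hD n) 2) hC
          _ = _ := by rw [mul_assoc (√C), mul_pow (√C), Real.sq_sqrt hC]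
      have l3 : eLpNorm (fun ω => ∑ k ∈ Finset.range (n + 1), e k ω) 2 P
          ≤ ENNReal.ofReal (C * √B * A (n + 1)) := by
        refine (h.eLpNorm_le_of_abs_le (i := 0) (s := Finset.range (n + 1))
          (d := fun k => C * γ (k + 1) ^ β)
          (fun k => mul_nonneg hC (Real.rpow_nonneg (hγ.pos k).le _)) ?_).trans (le_of_eq ?_)
        · filter_upwards [hebd] with ω hω
          exact (Finset.abs_sum_le_sum_abs _ _).trans (Finset.sum_le_sum fun k _ => hω k)
        · rw [← Finset.mul_sum, ← stepSum_eq_sum_range]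
          congr 1
          ring
      have e0 : (fun ω => ∑ k ∈ Finset.range (n + 1), F k ω)
          = (fun ω => ∑ k ∈ Finset.range (n + 1), c k * (Φ k ω - Φ (k + 1) ω))
            + (fun ω => ∑ k ∈ Finset.range (n + 1), c k * N k ω)
            + fun ω => ∑ k ∈ Finset.range (n + 1), e k ω := by
        ext ω
        simp only [Pi.add_apply]
        exact hdecomp _ _
      rw [e0]
      refine (eLpNorm_add_le ((m1 _).add (m2 _)) (m3 _) one_le_two).trans
        ((add_le_add ((eLpNorm_add_le (m1 _) (m2 _) one_le_two).trans (add_le_add l1 l2)) l3).trans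
          (le_of_eq ?_))
      rw [← ENNReal.ofReal_add (by positivity) (by positivity),
        ← ENNReal.ofReal_add (by positivity) (by positivity)]
      congr 1
      ring

end Expansion


/-! ### Lyapunov functions of the scheme: powers of `V` -/

section Powers

variable {q ℓ : ℕ} {Ω : Type*} {mΩ : MeasurableSpace Ω} {P : Measure Ω}
  {b : Vec q → Vec q} {σ : Vec q → Vec ℓ →L[ℝ] Vec q} {V : Vec q → ℝ}

/-- Pointwise consequences of the mean-reversion and sub-quadraticity of `V`, with one
constant `K`. -/
structure IsLyapunovBound (b : Vec q → Vec q) (σ : Vec q → Vec ℓ →L[ℝ] Vec q) (V : Vec q → ℝ)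
    (α K : ℝ) : Prop where
  continuous : Continuous V
  one_le : ∀ y, 1 ≤ V y
  alpha_pos : 0 < α
  const_nonneg : 0 ≤ K
  taylor : ∀ y h, |V (y + h) - V y - fderiv ℝ V y h| ≤ K * ‖h‖ ^ 2
  grad : ∀ y, ‖fderiv ℝ V y‖ ≤ K * √(V y)
  drift : ∀ y, fderiv ℝ V y (b y) ≤ -α * V y + K + K * traceSq (σ y)
  norm_drift : ∀ y, ‖b y‖ ≤ K * √(V y)
  trace_le : ∀ y, traceSq (σ y) ≤ K * V y

theorem traceSq_nonneg (s : Vec ℓ →L[ℝ] Vec q) : 0 ≤ traceSq s :=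
  Finset.sum_nonneg fun _ _ => sq_nonneg _

theorem norm_apply_le_sqrt_traceSq (s : Vec ℓ →L[ℝ] Vec q) (u : Vec ℓ) :
    ‖s u‖ ≤ √(traceSq s) * ‖u‖ :=
  (s.le_opNorm u).trans (mul_le_mul_of_nonneg_right (opNorm_le_sqrt_traceSq s) (norm_nonneg _))

/-- The Taylor bound comes from the boundedness of `D²V`; the drift bound is `𝒜V ≤ -α V + β`, with the
second-order part of `𝒜V` absorbed in a multiple of `Tr(σσ*)`. -/
theorem exists_isLyapunovBound (hV : IsStronglyStable b σ V) (hVsub : IsSubquadratic V)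
    (hgrowth : ∃ C : ℝ, ∀ y, ‖b y‖ ^ 2 + traceSq (σ y) ≤ C * V y) :
    ∃ α K, IsLyapunovBound b σ V α K := by
  obtain ⟨c, hc⟩ := exists_hasSqrtGrowth hV.one_le hgrowth
  obtain ⟨C, hC⟩ := hVsub
  obtain ⟨C', hC'⟩ := hgrowth
  obtain ⟨α, hα, β, hβ, hd⟩ := hV.drift
  have hc0 := hc.nonneg
  have hV0 : ∀ y, 0 ≤ V y := fun y => zero_le_one.trans (hV.one_le y)
  have hC0 : 0 ≤ C := (norm_nonneg _).trans (hC 0).2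
  have hC'0 : 0 ≤ C' := by
    have h1 := hC' 0
    have h2 := traceSq_nonneg (σ 0)
    have h3 : 0 < V 0 := zero_lt_one.trans_le (hV.one_le 0)
    have h4 : 0 ≤ C' * V 0 := by nlinarith [sq_nonneg ‖b 0‖]
    exact nonneg_of_mul_nonneg_left h4 h3
  -- A single constant that exceeds all those needed.
  refine ⟨α, C + √C + β + c + C', hV.contDiff.continuous, hV.one_le, hα, by positivity, ?_, ?_, ?_,
    ?_, ?_⟩
  · intro y h
    refine (abs_sub_sub_fderiv_le hV.contDiff (fun y => (hC y).2) y h).trans ?_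
    gcongr
    linarith [Real.sqrt_nonneg C]
  · intro y
    have h1 : ‖fderiv ℝ V y‖ ≤ √(C * V y) := Real.le_sqrt_of_sq_le (hC y).1
    rw [Real.sqrt_mul' _ (hV0 y)] at h1
    refine h1.trans ?_
    gcongr
    linarith [Real.sqrt_nonneg C]
  · intro y
    have h1 := hd y
    rw [generator] at h1
    have h2 : |∑ i : Fin ℓ, iteratedFDeriv ℝ 2 V y
        ![σ y (EuclideanSpace.single i 1), σ y (EuclideanSpace.single i 1)]|
        ≤ C * traceSq (σ y) := by
      refine (Finset.abs_sum_le_sum_abs _ _).trans ?_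
      rw [traceSq, Finset.mul_sum]
      refine Finset.sum_le_sum fun i _ => ?_
      rw [← Real.norm_eq_abs]
      refine (ContinuousMultilinearMap.le_opNorm _ _).trans ?_
      rw [Fin.prod_univ_two]
      simp only [Matrix.cons_val_zero, Matrix.cons_val_one]
      rw [← sq]
      exact mul_le_mul_of_nonneg_right (hC y).2 (sq_nonneg _)
    have h3 := neg_le_of_abs_le h2
    have ht := traceSq_nonneg (σ y)
    have h4 : 0 ≤ (√C + β + c + C') * traceSq (σ y) := by positivity
    have h5 : 0 ≤ C * traceSq (σ y) := by positivity
    have h6 := Real.sqrt_nonneg C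
    nlinarith
  · intro y
    refine (hc.drift y).trans ?_
    gcongr
    linarith [Real.sqrt_nonneg C]
  · intro y
    have h1 := hC' y
    have h2 : C' * V y ≤ (C + √C + β + c + C') * V y := by
      have := hV0 y
      gcongr
      linarith [Real.sqrt_nonneg C]
    nlinarith [norm_nonneg (b y)]

variable {α K : ℝ}

namespace IsLyapunovBound

theorem norm_increment_sq_le (h : IsLyapunovBound b σ V α K) {g : ℝ} (hg : 0 ≤ g) (y : Vec q)
    (u : Vec ℓ) : ‖g • b y + √g • σ y u‖ ^ 2
      ≤ 2 * (g ^ 2 * (K ^ 2 * V y) + g * (traceSq (σ y) * ‖u‖ ^ 2)) := by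
  have hV0 : 0 ≤ V y := zero_le_one.trans (h.one_le y)
  have h1 : ‖g • b y‖ ^ 2 ≤ g ^ 2 * (K ^ 2 * V y) := by
    rw [norm_smul, mul_pow, Real.norm_of_nonneg hg]
    have := pow_le_pow_left₀ (norm_nonneg _) (h.norm_drift y) 2
    rw [mul_pow, Real.sq_sqrt hV0] at this
    exact mul_le_mul_of_nonneg_left this (sq_nonneg _)
  have h2 : ‖√g • σ y u‖ ^ 2 ≤ g * (traceSq (σ y) * ‖u‖ ^ 2) := by
    rw [norm_smul, mul_pow, Real.norm_of_nonneg (Real.sqrt_nonneg _), Real.sq_sqrt hg]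
    have := pow_le_pow_left₀ (norm_nonneg _) (norm_apply_le_sqrt_traceSq (σ y) u) 2
    rw [mul_pow, Real.sq_sqrt (traceSq_nonneg _)] at this
    exact mul_le_mul_of_nonneg_left this hg
  have h3 := norm_add_le (g • b y) (√g • σ y u)
  nlinarith [sq_nonneg (‖g • b y‖ - ‖√g • σ y u‖), norm_nonneg (g • b y + √g • σ y u)]

/-- The increment of `V` minus its martingale part is at most its drift. -/
theorem step_le (h : IsLyapunovBound b σ V α K) {g : ℝ} (hg : 0 ≤ g) (y : Vec q) (u : Vec ℓ) :
    V (stepMap b σ g y u) ≤ V y + √g * fderiv ℝ V y (σ y u)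
      + g * (-α * V y + K + K * traceSq (σ y)) + 2 * K * (g ^ 2 * (K ^ 2 * V y)
        + g * (traceSq (σ y) * ‖u‖ ^ 2)) := by
  have h1 := (abs_le.1 (h.taylor y (g • b y + √g • σ y u))).2
  have h2 := mul_le_mul_of_nonneg_left (h.norm_increment_sq_le hg y u) h.const_nonneg
  have h3 := mul_le_mul_of_nonneg_left (h.drift y) hg
  rw [map_add, map_smul, map_smul, smul_eq_mul, smul_eq_mul] at h1
  rw [stepMap, add_assoc (y)]
  linarith

/-- One step changes `V` by an amount of order `√g V`. The noise enters through `√(V Tr(σσ*))`, which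
is what makes its effect small with respect to `V` when `Tr(σσ*) = o(V)`. -/
theorem abs_step_sub_le (h : IsLyapunovBound b σ V α K) {g : ℝ} (hg : 0 ≤ g) (hg1 : g ≤ 1)
    (y : Vec q) (u : Vec ℓ) :
    |V (stepMap b σ g y u) - V y| ≤ (K ^ 2 + K + 2 * K ^ 3 + 2 * K * √K) * (1 + ‖u‖) ^ 2 * √g
      * (√g * V y + √(V y * traceSq (σ y))) := by
  have hK := h.const_nonneg
  have hV0 : 0 ≤ V y := zero_le_one.trans (h.one_le y)
  set t := traceSq (σ y) with ht
  have ht0 : 0 ≤ t := traceSq_nonneg _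
  have hsg : √g ≤ 1 := Real.sqrt_le_one.2 hg1
  have hsg0 := Real.sqrt_nonneg g
  have hgg : g = √g * √g := (Real.mul_self_sqrt hg).symm
  have h1 := h.taylor y (g • b y + √g • σ y u)
  have h2 := mul_le_mul_of_nonneg_left (h.norm_increment_sq_le hg y u) hK
  have hVt : √(V y * t) = √(V y) * √t := Real.sqrt_mul hV0 t
  have h3 : |fderiv ℝ V y (g • b y + √g • σ y u)|
      ≤ K ^ 2 * g * V y + K * √g * √(V y * t) * ‖u‖ := by
    rw [map_add, map_smul, map_smul, smul_eq_mul, smul_eq_mul]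
    have a1 : |fderiv ℝ V y (b y)| ≤ K ^ 2 * V y := by
      rw [← Real.norm_eq_abs]
      refine ((fderiv ℝ V y).le_opNorm _).trans ((mul_le_mul (h.grad y) (h.norm_drift y)
        (norm_nonneg _) (by positivity)).trans (le_of_eq ?_))
      nth_rw 3 [← Real.sq_sqrt hV0]
      ring
    have a2 : |fderiv ℝ V y (σ y u)| ≤ K * √(V y * t) * ‖u‖ := by
      rw [← Real.norm_eq_abs]
      refine ((fderiv ℝ V y).le_opNorm _).trans ((mul_le_mul (h.grad y)
        (norm_apply_le_sqrt_traceSq (σ y) u) (norm_nonneg _) (by positivity)).trans (le_of_eq ?_))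
      rw [hVt]
      ring
    refine (abs_add_le _ _).trans ?_
    rw [abs_mul, abs_mul, abs_of_nonneg hg, abs_of_nonneg hsg0]
    nlinarith [mul_le_mul_of_nonneg_left a1 hg, mul_le_mul_of_nonneg_left a2 hsg0]
  have h4 : |V (stepMap b σ g y u) - V y| ≤ K ^ 2 * g * V y + K * √g * √(V y * t) * ‖u‖
      + K * (2 * (g ^ 2 * (K ^ 2 * V y) + g * (t * ‖u‖ ^ 2))) := by
    rw [stepMap, add_assoc (y)]
    rw [abs_le] at h1 h3 ⊢
    constructor <;> linarith [h1.1, h1.2, h3.1, h3.2]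
  have htt : t ≤ √K * √(V y * t) := by
    rw [hVt]
    calc t = √t * √t := (Real.mul_self_sqrt ht0).symm
      _ ≤ (√K * √(V y)) * √t := by
          gcongr
          rw [← Real.sqrt_mul hK]
          exact Real.sqrt_le_sqrt (h.trace_le y)
      _ = _ := by ring
  set z := 1 + ‖u‖ with hz
  have hu0 := norm_nonneg u
  have hz1 : 1 ≤ z ^ 2 := by nlinarith
  have hzu : ‖u‖ ≤ z ^ 2 := by nlinarith
  have hzu2 : ‖u‖ ^ 2 ≤ z ^ 2 := by nlinarith
  have hR0 : 0 ≤ √(V y * t) := Real.sqrt_nonneg _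
  set R := √(V y * t) with hR
  have b1 : K ^ 2 * g * V y ≤ K ^ 2 * z ^ 2 * √g * (√g * V y) := by
    calc K ^ 2 * g * V y = K ^ 2 * 1 * √g * (√g * V y) := by nth_rw 1 [hgg]; ring
      _ ≤ _ := by gcongr
  have b2 : K * √g * R * ‖u‖ ≤ K * z ^ 2 * √g * R := by
    calc K * √g * R * ‖u‖ = K * ‖u‖ * √g * R := by ring
      _ ≤ _ := by gcongr
  have b3 : K * (2 * (g ^ 2 * (K ^ 2 * V y))) ≤ 2 * K ^ 3 * z ^ 2 * √g * (√g * V y) := by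
    have hg2 : g ^ 2 ≤ g := by nlinarith
    calc K * (2 * (g ^ 2 * (K ^ 2 * V y))) ≤ K * (2 * (g * (K ^ 2 * V y))) := by gcongr
      _ = 2 * K ^ 3 * 1 * √g * (√g * V y) := by nth_rw 1 [hgg]; ring
      _ ≤ _ := by gcongr
  have b4 : K * (2 * (g * (t * ‖u‖ ^ 2))) ≤ 2 * K * √K * z ^ 2 * √g * R := by
    have hg2 : g ≤ √g := by nlinarith
    calc K * (2 * (g * (t * ‖u‖ ^ 2))) ≤ K * (2 * (√g * ((√K * R) * z ^ 2))) := by gcongr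
      _ = _ := by ring
  have hsV : 0 ≤ z ^ 2 * √g * (√g * V y) := by positivity
  have hsR : 0 ≤ z ^ 2 * √g * R := by positivity
  have k1 : 0 ≤ K ^ 2 * (z ^ 2 * √g * R) := by positivity
  have k2 : 0 ≤ K * (z ^ 2 * √g * (√g * V y)) := by positivity
  have k3 : 0 ≤ K ^ 3 * (z ^ 2 * √g * R) := by positivity
  have k4 : 0 ≤ K * √K * (z ^ 2 * √g * (√g * V y)) := by positivity
  linarith

end IsLyapunovBound

/-- Second order bound for a power. -/
theorem add_pow_le_of_nonneg {v x : ℝ} (hv : 0 ≤ v) {s : ℕ} (hs : 2 ≤ s) :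
    (v + x) ^ s ≤ v ^ s + s * v ^ (s - 1) * x + 2 ^ s * (v ^ (s - 2) * x ^ 2 + |x| ^ s) := by
  obtain ⟨r, rfl⟩ : ∃ r, s = r + 2 := ⟨s - 2, by omega⟩
  rw [add_comm v x, add_pow, Finset.sum_range_succ', Finset.sum_range_succ']
  have hterm : ∀ k ∈ Finset.range (r + 1),
      x ^ (k + 1 + 1) * v ^ (r + 2 - (k + 1 + 1)) * ((r + 2).choose (k + 1 + 1) : ℝ)
      ≤ ((r + 2).choose (k + 1 + 1) : ℝ) * (v ^ r * x ^ 2 + |x| ^ (r + 2)) := by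
    intro k hk
    have hk' : k ≤ r := Nat.lt_succ_iff.1 (Finset.mem_range.1 hk)
    rw [mul_comm]
    refine mul_le_mul_of_nonneg_left ?_ (Nat.cast_nonneg _)
    have e : r + 2 - (k + 1 + 1) = r - k := by omega
    rw [e]
    have h1 : x ^ (k + 1 + 1) * v ^ (r - k) ≤ |x| ^ 2 * (|x| ^ k * v ^ (r - k)) := by
      calc x ^ (k + 1 + 1) * v ^ (r - k) ≤ |x ^ (k + 1 + 1)| * v ^ (r - k) :=
            mul_le_mul_of_nonneg_right (le_abs_self _) (by positivity)
        _ = _ := by rw [abs_pow]; ring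
    refine h1.trans ?_
    rcases le_total |x| v with hx | hx
    · calc |x| ^ 2 * (|x| ^ k * v ^ (r - k)) ≤ |x| ^ 2 * (v ^ k * v ^ (r - k)) := by gcongr
        _ = v ^ r * x ^ 2 := by rw [← pow_add, sq_abs, Nat.add_sub_cancel' hk']; ring
        _ ≤ _ := le_add_of_nonneg_right (by positivity)
    · calc |x| ^ 2 * (|x| ^ k * v ^ (r - k)) ≤ |x| ^ 2 * (|x| ^ k * |x| ^ (r - k)) := by gcongr
        _ = |x| ^ (r + 2) := by rw [← pow_add, Nat.add_sub_cancel' hk']; ring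
        _ ≤ _ := le_add_of_nonneg_left (by positivity)
  have hsum := Finset.sum_le_sum hterm
  rw [← Finset.sum_mul] at hsum
  have hch : ∑ k ∈ Finset.range (r + 1), ((r + 2).choose (k + 1 + 1) : ℝ) ≤ 2 ^ (r + 2) := by
    have h1 := Nat.sum_range_choose (r + 2)
    rw [Finset.sum_range_succ', Finset.sum_range_succ'] at h1
    have h2 : ∑ k ∈ Finset.range (r + 1), (r + 2).choose (k + 1 + 1) ≤ 2 ^ (r + 2) := by omega
    exact_mod_cast h2
  have h3 := mul_le_mul_of_nonneg_right hch
    (by positivity : 0 ≤ v ^ r * x ^ 2 + |x| ^ (r + 2))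
  simp only [zero_add, pow_one, pow_zero, one_mul, Nat.choose_one_right, Nat.choose_zero_right,
    Nat.cast_one, mul_one, Nat.sub_zero] at *
  have e1 : r + 2 - 1 = r + 1 := by omega
  have e2 : r + 2 - 2 = r := by omega
  rw [e1, e2]
  linarith

/-- A lower power of `v` is at most a small multiple of the next one plus a constant: compare `v` with
`M / a`. -/
theorem pow_mul_le_of_le {M a v : ℝ} (hM : 0 ≤ M) (ha : 0 < a) (hv : 0 ≤ v) (s : ℕ) :
    M * v ^ s ≤ a * v ^ (s + 1) + M * (M / a) ^ s := by
  rcases le_total v (M / a) with h | h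
  · have : v ^ s ≤ (M / a) ^ s := pow_le_pow_left₀ hv h s
    have h2 : 0 ≤ a * v ^ (s + 1) := by positivity
    nlinarith
  · have h1 : M ≤ a * v := by rwa [div_le_iff₀' ha] at h
    have h2 : M * v ^ s ≤ a * v * v ^ s := mul_le_mul_of_nonneg_right h1 (by positivity)
    have h3 : 0 ≤ M * (M / a) ^ s := by positivity
    rw [pow_succ]
    nlinarith

/-- Pointwise expansion of `V^{p+1}` along one step. -/
theorem IsLyapunovBound.pow_step_le (h : IsLyapunovBound b σ V α K) {p : ℕ} (hp : 1 ≤ p) :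
    ∃ E, 0 ≤ E ∧ ∀ g, 0 ≤ g → g ≤ 1 → ∀ y u, V (stepMap b σ g y u) ^ (p + 1)
      ≤ V y ^ (p + 1) + (p + 1) * V y ^ p * √g * fderiv ℝ V y (σ y u)
        + (p + 1) * V y ^ p * (g * (-α * V y + K + K * traceSq (σ y))
          + 2 * K * (g ^ 2 * (K ^ 2 * V y)))
        + (p + 1) * V y ^ p * (2 * K * (g * traceSq (σ y))) * ‖u‖ ^ 2
        + E * (g * (g * V y ^ (p + 1) + V y ^ p * traceSq (σ y)))
          * (1 + ‖u‖) ^ (2 * (p + 1)) := by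
  have hK := h.const_nonneg
  have hV0 : ∀ y, 0 ≤ V y := fun y => zero_le_one.trans (h.one_le y)
  obtain ⟨D, hD⟩ : ∃ D, D = K ^ 2 + K + 2 * K ^ 3 + 2 * K * √K := ⟨_, rfl⟩
  have hD0 : 0 ≤ D := by rw [hD]; positivity
  obtain ⟨F, hF⟩ : ∃ F, F = 1 + (D * (1 + √K)) ^ (p - 1) := ⟨_, rfl⟩
  have hF0 : 0 ≤ F := by rw [hF]; positivity
  refine ⟨2 ^ (p + 1) * (2 * D ^ 2 * F), by positivity, fun g hg hg1 y u => ?_⟩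
  have h2 := h.step_le hg y u
  have h3 := h.abs_step_sub_le hg hg1 y u
  rw [← hD] at h3
  have htr := h.trace_le y
  have hv1 : 1 ≤ V y := h.one_le y
  have hv0 : 0 ≤ V y := hV0 y
  have ht0 : 0 ≤ traceSq (σ y) := traceSq_nonneg _
  obtain ⟨x, hxdef⟩ : ∃ x, x = V (stepMap b σ g y u) - V y := ⟨_, rfl⟩
  have e1 : V (stepMap b σ g y u) = V y + x := by rw [hxdef]; ring
  rw [← hxdef] at h3
  rw [e1] at h2 ⊢
  clear hxdef e1
  generalize fderiv ℝ V y (σ y u) = ℓ' at *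
  generalize V y = v at *
  generalize traceSq (σ y) = t at *
  obtain ⟨z, hz⟩ : ∃ z, z = (1 + ‖u‖) ^ 2 := ⟨_, rfl⟩
  have hz1 : 1 ≤ z := by rw [hz]; nlinarith [norm_nonneg u]
  have hz0 : 0 ≤ z := by linarith
  have e3 : (1 + ‖u‖) ^ (2 * (p + 1)) = z ^ (p - 1) * z ^ 2 := by
    rw [hz, ← pow_add, ← pow_mul]; congr 1; omega
  rw [e3]
  rw [← hz] at h3
  have h1 := add_pow_le_of_nonneg (x := x) hv0 (s := p + 1) (by omega)
  have h4 : x ^ 2 ≤ 2 * D ^ 2 * z ^ 2 * g * (g * v ^ 2 + v * t) := by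
    have a1 : x ^ 2 ≤ (D * z * √g * (√g * v + √(v * t))) ^ 2 := by
      rw [← sq_abs]
      exact pow_le_pow_left₀ (abs_nonneg _) h3 2
    refine a1.trans ?_
    have a2 : (√g * v + √(v * t)) ^ 2 ≤ 2 * (g * v ^ 2 + v * t) := by
      have b1 : √g ^ 2 = g := Real.sq_sqrt hg
      have b2 : √(v * t) ^ 2 = v * t := Real.sq_sqrt (by positivity)
      have b3 : (√g * v) ^ 2 = g * v ^ 2 := by rw [mul_pow, b1]
      have b4 := add_sq_le (a := √g * v) (b := √(v * t))
      rwa [b3, b2] at b4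
    calc (D * z * √g * (√g * v + √(v * t))) ^ 2
        = D ^ 2 * z ^ 2 * (√g ^ 2) * (√g * v + √(v * t)) ^ 2 := by ring
      _ ≤ D ^ 2 * z ^ 2 * g * (2 * (g * v ^ 2 + v * t)) := by
          rw [Real.sq_sqrt hg]
          gcongr
      _ = _ := by ring
  have h5 : |x| ≤ D * (1 + √K) * z * v := by
    refine h3.trans ?_
    have a1 : √(v * t) ≤ √K * v := by
      calc √(v * t) ≤ √(v * (K * v)) := Real.sqrt_le_sqrt (by gcongr)
        _ = √(K * v ^ 2) := by congr 1; ring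
        _ = √K * v := by rw [Real.sqrt_mul hK, Real.sqrt_sq hv0]
    have a2 : √g ≤ 1 := Real.sqrt_le_one.2 hg1
    calc D * z * √g * (√g * v + √(v * t)) ≤ D * z * 1 * (1 * v + √K * v) := by gcongr
      _ = _ := by ring
  -- Since `|x| = O(z v)`, the power `|x|^{p+1}` is reduced to `v^{p-1} x²`.
  have h6 : v ^ (p - 1) * x ^ 2 + |x| ^ (p + 1) ≤ F * z ^ (p - 1) * v ^ (p - 1) * x ^ 2 := by
    have e2 : |x| ^ (p + 1) = |x| ^ (p - 1) * x ^ 2 := by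
      rw [← sq_abs, ← pow_add]; congr 1; omega
    have a1 : |x| ^ (p - 1) ≤ (D * (1 + √K)) ^ (p - 1) * z ^ (p - 1) * v ^ (p - 1) := by
      refine (pow_le_pow_left₀ (abs_nonneg _) h5 _).trans (le_of_eq ?_)
      simp only [mul_pow]
    have a2 : v ^ (p - 1) ≤ z ^ (p - 1) * v ^ (p - 1) :=
      le_mul_of_one_le_left (by positivity) (one_le_pow₀ hz1)
    have a3 := mul_le_mul_of_nonneg_right (add_le_add a2 a1) (sq_nonneg x)
    rw [e2, hF]
    linarith
  have h7 : v ^ (p - 1) * x ^ 2 + |x| ^ (p + 1)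
      ≤ (2 * D ^ 2 * F) * (g * (g * v ^ (p + 1) + v ^ p * t)) * (z ^ (p - 1) * z ^ 2) := by
    refine h6.trans ((mul_le_mul_of_nonneg_left h4 (by positivity)).trans (le_of_eq ?_))
    have e4 : v ^ (p + 1) = v ^ (p - 1) * v ^ 2 := by
      rw [← pow_add]; congr 1; omega
    have e5 : v ^ p = v ^ (p - 1) * v := by
      rw [← pow_succ]; congr 1; omega
    rw [e4, e5]
    ring
  have e6 : p + 1 - 1 = p := by omega
  have e7 : p + 1 - 2 = p - 1 := by omega
  rw [e6, e7] at h1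
  push_cast at h1
  have h8 : (p + 1) * v ^ p * x ≤ (p + 1) * v ^ p * (√g * ℓ'
      + g * (-α * v + K + K * t) + 2 * K * (g ^ 2 * (K ^ 2 * v) + g * (t * ‖u‖ ^ 2))) := by
    refine mul_le_mul_of_nonneg_left ?_ (by positivity)
    linarith
  have h9 := mul_le_mul_of_nonneg_left h7 (by positivity : (0 : ℝ) ≤ 2 ^ (p + 1))
  refine h1.trans ((add_le_add (add_le_add le_rfl h8) h9).trans (le_of_eq ?_))
  ring

/-- The bound `Tr(σσ*) = o(V)` at infinity, made global by compactness. -/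
theorem exists_traceSq_le (hσ : Continuous σ)
    (hsmall : (fun y => traceSq (σ y)) =o[cocompact (Vec q)] V) (hV : ∀ y, 0 ≤ V y) {ε : ℝ}
    (hε0 : 0 < ε) : ∃ T, 0 ≤ T ∧ ∀ y, traceSq (σ y) ≤ ε * V y + T := by
  have h1 := hsmall.def hε0
  rw [Filter.eventually_iff, Filter.mem_cocompact] at h1
  obtain ⟨S, hS, hSc⟩ := h1
  have hc : Continuous fun y => traceSq (σ y) := by
    unfold traceSq
    exact continuous_finsetSum _ fun i _ => ((hσ.clm_apply continuous_const).norm).pow 2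
  obtain ⟨T, hT⟩ := hS.exists_bound_of_continuousOn hc.continuousOn
  refine ⟨|T|, abs_nonneg _, fun y => ?_⟩
  have := hV y
  by_cases hy : y ∈ S
  · have h2 := (le_abs_self _).trans ((hT y hy).trans (le_abs_self T))
    have : 0 ≤ ε * V y := by positivity
    linarith
  · have h2 := hSc hy
    simp only [Set.mem_ofPred_eq] at h2
    rw [Real.norm_of_nonneg (traceSq_nonneg _), Real.norm_of_nonneg this] at h2
    linarith [abs_nonneg T]

theorem IsNormalized.integrable_clm {u : Ω → Vec ℓ} {p : ℕ} (hu : IsNormalized P u p)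
    (L : Vec ℓ →L[ℝ] ℝ) : Integrable (fun ω => L (u ω)) P ∧ ∫ ω, L (u ω) ∂P = 0 := by
  have hlin : ∀ ω, L (u ω) = ∑ i, u ω i * L (EuclideanSpace.single i 1) := by
    intro ω
    have h1 := apply_eq_sum ((ContinuousLinearMap.id ℝ (Vec ℓ))) (u ω)
    simp only [ContinuousLinearMap.id_apply] at h1
    conv_lhs => rw [h1, map_sum]
    simp
  constructor
  · simp only [hlin]
    exact integrable_finsetSum _ fun i _ => (hu.integrable_apply i).mul_const _
  · simp only [hlin]
    rw [integral_finsetSum _ fun i _ => (hu.integrable_apply i).mul_const _]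
    simp [integral_mul_const, hu.mean]

theorem IsNormalized.integrable_norm_sq [IsProbabilityMeasure P] {u : Ω → Vec ℓ} {p : ℕ}
    (hu : IsNormalized P u p) : Integrable (fun ω => ‖u ω‖ ^ 2) P := by
  refine (hu.integrable_pow (k := 2) (by omega)).mono'
    ((hu.measurable.norm).pow_const 2).aestronglyMeasurable (ae_of_all _ fun ω => ?_)
  rw [Real.norm_of_nonneg (by positivity)]
  have := norm_nonneg (u ω)
  gcongr
  linarith

/-- One-step mean of `V^{p+1}`, before the smallness of the diffusion coefficient is used. -/
theorem IsLyapunovBound.integral_pow_step_le [IsProbabilityMeasure P]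
    (h : IsLyapunovBound b σ V α K) {u : Ω → Vec ℓ} {p : ℕ} (hp : 1 ≤ p)
    (hu : IsNormalized P u p) :
    ∃ C₁ C₂, 0 ≤ C₁ ∧ 0 ≤ C₂ ∧ ∀ g, 0 ≤ g → g ≤ 1 → ∀ y,
      ∫ ω, V (stepMap b σ g y (u ω)) ^ (p + 1) ∂P ≤ V y ^ (p + 1)
        + g * (-((p + 1) * α) * V y ^ (p + 1) + (p + 1) * K * V y ^ p
          + C₁ * traceSq (σ y) * V y ^ p + C₂ * g * V y ^ (p + 1)) := by
  have hK := h.const_nonneg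
  obtain ⟨E, hE0, hE⟩ := h.pow_step_le hp
  have hV0 : ∀ y, 0 ≤ V y := fun y => zero_le_one.trans (h.one_le y)
  have hm20 : 0 ≤ ∫ ω, ‖u ω‖ ^ 2 ∂P := integral_nonneg fun ω => by positivity
  have hM0 : 0 ≤ ∫ ω, (1 + ‖u ω‖) ^ (2 * (p + 1)) ∂P := integral_nonneg fun ω => by positivity
  refine ⟨(p + 1) * (K + 2 * K * ∫ ω, ‖u ω‖ ^ 2 ∂P)
      + E * ∫ ω, (1 + ‖u ω‖) ^ (2 * (p + 1)) ∂P,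
    (p + 1) * (2 * K ^ 3) + E * ∫ ω, (1 + ‖u ω‖) ^ (2 * (p + 1)) ∂P, by positivity,
    by positivity, fun g hg hg1 y => ?_⟩
  have hx := fun ω => hE g hg hg1 y (u ω)
  obtain ⟨ilin, hlin0⟩ := hu.integrable_clm ((fderiv ℝ V y).comp (σ y))
  simp only [ContinuousLinearMap.comp_apply] at ilin hlin0
  have isq := hu.integrable_norm_sq
  have hmom := hu.moment
  have hpos := fun ω => pow_nonneg (hV0 (stepMap b σ g y (u ω))) (p + 1)
  generalize (p + 1 : ℝ) * V y ^ p * √g = c1 at hx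
  generalize hc2 : (p + 1 : ℝ) * V y ^ p * (g * (-α * V y + K + K * traceSq (σ y))
          + 2 * K * (g ^ 2 * (K ^ 2 * V y))) = c2 at hx
  generalize hc3 : (p + 1 : ℝ) * V y ^ p * (2 * K * (g * traceSq (σ y))) = c3 at hx
  generalize hc4 : E * (g * (g * V y ^ (p + 1) + V y ^ p * traceSq (σ y))) = c4 at hx
  have f1 : Integrable (fun ω => V y ^ (p + 1) + c1 * fderiv ℝ V y (σ y (u ω))) P :=
    (integrable_const _).add (ilin.const_mul _)
  have f2 : Integrable (fun ω => V y ^ (p + 1) + c1 * fderiv ℝ V y (σ y (u ω)) + c2) P :=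
    f1.add (integrable_const _)
  have f3 : Integrable (fun ω => V y ^ (p + 1) + c1 * fderiv ℝ V y (σ y (u ω)) + c2
      + c3 * ‖u ω‖ ^ 2) P := f2.add (isq.const_mul _)
  have hint := integral_mono_of_nonneg (ae_of_all P hpos) (f3.add (hmom.const_mul c4))
    (ae_of_all P hx)
  refine hint.trans (le_of_eq ?_)
  have e1 := integral_add f3 (hmom.const_mul c4)
  have e2 := integral_add f2 (isq.const_mul c3)
  have e3 := integral_add f1 (integrable_const (μ := P) c2)
  have e4 := integral_add (integrable_const (μ := P) (V y ^ (p + 1))) (ilin.const_mul c1)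
  refine e1.trans ?_
  rw [e2, e3, e4, integral_const_mul, integral_const_mul, integral_const_mul, hlin0]
  simp only [integral_const, probReal_univ, smul_eq_mul, one_mul]
  rw [← hc2, ← hc3, ← hc4, pow_succ (V y) p]
  ring

/-- If `Tr(σσ*) = o(V)`, the one-step mean of `V^{p+1}` contracts for small steps. -/
theorem exists_integral_pow_step_le [IsProbabilityMeasure P] (h : IsLyapunovBound b σ V α K)
    (hσ : Continuous σ) (hsmall : (fun y => traceSq (σ y)) =o[cocompact (Vec q)] V)
    {u : Ω → Vec ℓ} {p : ℕ} (hp : 1 ≤ p) (hu : IsNormalized P u p) :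
    ∃ g₀ > 0, ∃ a > 0, ∃ B, 0 ≤ B ∧ ∀ g, 0 ≤ g → g ≤ g₀ → ∀ y,
      ∫ ω, V (stepMap b σ g y (u ω)) ^ (p + 1) ∂P ≤ (1 - a * g) * V y ^ (p + 1) + B * g := by
  have hK := h.const_nonneg
  have hα := h.alpha_pos
  have hV0 : ∀ y, 0 ≤ V y := fun y => zero_le_one.trans (h.one_le y)
  obtain ⟨C₁, C₂, hC₁, hC₂, hstep⟩ := h.integral_pow_step_le hp hu
  obtain ⟨a, ha⟩ : ∃ a, a = ((p : ℝ) + 1) * α / 4 := ⟨_, rfl⟩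
  have ha0 : 0 < a := by rw [ha]; positivity
  obtain ⟨T, hT0, hT⟩ := exists_traceSq_le hσ hsmall hV0 (by positivity : 0 < a / (C₁ + 1))
  have hM0 : 0 ≤ ((p : ℝ) + 1) * K + C₁ * T := by positivity
  refine ⟨min 1 (a / (C₂ + 1)), by positivity, a, ha0,
    (((p : ℝ) + 1) * K + C₁ * T) * ((((p : ℝ) + 1) * K + C₁ * T) / a) ^ p, by positivity,
    fun g hg hg0 y => ?_⟩
  refine (hstep g hg (hg0.trans (min_le_left _ _)) y).trans ?_
  have hgC : C₂ * g ≤ a := by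
    have h1 := hg0.trans (min_le_right _ _)
    rw [le_div_iff₀ (by positivity)] at h1
    nlinarith
  have hεC : C₁ * (a / (C₁ + 1)) ≤ a := by
    rw [mul_div_assoc', div_le_iff₀ (by positivity)]
    nlinarith
  have hv0 := hV0 y
  have htr := hT y
  have g3 := pow_mul_le_of_le hM0 ha0 hv0 p
  generalize V y = v at *
  generalize traceSq (σ y) = t at *
  have g1 : C₁ * t * v ^ p ≤ a * v ^ (p + 1) + C₁ * T * v ^ p := by
    have b1 := mul_le_mul_of_nonneg_left htr hC₁
    have b2 : C₁ * (a / (C₁ + 1)) * v ≤ a * v := mul_le_mul_of_nonneg_right hεC hv0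
    have b3 : C₁ * t * v ^ p ≤ (a * v + C₁ * T) * v ^ p :=
      mul_le_mul_of_nonneg_right (by linarith) (by positivity)
    rw [pow_succ]
    linarith
  have g2 : C₂ * g * v ^ (p + 1) ≤ a * v ^ (p + 1) :=
    mul_le_mul_of_nonneg_right hgC (by positivity)
  have e0 : ((p : ℝ) + 1) * α = 4 * a := by rw [ha]; ring
  rw [e0]
  generalize (((p : ℝ) + 1) * K + C₁ * T) * ((((p : ℝ) + 1) * K + C₁ * T) / a) ^ p = B at *
  have g4 : -(4 * a) * v ^ (p + 1) + ((p : ℝ) + 1) * K * v ^ p + C₁ * t * v ^ p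
      + C₂ * g * v ^ (p + 1) ≤ -a * v ^ (p + 1) + B := by
    linarith
  have g5 := mul_le_mul_of_nonneg_left g4 hg
  linarith

/-- Crude growth of `V` along one step. -/
theorem IsLyapunovBound.exists_step_le (h : IsLyapunovBound b σ V α K) (G : ℝ) :
    ∃ C, 0 ≤ C ∧ ∀ g, 0 ≤ g → g ≤ G → ∀ y u,
      V (stepMap b σ g y u) ≤ C * V y * (1 + ‖u‖) ^ 2 := by
  have hK := h.const_nonneg
  rcases lt_or_ge G 0 with hG | hG
  · exact ⟨0, le_rfl, fun g h0 h1 => absurd (h0.trans h1) (not_le.2 hG)⟩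
  refine ⟨1 + √G * (K * √K) + G * (K + K ^ 2) + 2 * K * (G ^ 2 * K ^ 2 + G * K), by positivity,
    fun g hg hgG y u => ?_⟩
  have hv1 := h.one_le y
  have hv0 : 0 ≤ V y := zero_le_one.trans hv1
  have ht0 : 0 ≤ traceSq (σ y) := traceSq_nonneg _
  have htr := h.trace_le y
  have hu0 := norm_nonneg u
  have hsv : √(V y) * √(V y) = V y := Real.mul_self_sqrt hv0
  have hsg : √g ≤ √G := Real.sqrt_le_sqrt hgG
  have h2 : fderiv ℝ V y (σ y u) ≤ K * √K * V y * ‖u‖ := by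
    have b2 := norm_apply_le_sqrt_traceSq (σ y) u
    have b3 : √(traceSq (σ y)) ≤ √K * √(V y) := by
      rw [← Real.sqrt_mul hK]; exact Real.sqrt_le_sqrt htr
    calc fderiv ℝ V y (σ y u) ≤ ‖fderiv ℝ V y‖ * ‖σ y u‖ :=
          (Real.le_norm_self _).trans ((fderiv ℝ V y).le_opNorm _)
      _ ≤ (K * √(V y)) * ((√K * √(V y)) * ‖u‖) := by
          gcongr
          · exact h.grad y
          · exact b2.trans (by gcongr)
      _ = K * √K * (√(V y) * √(V y)) * ‖u‖ := by ring
      _ = _ := by rw [hsv]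
  have hα := h.alpha_pos
  calc V (stepMap b σ g y u) ≤ _ := h.step_le hg y u
    _ ≤ V y + √G * (K * √K * V y * ‖u‖) + G * (K * V y + K * (K * V y))
        + 2 * K * (G ^ 2 * (K ^ 2 * V y) + G * ((K * V y) * ‖u‖ ^ 2)) := by
        have a1 : g * (-α * V y + K + K * traceSq (σ y)) ≤ G * (K * V y + K * (K * V y)) := by
          have : -α * V y + K + K * traceSq (σ y) ≤ K * V y + K * (K * V y) := by
            have := mul_le_mul_of_nonneg_left htr hK
            have := mul_le_mul_of_nonneg_left hv1 hK
            have := mul_nonneg hα.le hv0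
            linarith
          refine (mul_le_mul_of_nonneg_left this hg).trans ?_
          gcongr
        have a2 : √g * fderiv ℝ V y (σ y u) ≤ √G * (K * √K * V y * ‖u‖) := by
          refine (mul_le_mul_of_nonneg_left h2 (Real.sqrt_nonneg _)).trans ?_
          gcongr
        gcongr
    _ ≤ _ := by
        have c1 : ‖u‖ ≤ (1 + ‖u‖) ^ 2 := by nlinarith
        have c2 : ‖u‖ ^ 2 ≤ (1 + ‖u‖) ^ 2 := by nlinarith
        have c3 : 1 ≤ (1 + ‖u‖) ^ 2 := by nlinarith
        have d1 := mul_le_mul_of_nonneg_left c1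
          (by positivity : 0 ≤ √G * (K * √K) * V y)
        have d2 := mul_le_mul_of_nonneg_left c2
          (by positivity : 0 ≤ 2 * K * (G * K) * V y)
        have d3 := mul_le_mul_of_nonneg_left c3
          (by positivity : 0 ≤ (1 + G * (K + K ^ 2) + 2 * K * (G ^ 2 * K ^ 2)) * V y)
        linarith

variable {γ : ℕ → ℝ} {U : ℕ → Ω → Vec ℓ} {Y : ℕ → Ω → Vec q}

/-- The moment of `V` of order `p + 1` propagates along the scheme. -/
theorem IsLyapunovBound.integrable_pow [IsProbabilityMeasure P] (h : IsLyapunovBound b σ V α K)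
    (hc : IsEulerChain P b σ γ U Y) {G : ℝ} (hγ : ∀ n, 0 ≤ γ (n + 1) ∧ γ (n + 1) ≤ G) {p : ℕ}
    (hu : Integrable (fun ω => (1 + ‖U 1 ω‖) ^ (2 * (p + 1))) P)
    (h0 : Integrable (fun ω => V (Y 0 ω) ^ (p + 1)) P) (n : ℕ) :
    Integrable (fun ω => V (Y n ω) ^ (p + 1)) P := by
  obtain ⟨C, hC0, hC⟩ := h.exists_step_le G
  have hV0 : ∀ y, 0 ≤ V y := fun y => zero_le_one.trans (h.one_le y)
  induction n with
  | zero => exact h0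
  | succ n ih =>
    refine (hc.integrable_of_le_mul n (X := fun ω => V (Y (n + 1) ω) ^ (p + 1)) (A := fun y => C ^ (p + 1) * V y ^ (p + 1))
      (B := fun u => (1 + ‖u‖) ^ (2 * (p + 1)))
      ((h.continuous.measurable.comp (hc.measurable (n + 1))).pow_const _).aestronglyMeasurable
      ((h.continuous.pow _).const_smul (C ^ (p + 1))).measurable (by fun_prop)
      (ih.const_mul _) hu fun ω => ?_).1
    rw [abs_of_nonneg (pow_nonneg (hV0 _) _), hc.succ n ω]
    have h1 := hC (γ (n + 1)) (hγ n).1 (hγ n).2 (Y n ω) (U (n + 1) ω)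
    refine (pow_le_pow_left₀ (hV0 _) h1 (p + 1)).trans (le_of_eq ?_)
    rw [mul_pow, mul_pow, pow_mul]

/-- A contraction of the one-step mean of `W`, for small steps, is strong stability for `W`. -/
theorem isStableScheme_of_integral_step_le [IsProbabilityMeasure P]
    (hc : IsEulerChain P b σ γ U Y) (hγ : ∀ n, 0 ≤ γ (n + 1)) (hγlim : Tendsto γ atTop (𝓝 0))
    {W : Vec q → ℝ} (hW : Continuous W) (hint : ∀ n, Integrable (fun ω => W (Y n ω)) P)
    {g₀ a B : ℝ} (hg₀ : 0 < g₀) (ha : 0 < a) (hB : 0 ≤ B)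
    (hstep : ∀ g, 0 ≤ g → g ≤ g₀ → ∀ y,
      ∫ ω, W (stepMap b σ g y (U 1 ω)) ∂P ≤ (1 - a * g) * W y + B * g) :
    IsStableScheme P γ Y W := by
  obtain ⟨n₀, hn₀⟩ := eventually_atTop.1 (hγlim.eventually (gt_mem_nhds hg₀))
  refine ⟨n₀, a, ha, B, hB, fun n hn => ?_⟩
  have h1 := hc.condExp_step n (h := fun _ z => W z) (hW.comp continuous_snd).measurable
    (hint (n + 1))
  refine h1.le.trans (ae_of_all _ fun ω => ?_)
  exact hstep _ (hγ n) (hn₀ (n + 1) (by omega)).le _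

end Powers


/-! ### Lyapunov functions of the scheme: exponentials of a power of `V` -/

section Subgaussian

variable {ℓ : ℕ} {Ω : Type*} {mΩ : MeasurableSpace Ω} {P : Measure Ω}

/-- A sub-Gaussian variable has a finite square-exponential moment. The function
`exp (x² / 4b)` is, up to a constant, the mean of `exp (x z)` over a Gaussian `z`. -/
theorem integrable_exp_mul_sq_of_hasSubgaussianMGF [IsProbabilityMeasure P] {X : Ω → ℝ} {κ : ℝ≥0}
    (hX : HasSubgaussianMGF X κ P) (hm : Measurable X) :
    Integrable (fun ω => Real.exp ((4 * ((κ : ℝ) / 2 + 1))⁻¹ * X ω ^ 2)) P := by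
  set b : ℝ := (κ : ℝ) / 2 + 1 with hb
  have hb0 : 0 < b := by positivity
  have hgauss : ∀ x : ℝ, ∫⁻ z, ENNReal.ofReal (Real.exp (x * z - b * z ^ 2))
      = ENNReal.ofReal (√(Real.pi / b)) * ENNReal.ofReal (Real.exp ((4 * b)⁻¹ * x ^ 2)) := by
    intro x
    have e : ∀ z, Real.exp (x * z - b * z ^ 2)
        = Real.exp (-b * (z - x / (2 * b)) ^ 2) * Real.exp ((4 * b)⁻¹ * x ^ 2) := by
      intro z
      rw [← Real.exp_add]
      congr 1
      field_simp
      ring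
    have hi : Integrable (fun z : ℝ => Real.exp (-b * (z - x / (2 * b)) ^ 2)) :=
      (integrable_exp_neg_mul_sq hb0).comp_sub_right (x / (2 * b))
    rw [← ENNReal.ofReal_mul (Real.sqrt_nonneg _)]
    simp only [e]
    rw [← ofReal_integral_eq_lintegral_ofReal (hi.mul_const _)
      (ae_of_all _ fun z => by positivity), integral_mul_const,
      integral_sub_right_eq_self (fun z : ℝ => Real.exp (-b * z ^ 2)), integral_gaussian]
  have hfin : ∫⁻ ω, (∫⁻ z : ℝ, ENNReal.ofReal (Real.exp (X ω * z - b * z ^ 2))) ∂P < ∞ := by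
    rw [lintegral_lintegral_swap (by fun_prop)]
    have hz : ∀ z : ℝ, ∫⁻ ω, ENNReal.ofReal (Real.exp (X ω * z - b * z ^ 2)) ∂P
        ≤ ENNReal.ofReal (Real.exp (-1 * z ^ 2)) := by
      intro z
      have e : ∀ ω, Real.exp (X ω * z - b * z ^ 2)
          = Real.exp (z * X ω) * Real.exp (-(b * z ^ 2)) := by
        intro ω; rw [← Real.exp_add]; congr 1; ring
      simp only [e]
      rw [← ofReal_integral_eq_lintegral_ofReal ((hX.integrable_exp_mul z).mul_const _)
        (ae_of_all _ fun z => by positivity), integral_mul_const]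
      refine ENNReal.ofReal_le_ofReal ?_
      have h1 : ∫ ω, Real.exp (z * X ω) ∂P ≤ Real.exp (κ * z ^ 2 / 2) := hX.mgf_le z
      refine (mul_le_mul_of_nonneg_right h1 (Real.exp_pos _).le).trans (le_of_eq ?_)
      rw [← Real.exp_add, hb]
      congr 1; ring
    refine (lintegral_mono hz).trans_lt ?_
    have := (integrable_exp_neg_mul_sq (zero_lt_one)).lintegral_lt_top
    simpa using this
  refine ⟨by fun_prop, ?_⟩
  rw [hasFiniteIntegral_iff_ofReal (ae_of_all _ fun ω => (Real.exp_pos _).le)]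
  simp only [hgauss] at hfin
  rw [lintegral_const_mul _ (by fun_prop)] at hfin
  refine lt_of_le_of_ne le_top fun h => ?_
  rw [h, ENNReal.mul_top] at hfin
  · exact lt_irrefl _ hfin
  · simp only [ne_eq, ENNReal.ofReal_eq_zero, not_le]
    positivity

/-- The norm of a sub-normal vector has a Gaussian tail: its coordinates are sub-Gaussian, and the
exponential of the square of the norm is bounded by the one of the largest coordinate. -/
theorem IsSubnormal.exists_integrable_exp_sq [IsProbabilityMeasure P] {u : Ω → Vec ℓ}
    (hu : IsSubnormal P u) (hm : Measurable u) :
    ∃ δ > 0, Integrable (fun ω => Real.exp (δ * ‖u ω‖ ^ 2)) P := by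
  obtain ⟨κ, hκ⟩ := hu
  have hi : ∀ i, Integrable (fun ω => Real.exp ((4 * ((κ : ℝ) / 2 + 1))⁻¹ * u ω i ^ 2)) P := by
    intro i
    have h1 := hκ (EuclideanSpace.single i 1)
    have e : (fun ω => inner ℝ (EuclideanSpace.single i (1 : ℝ)) (u ω)) = fun ω => u ω i := by
      ext ω; simp [EuclideanSpace.inner_single_left]
    have e2 : κ * ‖(EuclideanSpace.single i (1 : ℝ) : Vec ℓ)‖₊ ^ 2 = κ := by
      have : ‖(EuclideanSpace.single i (1 : ℝ) : Vec ℓ)‖₊ = 1 := by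
        rw [← NNReal.coe_inj]; simp
      rw [this]; simp
    rw [e, e2] at h1
    exact integrable_exp_mul_sq_of_hasSubgaussianMGF h1 (by fun_prop)
  set a := (4 * ((κ : ℝ) / 2 + 1))⁻¹ with ha
  have ha0 : 0 < a := by positivity
  refine ⟨a / (ℓ + 1), by positivity, ?_⟩
  refine ((integrable_const (1 : ℝ)).add (integrable_finsetSum Finset.univ fun i _ => hi i)).mono'
    (by fun_prop) (ae_of_all _ fun ω => ?_)
  rw [Real.norm_of_nonneg (Real.exp_pos _).le]
  simp only [Pi.add_apply]
  have hs : 0 ≤ ∑ i, Real.exp (a * u ω i ^ 2) := Finset.sum_nonneg fun i _ => (Real.exp_pos _).le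
  rcases isEmpty_or_nonempty (Fin ℓ) with hem | hne
  · have : u ω = 0 := by ext i; exact isEmptyElim i
    simp [this]
  obtain ⟨i, -, hmax⟩ := Finset.exists_max_image Finset.univ (fun i => u ω i ^ 2)
    Finset.univ_nonempty
  have h1 : ‖u ω‖ ^ 2 ≤ ℓ * u ω i ^ 2 := by
    rw [EuclideanSpace.norm_sq_eq]
    refine (Finset.sum_le_card_nsmul Finset.univ _ (u ω i ^ 2) fun j hj => ?_).trans ?_
    · rw [Real.norm_eq_abs, sq_abs]; exact hmax j hj
    · simp
  have h2 : a / (ℓ + 1) * ‖u ω‖ ^ 2 ≤ a * u ω i ^ 2 := by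
    rw [div_mul_eq_mul_div, div_le_iff₀ (by positivity)]
    have : a * ‖u ω‖ ^ 2 ≤ a * (ℓ * u ω i ^ 2) := mul_le_mul_of_nonneg_left h1 ha0.le
    nlinarith [mul_nonneg ha0.le (sq_nonneg (u ω i))]
  have h3 := Finset.single_le_sum (f := fun i => Real.exp (a * u ω i ^ 2))
    (fun i _ => (Real.exp_pos _).le) (Finset.mem_univ i)
  have h4 := Real.exp_le_exp.2 h2
  simp only at h3
  linarith

end Subgaussian

section Exponential

variable {q ℓ : ℕ} {Ω : Type*} {mΩ : MeasurableSpace Ω} {P : Measure Ω}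
  {b : Vec q → Vec q} {σ : Vec q → Vec ℓ →L[ℝ] Vec q} {V : Vec q → ℝ} {α K ζ T : ℝ}

/-- One step of `V^ζ`, by concavity of `x ↦ x^ζ`. -/
theorem IsLyapunovBound.rpow_step_le (h : IsLyapunovBound b σ V α K) (hζ : 0 < ζ) (hζ1 : ζ ≤ 1)
    (hT : ∀ y, traceSq (σ y) ≤ T * V y ^ (1 - ζ)) {g : ℝ} (hg : 0 ≤ g) (y : Vec q) (u : Vec ℓ) :
    V (stepMap b σ g y u) ^ ζ ≤ V y ^ ζ
      + √g * (ζ * V y ^ (ζ - 1) * fderiv ℝ V y (σ y u))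
      + g * (-(ζ * α) * V y ^ ζ + K + K * T)
      + 2 * K * (g ^ 2 * K ^ 2 * V y ^ ζ + g * T * ‖u‖ ^ 2) := by
  have hstep := h.step_le hg y u
  have hK := h.const_nonneg
  have hv1 : 1 ≤ V y := h.one_le y
  have hv0 : 0 < V y := zero_lt_one.trans_le hv1
  have hv1' : 1 ≤ V (stepMap b σ g y u) := h.one_le _
  have ht := hT y
  have ht0 : 0 ≤ traceSq (σ y) := traceSq_nonneg _
  generalize V (stepMap b σ g y u) = v' at *
  generalize fderiv ℝ V y (σ y u) = d at *
  generalize V y = v at *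
  generalize traceSq (σ y) = t at *
  have hc0 : 0 < v ^ (ζ - 1) := Real.rpow_pos_of_pos hv0 _
  have hc1 : v ^ (ζ - 1) ≤ 1 := Real.rpow_le_one_of_one_le_of_nonpos hv1 (by linarith)
  have hcv : v ^ (ζ - 1) * v = v ^ ζ := by
    rw [← Real.rpow_add_one hv0.ne']; congr 1; ring
  have hct : v ^ (ζ - 1) * t ≤ T := by
    have : v ^ (ζ - 1) * v ^ (1 - ζ) = 1 := by
      rw [← Real.rpow_add hv0]; simp
    exact (mul_le_mul_of_nonneg_left ht hc0.le).trans (le_of_eq (by linear_combination T * this))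
  have hT0 : 0 ≤ T := (mul_nonneg hc0.le ht0).trans hct
  have hvz : 0 ≤ v ^ ζ := Real.rpow_nonneg hv0.le _
  have hconc : v' ^ ζ ≤ v ^ ζ + ζ * v ^ (ζ - 1) * (v' - v) := by
    have h1 : (1 + (v' / v - 1)) ^ ζ ≤ 1 + ζ * (v' / v - 1) :=
      _root_.rpow_one_add_le_one_add_mul_self (by
        have : 0 ≤ v' / v := by positivity
        linarith) hζ.le hζ1
    have e1 : 1 + (v' / v - 1) = v' / v := by ring
    rw [e1, Real.div_rpow (by linarith) hv0.le, div_le_iff₀ (Real.rpow_pos_of_pos hv0 _)] at h1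
    refine h1.trans (le_of_eq ?_)
    rw [← hcv]
    field_simp
  refine hconc.trans ?_
  have hζc : 0 ≤ ζ * v ^ (ζ - 1) := by positivity
  have h2 := mul_le_mul_of_nonneg_left (sub_le_iff_le_add'.2 (hstep.trans (le_of_eq
    (show _ = v + (√g * d + g * (-α * v + K + K * t) + 2 * K * (g ^ 2 * (K ^ 2 * v)
      + g * (t * ‖u‖ ^ 2))) by ring)))) hζc
  have a1 : ζ * v ^ (ζ - 1) * (-α * v + K + K * t) ≤ -(ζ * α) * v ^ ζ + K + K * T := by
    have b1 : ζ * v ^ (ζ - 1) * K ≤ K := by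
      have : ζ * v ^ (ζ - 1) ≤ 1 := by nlinarith
      nlinarith
    have b2 : ζ * v ^ (ζ - 1) * (K * t) ≤ K * T := by
      calc ζ * v ^ (ζ - 1) * (K * t) = ζ * (K * (v ^ (ζ - 1) * t)) := by ring
        _ ≤ 1 * (K * T) := by gcongr
        _ = _ := one_mul _
    rw [← hcv]
    linarith
  have a2 : ζ * v ^ (ζ - 1) * (g ^ 2 * (K ^ 2 * v) + g * (t * ‖u‖ ^ 2))
      ≤ g ^ 2 * K ^ 2 * v ^ ζ + g * T * ‖u‖ ^ 2 := by
    calc ζ * v ^ (ζ - 1) * (g ^ 2 * (K ^ 2 * v) + g * (t * ‖u‖ ^ 2))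
        = ζ * (g ^ 2 * K ^ 2 * (v ^ (ζ - 1) * v) + g * (v ^ (ζ - 1) * t) * ‖u‖ ^ 2) := by ring
      _ ≤ 1 * (g ^ 2 * K ^ 2 * (v ^ (ζ - 1) * v) + g * T * ‖u‖ ^ 2) := by gcongr
      _ = _ := by rw [hcv, one_mul]
  have a3 := mul_le_mul_of_nonneg_left a1 hg
  have a4 := mul_le_mul_of_nonneg_left a2 (by positivity : 0 ≤ 2 * K)
  linarith

/-- Convexity of the exponential between `0` and `δ x`. -/
theorem exp_mul_le_of_nonneg {θ δ x : ℝ} (hθ : 0 ≤ θ) (hδ : 0 < δ) (hθδ : θ ≤ δ) :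
    Real.exp (θ * x) ≤ 1 + θ / δ * (Real.exp (δ * x) - 1) := by
  have h := convexOn_exp.2 (Set.mem_univ 0) (Set.mem_univ (δ * x))
    (sub_nonneg.2 ((div_le_one hδ).2 hθδ)) (div_nonneg hθ hδ.le) (sub_add_cancel _ _)
  simp only [smul_eq_mul, mul_zero, zero_add, Real.exp_zero, mul_one] at h
  have e : θ / δ * (δ * x) = θ * x := by field_simp
  rw [e] at h
  linarith

/-- For small `θ`, the exponential moment of `θ X` is at most the exponential of a multiple of
`θ`. -/
theorem integral_exp_mul_sq_le [IsProbabilityMeasure P] {X : Ω → ℝ} (hXm : Measurable X)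
    {θ δ : ℝ} (hθ : 0 ≤ θ)
    (hδ : 0 < δ) (hθδ : θ ≤ δ) (hX : Integrable (fun ω => Real.exp (δ * X ω)) P) :
    Integrable (fun ω => Real.exp (θ * X ω)) P ∧
      ∫ ω, Real.exp (θ * X ω) ∂P ≤ Real.exp (θ * ((∫ ω, Real.exp (δ * X ω) ∂P) / δ)) := by
  have hi : Integrable (fun ω => 1 + θ / δ * (Real.exp (δ * X ω) - 1)) P :=
    (integrable_const _).add ((hX.sub (integrable_const _)).const_mul _)
  have hle := fun ω => exp_mul_le_of_nonneg (x := X ω) hθ hδ hθδ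
  refine ⟨hi.mono' (by fun_prop)
    (ae_of_all _ fun ω => by rw [Real.norm_of_nonneg (Real.exp_pos _).le]; exact hle ω), ?_⟩
  have h1 := integral_mono_of_nonneg (ae_of_all P fun ω => (Real.exp_pos (θ * X ω)).le) hi
    (ae_of_all P hle)
  refine h1.trans ?_
  have hX1 : Integrable (fun ω => θ / δ * (Real.exp (δ * X ω) - 1)) P :=
    (hX.sub (integrable_const _)).const_mul _
  rw [integral_add (integrable_const _) hX1, integral_const_mul, integral_sub hX (integrable_const _)]
  simp only [integral_const, probReal_univ, smul_eq_mul, one_mul]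
  refine le_trans ?_ (Real.add_one_le_exp _)
  have : 0 ≤ θ / δ := by positivity
  have e : θ * ((∫ ω, Real.exp (δ * X ω) ∂P) / δ) = θ / δ * ∫ ω, Real.exp (δ * X ω) ∂P := by ring
  rw [e]
  linarith

/-- An exponent that contracts linearly gives a contraction of the exponential. -/
theorem exp_contract_le {X ρ κ g : ℝ} (hρ : 0 < ρ) (hκ : 0 ≤ κ) (hg : 0 ≤ g)
    (hg1 : g ≤ 1) (hX : 0 ≤ X) :
    Real.exp (X * (1 - ρ * g) + g * κ) ≤ (1 - 1 / 2 * g) * Real.exp X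
      + Real.exp ((κ + 1) / ρ) * (1 / 2 + κ * Real.exp κ) * g := by
  rcases le_total (κ + 1) (ρ * X) with h | h
  · have h1 : X * (1 - ρ * g) + g * κ ≤ X + -g := by nlinarith
    have h2 : Real.exp (-g) ≤ 1 - 1 / 2 * g := by
      rw [Real.exp_neg, inv_le_comm₀ (Real.exp_pos _) (by linarith)]
      refine le_trans ?_ (Real.add_one_le_exp g)
      rw [inv_le_iff_one_le_mul₀ (by linarith)]
      nlinarith
    have h3 := (Real.exp_le_exp.2 h1).trans (le_of_eq (Real.exp_add _ _))
    have h4 := mul_le_mul_of_nonneg_left h2 (Real.exp_pos X).le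
    have h5 : 0 ≤ Real.exp ((κ + 1) / ρ) * (1 / 2 + κ * Real.exp κ) * g := by positivity
    linarith
  · have h1 : X * (1 - ρ * g) + g * κ ≤ X + g * κ := by
      have : 0 ≤ X * (ρ * g) := by positivity
      linarith
    have h2 : Real.exp (g * κ) ≤ 1 + g * (κ * Real.exp κ) := by
      have := exp_mul_le_of_nonneg (x := κ) hg one_pos hg1
      rw [div_one, one_mul] at this
      have h3 : Real.exp κ - 1 ≤ κ * Real.exp κ := by
        have := Real.add_one_le_exp (-κ)
        have h4 : Real.exp (-κ) * Real.exp κ = 1 := by rw [← Real.exp_add]; simp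
        nlinarith [Real.exp_pos κ]
      nlinarith
    have h3 : Real.exp X ≤ Real.exp ((κ + 1) / ρ) :=
      Real.exp_le_exp.2 (by rw [le_div_iff₀ hρ]; linarith)
    have h4 := (Real.exp_le_exp.2 h1).trans (le_of_eq (Real.exp_add _ _))
    have h5 := mul_le_mul_of_nonneg_left h2 (Real.exp_pos X).le
    have h6 := mul_le_mul_of_nonneg_right h3
      (by positivity : 0 ≤ (1 / 2 + κ * Real.exp κ) * g)
    nlinarith

/-- The exponential moments of a linear functional of a sub-normal vector. -/
theorem IsSubnormal.exists_integral_exp_le {u : Ω → Vec ℓ} (hu : IsSubnormal P u) :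
    ∃ κ : ℝ, 0 ≤ κ ∧ ∀ L : Vec ℓ →L[ℝ] ℝ, Integrable (fun ω => Real.exp (L (u ω))) P ∧
      ∫ ω, Real.exp (L (u ω)) ∂P ≤ Real.exp (κ * ‖L‖ ^ 2 / 2) := by
  obtain ⟨κ, hκ⟩ := hu
  refine ⟨κ, κ.2, fun L => ?_⟩
  have h1 := hκ ((InnerProductSpace.toDual ℝ (Vec ℓ)).symm L)
  simp only [InnerProductSpace.toDual_symm_apply] at h1
  have h2 := h1.integrable_exp_mul 1
  have h3 := h1.mgf_le 1
  simp only [mgf, one_mul, one_pow, mul_one] at h2 h3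
  refine ⟨h2, h3.trans (le_of_eq ?_)⟩
  congr 2
  push_cast
  simp

/-- The product of two exponentials, by the inequality between the means; the weight is chosen
so that the two terms balance. -/
theorem integral_exp_add_le {A B : Ω → ℝ} {s r : ℝ}
    (hA : Integrable (fun ω => Real.exp (2 * A ω)) P)
    (hB : Integrable (fun ω => Real.exp (2 * B ω)) P)
    (hAm : AEStronglyMeasurable A P) (hBm : AEStronglyMeasurable B P)
    (hAs : ∫ ω, Real.exp (2 * A ω) ∂P ≤ Real.exp (2 * s))
    (hBr : ∫ ω, Real.exp (2 * B ω) ∂P ≤ Real.exp (2 * r)) :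
    Integrable (fun ω => Real.exp (A ω + B ω)) P ∧
      ∫ ω, Real.exp (A ω + B ω) ∂P ≤ Real.exp (s + r) := by
  have hle : ∀ ω, Real.exp (A ω + B ω) ≤ Real.exp (r - s) / 2 * Real.exp (2 * A ω)
      + Real.exp (s - r) / 2 * Real.exp (2 * B ω) := by
    intro ω
    have e1 : Real.exp (r - s) * Real.exp (2 * A ω) = Real.exp ((r - s) / 2 + A ω) ^ 2 := by
      rw [← Real.exp_add, ← Real.exp_nat_mul]; congr 1; push_cast; ring
    have e2 : Real.exp (s - r) * Real.exp (2 * B ω) = Real.exp ((s - r) / 2 + B ω) ^ 2 := by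
      rw [← Real.exp_add, ← Real.exp_nat_mul]; congr 1; push_cast; ring
    have e3 : Real.exp (A ω + B ω)
        = Real.exp ((r - s) / 2 + A ω) * Real.exp ((s - r) / 2 + B ω) := by
      rw [← Real.exp_add]; congr 1; ring
    rw [e3]
    nlinarith [two_mul_le_add_sq (Real.exp ((r - s) / 2 + A ω)) (Real.exp ((s - r) / 2 + B ω))]
  have hi : Integrable (fun ω => Real.exp (r - s) / 2 * Real.exp (2 * A ω)
      + Real.exp (s - r) / 2 * Real.exp (2 * B ω)) P := (hA.const_mul _).add (hB.const_mul _)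
  refine ⟨hi.mono' (Real.continuous_exp.comp_aestronglyMeasurable (hAm.add hBm))
    (ae_of_all _ fun ω => by
      rw [Real.norm_of_nonneg (Real.exp_pos _).le]; exact hle ω), ?_⟩
  refine (integral_mono_of_nonneg (ae_of_all P fun ω => (Real.exp_pos _).le) hi
    (ae_of_all P hle)).trans ?_
  rw [integral_add (hA.const_mul _) (hB.const_mul _), integral_const_mul, integral_const_mul]
  have h1 := mul_le_mul_of_nonneg_left hAs (by positivity : 0 ≤ Real.exp (r - s) / 2)
  have h2 := mul_le_mul_of_nonneg_left hBr (by positivity : 0 ≤ Real.exp (s - r) / 2)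
  have e1 : Real.exp (r - s) * Real.exp (2 * s) = Real.exp (s + r) := by
    rw [← Real.exp_add]; congr 1; ring
  have e2 : Real.exp (s - r) * Real.exp (2 * r) = Real.exp (s + r) := by
    rw [← Real.exp_add]; congr 1; ring
  linarith

/-- The noise part of the gradient of `V^ζ`. The growth `Tr(σσ*) = O(V^{1-ζ})` is what makes its
square of order `V^ζ`, so that it can be absorbed by the mean reversion of `V^ζ`. -/
theorem IsLyapunovBound.norm_rpow_grad_sq_le (h : IsLyapunovBound b σ V α K) (hζ : 0 < ζ)
    (hζ1 : ζ ≤ 1) (hT : ∀ y, traceSq (σ y) ≤ T * V y ^ (1 - ζ)) (y : Vec q) :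
    ‖(ζ * V y ^ (ζ - 1)) • (fderiv ℝ V y).comp (σ y)‖ ^ 2 ≤ K ^ 2 * T * V y ^ ζ := by
  have hK := h.const_nonneg
  have hv0 : 0 < V y := zero_lt_one.trans_le (h.one_le y)
  have ht := hT y
  have ht0 : 0 ≤ traceSq (σ y) := traceSq_nonneg _
  have h1 : ‖(fderiv ℝ V y).comp (σ y)‖ ≤ (K * √(V y)) * √(traceSq (σ y)) :=
    (ContinuousLinearMap.opNorm_comp_le _ _).trans
      (mul_le_mul (h.grad y) (opNorm_le_sqrt_traceSq _) (norm_nonneg _) (by positivity))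
  have h2 := pow_le_pow_left₀ (norm_nonneg _) h1 2
  rw [mul_pow, mul_pow, Real.sq_sqrt hv0.le, Real.sq_sqrt ht0] at h2
  rw [norm_smul, mul_pow, Real.norm_eq_abs, sq_abs]
  have hc0 : 0 < V y ^ (ζ - 1) := Real.rpow_pos_of_pos hv0 _
  have e1 : V y ^ (ζ - 1) * V y = V y ^ ζ := by
    rw [← Real.rpow_add_one hv0.ne']; congr 1; ring
  have e2 : V y ^ (ζ - 1) * V y ^ (1 - ζ) = 1 := by
    rw [← Real.rpow_add hv0]; simp
  have hvz : 0 ≤ V y ^ ζ := Real.rpow_nonneg hv0.le _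
  have hT0 : 0 ≤ T := by
    have := (mul_nonneg hc0.le ht0).trans (mul_le_mul_of_nonneg_left ht hc0.le)
    rw [mul_left_comm, e2, mul_one] at this
    exact this
  calc (ζ * V y ^ (ζ - 1)) ^ 2 * ‖(fderiv ℝ V y).comp (σ y)‖ ^ 2
      ≤ (ζ * V y ^ (ζ - 1)) ^ 2 * (K ^ 2 * V y * (T * V y ^ (1 - ζ))) := by
        gcongr
        exact h2.trans (by gcongr)
    _ = ζ ^ 2 * (K ^ 2 * T * ((V y ^ (ζ - 1) * V y) * (V y ^ (ζ - 1) * V y ^ (1 - ζ)))) := by ring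
    _ = ζ ^ 2 * (K ^ 2 * T * V y ^ ζ) := by rw [e1, e2, mul_one]
    _ ≤ 1 * (K ^ 2 * T * V y ^ ζ) := by
        gcongr
        exact pow_le_one₀ hζ.le hζ1
    _ = _ := one_mul _

theorem const_nonneg_of_traceSq_le (hV : ∀ y, 1 ≤ V y)
    (hT : ∀ y, traceSq (σ y) ≤ T * V y ^ (1 - ζ)) : 0 ≤ T := by
  have h1 := (traceSq_nonneg (σ 0)).trans (hT 0)
  have h2 : 0 < V 0 ^ (1 - ζ) := Real.rpow_pos_of_pos (zero_lt_one.trans_le (hV 0)) _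
  exact nonneg_of_mul_nonneg_left h1 h2

/-- For small `λ`, the one-step mean of `exp (λ V^ζ)` contracts for small steps; the range of the
steps does not depend on `λ`. -/
theorem exists_integral_exp_step_le [IsProbabilityMeasure P] (h : IsLyapunovBound b σ V α K)
    (hb : Continuous b) (hσ : Continuous σ)
    (hζ : 0 < ζ) (hζ1 : ζ ≤ 1) (hT : ∀ y, traceSq (σ y) ≤ T * V y ^ (1 - ζ))
    {u : Ω → Vec ℓ} (hu : IsSubnormal P u) (hm : Measurable u) :
    ∃ lam₁ > 0, ∃ g₀ > 0, ∃ B, 0 ≤ B ∧ ∀ lam, 0 < lam → lam ≤ lam₁ →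
      ∀ g, 0 ≤ g → g ≤ g₀ → ∀ y,
        Integrable (fun ω => Real.exp (lam * V (stepMap b σ g y (u ω)) ^ ζ)) P ∧
        ∫ ω, Real.exp (lam * V (stepMap b σ g y (u ω)) ^ ζ) ∂P
          ≤ (1 - 1 / 2 * g) * Real.exp (lam * V y ^ ζ) + B * g := by
  have hK := h.const_nonneg
  have hα := h.alpha_pos
  have hT0 := const_nonneg_of_traceSq_le h.one_le hT
  obtain ⟨δ, hδ, hδi⟩ := hu.exists_integrable_exp_sq hm
  obtain ⟨κ, hκ0, hκ⟩ := hu.exists_integral_exp_le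
  obtain ⟨M, hM⟩ : ∃ M, M = (∫ ω, Real.exp (δ * ‖u ω‖ ^ 2) ∂P) / δ := ⟨_, rfl⟩
  have hM0 : 0 ≤ M := by
    rw [hM]
    exact div_nonneg (integral_nonneg fun ω => (Real.exp_pos _).le) hδ.le
  -- Of the rate `ζ α` of the linear part, the quadratic part of the drift may take a half, through
  -- the size of `g`, and the sub-normal exponent a quarter, through the size of `λ`.
  refine ⟨min 1 (ζ * α / (4 * (κ * (K ^ 2 * T) + 1))), by positivity,
    min 1 (min (ζ * α / (4 * (K ^ 3 + 1))) (δ / (4 * K * T + 1))), by positivity,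
    Real.exp ((K * (1 + T) + 2 * K * T * M + 1) / (ζ * α / 4))
      * (1 / 2 + (K * (1 + T) + 2 * K * T * M) * Real.exp (K * (1 + T) + 2 * K * T * M)),
    by positivity, fun lam hl hl1 g hg hg0 y => ?_⟩
  have hlam1 : lam ≤ 1 := hl1.trans (min_le_left _ _)
  have hlamκ : κ * lam * (K ^ 2 * T) ≤ ζ * α / 4 := by
    have := hl1.trans (min_le_right _ _)
    rw [le_div_iff₀ (by positivity)] at this
    linarith
  have hg1 : g ≤ 1 := hg0.trans (min_le_left _ _)
  have hgK : 2 * K * (g * K ^ 2) ≤ ζ * α / 2 := by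
    have := hg0.trans ((min_le_right _ _).trans (min_le_left _ _))
    rw [le_div_iff₀ (by positivity)] at this
    linarith
  have hgδ : 4 * K * T * g ≤ δ := by
    have := hg0.trans ((min_le_right _ _).trans (min_le_right _ _))
    rw [le_div_iff₀ (by positivity)] at this
    linarith
  have hv1 := h.one_le y
  have hvz : 0 ≤ V y ^ ζ := Real.rpow_nonneg (zero_le_one.trans hv1) _
  obtain ⟨L, hL⟩ : ∃ L, L = (ζ * V y ^ (ζ - 1)) • (fderiv ℝ V y).comp (σ y) := ⟨_, rfl⟩
  have hLn : ‖L‖ ^ 2 ≤ K ^ 2 * T * V y ^ ζ := by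
    rw [hL]; exact h.norm_rpow_grad_sq_le hζ hζ1 hT y
  have hLu : ∀ w, L w = ζ * V y ^ (ζ - 1) * fderiv ℝ V y (σ y w) := by
    intro w; rw [hL]; simp
  -- the martingale part and the quadratic part of the exponent
  have hA := hκ ((2 * (lam * √g)) • L)
  have hAe : ∀ ω, ((2 * (lam * √g)) • L) (u ω) = 2 * (lam * √g * L (u ω)) := by
    intro ω; simp; ring
  simp only [hAe] at hA
  have hθ : 0 ≤ 4 * lam * K * T * g := by positivity
  have hθδ : 4 * lam * K * T * g ≤ δ := by
    refine le_trans ?_ hgδ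
    have : 0 ≤ K * T * g := by positivity
    nlinarith
  have hB := integral_exp_mul_sq_le (P := P) (X := fun ω => ‖u ω‖ ^ 2) (by fun_prop) hθ hδ hθδ hδi
  rw [← hM] at hB
  have hBe : ∀ ω, 4 * lam * K * T * g * ‖u ω‖ ^ 2 = 2 * (2 * lam * K * T * g * ‖u ω‖ ^ 2) := by
    intro ω; ring
  simp only [hBe] at hB
  have hAB := integral_exp_add_le (s := lam * g * (ζ * α / 4) * V y ^ ζ)
    (r := 2 * lam * K * T * g * M) hA.1 hB.1 (by fun_prop) (by fun_prop) (hA.2.trans ?_)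
    (hB.2.trans (le_of_eq (by ring_nf)))
  rotate_left
  · rw [Real.exp_le_exp, norm_smul, mul_pow, Real.norm_eq_abs, sq_abs, mul_pow, mul_pow,
      Real.sq_sqrt hg]
    calc κ * (2 ^ 2 * (lam ^ 2 * g) * ‖L‖ ^ 2) / 2
        ≤ κ * (2 ^ 2 * (lam ^ 2 * g) * (K ^ 2 * T * V y ^ ζ)) / 2 := by gcongr
      _ = 2 * (lam * g * V y ^ ζ) * (κ * lam * (K ^ 2 * T)) := by ring
      _ ≤ 2 * (lam * g * V y ^ ζ) * (ζ * α / 4) := by gcongr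
      _ = _ := by ring
  have hpt : ∀ ω, Real.exp (lam * V (stepMap b σ g y (u ω)) ^ ζ)
      ≤ Real.exp (lam * V y ^ ζ * (1 - ζ * α / 2 * g) + g * (K * (1 + T)))
        * Real.exp (lam * √g * L (u ω) + 2 * lam * K * T * g * ‖u ω‖ ^ 2) := by
    intro ω
    rw [← Real.exp_add, Real.exp_le_exp]
    have h1 := mul_le_mul_of_nonneg_left (h.rpow_step_le hζ hζ1 hT hg y (u ω)) hl.le
    rw [← hLu] at h1
    refine h1.trans ?_
    have h2 := mul_le_mul_of_nonneg_right hgK (by positivity : 0 ≤ lam * g * V y ^ ζ)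
    have h3 := mul_le_mul_of_nonneg_right hlam1 (by positivity : 0 ≤ g * (K * (1 + T)))
    linarith
  have hVc := h.continuous
  have hmeas : Measurable fun ω => Real.exp (lam * V (stepMap b σ g y (u ω)) ^ ζ) := by
    have : Measurable fun ω => stepMap b σ g y (u ω) :=
      (continuous_stepMap hb hσ g).measurable.comp (measurable_const.prodMk hm)
    exact Real.measurable_exp.comp
      (((hVc.measurable.comp this).pow_const _).const_mul _)
  refine ⟨(hAB.1.const_mul _).mono' hmeas.aestronglyMeasurable (ae_of_all _ fun ω => by
    rw [Real.norm_of_nonneg (Real.exp_pos _).le]; exact hpt ω), ?_⟩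
  have h1 := integral_mono_of_nonneg (ae_of_all P fun ω => (Real.exp_pos _).le)
    (hAB.1.const_mul _) (ae_of_all P hpt)
  rw [integral_const_mul] at h1
  refine h1.trans ((mul_le_mul_of_nonneg_left hAB.2 (Real.exp_pos _).le).trans ?_)
  rw [← Real.exp_add]
  refine le_trans (Real.exp_le_exp.2 ?_) (exp_contract_le (X := lam * V y ^ ζ)
    (ρ := ζ * α / 4) (κ := K * (1 + T) + 2 * K * T * M) (by positivity) (by positivity) hg hg1
    (by positivity))
  have h3 := mul_le_mul_of_nonneg_right hlam1 (by positivity : 0 ≤ 2 * K * T * M * g)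
  linarith

end Exponential


/-! ### The Lyapunov functions along the scheme -/

section Chain

variable {q ℓ : ℕ} {Ω : Type*} {mΩ : MeasurableSpace Ω} {P : Measure Ω}
  {b : Vec q → Vec q} {σ : Vec q → Vec ℓ →L[ℝ] Vec q} {V W : Vec q → ℝ} {α K ζ T : ℝ}
  {γ : ℕ → ℝ} {U : ℕ → Ω → Vec ℓ} {Y : ℕ → Ω → Vec q}

/-- If the one-step mean of `W` is at most `A`, then `W(Y_{n+1})` is integrable as soon as
`A(Y_n)` is. -/
theorem IsEulerChain.integrable_of_integral_step_le [IsProbabilityMeasure P]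
    (hc : IsEulerChain P b σ γ U Y) (n : ℕ) (hW : Continuous W) (hW0 : ∀ y, 0 ≤ W y)
    {A : Vec q → ℝ}
    (hi : ∀ y, Integrable (fun ω => W (stepMap b σ (γ (n + 1)) y (U (n + 1) ω))) P)
    (hle : ∀ y, ∫ ω, W (stepMap b σ (γ (n + 1)) y (U (n + 1) ω)) ∂P ≤ A y)
    (hA : Integrable (fun ω => A (Y n ω)) P) : Integrable (fun ω => W (Y (n + 1) ω)) P := by
  simp only [hc.succ n]
  have hS := continuous_stepMap hc.continuous_drift hc.continuous_diffusion (γ (n + 1))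
  exact (integrable_of_integral_le_of_indep (hc.hist_le n) (measurable_hist Y le_rfl)
    (hc.measurable_innov n) (hc.indep n) (h := fun y v => W (stepMap b σ (γ (n + 1)) y v))
    (hW.comp hS).measurable (fun _ _ => hW0 _) hi hle hA).1

/-- `W` is a Lyapunov function of the scheme that dominates `V^{p+1}`. -/
structure IsSchemeLyapunov (P : Measure Ω) (γ : ℕ → ℝ) (Y : ℕ → Ω → Vec q) (V : Vec q → ℝ)
    (p : ℕ) (W : Vec q → ℝ) : Prop where
  continuous : Continuous W
  one_le : ∀ y, 1 ≤ W y
  integrable : ∀ n, Integrable (fun ω => W (Y n ω)) P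
  stable : IsStableScheme P γ Y W
  dominates : ∃ C, 0 ≤ C ∧ ∀ y, V y ^ (p + 1) ≤ C * W y

/-- The power `V^{p+1}` is a Lyapunov function of the scheme, either by the one-step estimate when
the diffusion coefficient is small, or by assumption. -/
theorem isSchemeLyapunov_pow [IsProbabilityMeasure P] (h : IsLyapunovBound b σ V α K)
    (hc : IsEulerChain P b σ γ U Y) {G : ℝ} (hγ : ∀ n, 0 ≤ γ (n + 1) ∧ γ (n + 1) ≤ G)
    (hγlim : Tendsto γ atTop (𝓝 0)) {p : ℕ} (hp : 1 ≤ p) (hu : IsNormalized P (U 1) p)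
    (h0 : Integrable (fun ω => V (Y 0 ω) ^ (p + 1)) P)
    (hst : (fun y => traceSq (σ y)) =o[cocompact (Vec q)] V ∨
      IsStableScheme P γ Y (fun y => V y ^ (p + 1))) :
    IsSchemeLyapunov P γ Y V p (fun y => V y ^ (p + 1)) := by
  have hint := h.integrable_pow hc hγ hu.moment h0
  refine ⟨h.continuous.pow _, fun y => one_le_pow₀ (h.one_le y), hint, ?_,
    1, zero_le_one, fun y => (one_mul _).ge⟩
  rcases hst with hs | hs
  · obtain ⟨g₀, hg₀, a, ha, B, hB, hstep⟩ :=
      exists_integral_pow_step_le h hc.continuous_diffusion hs hp hu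
    exact isStableScheme_of_integral_step_le hc (fun n => (hγ n).1) hγlim (h.continuous.pow _) hint
      hg₀ ha hB hstep
  · exact hs

/-- Crude growth of `V^ζ` along one step, additive in the noise because `Tr(σσ*) = O(V^{1-ζ})`. -/
theorem IsLyapunovBound.exists_rpow_step_le (h : IsLyapunovBound b σ V α K) (hζ : 0 < ζ)
    (hζ1 : ζ ≤ 1) (hT : ∀ y, traceSq (σ y) ≤ T * V y ^ (1 - ζ)) (G : ℝ) :
    ∃ C, 0 < C ∧ ∀ g, 0 ≤ g → g ≤ G → ∀ y u,
      V (stepMap b σ g y u) ^ ζ ≤ C * (V y ^ ζ + ‖u‖ ^ 2) := by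
  have hK := h.const_nonneg
  have hα := h.alpha_pos
  have hT0 := const_nonneg_of_traceSq_le h.one_le hT
  rcases lt_or_ge G 0 with hG | hG
  · exact ⟨1, one_pos, fun g h0 h1 => absurd (h0.trans h1) (not_le.2 hG)⟩
  refine ⟨1 + √G * (1 + K ^ 2 * T) + G * (K + K * T) + 2 * K * (G ^ 2 * K ^ 2 + G * T),
    by positivity, fun g hg hgG y u => ?_⟩
  have hv1 : 1 ≤ V y ^ ζ := Real.one_le_rpow (h.one_le y) hζ.le
  have hL := h.norm_rpow_grad_sq_le hζ hζ1 hT y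
  have hLu := ((ζ * V y ^ (ζ - 1)) • (fderiv ℝ V y).comp (σ y)).le_opNorm u
  have hd := (Real.le_norm_self _).trans hLu
  simp only [smul_apply, ContinuousLinearMap.comp_apply, smul_eq_mul] at hd
  refine (h.rpow_step_le hζ hζ1 hT hg y u).trans ?_
  generalize ‖(ζ * V y ^ (ζ - 1)) • (fderiv ℝ V y).comp (σ y)‖ = N at *
  generalize ζ * V y ^ (ζ - 1) * fderiv ℝ V y (σ y u) = d at *
  generalize V y ^ ζ = x at *
  have hx0 : 0 ≤ x := by linarith
  have a1 : d ≤ (1 + K ^ 2 * T) * (x + ‖u‖ ^ 2) := by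
    have e : N * ‖u‖ ≤ N ^ 2 + ‖u‖ ^ 2 := by
      nlinarith [sq_nonneg (N - ‖u‖), sq_nonneg N, sq_nonneg ‖u‖]
    have : 0 ≤ K ^ 2 * T * ‖u‖ ^ 2 := by positivity
    nlinarith
  have a2 : √g * d ≤ √G * ((1 + K ^ 2 * T) * (x + ‖u‖ ^ 2)) :=
    (mul_le_mul_of_nonneg_left a1 (Real.sqrt_nonneg _)).trans
      (mul_le_mul_of_nonneg_right (Real.sqrt_le_sqrt hgG) (by positivity))
  have a3 : g * (-(ζ * α) * x + K + K * T) ≤ G * ((K + K * T) * (x + ‖u‖ ^ 2)) := by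
    have : -(ζ * α) * x + K + K * T ≤ (K + K * T) * (x + ‖u‖ ^ 2) := by
      have b1 : 0 ≤ ζ * α * x := by positivity
      have b2 : (K + K * T) * 1 ≤ (K + K * T) * (x + ‖u‖ ^ 2) := by
        gcongr
        nlinarith [sq_nonneg ‖u‖]
      linarith
    exact (mul_le_mul_of_nonneg_left this hg).trans
      (mul_le_mul_of_nonneg_right hgG (by positivity))
  have a4 : g ^ 2 * K ^ 2 * x + g * T * ‖u‖ ^ 2 ≤ (G ^ 2 * K ^ 2 + G * T) * (x + ‖u‖ ^ 2) := by
    have b1 : g ^ 2 * K ^ 2 * x ≤ G ^ 2 * K ^ 2 * x := by gcongr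
    have b2 : g * T * ‖u‖ ^ 2 ≤ G * T * ‖u‖ ^ 2 := by gcongr
    have b3 : 0 ≤ G ^ 2 * K ^ 2 * ‖u‖ ^ 2 + G * T * x := by positivity
    linarith
  have a5 := mul_le_mul_of_nonneg_left a4 (by positivity : 0 ≤ 2 * K)
  nlinarith [sq_nonneg ‖u‖]

theorem integrable_exp_of_le {X : Ω → ℝ} {s c : ℝ} (hX : Measurable X) (hX0 : ∀ ω, 0 ≤ X ω)
    (hsc : s ≤ c) (hi : Integrable (fun ω => Real.exp (c * X ω)) P) :
    Integrable (fun ω => Real.exp (s * X ω)) P := by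
  refine hi.mono' (by fun_prop) (ae_of_all _ fun ω => ?_)
  rw [Real.norm_of_nonneg (Real.exp_pos _).le, Real.exp_le_exp]
  exact mul_le_mul_of_nonneg_right hsc (hX0 ω)

/-- Each `V^ζ(Y_n)` has an exponential moment, of an order that depends on `n`. -/
theorem IsLyapunovBound.exists_integrable_exp [IsProbabilityMeasure P]
    (h : IsLyapunovBound b σ V α K) (hc : IsEulerChain P b σ γ U Y) {G : ℝ}
    (hγ : ∀ n, 0 ≤ γ (n + 1) ∧ γ (n + 1) ≤ G) (hζ : 0 < ζ) (hζ1 : ζ ≤ 1)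
    (hT : ∀ y, traceSq (σ y) ≤ T * V y ^ (1 - ζ)) (hu : IsSubnormal P (U 1))
    (h0 : ∃ c > (0 : ℝ), Integrable (fun ω => Real.exp (c * V (Y 0 ω) ^ ζ)) P) (n : ℕ) :
    ∃ c > (0 : ℝ), Integrable (fun ω => Real.exp (c * V (Y n ω) ^ ζ)) P := by
  have hV0 : ∀ y, 0 ≤ V y := fun y => zero_le_one.trans (h.one_le y)
  have hVm : ∀ n, Measurable fun ω => V (Y n ω) ^ ζ := fun n =>
    (h.continuous.measurable.comp (hc.measurable n)).pow_const _
  obtain ⟨C, hC0, hC⟩ := h.exists_rpow_step_le hζ hζ1 hT G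
  obtain ⟨δ, hδ, hδi⟩ := hu.exists_integrable_exp_sq (hc.measurable_innov 0)
  induction n with
  | zero => exact h0
  | succ n ih =>
    obtain ⟨c, hc0, hci⟩ := ih
    refine ⟨min c δ / C, by positivity, ?_⟩
    refine (hc.integrable_of_le_mul n
      (X := fun ω => Real.exp (min c δ / C * V (Y (n + 1) ω) ^ ζ))
      (A := fun y => Real.exp (min c δ * V y ^ ζ))
      (B := fun u => Real.exp (min c δ * ‖u‖ ^ 2))
      (Real.measurable_exp.comp ((hVm (n + 1)).const_mul _)).aestronglyMeasurable
      (Real.measurable_exp.comp ((h.continuous.measurable.pow_const _).const_mul _))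
      (by fun_prop) ?_ ?_ fun ω => ?_).1
    · exact integrable_exp_of_le (hVm n) (fun ω => Real.rpow_nonneg (hV0 _) _)
        (min_le_left _ _) hci
    · exact integrable_exp_of_le ((hc.measurable_innov 0).norm.pow_const 2)
        (fun ω => sq_nonneg _) (min_le_right _ _) hδi
    · rw [abs_of_pos (Real.exp_pos _), ← Real.exp_add, Real.exp_le_exp, hc.succ n ω]
      have h1 := hC (γ (n + 1)) (hγ n).1 (hγ n).2 (Y n ω) (U (n + 1) ω)
      have h2 := mul_le_mul_of_nonneg_left h1 (by positivity : 0 ≤ min c δ / C)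
      refine h2.trans (le_of_eq ?_)
      field_simp

/-- The exponentials `exp (λ V^ζ)` are Lyapunov functions of the scheme for small `λ`. -/
theorem exists_isSchemeLyapunov_exp [IsProbabilityMeasure P] (h : IsLyapunovBound b σ V α K)
    (hc : IsEulerChain P b σ γ U Y) {G : ℝ} (hγ : ∀ n, 0 ≤ γ (n + 1) ∧ γ (n + 1) ≤ G)
    (hγlim : Tendsto γ atTop (𝓝 0)) (hζ : 0 < ζ) (hζ1 : ζ ≤ 1) (hu : IsSubnormal P (U 1))
    (hT : ∃ T, ∀ y, traceSq (σ y) ≤ T * V y ^ (1 - ζ))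
    (h0 : ∃ c > (0 : ℝ), Integrable (fun ω => Real.exp (c * V (Y 0 ω) ^ ζ)) P) :
    ∃ lam₀ > 0, ∀ lam, 0 < lam → lam ≤ lam₀ → ∀ p,
      IsSchemeLyapunov P γ Y V p (fun y => Real.exp (lam * V y ^ ζ)) := by
  obtain ⟨T, hT⟩ := hT
  have hV0 : ∀ y, 0 ≤ V y := fun y => zero_le_one.trans (h.one_le y)
  have hVm : ∀ n, Measurable fun ω => V (Y n ω) ^ ζ := fun n =>
    (h.continuous.measurable.comp (hc.measurable n)).pow_const _
  obtain ⟨lam₁, hlam₁, g₀, hg₀, B, hB, hstep⟩ := exists_integral_exp_step_le h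
    hc.continuous_drift hc.continuous_diffusion hζ hζ1 hT hu (hc.measurable_innov 0)
  obtain ⟨n₀, hn₀⟩ := eventually_atTop.1 (hγlim.eventually (gt_mem_nhds hg₀))
  choose c hc0 hci using h.exists_integrable_exp hc hγ hζ hζ1 hT hu h0
  -- The first `n₀` steps may be too large for the contraction: there `λ` is bounded by a common
  -- exponential moment of `Y_0, …, Y_{n₀}`.
  obtain ⟨c', hc'0, hc'⟩ : ∃ c' > 0, ∀ n ≤ n₀, c' ≤ c n := by
    refine ⟨(Finset.range (n₀ + 1)).inf' ⟨0, by simp⟩ c, ?_, fun n hn => ?_⟩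
    · exact (Finset.lt_inf'_iff _).2 fun i _ => hc0 i
    · exact Finset.inf'_le _ (Finset.mem_range.2 (by omega))
  refine ⟨min lam₁ c', by positivity, fun lam hl hle p => ?_⟩
  have hWc : Continuous fun y => Real.exp (lam * V y ^ ζ) :=
    Real.continuous_exp.comp
      (continuous_const.mul (h.continuous.rpow_const fun y => Or.inr hζ.le))
  have hW1 : ∀ y, 1 ≤ Real.exp (lam * V y ^ ζ) := fun y =>
    Real.one_le_exp (mul_nonneg hl.le (Real.rpow_nonneg (hV0 y) _))
  have hstep' := hstep lam hl (hle.trans (min_le_left _ _))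
  have hint : ∀ n, Integrable (fun ω => Real.exp (lam * V (Y n ω) ^ ζ)) P := by
    intro n
    induction n with
    | zero =>
      exact integrable_exp_of_le (hVm 0) (fun ω => Real.rpow_nonneg (hV0 _) _)
        ((hle.trans (min_le_right _ _)).trans (hc' 0 (Nat.zero_le _))) (hci 0)
    | succ n ih =>
      rcases le_or_gt (n + 1) n₀ with hn | hn
      · exact integrable_exp_of_le (hVm _) (fun ω => Real.rpow_nonneg (hV0 _) _)
          ((hle.trans (min_le_right _ _)).trans (hc' _ hn)) (hci _)
      · have hs := hstep' (γ (n + 1)) (hγ n).1 (hn₀ (n + 1) (by omega)).le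
        have hid : ∀ y, IdentDistrib
            (fun ω => Real.exp (lam * V (stepMap b σ (γ (n + 1)) y (U (n + 1) ω)) ^ ζ))
            (fun ω => Real.exp (lam * V (stepMap b σ (γ (n + 1)) y (U 1 ω)) ^ ζ)) P P := fun y =>
          (hc.ident n).comp (u := fun v => Real.exp (lam * V (stepMap b σ (γ (n + 1)) y v) ^ ζ))
            ((hWc.measurable).comp
            ((continuous_stepMap hc.continuous_drift hc.continuous_diffusion _).measurable.comp
              measurable_prodMk_left))
        refine hc.integrable_of_integral_step_le n hWc (fun y => (Real.exp_pos _).le)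
          (A := fun y => (1 - 1 / 2 * γ (n + 1)) * Real.exp (lam * V y ^ ζ) + B * γ (n + 1))
          (fun y => (hid y).integrable_iff.2 (hs y).1)
          (fun y => (hid y).integral_eq.le.trans (hs y).2)
          ((ih.const_mul _).add (integrable_const _))
  refine ⟨hWc, hW1, hint, isStableScheme_of_integral_step_le hc (fun n => (hγ n).1) hγlim hWc hint
    hg₀ (by norm_num : (0 : ℝ) < 1 / 2) hB fun g hg hg0 y => (hstep' g hg hg0 y).2, ?_⟩
  obtain ⟨N, hN⟩ := exists_nat_ge (((p : ℝ) + 1) / ζ)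
  refine ⟨N.factorial / lam ^ N, by positivity, fun y => ?_⟩
  have hx : 0 ≤ lam * V y ^ ζ := mul_nonneg hl.le (Real.rpow_nonneg (hV0 y) _)
  have h1 := Real.pow_div_factorial_le_exp _ hx N
  have h2 : V y ^ (p + 1) ≤ (V y ^ ζ) ^ N := by
    rw [← Real.rpow_natCast (V y ^ ζ), ← Real.rpow_mul (hV0 y), ← Real.rpow_natCast]
    refine Real.rpow_le_rpow_of_exponent_le (h.one_le y) ?_
    rw [div_le_iff₀ hζ] at hN
    push_cast
    linarith
  rw [div_le_iff₀ (by positivity), mul_pow] at h1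
  rw [div_mul_eq_mul_div, le_div_iff₀ (by positivity)]
  have h3 := mul_le_mul_of_nonneg_left h2 (by positivity : 0 ≤ lam ^ N)
  linarith

/-- The thresholds: one `λ₀(ζ)` for every `ζ`. -/
theorem exists_threshold [IsProbabilityMeasure P] (h : IsLyapunovBound b σ V α K)
    {Y₀ : Ω → Vec q} (hc : IsEulerChain P b σ γ U (eulerScheme b σ γ U Y₀)) {G : ℝ}
    (hγ : ∀ n, 0 ≤ γ (n + 1) ∧ γ (n + 1) ≤ G) (hγlim : Tendsto γ atTop (𝓝 0)) :
    ∃ lam₀ : ℝ → ℝ, (∀ ζ, 0 < lam₀ ζ) ∧ ∀ p, 1 ≤ p → IsNormalized P (U 1) p →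
      ∀ W, IsAdmissible b σ V P γ U Y₀ p lam₀ W →
        IsSchemeLyapunov P γ (eulerScheme b σ γ U Y₀) V p W := by
  have key : ∀ ζ : ℝ, ∃ lam₀ > 0, 0 < ζ → ζ ≤ 1 → IsSubnormal P (U 1) →
      (∃ T, ∀ y, traceSq (σ y) ≤ T * V y ^ (1 - ζ)) →
      (∃ c > (0 : ℝ), Integrable (fun ω => Real.exp (c * V (Y₀ ω) ^ ζ)) P) →
      ∀ lam, 0 < lam → lam ≤ lam₀ → ∀ p,
        IsSchemeLyapunov P γ (eulerScheme b σ γ U Y₀) V p (fun y => Real.exp (lam * V y ^ ζ)) := by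
    intro ζ
    by_cases hcond : 0 < ζ ∧ ζ ≤ 1 ∧ IsSubnormal P (U 1) ∧
      (∃ T, ∀ y, traceSq (σ y) ≤ T * V y ^ (1 - ζ)) ∧
      (∃ c > (0 : ℝ), Integrable (fun ω => Real.exp (c * V (Y₀ ω) ^ ζ)) P)
    · obtain ⟨h1, h2, h3, h4, h5⟩ := hcond
      obtain ⟨lam₀, hl, H⟩ := exists_isSchemeLyapunov_exp h hc hγ hγlim h1 h2 h3 h4 h5
      exact ⟨lam₀, hl, fun _ _ _ _ _ => H⟩
    · exact ⟨1, one_pos, fun h1 h2 h3 h4 h5 => absurd ⟨h1, h2, h3, h4, h5⟩ hcond⟩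
  choose lam₀ hpos H using key
  refine ⟨lam₀, hpos, fun p hp hu W hW => ?_⟩
  rcases hW with ⟨hW, h0, hst⟩ | ⟨ζ, lam, h1, h2, h3, h4, hW, h5, h6, h7⟩
  · obtain rfl : W = fun y => V y ^ (p + 1) := funext hW
    exact isSchemeLyapunov_pow h hc hγ hγlim hp hu h0 hst
  · obtain rfl : W = fun y => Real.exp (lam * V y ^ ζ) := funext hW
    exact H ζ h1 h2 h5 h6 h7 lam h3 h4 p

end Chain


/-! ### Rate of the empirical means -/

section Rate

variable {q ℓ : ℕ} {Ω : Type*} {mΩ : MeasurableSpace Ω} {P : Measure Ω}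
  {b : Vec q → Vec q} {σ : Vec q → Vec ℓ →L[ℝ] Vec q} {V W : Vec q → ℝ} {c K : ℝ}
  {γ : ℕ → ℝ} {U : ℕ → Ω → Vec ℓ} {Y : ℕ → Ω → Vec q} {p : ℕ}

/-- The contraction keeps the means of `W` along the scheme bounded. -/
theorem IsSchemeLyapunov.exists_integral_le [IsProbabilityMeasure P]
    (hW : IsSchemeLyapunov P γ Y V p W) (hYm : ∀ n, hist Y n ≤ mΩ)
    (hγ0 : ∀ n, 0 ≤ γ (n + 1)) (hγlim : Tendsto γ atTop (𝓝 0)) :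
    ∃ B, ∀ n, ∫ ω, W (Y n ω) ∂P ≤ B := by
  obtain ⟨n₀, a, ha, β, hβ, hst⟩ := hW.stable
  obtain ⟨n₁, hn₁⟩ := eventually_atTop.1 (hγlim.eventually (gt_mem_nhds (inv_pos.2 ha)))
  have hpos : ∀ n, 0 ≤ ∫ ω, W (Y n ω) ∂P := fun n =>
    integral_nonneg fun ω => zero_le_one.trans (hW.one_le _)
  set N := max n₀ n₁ with hN
  refine ⟨∑ k ∈ Finset.range (N + 1), ∫ ω, W (Y k ω) ∂P + β / a, fun n => ?_⟩
  induction n with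
  | zero =>
    have := Finset.single_le_sum (f := fun k => ∫ ω, W (Y k ω) ∂P) (fun k _ => hpos k)
      (Finset.mem_range.2 (Nat.succ_pos N))
    have h2 : 0 ≤ β / a := by positivity
    linarith
  | succ n ih =>
    have h2 : 0 ≤ β / a := by positivity
    rcases lt_or_ge n N with hn | hn
    · have := Finset.single_le_sum (f := fun k => ∫ ω, W (Y k ω) ∂P) (fun k _ => hpos k)
        (Finset.mem_range.2 (by omega : n + 1 < N + 1))
      linarith
    · have h1 : ∫ ω, W (Y (n + 1) ω) ∂P ≤ (1 - a * γ (n + 1)) * ∫ ω, W (Y n ω) ∂P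
          + β * γ (n + 1) := by
        have e := integral_condExp (hYm n) (μ := P) (f := fun ω => W (Y (n + 1) ω))
        have h3 := integral_mono_ae integrable_condExp
          (((hW.integrable n).const_mul (1 - a * γ (n + 1))).add
            (integrable_const (β * γ (n + 1)))) (hst n (by omega))
        have h4 := integral_add ((hW.integrable n).const_mul (1 - a * γ (n + 1)))
            (integrable_const (μ := P) (β * γ (n + 1)))
        rw [integral_const_mul] at h4
        simp only [integral_const, probReal_univ, smul_eq_mul, one_mul] at h4
        exact (e.symm.le.trans h3).trans h4.le
      have hg1 : a * γ (n + 1) ≤ 1 := by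
        have := (hn₁ (n + 1) (by omega)).le
        rw [← mul_inv_cancel₀ ha.ne']
        exact mul_le_mul_of_nonneg_left this ha.le
      set S := ∑ k ∈ Finset.range (N + 1), ∫ ω, W (Y k ω) ∂P with hS
      have hS0 : 0 ≤ S := Finset.sum_nonneg fun k _ => hpos k
      have h5 := mul_le_mul_of_nonneg_left ih (sub_nonneg.2 hg1)
      have h6 : β * γ (n + 1) = a * γ (n + 1) * (β / a) := by field_simp
      have h7 : 0 ≤ a * γ (n + 1) * S := mul_nonneg (mul_nonneg ha.le (hγ0 n)) hS0
      linarith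

/-- The square root of a Lyapunov function, along the scheme. -/
theorem IsSchemeLyapunov.exists_isLyapunovSequence [IsProbabilityMeasure P]
    (hW : IsSchemeLyapunov P γ Y V p W) (hc : IsEulerChain P b σ γ U Y)
    (hγ0 : ∀ n, 0 ≤ γ (n + 1)) (hγlim : Tendsto γ atTop (𝓝 0)) :
    ∃ B α β' n₀, IsLyapunovSequence P hc.filtration γ (fun n ω => √(W (Y n ω))) B α β' n₀ := by
  obtain ⟨B, hB⟩ := hW.exists_integral_le hc.hist_le hγ0 hγlim
  obtain ⟨n₀, a, ha, β, hβ, hst⟩ := hW.stable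
  have hsq : ∀ n ω, √(W (Y n ω)) ^ 2 = W (Y n ω) := fun n ω =>
    Real.sq_sqrt (zero_le_one.trans (hW.one_le _))
  have hm : ∀ n, Measurable[hist Y n] fun ω => √(W (Y n ω)) := fun n =>
    (hW.continuous.sqrt.measurable).comp (measurable_hist Y le_rfl)
  refine ⟨B, a, β, n₀, fun n => (hm n).stronglyMeasurable,
    fun n ω => Real.one_le_sqrt.2 (hW.one_le _), fun n => ?_, fun n => ?_, ha, hβ, fun n hn => ?_⟩
  · rw [memLp_two_iff_integrable_sq ((hm n).mono (hc.hist_le n) le_rfl).aestronglyMeasurable]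
    simp only [hsq]
    exact hW.integrable n
  · simp only [hsq]
    exact hB n
  · simp only [hsq]
    exact hst n hn

theorem continuous_generator (hb : Continuous b) (hσ : Continuous σ) {φ : Vec q → ℝ}
    (hφ : ContDiff ℝ 2 φ) : Continuous (generator b σ φ) := by
  unfold generator
  have h1 : Continuous (fderiv ℝ φ) := hφ.continuous_fderiv (by norm_num)
  have h2 : Continuous (iteratedFDeriv ℝ 2 φ) := hφ.continuous_iteratedFDeriv (by norm_num)
  refine (h1.clm_apply hb).add (continuous_const.mul (continuous_finsetSum _ fun i _ => ?_))
  have h3 : Continuous fun y => σ y (EuclideanSpace.single i 1) := hσ.clm_apply continuous_const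
  have h4 : Continuous fun y => ![σ y (EuclideanSpace.single i (1 : ℝ)),
      σ y (EuclideanSpace.single i 1)] := by
    refine continuous_pi fun j => ?_
    fin_cases j <;> exact h3
  exact h2.eval h4

/-- `𝒜φ` only involves `D^jφ` with `j ≤ 2`, and `|b|`, `|σ|` are of order `√V`. -/
theorem abs_generator_le (h : HasSqrtGrowth b σ V c) {w φ : Vec q → ℝ} (hp : 2 ≤ p)
    (hK : HasDerivGrowth V w φ p K) (y : Vec q) :
    |generator b σ φ y| ≤ (c + ℓ * c ^ 2) * K * w y := by
  have hc := h.nonneg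
  have hV0 : 0 ≤ V y := zero_le_one.trans (h.one_le y)
  have h1 := hK 1 (by omega) y
  have h2 := hK 2 hp y
  rw [pow_one] at h1
  have e1 : ‖iteratedFDeriv ℝ 1 φ y‖ = ‖fderiv ℝ φ y‖ := norm_iteratedFDeriv_one _
  rw [e1] at h1
  have a1 : |fderiv ℝ φ y (b y)| ≤ c * (K * w y) := by
    refine ((fderiv ℝ φ y).le_opNorm _).trans ?_
    refine (mul_le_mul_of_nonneg_left (h.drift y) (norm_nonneg _)).trans ?_
    calc ‖fderiv ℝ φ y‖ * (c * √(V y)) = c * (‖fderiv ℝ φ y‖ * √(V y)) := by ring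
      _ ≤ _ := mul_le_mul_of_nonneg_left h1 hc
  have a2 : |∑ i : Fin ℓ, iteratedFDeriv ℝ 2 φ y
      ![σ y (EuclideanSpace.single i 1), σ y (EuclideanSpace.single i 1)]|
      ≤ ℓ * (c ^ 2 * (K * w y)) := by
    refine (Finset.abs_sum_le_sum_abs _ _).trans ?_
    refine (Finset.sum_le_card_nsmul Finset.univ _ (c ^ 2 * (K * w y)) fun i _ => ?_).trans
      (by simp)
    rw [← Real.norm_eq_abs]
    refine (ContinuousMultilinearMap.le_opNorm _ _).trans ?_
    rw [Fin.prod_univ_two]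
    simp only [Matrix.cons_val_zero, Matrix.cons_val_one]
    have b1 : ‖σ y (EuclideanSpace.single i 1)‖ ≤ c * √(V y) := by
      refine ((σ y).le_opNorm _).trans ?_
      simpa using h.diffusion y
    calc ‖iteratedFDeriv ℝ 2 φ y‖ * (‖σ y (EuclideanSpace.single i 1)‖
          * ‖σ y (EuclideanSpace.single i 1)‖)
        ≤ ‖iteratedFDeriv ℝ 2 φ y‖ * ((c * √(V y)) * (c * √(V y))) := by gcongr
      _ = c ^ 2 * (‖iteratedFDeriv ℝ 2 φ y‖ * √(V y) ^ 2) := by ring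
      _ ≤ _ := mul_le_mul_of_nonneg_left h2 (sq_nonneg c)
  rw [generator]
  refine (abs_add_le _ _).trans ?_
  rw [abs_mul, abs_of_pos (by norm_num : (0 : ℝ) < 1 / 2)]
  have a3 := abs_nonneg (∑ i : Fin ℓ, iteratedFDeriv ℝ 2 φ y
      ![σ y (EuclideanSpace.single i 1), σ y (EuclideanSpace.single i 1)])
  linarith

theorem isNormalized_of_isWhiteNoise [IsProbabilityMeasure P] (hU : IsWhiteNoise P U)
    (hp : MemLp (U 1) (2 * ((p : ℝ≥0∞) + 1)) P) : IsNormalized P (U 1) p := by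
  refine ⟨hU.measurable 1 le_rfl, ?_, hU.mean, hU.cov⟩
  have e : (2 * ((p : ℝ≥0∞) + 1)) = ((2 * (p + 1) : ℕ) : ℝ≥0∞) := by
    rw [Nat.cast_mul, Nat.cast_add, Nat.cast_one, Nat.cast_ofNat]
  rw [e] at hp
  have h1 : MemLp (fun ω => 1 + ‖U 1 ω‖) ((2 * (p + 1) : ℕ) : ℝ≥0∞) P :=
    (memLp_const (1 : ℝ)).add hp.norm
  have h2 := h1.integrable_norm_pow (by omega)
  refine h2.congr (ae_of_all _ fun ω => ?_)
  simp only
  rw [Real.norm_of_nonneg (by positivity)]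

/-- Almost sure and `L²` rate for the additive functional of `𝒜φ`. -/
theorem IsSchemeLyapunov.sum_generator_rate [IsProbabilityMeasure P]
    (hW : IsSchemeLyapunov P γ Y V p W) (hc : IsEulerChain P b σ γ U Y)
    (hγ : IsStepSequence γ) (hγlim : Tendsto γ atTop (𝓝 0))
    (hg : HasSqrtGrowth b σ V c) (hVc : Continuous V)
    (hu : IsNormalized P (U 1) p) {φ : Vec q → ℝ} (hφ : φ ∈ poissonClass V W p)
    (hL : ∃ L, LipschitzWith L (iteratedFDeriv ℝ p φ)) {m : ℕ} (hm3 : 3 ≤ m) (hmp : m ≤ p)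
    (herr : ∀ r, 3 ≤ r → r < m → errorTerm b σ P (U 1) φ r = 0)
    (hs : StepConditions γ ((m : ℝ) / 2 - 1)) :
    (∀ᵐ ω ∂P, ∃ R, ∀ n, |∑ k ∈ Finset.range n, -generator b σ φ (Y k ω)|
      ≤ R * stepSum γ ((m : ℝ) / 2 - 1) n) ∧
    ∃ R, ∀ n, eLpNorm (fun ω => ∑ k ∈ Finset.range n, -generator b σ φ (Y k ω)) 2 P
      ≤ ENNReal.ofReal (R * stepSum γ ((m : ℝ) / 2 - 1) n) := by
  obtain ⟨L, hL⟩ := hL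
  obtain ⟨K₀, hK₀0, hK₀⟩ := exists_hasDerivGrowth hVc hg.one_le hW.one_le hφ
  obtain ⟨D, hD0, hD⟩ := hW.dominates
  have hw1 : ∀ y, 1 ≤ √(W y) := fun y => Real.one_le_sqrt.2 (hW.one_le y)
  -- One constant for the derivatives of `φ` and for `V^{(p+1)/2} = O(√W)`.
  obtain ⟨K, hK0, hK, hVw⟩ : ∃ K, 0 ≤ K ∧ HasDerivGrowth V (fun y => √(W y)) φ p K ∧
      ∀ y, √(V y) ^ (p + 1) ≤ K * √(W y) := by
    refine ⟨K₀ + √D, by positivity, fun j hj y => (hK₀ j hj y).trans ?_, fun y => ?_⟩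
    · gcongr
      linarith [Real.sqrt_nonneg D]
    · have hV0 : 0 ≤ V y := zero_le_one.trans (hg.one_le y)
      have h1 : √(V y) ^ (p + 1) ≤ √(D * W y) := by
        refine Real.le_sqrt_of_sq_le ?_
        rw [← pow_mul, mul_comm, pow_mul, Real.sq_sqrt hV0]
        exact hD y
      rw [Real.sqrt_mul hD0] at h1
      refine h1.trans ?_
      gcongr
      linarith
  have hφc := hφ.1.continuous
  have hφ2 : ContDiff ℝ 2 φ := hφ.1.of_le (by exact_mod_cast (by omega : 2 ≤ p))
  obtain ⟨B, α, β', n₀, hseq⟩ :=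
    hW.exists_isLyapunovSequence hc (fun n => (hγ.pos n).le) hγlim
  obtain ⟨C₁, hC₁, hinc⟩ := exists_abs_increment_le hg hw1 (by omega) hφ.1 hL hK hVw (γ 1)
  obtain ⟨C₂, hC₂, hmean⟩ := exists_abs_integral_step_sub_le hg hw1 hu hφ.1 hL hK hVw hm3
    (by omega : m ≤ p + 1) herr (γ 1)
  set M := ∫ ω, (1 + ‖U 1 ω‖) ^ (2 * (p + 1)) ∂P with hM
  have hM0 : 0 ≤ M := integral_nonneg fun ω => by positivity
  have hB0 : 0 ≤ B := (integral_nonneg fun ω => sq_nonneg _).trans (hseq.bound 0)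
  have hWsq : ∀ y, √(W y) ^ 2 = W y := fun y => Real.sq_sqrt (zero_le_one.trans (hW.one_le _))
  have hYm := hc.measurable
  have hΔ : ∀ n, Integrable (fun ω => (φ (Y (n + 1) ω) - φ (Y n ω)) ^ 2) P ∧
      ∫ ω, (φ (Y (n + 1) ω) - φ (Y n ω)) ^ 2 ∂P ≤ C₁ ^ 2 * γ (n + 1) * (B * M) := by
    intro n
    have hm1 : Measurable fun ω => (φ (Y (n + 1) ω) - φ (Y n ω)) ^ 2 :=
      ((hφc.measurable.comp (hYm _)).sub (hφc.measurable.comp (hYm _))).pow_const 2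
    have h1 := hc.integrable_of_le_mul n (X := fun ω => (φ (Y (n + 1) ω) - φ (Y n ω)) ^ 2)
      (A := fun y => C₁ ^ 2 * γ (n + 1) * W y) (B := fun u => (1 + ‖u‖) ^ (2 * (p + 1)))
      hm1.aestronglyMeasurable (hW.continuous.measurable.const_mul _) (by fun_prop)
      ((hW.integrable n).const_mul _) hu.moment fun ω => by
        rw [abs_of_nonneg (sq_nonneg _), hc.succ n ω, ← sq_abs]
        refine (pow_le_pow_left₀ (abs_nonneg _)
          (hinc (γ (n + 1)) (hγ.pos n).le (hγ.le_first n) (Y n ω) (U (n + 1) ω)) 2).trans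
          (le_of_eq ?_)
        rw [mul_pow, mul_pow, mul_pow, Real.sq_sqrt (hγ.pos n).le, hWsq, ← pow_mul, mul_comm _ 2]
        ring
    refine ⟨h1.1, ?_⟩
    have h2 := h1.2
    simp only [abs_sq] at h2
    refine h2.trans ?_
    rw [integral_const_mul, mul_assoc]
    have h3 := hseq.bound n
    simp only [hWsq] at h3
    have := (hγ.pos n).le
    gcongr
  have hβ : (1 : ℝ) / 2 ≤ (m : ℝ) / 2 - 1 := by
    have : (3 : ℝ) ≤ m := by exact_mod_cast hm3
    linarith
  refine hseq.sum_rate (Φ := fun n ω => φ (Y n ω)) (C := K + C₁ ^ 2 * (B * M) + C₂) hγ hβ hs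
    (by positivity) (fun n => ?_) (fun n ω => ?_) (fun n => ?_) (fun n => ?_) fun n => ?_
  · exact (hφc.measurable.comp (measurable_hist Y le_rfl)).stronglyMeasurable
  · have h1 := hK 0 (Nat.zero_le _) (Y n ω)
    rw [pow_zero, mul_one, norm_iteratedFDeriv_zero, Real.norm_eq_abs] at h1
    refine h1.trans ?_
    gcongr
    have : 0 ≤ C₁ ^ 2 * (B * M) := by positivity
    linarith
  · refine (hΔ n).2.trans ?_
    have h1 := (hγ.pos n).le
    have : 0 ≤ (K + C₂) * γ (n + 1) := by positivity
    linarith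
  · have hint : Integrable (fun ω => φ (Y (n + 1) ω) - φ (Y n ω)) P := by
      refine MemLp.integrable (q := 2) one_le_two ?_
      have hm1 : Measurable fun ω => φ (Y (n + 1) ω) - φ (Y n ω) :=
        (hφc.measurable.comp (hYm _)).sub (hφc.measurable.comp (hYm _))
      exact (memLp_two_iff_integrable_sq hm1.aestronglyMeasurable).2 (hΔ n).1
    have h1 := hc.condExp_step n (h := fun y z => φ z - φ y)
      ((hφc.comp continuous_snd).sub (hφc.comp continuous_fst)).measurable hint
    filter_upwards [h1] with ω hω
    have e : ∫ ω', (φ (stepMap b σ (γ (n + 1)) (Y n ω) (U 1 ω')) - φ (Y n ω)) ∂P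
        = ∫ ω', φ (stepMap b σ (γ (n + 1)) (Y n ω) (U 1 ω')) ∂P - φ (Y n ω) := by
      have hi : Integrable
          (fun ω' => φ (stepMap b σ (γ (n + 1)) (Y n ω) (U 1 ω')) - φ (Y n ω)) P := by
        have hmz : Measurable fun ω' => stepMap b σ (γ (n + 1)) (Y n ω) (U 1 ω') :=
          (continuous_stepMap hc.continuous_drift hc.continuous_diffusion _).measurable.comp
            (measurable_const.prodMk hu.measurable)
        refine ((hu.integrable_pow (k := p + 1) (by omega)).const_mul
          (C₁ * √(γ (n + 1)) * √(W (Y n ω)))).mono'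
          ((hφc.measurable.comp hmz).sub measurable_const).aestronglyMeasurable
          (ae_of_all _ fun ω' => ?_)
        rw [Real.norm_eq_abs]
        refine (hinc _ (hγ.pos n).le (hγ.le_first n) _ _).trans (le_of_eq ?_)
        ring
      have hi2 : Integrable (fun ω' => φ (stepMap b σ (γ (n + 1)) (Y n ω) (U 1 ω'))) P := by
        have := hi.add (integrable_const (φ (Y n ω)))
        refine this.congr (ae_of_all _ fun ω' => ?_)
        simp
      rw [integral_sub hi2 (integrable_const _)]
      simp
    have h2 := hmean (γ (n + 1)) (hγ.pos n).le (hγ.le_first n) (Y n ω)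
    have hω' : P[fun ω => φ (Y (n + 1) ω) - φ (Y n ω)|hc.filtration n] ω
        = ∫ ω', φ (stepMap b σ (γ (n + 1)) (Y n ω) (U 1 ω')) ∂P - φ (Y n ω) := hω.trans e
    rw [hω', mul_neg, ← sub_eq_add_neg]
    refine h2.trans ?_
    have e3 : √(γ (n + 1)) ^ m = γ (n + 1) ^ ((m : ℝ) / 2 - 1 + 1) := by
      rw [Real.sqrt_eq_rpow, ← Real.rpow_natCast, ← Real.rpow_mul (hγ.pos n).le]
      congr 1; ring
    rw [e3]
    have := Real.rpow_nonneg (hγ.pos n).le ((m : ℝ) / 2 - 1 + 1)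
    gcongr
    have : 0 ≤ C₁ ^ 2 * (B * M) := by positivity
    linarith
  · exact (((continuous_generator hc.continuous_drift hc.continuous_diffusion
      hφ2).measurable.comp (hYm n)).neg).aestronglyMeasurable

/-- Cesàro's lemma for `γ_n^β → 0`. -/
theorem tendsto_stepSum_div {β : ℝ} (hβ : 0 < β) (hγlim : Tendsto γ atTop (𝓝 0)) :
    Tendsto (fun n => stepSum γ β n / n) atTop (𝓝 0) := by
  have h1 : Tendsto (fun n => γ (n + 1) ^ β) atTop (𝓝 0) := by
    have := ((tendsto_add_atTop_iff_nat 1).2 hγlim).rpow_const (p := β) (Or.inr hβ.le)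
    rwa [Real.zero_rpow hβ.ne'] at this
  refine h1.cesaro.congr fun n => ?_
  rw [stepSum_eq_sum_range, div_eq_inv_mul]

/-- Nonnegative non-increasing steps with a divergent sum are positive: after a zero step all the
following ones would vanish. -/
theorem isStepSequence_of_tendsto (hγ : ∀ n ≥ 1, 0 ≤ γ n)
    (hγsum : Tendsto (fun n => ∑ k ∈ Finset.Icc 1 n, γ k) atTop atTop)
    (hγanti : ∀ n ≥ 1, γ (n + 1) ≤ γ n) : IsStepSequence γ := by
  refine ⟨fun n => lt_of_le_of_ne (hγ _ (by omega)) fun h0 => ?_, fun n => hγanti _ (by omega)⟩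
  have hz : ∀ k ≥ n + 1, γ k = 0 := by
    intro k hk
    induction k, hk using Nat.le_induction with
    | base => exact h0.symm
    | succ k hk ih =>
      exact le_antisymm ((hγanti k (by omega)).trans ih.le) (hγ _ (by omega))
  have hb : ∀ k, ∑ i ∈ Finset.Icc 1 k, γ i ≤ ∑ i ∈ Finset.Icc 1 n, γ i := by
    intro k
    have h1 : ∑ i ∈ Finset.Icc 1 (max k n), γ i = ∑ i ∈ Finset.Icc 1 n, γ i := by
      refine (Finset.sum_subset (Finset.Icc_subset_Icc le_rfl (le_max_right _ _))
        fun i hi hi' => hz i ?_).symm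
      simp only [Finset.mem_Icc] at hi hi'
      omega
    rw [← h1]
    exact Finset.sum_le_sum_of_subset_of_nonneg
      (Finset.Icc_subset_Icc le_rfl (le_max_left _ _)) fun i hi _ =>
        hγ i (Finset.mem_Icc.1 hi).1
  obtain ⟨k, hk⟩ := (hγsum.eventually (eventually_gt_atTop (∑ i ∈ Finset.Icc 1 n, γ i))).exists
  exact absurd (hb k) (not_le.2 hk)

/-- The rate of the empirical means, given the integrability of `W` under `ν`. -/
theorem mem_rateClass [IsProbabilityMeasure P]
    (hW : IsSchemeLyapunov P γ Y V p W) (hc : IsEulerChain P b σ γ U Y)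
    (hγ : IsStepSequence γ) (hγlim : Tendsto γ atTop (𝓝 0))
    (hg : HasSqrtGrowth b σ V c) (hVc : Continuous V)
    (hu : IsNormalized P (U 1) p) {f φ : Vec q → ℝ} (hφ : φ ∈ poissonClass V W p)
    (hL : ∃ L, LipschitzWith L (iteratedFDeriv ℝ p φ))
    {ν : Measure (Vec q)} [IsProbabilityMeasure ν] (hWν : Integrable W ν)
    (hf : ∀ y, generator b σ φ y = -(f y - ∫ z, f z ∂ν))
    {m : ℕ} (hm : m = qStar b σ P (U 1) φ p) (hmp : m ≤ p)
    (hs : StepConditions γ ((m : ℝ) / 2 - 1))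
    {ε : ℕ → ℝ} (hε : ∀ n, ε n = stepSum γ ((m : ℝ) / 2 - 1) n / n) :
    f ∈ rateClass P Y ν ε 2 ∧ Tendsto ε atTop (𝓝 0) := by
  -- The infimum that defines `q*` is attained, and the error terms below it vanish.
  have hmem := Nat.sInf_mem (s := {r | 3 ≤ r ∧ r ≤ p ∧ errorTerm b σ P (U 1) φ r ≠ 0} ∪ {p + 1})
    ⟨p + 1, Or.inr rfl⟩
  rw [← qStar, ← hm] at hmem
  have hm3 : 3 ≤ m := by
    rcases hmem with h | h
    · exact h.1
    · have : m = p + 1 := h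
      omega
  have herr : ∀ r, 3 ≤ r → r < m → errorTerm b σ P (U 1) φ r = 0 := by
    intro r hr hrm
    by_contra h
    rw [hm, qStar] at hrm
    exact Nat.notMem_of_lt_sInf hrm (Or.inl ⟨hr, by rw [← qStar, ← hm] at hrm; omega, h⟩)
  have hm3' : (3 : ℝ) ≤ m := by exact_mod_cast hm3
  obtain ⟨has, R, hR⟩ := hW.sum_generator_rate hc hγ hγlim hg hVc hu hφ hL hm3 hmp herr hs
  have hF : ∀ y, -generator b σ φ y = f y - ∫ z, f z ∂ν := fun y => by rw [hf]; ring
  have hmean : ∀ n : ℕ, 1 ≤ n → ∀ ω, (1 / (n : ℝ)) * ∑ k ∈ Finset.range n, f (Y k ω)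
      - ∫ y, f y ∂ν = (1 / (n : ℝ)) * ∑ k ∈ Finset.range n, -generator b σ φ (Y k ω) := by
    intro n hn ω
    have hn' : (n : ℝ) ≠ 0 := by positivity
    simp only [hF, Finset.sum_sub_distrib, Finset.sum_const, Finset.card_range, nsmul_eq_mul]
    field_simp
  refine ⟨⟨?_, ?_, R, fun n hn => ?_⟩, ?_⟩
  · have hfc : Continuous f := by
      have h1 := continuous_generator hc.continuous_drift hc.continuous_diffusion
        (hφ.1.of_le (by exact_mod_cast (by omega : 2 ≤ p)) : ContDiff ℝ 2 φ)
      have h2 : f = fun y => ∫ z, f z ∂ν - generator b σ φ y := by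
        ext y; rw [hf]; ring
      rw [h2]
      exact continuous_const.sub h1
    obtain ⟨K, hK0, hK⟩ := exists_hasDerivGrowth hVc hg.one_le hW.one_le hφ
    have hA := abs_generator_le hg (by omega : 2 ≤ p) hK
    have hsq : MemLp (fun y => √(W y)) 2 ν := by
      rw [memLp_two_iff_integrable_sq hW.continuous.sqrt.aestronglyMeasurable]
      simpa only [Real.sq_sqrt (zero_le_one.trans (hW.one_le _))] using hWν
    have hAL : MemLp (generator b σ φ) 2 ν := by
      refine (hsq.const_mul ((c + ℓ * c ^ 2) * K)).mono ?_ (ae_of_all _ fun y => ?_)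
      · exact (continuous_generator hc.continuous_drift hc.continuous_diffusion
          (hφ.1.of_le (by exact_mod_cast (by omega : 2 ≤ p)) :
            ContDiff ℝ 2 φ)).aestronglyMeasurable
      · rw [Real.norm_eq_abs]
        exact (hA y).trans (Real.le_norm_self _)
    have h3 := (memLp_const (p := 2) (μ := ν) (∫ z, f z ∂ν)).sub hAL
    refine (memLp_congr_ae (ae_of_all _ fun y => ?_)).1 h3
    simp only [Pi.sub_apply]
    rw [hf]; ring
  · filter_upwards [has] with ω hω
    obtain ⟨R, hR⟩ := hω
    refine IsBigO.of_bound R (eventually_atTop.2 ⟨1, fun n hn => ?_⟩)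
    rw [hmean n hn ω, hε, Real.norm_eq_abs, abs_mul, abs_of_nonneg (by positivity),
      Real.norm_of_nonneg (div_nonneg ((stepSum_zero (γ := γ)).symm.le.trans
        (hγ.monotone_stepSum (Nat.zero_le n))) (Nat.cast_nonneg n))]
    calc 1 / (n : ℝ) * |∑ k ∈ Finset.range n, -generator b σ φ (Y k ω)|
        ≤ 1 / (n : ℝ) * (R * stepSum γ ((m : ℝ) / 2 - 1) n) :=
          mul_le_mul_of_nonneg_left (hR n) (by positivity)
      _ = _ := by ring
  · simp only [hmean n hn]
    have e := eLpNorm_const_smul (1 / (n : ℝ))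
      (fun ω => ∑ k ∈ Finset.range n, -generator b σ φ (Y k ω)) 2 P
    have h1 : eLpNorm (fun ω => 1 / (n : ℝ) * ∑ k ∈ Finset.range n, -generator b σ φ (Y k ω)) 2 P
        = ‖1 / (n : ℝ)‖ₑ * eLpNorm (fun ω => ∑ k ∈ Finset.range n, -generator b σ φ (Y k ω)) 2 P :=
      e
    rw [h1]
    refine (mul_le_mul_right (hR n) _).trans ?_
    rw [Real.enorm_eq_ofReal (by positivity), ← ENNReal.ofReal_mul (by positivity), hε]
    refine ENNReal.ofReal_le_ofReal (le_of_eq ?_)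
    ring
  · rw [funext hε]
    exact tendsto_stepSum_div (by linarith) hγlim

end Rate


/-! ### Fourth moments of the increments of the scheme -/

section FourthMoment

variable {q ℓ : ℕ} {Ω : Type*} {mΩ : MeasurableSpace Ω} {P : Measure Ω}
  {b : Vec q → Vec q} {σ : Vec q → Vec ℓ →L[ℝ] Vec q} {V : Vec q → ℝ} {c : ℝ}
  {γ : ℕ → ℝ} {U : ℕ → Ω → Vec ℓ} {Y : ℕ → Ω → Vec q} {p : ℕ}

/-- The term linear in `ξ` is kept exactly, so that it disappears in the mean when `ξ` is
centred. -/
theorem norm_add_pow_four_le (x ξ : Vec q) : ‖x + ξ‖ ^ 4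
    ≤ ‖x‖ ^ 4 + 4 * ‖x‖ ^ 2 * inner ℝ x ξ + 8 * ‖x‖ ^ 2 * ‖ξ‖ ^ 2 + 3 * ‖ξ‖ ^ 4 := by
  have h1 : ‖x + ξ‖ ^ 2 = ‖x‖ ^ 2 + 2 * inner ℝ x ξ + ‖ξ‖ ^ 2 := norm_add_sq_real x ξ
  have h2 : |inner ℝ x ξ| ≤ ‖x‖ * ‖ξ‖ := abs_real_inner_le_norm x ξ
  have e : ‖x + ξ‖ ^ 4 = (‖x + ξ‖ ^ 2) ^ 2 := by ring
  rw [e, h1]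
  have hx := norm_nonneg x
  have hξ := norm_nonneg ξ
  generalize inner ℝ x ξ = i at *
  generalize ‖x‖ = a at *
  generalize ‖ξ‖ = d at *
  have h3 : i ^ 2 ≤ a ^ 2 * d ^ 2 := by
    rw [← sq_abs, ← mul_pow]; exact pow_le_pow_left₀ (abs_nonneg _) h2 2
  have h4 : i * d ^ 2 ≤ a * d * d ^ 2 :=
    mul_le_mul_of_nonneg_right ((le_abs_self _).trans h2) (sq_nonneg _)
  have h5 : 2 * (a * d * d ^ 2) ≤ a ^ 2 * d ^ 2 + d ^ 4 := by nlinarith [sq_nonneg (a * d - d ^ 2)]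
  nlinarith

/-- The one-step growth of a fourth power, with a parameter `θ` from Young's inequality. -/
theorem exists_integral_step_pow_four_le [IsProbabilityMeasure P] (h : HasSqrtGrowth b σ V c)
    {u : Ω → Vec ℓ} (hp : 1 ≤ p) (hu : IsNormalized P u p) (G : ℝ) :
    ∃ C, 0 ≤ C ∧ ∀ g, 0 ≤ g → g ≤ G → ∀ y z θ, 0 < θ →
      Integrable (fun ω => ‖stepMap b σ g y (u ω) - z‖ ^ 4) P ∧
      ∫ ω, ‖stepMap b σ g y (u ω) - z‖ ^ 4 ∂P
        ≤ (1 + C * g + C * g / θ) * ‖y - z‖ ^ 4 + C * g * (θ + g) * V y ^ 2 := by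
  have hc := h.nonneg
  rcases lt_or_ge G 0 with hG | hG
  · exact ⟨0, le_rfl, fun g h0 h1 => absurd (h0.trans h1) (not_le.2 hG)⟩
  obtain ⟨M, hM⟩ : ∃ M, M = ∫ ω, (1 + ‖u ω‖) ^ 4 ∂P := ⟨_, rfl⟩
  have hM0 : 0 ≤ M := by rw [hM]; exact integral_nonneg fun ω => by positivity
  have i4 : Integrable (fun ω => (1 + ‖u ω‖) ^ 4) P := hu.integrable_pow (by omega)
  obtain ⟨C, hC⟩ : ∃ C, C = 4 * c + 10 * G * c ^ 2 + 5 * G ^ 2 * c ^ 4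
      + 16 * c ^ 2 * M * (1 + G * c ^ 2) + 3 * c ^ 4 * M := ⟨_, rfl⟩
  have hC0 : 0 ≤ C := by rw [hC]; positivity
  refine ⟨C, hC0, fun g hg hgG y z θ hθ => ?_⟩
  have hv0 : 0 ≤ V y := zero_le_one.trans (h.one_le y)
  obtain ⟨x, hx⟩ : ∃ x, x = y - z + g • b y := ⟨_, rfl⟩
  have hstep : ∀ ω, stepMap b σ g y (u ω) - z = x + √g • σ y (u ω) := by
    intro ω; rw [stepMap, hx]; abel
  have hξ : ∀ ω, ‖√g • σ y (u ω)‖ ≤ √g * (c * √(V y)) * ‖u ω‖ := by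
    intro ω
    rw [norm_smul, Real.norm_of_nonneg (Real.sqrt_nonneg _), mul_assoc]
    exact mul_le_mul_of_nonneg_left (((σ y).le_opNorm _).trans
      (mul_le_mul_of_nonneg_right (h.diffusion y) (norm_nonneg _))) (Real.sqrt_nonneg _)
  have hξ2 : ∀ ω, ‖√g • σ y (u ω)‖ ^ 2 ≤ g * c ^ 2 * V y * (1 + ‖u ω‖) ^ 4 := by
    intro ω
    have h1 := pow_le_pow_left₀ (norm_nonneg _) (hξ ω) 2
    rw [mul_pow, mul_pow, mul_pow, Real.sq_sqrt hg, Real.sq_sqrt hv0] at h1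
    refine h1.trans ?_
    rw [← mul_assoc]
    have := norm_nonneg (u ω)
    have h2 : ‖u ω‖ ^ 2 ≤ (1 + ‖u ω‖) ^ 4 :=
      (pow_le_pow_left₀ this (by linarith) 2).trans
        (pow_le_pow_right₀ (by linarith) (by norm_num))
    gcongr
  have hξ4 : ∀ ω, ‖√g • σ y (u ω)‖ ^ 4 ≤ g ^ 2 * c ^ 4 * V y ^ 2 * (1 + ‖u ω‖) ^ 4 := by
    intro ω
    have h1 := pow_le_pow_left₀ (norm_nonneg _) (hξ ω) 4
    have e1 : √g ^ 4 = g ^ 2 := by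
      rw [show (4 : ℕ) = 2 * 2 by norm_num, pow_mul, Real.sq_sqrt hg]
    have e2 : √(V y) ^ 4 = V y ^ 2 := by
      rw [show (4 : ℕ) = 2 * 2 by norm_num, pow_mul, Real.sq_sqrt hv0]
    rw [mul_pow, mul_pow, mul_pow, e1, e2, ← mul_assoc] at h1
    refine h1.trans ?_
    have := norm_nonneg (u ω)
    gcongr
    linarith
  have hpt : ∀ ω, ‖stepMap b σ g y (u ω) - z‖ ^ 4 ≤ ‖x‖ ^ 4
      + 4 * ‖x‖ ^ 2 * √g * inner ℝ x (σ y (u ω))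
      + (8 * ‖x‖ ^ 2 * (g * c ^ 2 * V y) + 3 * (g ^ 2 * c ^ 4 * V y ^ 2)) * (1 + ‖u ω‖) ^ 4 := by
    intro ω
    rw [hstep]
    refine (norm_add_pow_four_le _ _).trans ?_
    rw [inner_smul_right]
    have h2 := mul_le_mul_of_nonneg_left (hξ2 ω) (by positivity : 0 ≤ 8 * ‖x‖ ^ 2)
    have h4 := hξ4 ω
    linarith
  obtain ⟨ilin, hlin0⟩ := hu.integrable_clm ((innerSL ℝ x).comp (σ y))
  simp only [ContinuousLinearMap.comp_apply, innerSL_apply_apply] at ilin hlin0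
  have f1 : Integrable (fun ω => ‖x‖ ^ 4 + 4 * ‖x‖ ^ 2 * √g * inner ℝ x (σ y (u ω))) P :=
    (integrable_const _).add (ilin.const_mul _)
  have f2 := i4.const_mul (8 * ‖x‖ ^ 2 * (g * c ^ 2 * V y) + 3 * (g ^ 2 * c ^ 4 * V y ^ 2))
  have hm := hu.measurable
  refine ⟨(f1.add f2).mono' ?_ (ae_of_all _ fun ω => ?_), ?_⟩
  · have : Measurable fun ω => stepMap b σ g y (u ω) - z := by
      simp only [hstep]
      have : Measurable fun ω => σ y (u ω) := (σ y).continuous.measurable.comp hm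
      fun_prop
    exact (this.norm.pow_const 4).aestronglyMeasurable
  · rw [Real.norm_of_nonneg (by positivity)]
    exact hpt ω
  have h1 := integral_mono_of_nonneg (ae_of_all P fun ω => by positivity) (f1.add f2)
    (ae_of_all P hpt)
  refine h1.trans ?_
  have e1 := integral_add f1 f2
  have e2 := integral_add (integrable_const (μ := P) (‖x‖ ^ 4))
    (ilin.const_mul (4 * ‖x‖ ^ 2 * √g))
  refine e1.le.trans ?_
  rw [e2, integral_const_mul, integral_const_mul, hlin0, ← hM]
  simp only [integral_const, probReal_univ, smul_eq_mul, one_mul, mul_zero, add_zero]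
  -- the deterministic part
  have hxn : ‖x‖ ≤ ‖y - z‖ + g * (c * √(V y)) := by
    rw [hx]
    refine (norm_add_le _ _).trans ?_
    rw [norm_smul, Real.norm_of_nonneg hg]
    gcongr
    exact h.drift y
  have hs : √(V y) ^ 2 = V y := Real.sq_sqrt hv0
  have hsn := Real.sqrt_nonneg (V y)
  have hxn0 := norm_nonneg x
  have hzn := norm_nonneg (y - z)
  clear hpt hξ hξ2 hξ4 hstep hx h1 e1 e2 f1 f2 ilin hlin0 i4 hM
  generalize ‖x‖ = X at *
  generalize ‖y - z‖ = a at *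
  generalize √(V y) = r at *
  rw [← hs]
  have hX2 : X ^ 2 ≤ 2 * a ^ 2 + 2 * (g ^ 2 * c ^ 2 * r ^ 2) := by
    have := pow_le_pow_left₀ hxn0 hxn 2
    nlinarith [sq_nonneg (a - g * (c * r))]
  have hX4 : X ^ 4 ≤ a ^ 4 + g * (4 * c * (a ^ 4 + a ^ 2 * r ^ 2)
      + 10 * G * c ^ 2 * (a ^ 2 * r ^ 2)) + 5 * G ^ 2 * c ^ 4 * (g ^ 2 * r ^ 4) := by
    have h1 := pow_le_pow_left₀ hxn0 hxn 4
    obtain ⟨d, hd⟩ : ∃ d, d = g * (c * r) := ⟨_, rfl⟩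
    have hd0 : 0 ≤ d := by rw [hd]; positivity
    rw [← hd] at h1
    have e1 : (a + d) ^ 4 = a ^ 4 + 4 * a ^ 3 * d + 6 * a ^ 2 * d ^ 2 + 4 * a * d ^ 3 + d ^ 4 := by
      ring
    have e2 : 4 * a * d ^ 3 ≤ 4 * (a ^ 2 * d ^ 2) + 4 * d ^ 4 := by
      have : a * d * (d ^ 2) ≤ a ^ 2 * d ^ 2 + d ^ 4 := by
        nlinarith [sq_nonneg (a * d - d ^ 2), sq_nonneg (a * d), sq_nonneg (d ^ 2)]
      linarith
    have e3 : 4 * a ^ 3 * d ≤ g * (4 * c * (a ^ 4 + a ^ 2 * r ^ 2)) := by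
      have : a ^ 3 * r ≤ a ^ 4 + a ^ 2 * r ^ 2 := by
        nlinarith [sq_nonneg (a ^ 2 - a * r), sq_nonneg (a ^ 2), sq_nonneg (a * r)]
      calc 4 * a ^ 3 * d = g * (4 * c * (a ^ 3 * r)) := by rw [hd]; ring
        _ ≤ _ := by gcongr
    have e4 : 10 * (a ^ 2 * d ^ 2) ≤ g * (10 * G * c ^ 2 * (a ^ 2 * r ^ 2)) := by
      calc 10 * (a ^ 2 * d ^ 2) = g * (10 * g * c ^ 2 * (a ^ 2 * r ^ 2)) := by rw [hd]; ring
        _ ≤ _ := by gcongr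
    have e5 : 5 * d ^ 4 ≤ 5 * G ^ 2 * c ^ 4 * (g ^ 2 * r ^ 4) := by
      calc 5 * d ^ 4 = 5 * g ^ 2 * c ^ 4 * (g ^ 2 * r ^ 4) := by rw [hd]; ring
        _ ≤ _ := by gcongr
    linarith
  have hX2' : 8 * X ^ 2 * (g * c ^ 2 * r ^ 2) * M ≤ 16 * c ^ 2 * M * (g * (a ^ 2 * r ^ 2))
      + 16 * c ^ 2 * M * (G * c ^ 2) * (g ^ 2 * r ^ 4) := by
    have h1 := mul_le_mul_of_nonneg_right hX2 (by positivity : 0 ≤ 8 * (g * c ^ 2 * r ^ 2) * M)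
    have h2 := mul_le_mul_of_nonneg_right hgG
      (by positivity : 0 ≤ 16 * c ^ 2 * M * c ^ 2 * (g ^ 2 * r ^ 4))
    linarith
  have hY : g * (a ^ 2 * r ^ 2) ≤ g / θ * a ^ 4 + g * θ * r ^ 4 := by
    have : a ^ 2 * r ^ 2 ≤ a ^ 4 / θ + θ * r ^ 4 := by
      rw [div_add' _ _ _ hθ.ne', le_div_iff₀ hθ]
      nlinarith [sq_nonneg (a ^ 2 - θ * r ^ 2), sq_nonneg (a ^ 2), sq_nonneg (θ * r ^ 2)]
    calc g * (a ^ 2 * r ^ 2) ≤ g * (a ^ 4 / θ + θ * r ^ 4) := by gcongr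
      _ = _ := by ring
  have hY' := mul_le_mul_of_nonneg_left hY
    (by positivity : 0 ≤ 4 * c + 10 * G * c ^ 2 + 16 * c ^ 2 * M)
  have k1 : (4 * c + 10 * G * c ^ 2 + 16 * c ^ 2 * M) * (g / θ * a ^ 4 + g * θ * r ^ 4)
      ≤ C * (g / θ * a ^ 4 + g * θ * r ^ 4) := by
    gcongr
    rw [hC]
    have : 0 ≤ 5 * G ^ 2 * c ^ 4 + 16 * c ^ 2 * M * (G * c ^ 2) + 3 * c ^ 4 * M := by positivity
    linarith
  have k2 : 4 * c * (g * a ^ 4) ≤ C * (g * a ^ 4) := by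
    gcongr
    rw [hC]
    have : 0 ≤ 10 * G * c ^ 2 + 5 * G ^ 2 * c ^ 4 + 16 * c ^ 2 * M * (1 + G * c ^ 2)
      + 3 * c ^ 4 * M := by positivity
    linarith
  have k3 : (5 * G ^ 2 * c ^ 4 + 16 * c ^ 2 * M * (G * c ^ 2) + 3 * c ^ 4 * M) * (g ^ 2 * r ^ 4)
      ≤ C * (g ^ 2 * r ^ 4) := by
    gcongr
    rw [hC]
    have : 0 ≤ 4 * c + 10 * G * c ^ 2 + 16 * c ^ 2 * M := by positivity
    linarith
  have e1 : C * g / θ = C * (g / θ) := by ring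
  rw [e1]
  linarith

/-- The elapsed time `Γ_n = γ_1 + ⋯ + γ_n`. -/
def elapsed (γ : ℕ → ℝ) (n : ℕ) : ℝ := ∑ k ∈ Finset.range n, γ (k + 1)

theorem elapsed_zero : elapsed γ 0 = 0 := by simp [elapsed]

theorem elapsed_succ (n : ℕ) : elapsed γ (n + 1) = elapsed γ n + γ (n + 1) :=
  Finset.sum_range_succ _ _

/-- The fourth moment of an increment of the scheme is of the order of the square of the elapsed
time. -/
theorem IsEulerChain.exists_integral_pow_four_le [IsProbabilityMeasure P]
    (hc : IsEulerChain P b σ γ U Y) (hγ : IsStepSequence γ) (h : HasSqrtGrowth b σ V c)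
    (hp : 1 ≤ p) (hu : IsNormalized P (U 1) p) {B : ℝ}
    (hVi : ∀ n, Integrable (fun ω => V (Y n ω) ^ 2) P) (hVB : ∀ n, ∫ ω, V (Y n ω) ^ 2 ∂P ≤ B) :
    ∃ C, 0 ≤ C ∧ ∀ m k, Integrable (fun ω => ‖Y (m + k) ω - Y m ω‖ ^ 4) P ∧
      ∫ ω, ‖Y (m + k) ω - Y m ω‖ ^ 4 ∂P ≤ C * (elapsed γ (m + k) - elapsed γ m) ^ 2
        * Real.exp (C * (elapsed γ (m + k) - elapsed γ m)) := by
  obtain ⟨C, hC0, hC⟩ := exists_integral_step_pow_four_le h hp hu (γ 1)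
  have hB0 : 0 ≤ B := (integral_nonneg fun ω => sq_nonneg _).trans (hVB 0)
  obtain ⟨L, hL⟩ : ∃ L, L = 4 * (C + 1) ^ 2 * B + 2 * (C + 1) * B := ⟨_, rfl⟩
  have hL0 : 0 ≤ L := by rw [hL]; positivity
  -- `L` is chosen so that the bound `L T² exp (C T)` propagates
  suffices key : ∀ m k, 0 ≤ elapsed γ (m + k) - elapsed γ m ∧
      Integrable (fun ω => ‖Y (m + k) ω - Y m ω‖ ^ 4) P ∧
      ∫ ω, ‖Y (m + k) ω - Y m ω‖ ^ 4 ∂P ≤ L * (elapsed γ (m + k) - elapsed γ m) ^ 2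
        * Real.exp (C * (elapsed γ (m + k) - elapsed γ m)) by
    refine ⟨C + L, by positivity, fun m k => ⟨(key m k).2.1, (key m k).2.2.trans ?_⟩⟩
    have hT := (key m k).1
    gcongr <;> linarith
  intro m k
  induction k with
  | zero => simp
  | succ k ih =>
    obtain ⟨hT, hi, hb⟩ := ih
    have hg := hγ.pos (m + k)
    have hstep := hC (γ (m + k + 1)) hg.le (hγ.le_first _)
    obtain ⟨T, hTd⟩ : ∃ T, T = elapsed γ (m + k) - elapsed γ m := ⟨_, rfl⟩
    have eT : elapsed γ (m + (k + 1)) - elapsed γ m = T + γ (m + k + 1) := by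
      rw [← add_assoc, elapsed_succ, hTd]; ring
    rw [eT]
    rw [← hTd] at hT hb
    -- Young's parameter `θ`, proportional to the elapsed time, balances the two error terms.
    obtain ⟨θ, hθd⟩ : ∃ θ, θ = 2 * (C + 1) * (T + γ (m + k + 1)) := ⟨_, rfl⟩
    have hθ : 0 < θ := by rw [hθd]; positivity
    have hSm := (continuous_stepMap hc.continuous_drift hc.continuous_diffusion
      (γ (m + k + 1))).measurable
    have hA := ((hi.const_mul (1 + C * γ (m + k + 1) + C * γ (m + k + 1) / θ)).add
      ((hVi (m + k)).const_mul (C * γ (m + k + 1) * (θ + γ (m + k + 1)))))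
    have hid : ∀ e : Vec q × Vec q, IdentDistrib
        (fun ω => ‖stepMap b σ (γ (m + k + 1)) e.1 (U (m + k + 1) ω) - e.2‖ ^ 4)
        (fun ω => ‖stepMap b σ (γ (m + k + 1)) e.1 (U 1 ω) - e.2‖ ^ 4) P P := fun e =>
      (hc.ident (m + k)).comp (u := fun v => ‖stepMap b σ (γ (m + k + 1)) e.1 v - e.2‖ ^ 4)
        (((hSm.comp (measurable_prodMk_left (x := e.1))).sub_const e.2).norm.pow_const 4)
    have hgen := integrable_of_integral_le_of_indep (P := P) (hc.hist_le (m + k))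
      (Z := fun ω => (Y (m + k) ω, Y m ω))
      ((measurable_hist Y le_rfl).prodMk (measurable_hist Y (Nat.le_add_right m k)))
      (hc.measurable_innov (m + k)) (hc.indep (m + k))
      (h := fun e v => ‖stepMap b σ (γ (m + k + 1)) e.1 v - e.2‖ ^ 4)
      (((hSm.comp ((measurable_fst.comp measurable_fst).prodMk measurable_snd)).sub
        (measurable_snd.comp measurable_fst)).norm.pow_const 4)
      (fun _ _ => by positivity)
      (A := fun e => (1 + C * γ (m + k + 1) + C * γ (m + k + 1) / θ) * ‖e.1 - e.2‖ ^ 4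
        + C * γ (m + k + 1) * (θ + γ (m + k + 1)) * V e.1 ^ 2)
      (fun e => (hid e).integrable_iff.2 (hstep e.1 e.2 θ hθ).1)
      (fun e => (hid e).integral_eq.le.trans (hstep e.1 e.2 θ hθ).2) hA
    have e1 : ∀ ω, ‖Y (m + (k + 1)) ω - Y m ω‖ ^ 4
        = ‖stepMap b σ (γ (m + k + 1)) (Y (m + k) ω) (U (m + k + 1) ω) - Y m ω‖ ^ 4 := by
      intro ω; rw [← add_assoc, hc.succ]
    simp only [e1]
    refine ⟨by linarith, hgen.1, hgen.2.trans ?_⟩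
    have e2 := integral_add (hi.const_mul (1 + C * γ (m + k + 1) + C * γ (m + k + 1) / θ))
      ((hVi (m + k)).const_mul (C * γ (m + k + 1) * (θ + γ (m + k + 1))))
    refine e2.le.trans ?_
    rw [integral_const_mul, integral_const_mul]
    have hVB' := hVB (m + k)
    have ha0 : 0 ≤ ∫ ω, ‖Y (m + k) ω - Y m ω‖ ^ 4 ∂P := integral_nonneg fun ω => by positivity
    have hv0 : 0 ≤ ∫ ω, V (Y (m + k) ω) ^ 2 ∂P := integral_nonneg fun ω => sq_nonneg _
    clear hgen e1 e2 hA hid hstep hi eT hTd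
    generalize (∫ ω, ‖Y (m + k) ω - Y m ω‖ ^ 4 ∂P) = a at *
    generalize (∫ ω, V (Y (m + k) ω) ^ 2 ∂P) = w at *
    generalize γ (m + k + 1) = g at *
    have hE1 : 1 ≤ Real.exp (C * T) := Real.one_le_exp (by positivity)
    have hEg : 1 + C * g ≤ Real.exp (C * g) := by linarith [Real.add_one_le_exp (C * g)]
    have hEs : Real.exp (C * (T + g)) = Real.exp (C * T) * Real.exp (C * g) := by
      rw [← Real.exp_add]; congr 1; ring
    have hEg1 : 1 ≤ Real.exp (C * g) := Real.one_le_exp (by positivity)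
    rw [hEs]
    generalize Real.exp (C * T) = E at *
    generalize Real.exp (C * g) = F at *
    have hE0 : 0 ≤ E := by linarith
    have t1 : (1 + C * g) * a ≤ F * (L * T ^ 2 * E) := mul_le_mul hEg hb ha0 (by linarith)
    have t2 : C * g / θ * a ≤ g * (T + g) * (L / 2) * E := by
      have : C * g / θ * a ≤ C * g / θ * (L * T ^ 2 * E) := by gcongr
      refine this.trans ?_
      rw [div_mul_eq_mul_div, div_le_iff₀ hθ, hθd]
      have u1 : T ^ 2 ≤ (T + g) ^ 2 := by gcongr; linarith
      calc C * g * (L * T ^ 2 * E) ≤ (C + 1) * g * (L * (T + g) ^ 2 * E) := by gcongr; linarith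
        _ = _ := by ring
    have t3 : C * g * (θ + g) * w ≤ g * (T + g) * (L / 2) := by
      calc C * g * (θ + g) * w ≤ (C + 1) * g * (θ + (T + g)) * B := by
            gcongr <;> linarith
        _ = g * (T + g) * (L / 2) := by rw [hθd, hL]; ring
    have t4 : g * (T + g) * (L / 2) * E ≤ g * (T + g) * (L / 2) * (E * F) := by
      gcongr
      exact le_mul_of_one_le_right hE0 hEg1
    have t5 : g * (T + g) * (L / 2) ≤ g * (T + g) * (L / 2) * (E * F) :=
      le_mul_of_one_le_right (by positivity) (one_le_mul_of_one_le_of_one_le hE1 hEg1)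
    have t6 : g * (T + g) ≤ (T + g) ^ 2 - T ^ 2 := by nlinarith
    have t7 := mul_le_mul_of_nonneg_right t6 (by positivity : 0 ≤ L * (E * F))
    linarith

end FourthMoment


/-! ### The scheme in continuous time -/

section Clock

variable {γ : ℕ → ℝ}

theorem IsStepSequence.strictMono_elapsed (hγ : IsStepSequence γ) : StrictMono (elapsed γ) :=
  strictMono_nat_of_lt_succ fun n => by rw [elapsed_succ]; linarith [hγ.pos n]

theorem IsStepSequence.antitone_succ (hγ : IsStepSequence γ) : Antitone fun n => γ (n + 1) :=
  antitone_nat_of_succ_le hγ.anti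

/-- The index of the last step before time `t`: the least `n` with `t < Γ_{n+1}`. -/
def clock (γ : ℕ → ℝ) (t : ℝ) : ℕ := sInf {n | t < elapsed γ (n + 1)}

theorem lt_elapsed_clock (hsum : Tendsto (elapsed γ) atTop atTop) (t : ℝ) :
    t < elapsed γ (clock γ t + 1) := by
  have h1 := ((tendsto_add_atTop_iff_nat 1).2 hsum).eventually (eventually_gt_atTop t)
  exact Nat.sInf_mem (s := {n | t < elapsed γ (n + 1)}) h1.exists

theorem elapsed_clock_le {t : ℝ} (ht : 0 ≤ t) : elapsed γ (clock γ t) ≤ t := by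
  rcases Nat.eq_zero_or_pos (clock γ t) with h | h
  · rw [h, elapsed_zero]; exact ht
  · have h1 : clock γ t - 1 ∉ {n | t < elapsed γ (n + 1)} :=
      Nat.notMem_of_lt_sInf (Nat.sub_one_lt_of_lt h)
    rw [Set.mem_ofPred_eq, not_lt, Nat.sub_add_cancel h] at h1
    exact h1

theorem clock_mono (hsum : Tendsto (elapsed γ) atTop atTop) : Monotone (clock γ) := by
  intro s t hst
  exact Nat.sInf_le (hst.trans_lt (lt_elapsed_clock hsum t))

theorem le_clock (hγ : IsStepSequence γ) (hsum : Tendsto (elapsed γ) atTop atTop) {n : ℕ} {t : ℝ}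
    (h : elapsed γ n ≤ t) : n ≤ clock γ t := by
  have := hγ.strictMono_elapsed.lt_iff_lt.1 (h.trans_lt (lt_elapsed_clock hsum t))
  omega

/-- The time elapsed on the clock between `s` and `t` is `t - s` up to one step. -/
theorem abs_elapsed_clock_sub_le (hγ : IsStepSequence γ) (hsum : Tendsto (elapsed γ) atTop atTop)
    {s t : ℝ} (hs : 0 ≤ s) (hst : s ≤ t) :
    |elapsed γ (clock γ t) - elapsed γ (clock γ s) - (t - s)| ≤ γ (clock γ s + 1) := by
  have h1 := elapsed_clock_le (γ := γ) hs
  have h2 := elapsed_clock_le (γ := γ) (hs.trans hst)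
  have h3 := lt_elapsed_clock hsum s
  have h4 := lt_elapsed_clock hsum t
  have h5 := hγ.antitone_succ (clock_mono hsum hst)
  simp only at h5
  rw [elapsed_succ] at h3 h4
  rw [abs_le]
  constructor <;> linarith

end Clock

section Interpolation

variable {q ℓ : ℕ} {Ω : Type*} {mΩ : MeasurableSpace Ω} {P : Measure Ω}
  {b : Vec q → Vec q} {σ : Vec q → Vec ℓ →L[ℝ] Vec q} {V : Vec q → ℝ} {c : ℝ}
  {γ : ℕ → ℝ} {U : ℕ → Ω → Vec ℓ} {Y : ℕ → Ω → Vec q} {p : ℕ} {B : ℝ}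

theorem exists_step_le (hγ : IsStepSequence γ) (hsum : Tendsto (elapsed γ) atTop atTop)
    (hγlim : Tendsto γ atTop (𝓝 0)) {δ : ℝ} (hδ : 0 < δ) :
    ∃ N, 0 ≤ N ∧ ∀ s, N ≤ s → γ (clock γ s + 1) ≤ δ := by
  obtain ⟨n, hn⟩ := eventually_atTop.1 (hγlim.eventually (gt_mem_nhds hδ))
  refine ⟨elapsed γ n, ?_, fun s hs => (hn _ ?_).le⟩
  · rw [← elapsed_zero (γ := γ)]; exact hγ.strictMono_elapsed.monotone (Nat.zero_le n)
  · have := le_clock hγ hsum hs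
    omega

/-- Fourth moments of the increments of the scheme in continuous time. -/
theorem IsEulerChain.exists_integral_clock_pow_four_le [IsProbabilityMeasure P]
    (hc : IsEulerChain P b σ γ U Y) (hγ : IsStepSequence γ)
    (hsum : Tendsto (elapsed γ) atTop atTop) (hγlim : Tendsto γ atTop (𝓝 0))
    (h : HasSqrtGrowth b σ V c) (hp : 1 ≤ p) (hu : IsNormalized P (U 1) p)
    (hVi : ∀ n, Integrable (fun ω => V (Y n ω) ^ 2) P) (hVB : ∀ n, ∫ ω, V (Y n ω) ^ 2 ∂P ≤ B) :
    ∃ C, 0 ≤ C ∧ ∀ η > 0, ∃ N, 0 ≤ N ∧ ∀ s t, N ≤ s → s ≤ t → t ≤ s + 1 →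
      Integrable (fun ω => ‖Y (clock γ t) ω - Y (clock γ s) ω‖ ^ 4) P ∧
      ∫ ω, ‖Y (clock γ t) ω - Y (clock γ s) ω‖ ^ 4 ∂P ≤ C * (t - s) ^ 2 + η := by
  obtain ⟨C, hC0, hC⟩ := hc.exists_integral_pow_four_le hγ h hp hu hVi hVB
  refine ⟨C * Real.exp (C * 2), by positivity, fun η hη => ?_⟩
  set D := C * Real.exp (C * 2) with hD
  have hD0 : 0 ≤ D := by positivity
  obtain ⟨N, hN0, hN⟩ := exists_step_le hγ hsum hγlim
    (by positivity : 0 < min 1 (η / (3 * D + 1)))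
  refine ⟨N, hN0, fun s t hs hst hts => ?_⟩
  obtain ⟨k, hk⟩ := Nat.exists_eq_add_of_le (clock_mono hsum hst)
  have h1 := hC (clock γ s) k
  rw [← hk] at h1
  refine ⟨h1.1, h1.2.trans ?_⟩
  have h2 := abs_le.1 (abs_elapsed_clock_sub_le hγ hsum (hN0.trans hs) hst)
  have h3 := hN s hs
  have hδ0 := hγ.pos (clock γ s)
  have hT0 : 0 ≤ elapsed γ (clock γ t) - elapsed γ (clock γ s) :=
    sub_nonneg.2 (hγ.strictMono_elapsed.monotone (clock_mono hsum hst))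
  generalize elapsed γ (clock γ t) - elapsed γ (clock γ s) = T at *
  generalize γ (clock γ s + 1) = δ at *
  have hδ1 : δ ≤ 1 := h3.trans (min_le_left _ _)
  have hδη : δ * (3 * D + 1) ≤ η := by
    have := h3.trans (min_le_right _ _)
    rwa [le_div_iff₀ (by positivity)] at this
  have e1 : Real.exp (C * T) ≤ Real.exp (C * 2) := by
    rw [Real.exp_le_exp]; gcongr; linarith
  have e2 : T ^ 2 ≤ (t - s) ^ 2 + 3 * δ := by
    have : T ^ 2 ≤ (t - s + δ) ^ 2 := by gcongr; linarith
    nlinarith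
  calc C * T ^ 2 * Real.exp (C * T) ≤ C * T ^ 2 * Real.exp (C * 2) := by gcongr
    _ = D * T ^ 2 := by rw [hD]; ring
    _ ≤ D * ((t - s) ^ 2 + 3 * δ) := by gcongr
    _ ≤ _ := by nlinarith

/-- Second-order growth data of a smooth compactly supported function. -/
theorem exists_hasDerivGrowth_of_hasCompactSupport (hVc : Continuous V) (hV1 : ∀ y, 1 ≤ V y)
    {g : Vec q → ℝ} (hg : ContDiff ℝ ((⊤ : ℕ∞) : WithTop ℕ∞) g) (hgs : HasCompactSupport g) :
    ∃ K, (∀ y, √(V y) ^ (2 + 1) ≤ K * V y ^ 2) ∧ HasDerivGrowth V (fun y => V y ^ 2) g 2 K := by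
  have hb : ∀ j, ∃ M, 0 ≤ M ∧ ∀ y, ‖iteratedFDeriv ℝ j g y‖ * √(V y) ^ j ≤ M := by
    intro j
    have hcont : Continuous fun y => ‖iteratedFDeriv ℝ j g y‖ * √(V y) ^ j :=
      ((hg.continuous_iteratedFDeriv (m := j) (by exact_mod_cast le_top)).norm).mul
        (hVc.sqrt.pow j)
    have hcs : HasCompactSupport fun y => ‖iteratedFDeriv ℝ j g y‖ * √(V y) ^ j :=
      ((hgs.iteratedFDeriv j).norm).mul_right
    obtain ⟨M, hM⟩ := hcont.bounded_above_of_compact_support hcs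
    exact ⟨|M|, abs_nonneg _, fun y => (Real.le_norm_self _).trans ((hM y).trans (le_abs_self _))⟩
  choose M hM0 hM using hb
  have hV2 : ∀ y, 1 ≤ V y ^ 2 := fun y => one_le_pow₀ (hV1 y)
  have hs := hM0 0
  have hs1 := hM0 1
  have hs2 := hM0 2
  refine ⟨1 + M 0 + M 1 + M 2, fun y => ?_, fun j hj y => (hM j y).trans ?_⟩
  · have hv := hV1 y
    have h1 : √(V y) ^ (2 + 1) ≤ V y ^ 2 := by
      have e : √(V y) ^ 2 = V y := Real.sq_sqrt (by linarith)
      have h2 : √(V y) ≤ V y := by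
        rw [Real.sqrt_le_left (by linarith)]; nlinarith
      rw [pow_succ, e, sq]
      exact mul_le_mul_of_nonneg_left h2 (by linarith)
    refine h1.trans (le_mul_of_one_le_left (by positivity) (by linarith))
  · refine le_trans ?_ (le_mul_of_one_le_right (by positivity) (hV2 y))
    interval_cases j <;> linarith

/-- A continuous compactly supported function has increments `≤ ε + C |x - y|⁴`. -/
theorem exists_abs_sub_le_add_pow_four {F : Vec q → ℝ} (hF : Continuous F)
    (hFs : HasCompactSupport F) {ε : ℝ} (hε : 0 < ε) :
    ∃ C, 0 ≤ C ∧ ∀ x y, |F x - F y| ≤ ε + C * ‖x - y‖ ^ 4 := by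
  obtain ⟨M, hM⟩ := hF.bounded_above_of_compact_support hFs
  have hM0 : 0 ≤ M := (norm_nonneg _).trans (hM 0)
  obtain ⟨δ, hδ, hd⟩ := Metric.uniformContinuous_iff.1
    (hFs.uniformContinuous_of_continuous hF) ε hε
  refine ⟨2 * M / δ ^ 4, by positivity, fun x y => ?_⟩
  rcases lt_or_ge (dist x y) δ with h | h
  · have := hd h
    rw [Real.dist_eq] at this
    have h2 : 0 ≤ 2 * M / δ ^ 4 * ‖x - y‖ ^ 4 := by positivity
    linarith
  · rw [dist_eq_norm] at h
    have h1 : |F x - F y| ≤ 2 * M := by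
      have := norm_sub_le (F x) (F y)
      rw [Real.norm_eq_abs] at this
      linarith [hM x, hM y]
    have h2 : 2 * M ≤ 2 * M / δ ^ 4 * ‖x - y‖ ^ 4 := by
      rw [div_mul_eq_mul_div, le_div_iff₀ (by positivity)]
      gcongr
    linarith

/-- The generator is a local operator. -/
theorem hasCompactSupport_generator {g : Vec q → ℝ} (hgs : HasCompactSupport g) :
    HasCompactSupport (generator b σ g) := by
  refine hgs.mono' fun y hy => ?_
  by_contra h
  apply hy
  have h1 : fderiv ℝ g y = 0 := by
    by_contra h'
    exact h (support_fderiv_subset ℝ h')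
  have h2 : iteratedFDeriv ℝ 2 g y = 0 := by
    by_contra h'
    exact h (support_iteratedFDeriv_subset 2 h')
  simp [generator, h1, h2]

/-- Testing against a bounded variable of the past only sees the conditional mean. -/
theorem abs_integral_mul_le_of_abs_condExp_le [IsProbabilityMeasure P] {m : MeasurableSpace Ω}
    (hm : m ≤ mΩ) {Φ H R : Ω → ℝ} (hΦ : Integrable Φ P) (hH : StronglyMeasurable[m] H)
    (hH1 : ∀ ω, |H ω| ≤ 1) (hR : Integrable R P) (hle : ∀ᵐ ω ∂P, |P[Φ|m] ω| ≤ R ω) :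
    |∫ ω, Φ ω * H ω ∂P| ≤ ∫ ω, R ω ∂P := by
  have hΦH : Integrable (Φ * H) P :=
    hΦ.mul_bdd (c := 1) (hH.mono hm).aestronglyMeasurable (ae_of_all _ hH1)
  have h1 := condExp_mul_of_stronglyMeasurable_right hH hΦH hΦ
  have h2 : ∫ ω, Φ ω * H ω ∂P = ∫ ω, P[Φ|m] ω * H ω ∂P :=
    (integral_condExp hm (f := Φ * H)).symm.trans (integral_congr_ae h1)
  rw [h2, ← Real.norm_eq_abs]
  refine norm_integral_le_of_norm_le hR ?_
  filter_upwards [hle] with ω hω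
  rw [norm_mul, Real.norm_eq_abs, Real.norm_eq_abs]
  calc |P[Φ|m] ω| * |H ω| ≤ |P[Φ|m] ω| * 1 :=
        mul_le_mul_of_nonneg_left (hH1 ω) (abs_nonneg _)
    _ ≤ R ω := by rw [mul_one]; exact hω

/-- The scheme solves the martingale problem up to small errors: the mean increment of `g(Y)`
between two indices, tested against the past, is the elapsed time multiplied by `𝒜g`. -/
theorem IsEulerChain.exists_abs_integral_sub_le [IsProbabilityMeasure P]
    (hc : IsEulerChain P b σ γ U Y) (hγ : IsStepSequence γ)
    (h : HasSqrtGrowth b σ V c) (hVc : Continuous V) (hp : 2 ≤ p) (hu : IsNormalized P (U 1) p)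
    (hVi : ∀ n, Integrable (fun ω => V (Y n ω) ^ 2) P) (hVB : ∀ n, ∫ ω, V (Y n ω) ^ 2 ∂P ≤ B)
    {g : Vec q → ℝ} (hg : ContDiff ℝ ((⊤ : ℕ∞) : WithTop ℕ∞) g) (hgs : HasCompactSupport g)
    {ε : ℝ} (hε : 0 < ε) :
    ∃ C, 0 ≤ C ∧ ∀ m k, ∀ H : Ω → ℝ, Measurable[hist Y m] H → (∀ ω, |H ω| ≤ 1) →
      |∫ ω, (g (Y (m + k) ω) - g (Y m ω) - (elapsed γ (m + k) - elapsed γ m)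
        * generator b σ g (Y m ω)) * H ω ∂P|
      ≤ (elapsed γ (m + k) - elapsed γ m) * (ε + C * √(γ (m + 1))
        + C * (elapsed γ (m + k) - elapsed γ m) ^ 2
          * Real.exp (C * (elapsed γ (m + k) - elapsed γ m))) := by
  have hg2 : ContDiff ℝ 2 g := hg.of_le (WithTop.coe_le_coe.2 (le_top : (2 : ℕ∞) ≤ ⊤))
  have hgc := hg.continuous
  obtain ⟨K, hK1, hK⟩ := exists_hasDerivGrowth_of_hasCompactSupport hVc h.one_le hg hgs
  have hw1 : ∀ y, 1 ≤ V y ^ 2 := fun y => one_le_pow₀ (h.one_le y)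
  obtain ⟨L, hL⟩ := ContDiff.lipschitzWith_of_hasCompactSupport (𝕂 := ℝ) (n := 1)
    (hgs.iteratedFDeriv (𝕜 := ℝ) 2) (hg.iteratedFDeriv_right
      (WithTop.coe_le_coe.2 (le_top : (1 + 2 : ℕ∞) ≤ ⊤))) one_ne_zero
  obtain ⟨C₂, hC₂, hmean⟩ := exists_abs_integral_step_sub_le (m := 3) h hw1 (hu.mono hp)
    (by exact_mod_cast hg2) hL hK hK1 le_rfl le_rfl (fun r h1 h2 => absurd h1 (not_le.2 h2)) (γ 1)
  have hAc := continuous_generator hc.continuous_drift hc.continuous_diffusion hg2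
  have hAs := hasCompactSupport_generator (b := b) (σ := σ) hgs
  obtain ⟨Cε, hCε, hmod⟩ := exists_abs_sub_le_add_pow_four hAc hAs hε
  obtain ⟨C₄, hC₄, hfour⟩ := hc.exists_integral_pow_four_le hγ h (by omega) hu hVi hVB
  obtain ⟨M, hM⟩ := hgc.bounded_above_of_compact_support hgs
  obtain ⟨M', hM'⟩ := hAc.bounded_above_of_compact_support hAs
  have hB0 : 0 ≤ B := (integral_nonneg fun ω => sq_nonneg _).trans (hVB 0)
  have hgi : ∀ n, Integrable (fun ω => g (Y n ω)) P := fun n =>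
    (integrable_const M).mono' (hgc.measurable.comp (hc.measurable n)).aestronglyMeasurable
      (ae_of_all _ fun ω => hM _)
  have hAi : ∀ n, Integrable (fun ω => generator b σ g (Y n ω)) P := fun n =>
    (integrable_const M').mono' (hAc.measurable.comp (hc.measurable n)).aestronglyMeasurable
      (ae_of_all _ fun ω => hM' _)
  refine ⟨C₂ * B + Cε * C₄ + C₄, by positivity, fun m k H hH hH1 => ?_⟩
  have hHm : ∀ n, m ≤ n → StronglyMeasurable[hist Y n] H := fun n hn =>
    (hH.mono (hist_mono Y hn) le_rfl).stronglyMeasurable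
  have hHb : ∀ X : Ω → ℝ, Integrable X P → Integrable (fun ω => X ω * H ω) P := fun X hX =>
    hX.mul_bdd (c := 1) ((hHm m le_rfl).mono (hc.hist_le m)).aestronglyMeasurable
      (ae_of_all _ hH1)
  -- One step: the weak error is of order `γ^{3/2}`.
  have hone : ∀ n, m ≤ n → |∫ ω, (g (Y (n + 1) ω) - g (Y n ω)
      - γ (n + 1) * generator b σ g (Y n ω)) * H ω ∂P| ≤ γ (n + 1) * (C₂ * B * √(γ (m + 1))) := by
    intro n hn
    have hint : Integrable (fun ω => g (Y (n + 1) ω) - g (Y n ω)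
      - γ (n + 1) * generator b σ g (Y n ω)) P := ((hgi _).sub (hgi n)).sub ((hAi n).const_mul _)
    have hce := hc.condExp_step n
      (h := fun y z => g z - g y - γ (n + 1) * generator b σ g y)
      (((hgc.comp continuous_snd).sub (hgc.comp continuous_fst)).sub
        (continuous_const.mul (hAc.comp continuous_fst))).measurable hint
    have h1 := abs_integral_mul_le_of_abs_condExp_le (hc.hist_le n) hint (hHm n hn) hH1
      (R := fun ω => C₂ * √(γ (n + 1)) ^ 3 * V (Y n ω) ^ 2) ((hVi n).const_mul _) (by
        filter_upwards [hce] with ω hω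
        rw [hω]
        have hz : Measurable fun ω' => stepMap b σ (γ (n + 1)) (Y n ω) (U 1 ω') :=
          (continuous_stepMap hc.continuous_drift hc.continuous_diffusion _).measurable.comp
            (measurable_const.prodMk hu.measurable)
        have hi2 : Integrable (fun ω' => g (stepMap b σ (γ (n + 1)) (Y n ω) (U 1 ω'))) P :=
          (integrable_const M).mono' (hgc.measurable.comp hz).aestronglyMeasurable
            (ae_of_all _ fun ω => hM _)
        have e : ∫ ω', (g (stepMap b σ (γ (n + 1)) (Y n ω) (U 1 ω')) - g (Y n ω)
            - γ (n + 1) * generator b σ g (Y n ω)) ∂P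
            = ∫ ω', g (stepMap b σ (γ (n + 1)) (Y n ω) (U 1 ω')) ∂P - g (Y n ω)
            - γ (n + 1) * generator b σ g (Y n ω) := by
          simp only [sub_sub]
          rw [integral_sub hi2 (integrable_const _)]
          simp
        rw [e]
        exact hmean (γ (n + 1)) (hγ.pos n).le (hγ.le_first n) (Y n ω))
    refine h1.trans ?_
    rw [integral_const_mul]
    have hg0 := (hγ.pos n).le
    have hgm : √(γ (n + 1)) ≤ √(γ (m + 1)) := Real.sqrt_le_sqrt (hγ.antitone_succ hn)
    have hVn := hVB n
    calc C₂ * √(γ (n + 1)) ^ 3 * ∫ ω, V (Y n ω) ^ 2 ∂P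
        ≤ C₂ * √(γ (n + 1)) ^ 3 * B := by gcongr
      _ = C₂ * B * (√(γ (n + 1)) ^ 2 * √(γ (n + 1))) := by ring
      _ = C₂ * B * (γ (n + 1) * √(γ (n + 1))) := by rw [Real.sq_sqrt hg0]
      _ ≤ C₂ * B * (γ (n + 1) * √(γ (m + 1))) := by gcongr
      _ = _ := by ring
  -- The variation of `𝒜g` along the scheme: a modulus of continuity and the fourth moments of the
  -- increments.
  have htwo : ∀ k, |∫ ω, (generator b σ g (Y (m + k) ω) - generator b σ g (Y m ω)) * H ω ∂P|
      ≤ ε + Cε * (C₄ * (elapsed γ (m + k) - elapsed γ m) ^ 2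
        * Real.exp (C₄ * (elapsed γ (m + k) - elapsed γ m))) := by
    intro k
    obtain ⟨h1, h2⟩ := hfour m k
    have hR : Integrable (fun ω => ε + Cε * ‖Y (m + k) ω - Y m ω‖ ^ 4) P :=
      (integrable_const _).add (h1.const_mul _)
    rw [← Real.norm_eq_abs]
    refine (norm_integral_le_of_norm_le hR (ae_of_all _ fun ω => ?_)).trans ?_
    · rw [norm_mul, Real.norm_eq_abs, Real.norm_eq_abs]
      refine (mul_le_of_le_one_right (abs_nonneg _) (hH1 ω)).trans (hmod _ _)
    · rw [integral_add (integrable_const _) (h1.const_mul _), integral_const_mul]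
      simp only [integral_const, probReal_univ, smul_eq_mul, one_mul]
      gcongr
  have hmonoT : Monotone fun k => elapsed γ (m + k) - elapsed γ m := fun i j hij =>
    sub_le_sub_right (hγ.strictMono_elapsed.monotone (by omega)) _
  have hT0 : ∀ k, 0 ≤ elapsed γ (m + k) - elapsed γ m := fun k =>
    sub_nonneg.2 (hγ.strictMono_elapsed.monotone (by omega))
  have hlin : ∀ {X₁ X₂ X₃ : Ω → ℝ}, Integrable X₁ P → Integrable X₂ P → Integrable X₃ P →
      ∀ a : ℝ, ∫ ω, (X₁ ω + X₂ ω + a * X₃ ω) ∂P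
        = ∫ ω, X₁ ω ∂P + ∫ ω, X₂ ω ∂P + a * ∫ ω, X₃ ω ∂P := by
    intro X₁ X₂ X₃ h1 h2 h3 a
    have h12 : Integrable (fun ω => X₁ ω + X₂ ω) P := h1.add h2
    rw [integral_add h12 (h3.const_mul a), integral_add h1 h2, integral_const_mul]
  -- the errors accumulate linearly in the elapsed time
  have hacc : ∀ j ≤ k, |∫ ω, (g (Y (m + j) ω) - g (Y m ω) - (elapsed γ (m + j) - elapsed γ m)
        * generator b σ g (Y m ω)) * H ω ∂P|
      ≤ (elapsed γ (m + j) - elapsed γ m) * (ε + C₂ * B * √(γ (m + 1))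
        + Cε * (C₄ * (elapsed γ (m + k) - elapsed γ m) ^ 2
          * Real.exp (C₄ * (elapsed γ (m + k) - elapsed γ m)))) := by
    intro j hj
    induction j with
    | zero => simp
    | succ j ih =>
      have ih := ih (by omega)
      have hTj : elapsed γ (m + (j + 1)) - elapsed γ m
          = elapsed γ (m + j) - elapsed γ m + γ (m + j + 1) := by
        rw [← add_assoc, elapsed_succ]; ring
      have i1 := hHb (fun ω => g (Y (m + j) ω) - g (Y m ω) - (elapsed γ (m + j) - elapsed γ m)
        * generator b σ g (Y m ω)) (((hgi (m + j)).sub (hgi m)).sub ((hAi m).const_mul _))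
      have i2 := hHb (fun ω => g (Y (m + j + 1) ω) - g (Y (m + j) ω)
        - γ (m + j + 1) * generator b σ g (Y (m + j) ω))
        (((hgi (m + j + 1)).sub (hgi (m + j))).sub ((hAi (m + j)).const_mul _))
      have i3 := hHb (fun ω => generator b σ g (Y (m + j) ω) - generator b σ g (Y m ω))
        ((hAi (m + j)).sub (hAi m))
      have e : ∫ ω, (g (Y (m + (j + 1)) ω) - g (Y m ω) - (elapsed γ (m + (j + 1)) - elapsed γ m)
          * generator b σ g (Y m ω)) * H ω ∂P
          = ∫ ω, (g (Y (m + j) ω) - g (Y m ω) - (elapsed γ (m + j) - elapsed γ m)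
            * generator b σ g (Y m ω)) * H ω ∂P
          + ∫ ω, (g (Y (m + j + 1) ω) - g (Y (m + j) ω)
            - γ (m + j + 1) * generator b σ g (Y (m + j) ω)) * H ω ∂P
          + γ (m + j + 1) * ∫ ω, (generator b σ g (Y (m + j) ω) - generator b σ g (Y m ω))
            * H ω ∂P := by
        refine Eq.trans (integral_congr_ae (ae_of_all _ fun ω => ?_)) (hlin i1 i2 i3 _)
        simp only
        rw [hTj, ← add_assoc]
        ring
      rw [e, hTj]
      have h1 := hone (m + j) (Nat.le_add_right m j)
      have h2 := htwo j
      have hgp := (hγ.pos (m + j)).le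
      have h3 : Cε * (C₄ * (elapsed γ (m + j) - elapsed γ m) ^ 2
          * Real.exp (C₄ * (elapsed γ (m + j) - elapsed γ m)))
          ≤ Cε * (C₄ * (elapsed γ (m + k) - elapsed γ m) ^ 2
          * Real.exp (C₄ * (elapsed γ (m + k) - elapsed γ m))) := by
        have a1 := hmonoT (show j ≤ k by omega)
        have a2 := hT0 j
        simp only at a1
        gcongr
      have h4 := mul_le_mul_of_nonneg_left (h2.trans (add_le_add le_rfl h3)) hgp
      refine (abs_add_le _ _).trans ((add_le_add (abs_add_le _ _) le_rfl).trans ?_)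
      rw [abs_mul, abs_of_nonneg hgp]
      linarith
  refine (hacc k le_rfl).trans ?_
  have hTk := hT0 k
  generalize elapsed γ (m + k) - elapsed γ m = T at *
  have hsq := Real.sqrt_nonneg (γ (m + 1))
  have a1 : C₂ * B * √(γ (m + 1)) ≤ (C₂ * B + Cε * C₄ + C₄) * √(γ (m + 1)) := by
    gcongr
    have : 0 ≤ Cε * C₄ + C₄ := by positivity
    linarith
  have a2 : Cε * (C₄ * T ^ 2 * Real.exp (C₄ * T)) ≤ (C₂ * B + Cε * C₄ + C₄) * T ^ 2
      * Real.exp ((C₂ * B + Cε * C₄ + C₄) * T) := by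
    rw [← mul_assoc, ← mul_assoc]
    have : 0 ≤ C₂ * B := by positivity
    have : 0 ≤ Cε * C₄ := by positivity
    gcongr <;> linarith
  gcongr

/-- The approximate martingale problem in continuous time. -/
theorem IsEulerChain.exists_abs_integral_clock_sub_le [IsProbabilityMeasure P]
    (hc : IsEulerChain P b σ γ U Y) (hγ : IsStepSequence γ)
    (hsum : Tendsto (elapsed γ) atTop atTop) (hγlim : Tendsto γ atTop (𝓝 0))
    (h : HasSqrtGrowth b σ V c) (hVc : Continuous V) (hp : 2 ≤ p) (hu : IsNormalized P (U 1) p)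
    (hVi : ∀ n, Integrable (fun ω => V (Y n ω) ^ 2) P) (hVB : ∀ n, ∫ ω, V (Y n ω) ^ 2 ∂P ≤ B)
    {g : Vec q → ℝ} (hg : ContDiff ℝ ((⊤ : ℕ∞) : WithTop ℕ∞) g) (hgs : HasCompactSupport g)
    {ε : ℝ} (hε : 0 < ε) :
    ∃ r, 0 < r ∧ ∀ η > 0, ∃ N, 0 ≤ N ∧ ∀ s t, N ≤ s → s ≤ t → t ≤ s + r →
      ∀ H : Ω → ℝ, Measurable[hist Y (clock γ s)] H → (∀ ω, |H ω| ≤ 1) →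
      |∫ ω, (g (Y (clock γ t) ω) - g (Y (clock γ s) ω)
        - (t - s) * generator b σ g (Y (clock γ s) ω)) * H ω ∂P| ≤ ε * (t - s) + η := by
  obtain ⟨C, hC0, hC⟩ := hc.exists_abs_integral_sub_le hγ h hVc hp hu hVi hVB hg hgs
    (by positivity : 0 < ε / 2)
  have hg2 : ContDiff ℝ 2 g := hg.of_le (WithTop.coe_le_coe.2 (le_top : (2 : ℕ∞) ≤ ⊤))
  have hgc := hg.continuous
  have hAc := continuous_generator hc.continuous_drift hc.continuous_diffusion hg2
  have hAs := hasCompactSupport_generator (b := b) (σ := σ) hgs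
  obtain ⟨M, hM⟩ := hgc.bounded_above_of_compact_support hgs
  obtain ⟨M', hM'⟩ := hAc.bounded_above_of_compact_support hAs
  have hM'0 : 0 ≤ M' := (norm_nonneg _).trans (hM' 0)
  obtain ⟨D, hD⟩ : ∃ D, D = C * Real.exp (C * 2) := ⟨_, rfl⟩
  have hD0 : 0 ≤ D := by rw [hD]; positivity
  -- On durations at most `r` the term of third order in the duration is at most `ε / 4` times the
  -- duration; all the terms with the step size `δ` go to the additive error `η`.
  refine ⟨min (1 / 2) (ε / (4 * (D + 1))), by positivity, fun η hη => ?_⟩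
  have hlimδ : Tendsto (fun δ : ℝ => δ * (ε + C + D) + C * √δ + M' * δ) (𝓝[>] 0) (𝓝 0) := by
    have : Continuous fun δ : ℝ => δ * (ε + C + D) + C * √δ + M' * δ := by fun_prop
    have h1 := this.tendsto 0
    simp only [zero_mul, Real.sqrt_zero, mul_zero, add_zero] at h1
    exact h1.mono_left nhdsWithin_le_nhds
  obtain ⟨δ₀, hδ₀η, hδ₀0, hδ₀1⟩ := ((hlimδ.eventually (gt_mem_nhds hη)).and
    (Ioo_mem_nhdsGT (by norm_num : (0 : ℝ) < 1 / 2))).exists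
  obtain ⟨N, hN0, hN⟩ := exists_step_le hγ hsum hγlim hδ₀0
  refine ⟨N, hN0, fun s t hs hst hts H hH hH1 => ?_⟩
  obtain ⟨k, hk⟩ := Nat.exists_eq_add_of_le (clock_mono hsum hst)
  have h1 := hC (clock γ s) k H hH hH1
  rw [← hk] at h1
  have h2 := abs_elapsed_clock_sub_le hγ hsum (hN0.trans hs) hst
  have h3 := hN s hs
  have hδ0 := hγ.pos (clock γ s)
  have hT0 : 0 ≤ elapsed γ (clock γ t) - elapsed γ (clock γ s) :=
    sub_nonneg.2 (hγ.strictMono_elapsed.monotone (clock_mono hsum hst))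
  have hgi : ∀ n, Integrable (fun ω => g (Y n ω)) P := fun n =>
    (integrable_const M).mono' (hgc.measurable.comp (hc.measurable n)).aestronglyMeasurable
      (ae_of_all _ fun ω => hM _)
  have hAi : ∀ n, Integrable (fun ω => generator b σ g (Y n ω)) P := fun n =>
    (integrable_const M').mono' (hAc.measurable.comp (hc.measurable n)).aestronglyMeasurable
      (ae_of_all _ fun ω => hM' _)
  have hHm : AEStronglyMeasurable H P := (hH.mono (hc.hist_le _) le_rfl).aestronglyMeasurable
  generalize elapsed γ (clock γ t) - elapsed γ (clock γ s) = T at *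
  generalize γ (clock γ s + 1) = δ at *
  have i1 : Integrable (fun ω => (g (Y (clock γ t) ω) - g (Y (clock γ s) ω)
      - T * generator b σ g (Y (clock γ s) ω)) * H ω) P :=
    (((hgi _).sub (hgi _)).sub ((hAi _).const_mul _)).mul_bdd (c := 1) hHm (ae_of_all _ hH1)
  have i2 : Integrable (fun ω => generator b σ g (Y (clock γ s) ω) * H ω) P :=
    (hAi _).mul_bdd (c := 1) hHm (ae_of_all _ hH1)
  have e : ∫ ω, (g (Y (clock γ t) ω) - g (Y (clock γ s) ω)
        - (t - s) * generator b σ g (Y (clock γ s) ω)) * H ω ∂P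
      = ∫ ω, (g (Y (clock γ t) ω) - g (Y (clock γ s) ω)
        - T * generator b σ g (Y (clock γ s) ω)) * H ω ∂P
        + (T - (t - s)) * ∫ ω, generator b σ g (Y (clock γ s) ω) * H ω ∂P := by
    rw [← integral_const_mul, ← integral_add i1 (i2.const_mul _)]
    refine integral_congr_ae (ae_of_all _ fun ω => ?_)
    simp only
    ring
  have hI2 : |∫ ω, generator b σ g (Y (clock γ s) ω) * H ω ∂P| ≤ M' := by
    have := norm_integral_le_of_norm_le_const (μ := P) (C := M')
      (f := fun ω => generator b σ g (Y (clock γ s) ω) * H ω) (ae_of_all _ fun ω => by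
        rw [norm_mul]
        exact (mul_le_of_le_one_right (norm_nonneg _) (hH1 ω)).trans (hM' _))
    simpa using this
  rw [e]
  refine (abs_add_le _ _).trans ?_
  rw [abs_mul]
  have h4 : |T - (t - s)| * |∫ ω, generator b σ g (Y (clock γ s) ω) * H ω ∂P| ≤ δ * M' :=
    mul_le_mul h2 hI2 (abs_nonneg _) hδ0.le
  have h2' := abs_le.1 h2
  have hr1 : t - s ≤ 1 / 2 := by linarith [min_le_left (1 / 2 : ℝ) (ε / (4 * (D + 1)))]
  have hr2 : (t - s) * (4 * (D + 1)) ≤ ε := by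
    have : t - s ≤ ε / (4 * (D + 1)) := by
      linarith [min_le_right (1 / 2 : ℝ) (ε / (4 * (D + 1)))]
    rwa [le_div_iff₀ (by positivity)] at this
  have hT1 : T ≤ 1 := by linarith
  have hTs : T ≤ t - s + δ := by linarith
  have hts0 : 0 ≤ t - s := sub_nonneg.2 hst
  have hsq : √δ ≤ √δ₀ := Real.sqrt_le_sqrt h3
  have hsq0 := Real.sqrt_nonneg δ
  have h5 : C * T ^ 2 * Real.exp (C * T) ≤ ε / 4 + D * δ := by
    have a1 : Real.exp (C * T) ≤ Real.exp (C * 2) := by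
      rw [Real.exp_le_exp]; gcongr; linarith
    calc C * T ^ 2 * Real.exp (C * T) ≤ C * T ^ 2 * Real.exp (C * 2) := by gcongr
      _ = D * (T * T) := by rw [hD]; ring
      _ ≤ D * (1 * (t - s + δ)) := by gcongr
      _ ≤ _ := by nlinarith
  have h6 : T * (ε / 2 + C * √δ + C * T ^ 2 * Real.exp (C * T))
      ≤ ε * (t - s) + ε * δ + C * √δ + D * δ := by
    calc T * (ε / 2 + C * √δ + C * T ^ 2 * Real.exp (C * T))
        ≤ T * (ε / 2 + C * √δ + (ε / 4 + D * δ)) := by gcongr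
      _ = T * (3 / 4 * ε) + T * (C * √δ + D * δ) := by ring
      _ ≤ (t - s + δ) * (1 * ε) + 1 * (C * √δ + D * δ) := by gcongr; norm_num
      _ = _ := by ring
  have h7 : δ * (ε + C + D) + C * √δ + M' * δ ≤ δ₀ * (ε + C + D) + C * √δ₀ + M' * δ₀ := by
    gcongr
  have h8 : 0 ≤ δ * C := mul_nonneg hδ0.le hC0
  linarith

end Interpolation


/-! ### Limits of time averages of the laws of the shifted paths -/

section LimitLaw

variable {q : ℕ} {Ω : Type*} {mΩ : MeasurableSpace Ω} {P : Measure Ω} {Z : ℝ → Ω → Vec q}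
  {V : Vec q → ℝ} {B : ℝ}

/-- The path of the process `Z` from time `θ` on, observed at the nonnegative rational times. -/
def shiftedPath (Z : ℝ → Ω → Vec q) (θ : ℝ) (ω : Ω) : ℚ≥0 → Vec q := fun s => Z (θ + s) ω

theorem measurable_shiftedPath (hZ : ∀ t, Measurable (Z t)) (θ : ℝ) :
    Measurable (shiftedPath Z θ) := measurable_pi_lambda _ fun _ => hZ _

/-- The law of the path of `Z` seen from a time that is uniformly distributed on the points of mesh
`1 / N!` of `[N, 2 N + 1)`. Every rational number is a multiple of the mesh for large `N`, which
makes the limits of these laws stationary. -/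
def averagedLaw (P : Measure Ω) (Z : ℝ → Ω → Vec q) (N : ℕ) : Measure (ℚ≥0 → Vec q) :=
  ((N.factorial * (N + 1) : ℕ) : ℝ≥0∞)⁻¹ • ∑ j ∈ Finset.range (N.factorial * (N + 1)),
    P.map (shiftedPath Z (N + j / N.factorial))

theorem mesh_pos (N : ℕ) : 0 < N.factorial * (N + 1) :=
  Nat.mul_pos (Nat.factorial_pos N) N.succ_pos

/-- An average of probabilities is at most their common bound. -/
theorem averagedLaw_apply_le [IsProbabilityMeasure P] (hZ : ∀ t, Measurable (Z t)) (N : ℕ)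
    {A : Set (ℚ≥0 → Vec q)} (hA : MeasurableSet A) {c : ℝ≥0∞}
    (h : ∀ θ : ℝ, 0 ≤ θ → P (shiftedPath Z θ ⁻¹' A) ≤ c) : averagedLaw P Z N A ≤ c := by
  rw [averagedLaw, Measure.smul_apply, Measure.finsetSum_apply]
  calc _ ≤ ((N.factorial * (N + 1) : ℕ) : ℝ≥0∞)⁻¹ •
      ∑ j ∈ Finset.range (N.factorial * (N + 1)), c := by
        rw [smul_eq_mul, smul_eq_mul]
        gcongr with j hj
        rw [Measure.map_apply (measurable_shiftedPath hZ _) hA]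
        exact h _ (by positivity)
    _ = c := by
        rw [Finset.sum_const, Finset.card_range, nsmul_eq_mul, smul_eq_mul, ← mul_assoc,
          ENNReal.inv_mul_cancel (by exact_mod_cast (mesh_pos N).ne') (ENNReal.natCast_ne_top _),
          one_mul]

theorem isProbabilityMeasure_averagedLaw [IsProbabilityMeasure P] (hZ : ∀ t, Measurable (Z t))
    (N : ℕ) : IsProbabilityMeasure (averagedLaw P Z N) := by
  constructor
  rw [averagedLaw, Measure.smul_apply, Measure.finsetSum_apply]
  have : ∀ j ∈ Finset.range (N.factorial * (N + 1)),
      (P.map (shiftedPath Z (N + j / N.factorial))) Set.univ = 1 := fun j _ => by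
    rw [Measure.map_apply (measurable_shiftedPath hZ _) MeasurableSet.univ, Set.preimage_univ,
      measure_univ]
  rw [Finset.sum_congr rfl this, Finset.sum_const, Finset.card_range, nsmul_eq_mul, mul_one,
    smul_eq_mul,
    ENNReal.inv_mul_cancel (by exact_mod_cast (mesh_pos N).ne') (ENNReal.natCast_ne_top _)]

theorem integral_averagedLaw [IsProbabilityMeasure P] (hZ : ∀ t, Measurable (Z t)) (N : ℕ)
    {F : (ℚ≥0 → Vec q) → ℝ} (hF : Continuous F) {C : ℝ} (hC : ∀ x, |F x| ≤ C) :
    ∫ x, F x ∂(averagedLaw P Z N) = ((N.factorial * (N + 1) : ℕ) : ℝ)⁻¹ *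
      ∑ j ∈ Finset.range (N.factorial * (N + 1)),
        ∫ ω, F (shiftedPath Z (N + j / N.factorial) ω) ∂P := by
  have hm := hF.measurable
  rw [averagedLaw, integral_smul_measure, integral_finsetSum_measure]
  · rw [ENNReal.toReal_inv, ENNReal.toReal_natCast, smul_eq_mul]
    congr 1
    refine Finset.sum_congr rfl fun j _ => ?_
    rw [integral_map (measurable_shiftedPath hZ _).aemeasurable hm.aestronglyMeasurable]
  · intro j _
    have := Measure.isProbabilityMeasure_map
      (measurable_shiftedPath hZ (N + j / N.factorial)).aemeasurable (μ := P)
    exact Integrable.of_bound hm.aestronglyMeasurable C (ae_of_all _ hC)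

/-- The law at each of the countably many times is tight by Markov's inequality for `V`. A product of
sublevel sets of `V`, with summable failure probabilities, is a compact set of paths. -/
theorem isTightMeasureSet_averagedLaw [IsProbabilityMeasure P] (hZ : ∀ t, Measurable (Z t))
    (hVc : Continuous V) (hV1 : ∀ y, 1 ≤ V y) (hVt : Tendsto V (cocompact (Vec q)) atTop)
    (hVi : ∀ t, Integrable (fun ω => V (Z t ω)) P) (hVB : ∀ t, ∫ ω, V (Z t ω) ∂P ≤ B) :
    IsTightMeasureSet (Set.range (averagedLaw P Z)) := by
  rw [isTightMeasureSet_iff_exists_isCompact_measure_compl_le]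
  intro ε hε
  obtain ⟨δ, hδ, hδs⟩ := ENNReal.exists_pos_sum_of_countable' hε.ne' ℚ≥0
  have hB0 : 0 ≤ B := (integral_nonneg fun ω => zero_le_one.trans (hV1 _)).trans (hVB 0)
  have hR : ∀ s, ∃ R : ℝ, 0 < R ∧ ENNReal.ofReal (B / R) ≤ δ s := by
    intro s
    have h1 : Tendsto (fun R : ℝ => ENNReal.ofReal (B / R)) atTop (𝓝 0) := by
      have := ENNReal.tendsto_ofReal (tendsto_const_nhds (x := B) |>.div_atTop tendsto_id)
      simpa using this
    obtain ⟨R, h2, h3⟩ := ((h1.eventually (ge_mem_nhds (hδ s))).and (eventually_gt_atTop 0)).exists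
    exact ⟨R, h3, h2⟩
  choose R hR0 hR using hR
  have hcomp : ∀ s, IsCompact {y | V y ≤ R s} := by
    intro s
    have h1 := (hVt.eventually (eventually_gt_atTop (R s)))
    obtain ⟨K, hK, hKs⟩ := mem_cocompact.1 h1
    refine hK.of_isClosed_subset (isClosed_le hVc continuous_const) fun y hy => ?_
    by_contra hyK
    exact absurd (show R s < V y from hKs hyK) (not_lt.2 hy)
  refine ⟨Set.univ.pi fun s => {y | V y ≤ R s}, isCompact_univ_pi hcomp, ?_⟩
  rintro _ ⟨N, rfl⟩
  have hcl : MeasurableSet (Set.univ.pi fun s : ℚ≥0 => {y | V y ≤ R s})ᶜ :=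
    (isCompact_univ_pi hcomp).measurableSet.compl
  refine averagedLaw_apply_le hZ N hcl fun θ _ => ?_
  have hsub : shiftedPath Z θ ⁻¹' (Set.univ.pi fun s : ℚ≥0 => {y | V y ≤ R s})ᶜ
      ⊆ ⋃ s : ℚ≥0, {ω | R s ≤ V (Z (θ + s) ω)} := by
    intro ω hω
    simp only [Set.mem_preimage, Set.mem_compl_iff, Set.mem_univ_pi, Set.mem_ofPred_eq,
      not_forall, not_le] at hω
    obtain ⟨s, hs⟩ := hω
    exact Set.mem_iUnion.2 ⟨s, hs.le⟩
  refine (measure_mono hsub).trans ((measure_iUnion_le _).trans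
    ((ENNReal.tsum_le_tsum fun s => ?_).trans hδs.le))
  refine le_trans ?_ (hR s)
  have h1 := mul_meas_ge_le_integral_of_nonneg
    (ae_of_all P fun ω => zero_le_one.trans (hV1 (Z (θ + s) ω))) (hVi _) (R s)
  rw [ENNReal.le_ofReal_iff_toReal_le (measure_ne_top _ _) (div_nonneg hB0 (hR0 s).le),
    le_div_iff₀ (hR0 s), mul_comm]
  exact h1.trans (hVB _)

/-- Shifting the index changes a sum only at its two ends. -/
theorem abs_sum_shift_sub_le {a : ℕ → ℝ} {C : ℝ} (ha : ∀ j, |a j| ≤ C) (M m : ℕ) :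
    |∑ j ∈ Finset.range M, a (j + m) - ∑ j ∈ Finset.range M, a j| ≤ 2 * m * C := by
  induction m with
  | zero => simp
  | succ m ih =>
    have h1 := Finset.sum_range_sub (fun j => a (j + m)) M
    rw [Finset.sum_sub_distrib] at h1
    have h2 : ∀ j, j + (m + 1) = j + 1 + m := fun j => by ring
    simp only [h2]
    have h3 := abs_le.1 (ha (M + m))
    have h4 := abs_le.1 (ha (0 + m))
    rw [abs_le] at ih ⊢
    push_cast
    constructor <;> nlinarith

/-- If the laws of `Z t` are tight then there is a probability measure on the paths, a limit of time
averages of the laws of the shifted paths of `Z`, which is stationary and satisfies every bound that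
the shifted paths satisfy asymptotically. -/
theorem exists_stationary_limit [IsProbabilityMeasure P] (hZ : ∀ t, Measurable (Z t))
    (hVc : Continuous V) (hV1 : ∀ y, 1 ≤ V y) (hVt : Tendsto V (cocompact (Vec q)) atTop)
    (hVi : ∀ t, Integrable (fun ω => V (Z t ω)) P) (hVB : ∀ t, ∫ ω, V (Z t ω) ∂P ≤ B) :
    ∃ μ : Measure (ℚ≥0 → Vec q), IsProbabilityMeasure μ ∧
      (∀ s, μ.map (fun x => x s) = μ.map fun x => x 0) ∧
      ∀ F : (ℚ≥0 → Vec q) → ℝ, Continuous F → (∃ C, ∀ x, |F x| ≤ C) → ∀ a,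
        (∀ η > 0, ∃ N : ℝ, ∀ θ ≥ N, ∫ ω, F (shiftedPath Z θ ω) ∂P ≤ a + η) →
        ∫ x, F x ∂μ ≤ a := by
  have hprob := isProbabilityMeasure_averagedLaw (P := P) hZ
  set ρ : ℕ → ProbabilityMeasure (ℚ≥0 → Vec q) := fun N => ⟨averagedLaw P Z N, hprob N⟩ with hρ
  have htight := isTightMeasureSet_averagedLaw hZ hVc hV1 hVt hVi hVB
  have hcomp : IsCompact (closure (Set.range ρ)) := by
    apply isCompact_closure_of_isTightMeasureSet
    convert htight using 1
    ext m
    constructor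
    · rintro ⟨_, ⟨N, rfl⟩, rfl⟩
      exact ⟨N, rfl⟩
    · rintro ⟨N, rfl⟩
      exact ⟨ρ N, ⟨N, rfl⟩, rfl⟩
  -- A limit along an ultrafilter replaces the extraction of a subsequence.
  obtain ⟨μ, -, hμ⟩ := hcomp.ultrafilter_le_nhds ((hyperfilter ℕ).map ρ)
    (le_trans (by simp) (monotone_principal subset_closure))
  have hμ' : Tendsto ρ (hyperfilter ℕ) (𝓝 μ) := hμ
  rw [ProbabilityMeasure.tendsto_iff_forall_integral_tendsto] at hμ'
  have hlim : ∀ F : (ℚ≥0 → Vec q) → ℝ, Continuous F → (∃ C, ∀ x, |F x| ≤ C) →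
      Tendsto (fun N => ∫ x, F x ∂(averagedLaw P Z N)) (hyperfilter ℕ)
        (𝓝 (∫ x, F x ∂(μ : Measure _))) := by
    rintro F hF ⟨C, hC⟩
    exact hμ' (BoundedContinuousFunction.ofNormedAddCommGroup F hF C hC)
  refine ⟨μ, inferInstance, fun s => ?_, ?_⟩
  · have hms : Measurable fun x : ℚ≥0 → Vec q => x s := measurable_pi_apply s
    have hm0 : Measurable fun x : ℚ≥0 → Vec q => x 0 := measurable_pi_apply 0
    have := Measure.isProbabilityMeasure_map hms.aemeasurable (μ := (μ : Measure _))
    have := Measure.isProbabilityMeasure_map hm0.aemeasurable (μ := (μ : Measure _))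
    refine ext_of_forall_integral_eq_of_IsFiniteMeasure fun f => ?_
    have hfb : ∀ y, |f y| ≤ ‖f‖ := f.norm_coe_le_norm
    rw [integral_map hms.aemeasurable f.continuous.aestronglyMeasurable,
      integral_map hm0.aemeasurable f.continuous.aestronglyMeasurable]
    have e1 := hlim (fun x => f (x s)) (f.continuous.comp (continuous_apply s)) ⟨_, fun x => hfb _⟩
    have e0 := hlim (fun x => f (x 0)) (f.continuous.comp (continuous_apply 0)) ⟨_, fun x => hfb _⟩
    have hdiff : Tendsto (fun N => ∫ x, f (x s) ∂(averagedLaw P Z N)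
        - ∫ x, f (x 0) ∂(averagedLaw P Z N)) atTop (𝓝 0) := by
      have h1 : Tendsto (fun N : ℕ => 2 * ‖f‖ * s / ((N : ℝ) + 1)) atTop (𝓝 0) :=
        tendsto_const_nhds.div_atTop
          (tendsto_atTop_add_const_right _ _ tendsto_natCast_atTop_atTop)
      refine squeeze_zero_norm' ?_ h1
      filter_upwards [eventually_ge_atTop s.den] with N hN
      obtain ⟨k, hk⟩ := Nat.dvd_factorial s.den_pos hN
      have hfac : (0 : ℝ) < N.factorial := by exact_mod_cast N.factorial_pos
      have hs : (s : ℝ) = ((s.num * k : ℕ) : ℝ) / N.factorial := by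
        have hk0 : (k : ℝ) ≠ 0 := by
          rintro h
          rw [hk] at hfac
          push_cast at hfac
          rw [h, mul_zero] at hfac
          exact lt_irrefl _ hfac
        rw [hk]
        push_cast
        rw [mul_div_mul_right _ _ hk0]
        exact NNRat.cast_def s
      -- For large `N` the rational time `s` is a multiple of the mesh `1 / N!`, so that a shift of time
      -- by `s` is a shift of the summation index.
      rw [integral_averagedLaw hZ N (F := fun x => f (x s))
          (f.continuous.comp (continuous_apply s)) (fun x => hfb _),
        integral_averagedLaw hZ N (F := fun x => f (x 0))
          (f.continuous.comp (continuous_apply 0)) (fun x => hfb _)]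
      have h2 : ∀ j : ℕ, ∫ ω, f (shiftedPath Z (N + j / N.factorial) ω s) ∂P
          = ∫ ω, f (Z (N + ((j + s.num * k : ℕ) : ℝ) / N.factorial) ω) ∂P := by
        intro j
        have : (N : ℝ) + j / N.factorial + s
            = N + ((j + s.num * k : ℕ) : ℝ) / N.factorial := by
          rw [hs]; push_cast; ring
        simp only [shiftedPath, this]
      have h3 : ∀ j : ℕ, ∫ ω, f (shiftedPath Z (N + j / N.factorial) ω 0) ∂P
          = ∫ ω, f (Z (N + (j : ℝ) / N.factorial) ω) ∂P := by
        intro j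
        simp only [shiftedPath, NNRat.cast_zero, add_zero]
      simp only [h2, h3]
      rw [← mul_sub, Real.norm_eq_abs, abs_mul]
      have h4 := abs_sum_shift_sub_le (C := ‖f‖)
        (a := fun j : ℕ => ∫ ω, f (Z (N + (j : ℝ) / N.factorial) ω) ∂P) (fun j => by
          have := norm_integral_le_of_norm_le_const
            (f := fun ω => f (Z (N + (j : ℝ) / N.factorial) ω)) (ae_of_all P fun ω => hfb _)
          simpa using this) (N.factorial * (N + 1)) (s.num * k)
      refine (mul_le_mul_of_nonneg_left h4 (abs_nonneg _)).trans (le_of_eq ?_)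
      rw [abs_of_nonneg (by positivity), hs]
      push_cast
      field_simp
    have h5 := (e1.sub e0)
    exact sub_eq_zero.1 (tendsto_nhds_unique h5 (hdiff.mono_left Nat.hyperfilter_le_atTop))
  · rintro F hF ⟨C, hC⟩ a hFa
    refine le_of_forall_pos_le_add fun η hη => ?_
    obtain ⟨T, hT⟩ := hFa η hη
    refine le_of_tendsto (hlim F hF ⟨C, hC⟩) (Filter.Eventually.filter_mono
      Nat.hyperfilter_le_atTop ?_)
    filter_upwards [eventually_ge_atTop ⌈T⌉₊] with N hN
    rw [integral_averagedLaw hZ N hF hC]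
    have hpos : (0 : ℝ) < ((N.factorial * (N + 1) : ℕ) : ℝ) := by exact_mod_cast mesh_pos N
    rw [inv_mul_le_iff₀ hpos]
    have h1 : ∀ j ∈ Finset.range (N.factorial * (N + 1)),
        ∫ ω, F (shiftedPath Z (N + j / N.factorial) ω) ∂P ≤ a + η := by
      intro j _
      refine hT _ ?_
      have h2 : T ≤ N := (Nat.le_ceil T).trans (by exact_mod_cast hN)
      have h3 : (0 : ℝ) ≤ (j : ℝ) / N.factorial := by positivity
      linarith
    refine (Finset.sum_le_sum h1).trans (le_of_eq ?_)
    rw [Finset.sum_const, Finset.card_range, nsmul_eq_mul]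

/-- Monotone convergence along the truncations of a nonnegative function. -/
theorem lintegral_ofReal_le_of_forall_integral_min_le {α : Type*} {mα : MeasurableSpace α}
    {μ : Measure α} [IsFiniteMeasure μ] {F : α → ℝ} (hF : Measurable F) (hF0 : ∀ x, 0 ≤ F x) {a : ℝ}
    (h : ∀ K : ℕ, ∫ x, min (F x) K ∂μ ≤ a) : ∫⁻ x, ENNReal.ofReal (F x) ∂μ ≤ ENNReal.ofReal a := by
  have h1 : ∀ x, Tendsto (fun K : ℕ => ENNReal.ofReal (min (F x) K)) atTop
      (𝓝 (ENNReal.ofReal (F x))) := by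
    intro x
    refine tendsto_const_nhds.congr' ?_
    filter_upwards [eventually_ge_atTop ⌈F x⌉₊] with K hK
    rw [min_eq_left ((Nat.le_ceil _).trans (by exact_mod_cast hK))]
  have h2 := lintegral_tendsto_of_tendsto_of_monotone (μ := μ)
    (f := fun (K : ℕ) x => ENNReal.ofReal (min (F x) K)) (F := fun x => ENNReal.ofReal (F x))
    (fun K => (hF.min measurable_const).ennreal_ofReal.aemeasurable)
    (ae_of_all _ fun x K L hKL => ENNReal.ofReal_le_ofReal
      (min_le_min_left _ (by exact_mod_cast hKL))) (ae_of_all _ h1)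
  refine le_of_tendsto' h2 fun K => ?_
  have hm : ∀ x, 0 ≤ min (F x) (K : ℝ) := fun x => le_min (hF0 x) (Nat.cast_nonneg K)
  rw [← ofReal_integral_eq_lintegral_ofReal _ (ae_of_all _ hm)]
  · exact ENNReal.ofReal_le_ofReal (h K)
  · exact Integrable.of_bound (hF.min measurable_const).aestronglyMeasurable K
      (ae_of_all _ fun x => by
        rw [Real.norm_of_nonneg (hm x)]; exact min_le_right _ _)

end LimitLaw


/-! ### The stationary limit of the Euler scheme, at rational times -/

/-- `μ` is the law, on the nonnegative rational times, of a stationary process which solves the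
martingale problem for the generator up to an error that is small with respect to the duration, and
whose increments satisfy Kolmogorov's moment condition. -/
structure IsRationalSolution {q ℓ : ℕ} (b : Vec q → Vec q) (σ : Vec q → Vec ℓ →L[ℝ] Vec q)
    (μ : Measure (ℚ≥0 → Vec q)) (C : ℝ) : Prop where
  isProbabilityMeasure : IsProbabilityMeasure μ
  continuous_drift : Continuous b
  continuous_diffusion : Continuous σ
  stationary : ∀ s, μ.map (fun x => x s) = μ.map fun x => x 0
  pow_four : ∀ s t : ℚ≥0, s ≤ t → (t : ℝ) ≤ s + 1 →
    ∫⁻ x, ENNReal.ofReal (‖x t - x s‖ ^ 4) ∂μ ≤ ENNReal.ofReal (C * ((t : ℝ) - s) ^ 2)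
  martingale : ∀ g : Vec q → ℝ, ContDiff ℝ ((⊤ : ℕ∞) : WithTop ℕ∞) g → HasCompactSupport g →
    ∀ ε > 0, ∃ r > 0, ∀ s t : ℚ≥0, s ≤ t → (t : ℝ) ≤ s + r →
      ∀ (ι : Type) [Finite ι] (u : ι → ℚ≥0), (∀ i, u i ≤ s) →
      ∀ h : (ι → Vec q) → ℝ, Continuous h → (∀ z, |h z| ≤ 1) →
        ∫ x, (g (x t) - g (x s) - ((t : ℝ) - s) * generator b σ g (x s)) *
          h (fun i => x (u i)) ∂μ ≤ ε * ((t : ℝ) - s)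

section Chain

variable {q ℓ : ℕ} {Ω : Type*} {mΩ : MeasurableSpace Ω} {P : Measure Ω}
  {b : Vec q → Vec q} {σ : Vec q → Vec ℓ →L[ℝ] Vec q} {V : Vec q → ℝ} {c : ℝ}
  {γ : ℕ → ℝ} {U : ℕ → Ω → Vec ℓ} {Y : ℕ → Ω → Vec q} {p : ℕ} {B : ℝ}

/-- Time averages of the Euler scheme have a limit which solves the stationary martingale
problem, and functions that are bounded in mean along the scheme are integrable in the limit. -/
theorem IsEulerChain.exists_isRationalSolution [IsProbabilityMeasure P]
    (hc : IsEulerChain P b σ γ U Y) (hγ : IsStepSequence γ)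
    (hsum : Tendsto (elapsed γ) atTop atTop) (hγlim : Tendsto γ atTop (𝓝 0))
    (h : HasSqrtGrowth b σ V c) (hVc : Continuous V) (hV1 : ∀ y, 1 ≤ V y)
    (hVt : Tendsto V (cocompact (Vec q)) atTop) (hp : 2 ≤ p) (hu : IsNormalized P (U 1) p)
    (hVi : ∀ n, Integrable (fun ω => V (Y n ω) ^ 2) P) (hVB : ∀ n, ∫ ω, V (Y n ω) ^ 2 ∂P ≤ B) :
    ∃ (μ : Measure (ℚ≥0 → Vec q)) (C : ℝ), IsRationalSolution b σ μ C ∧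
      ∀ W : Vec q → ℝ, Continuous W → (∀ y, 0 ≤ W y) → ∀ R,
        (∀ n, Integrable (fun ω => W (Y n ω)) P) → (∀ n, ∫ ω, W (Y n ω) ∂P ≤ R) →
        ∫⁻ x, ENNReal.ofReal (W (x 0)) ∂μ ≤ ENNReal.ofReal R := by
  have hVsq : ∀ y, V y ≤ V y ^ 2 := fun y => by nlinarith [hV1 y]
  have hVi1 : ∀ n, Integrable (fun ω => V (Y n ω)) P := fun n =>
    (hVi n).mono' (hVc.measurable.comp (hc.measurable n)).aestronglyMeasurable
      (ae_of_all _ fun ω => by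
        rw [Real.norm_of_nonneg (zero_le_one.trans (hV1 _))]; exact hVsq _)
  obtain ⟨μ, hμ, hstat, hμF⟩ := exists_stationary_limit (P := P) (Z := fun t => Y (clock γ t))
    (V := V) (B := B) (fun t => hc.measurable _) hVc hV1 hVt (fun t => hVi1 _) (fun t =>
      (integral_mono (hVi1 _) (hVi _) fun ω => hVsq _).trans (hVB _))
  obtain ⟨C, hC0, hC⟩ := hc.exists_integral_clock_pow_four_le hγ hsum hγlim h
    (by omega : 1 ≤ p) hu hVi hVB
  refine ⟨μ, C, ⟨hμ, hc.continuous_drift, hc.continuous_diffusion, hstat, ?_, ?_⟩, ?_⟩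
  · intro s t hst hts
    have hF : Continuous fun x : ℚ≥0 → Vec q => ‖x t - x s‖ ^ 4 := by fun_prop
    refine lintegral_ofReal_le_of_forall_integral_min_le hF.measurable (fun x => by positivity)
      fun K => ?_
    refine hμF _ (hF.min continuous_const) ⟨K, fun x => ?_⟩ _ fun η hη => ?_
    · rw [abs_of_nonneg (le_min (by positivity) (Nat.cast_nonneg K))]
      exact min_le_right _ _
    · obtain ⟨N, hN0, hN⟩ := hC η hη
      refine ⟨N, fun θ hθ => ?_⟩
      have hst' : (s : ℝ) ≤ t := by exact_mod_cast hst
      obtain ⟨h1, h2⟩ := hN (θ + s) (θ + t) (hθ.trans (le_add_of_nonneg_right (by positivity)))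
        (by linarith) (by linarith)
      rw [show θ + t - (θ + s) = (t : ℝ) - s by ring] at h2
      refine le_trans (integral_mono_of_nonneg (ae_of_all _ fun ω => ?_) h1
        (ae_of_all _ fun ω => ?_)) h2
      · exact le_min (by positivity) (Nat.cast_nonneg K)
      · exact min_le_left _ _
  · intro g hg hgs ε hε
    obtain ⟨r, hr, hN⟩ := hc.exists_abs_integral_clock_sub_le hγ hsum hγlim h hVc hp hu hVi hVB
      hg hgs hε
    refine ⟨r, hr, fun s t hst hts ι _ u hus f hf hf1 => ?_⟩
    have hst' : (s : ℝ) ≤ t := by exact_mod_cast hst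
    have hg2 : ContDiff ℝ 2 g := hg.of_le (WithTop.coe_le_coe.2 (le_top : (2 : ℕ∞) ≤ ⊤))
    have hgc := hg.continuous
    have hAc := continuous_generator hc.continuous_drift hc.continuous_diffusion hg2
    obtain ⟨M, hM⟩ := hgc.bounded_above_of_compact_support hgs
    obtain ⟨M', hM'⟩ := hAc.bounded_above_of_compact_support
      (hasCompactSupport_generator (b := b) (σ := σ) hgs)
    refine hμF _ ?_ ⟨M + M + ((t : ℝ) - s) * M', fun x => ?_⟩ _ fun η hη => ?_
    · have h1 : Continuous fun x : ℚ≥0 → Vec q => fun i => x (u i) := by fun_prop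
      have h2 := hf.comp h1
      have h3 : Continuous fun x : ℚ≥0 → Vec q => generator b σ g (x s) :=
        hAc.comp (continuous_apply s)
      have h4 : Continuous fun x : ℚ≥0 → Vec q => g (x s) := hgc.comp (continuous_apply s)
      have h5 : Continuous fun x : ℚ≥0 → Vec q => g (x t) := hgc.comp (continuous_apply t)
      exact ((h5.sub h4).sub (continuous_const.mul h3)).mul h2
    · rw [abs_mul]
      have h1 := abs_sub (g (x t) - g (x s)) (((t : ℝ) - s) * generator b σ g (x s))
      have h2 := abs_sub (g (x t)) (g (x s))
      have h3 : |((t : ℝ) - s) * generator b σ g (x s)| ≤ ((t : ℝ) - s) * M' := by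
        rw [abs_mul, abs_of_nonneg (sub_nonneg.2 hst')]
        exact mul_le_mul_of_nonneg_left (hM' _) (sub_nonneg.2 hst')
      have h4 : |g (x t)| ≤ M := hM _
      have h5 : |g (x s)| ≤ M := hM _
      exact (mul_le_of_le_one_right (abs_nonneg _) (hf1 _)).trans (by linarith)
    · obtain ⟨N, hN0, hN⟩ := hN η hη
      refine ⟨N, fun θ hθ => ?_⟩
      have hH : Measurable[hist Y (clock γ (θ + s))]
          fun ω => f fun i => Y (clock γ (θ + u i)) ω := by
        refine hf.measurable.comp
          (@measurable_pi_lambda _ _ _ (hist Y (clock γ (θ + s))) _ _ fun i => ?_)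
        have : (u i : ℝ) ≤ s := by exact_mod_cast hus i
        exact measurable_hist Y (clock_mono hsum (by linarith))
      have h1 := hN (θ + s) (θ + t) (hθ.trans (le_add_of_nonneg_right (by positivity)))
        (by linarith) (by linarith) _ hH (fun ω => hf1 _)
      rw [show θ + t - (θ + s) = (t : ℝ) - s by ring] at h1
      exact (abs_le.1 h1).2
  · intro W hWc hW0 R hWi hWR
    have hF : Continuous fun x : ℚ≥0 → Vec q => W (x 0) := hWc.comp (continuous_apply 0)
    refine lintegral_ofReal_le_of_forall_integral_min_le hF.measurable (fun x => hW0 _)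
      fun K => ?_
    refine hμF _ (hF.min continuous_const) ⟨K, fun x => ?_⟩ _ fun η hη => ⟨0, fun θ _ => ?_⟩
    · rw [abs_of_nonneg (le_min (hW0 _) (Nat.cast_nonneg K))]
      exact min_le_right _ _
    · refine le_trans (integral_mono_of_nonneg (ae_of_all _ fun ω => ?_)
        (hWi (clock γ (θ + (0 : ℚ≥0)))) (ae_of_all _ fun ω => ?_)) ((hWR _).trans (by linarith))
      · exact le_min (hW0 _) (Nat.cast_nonneg K)
      · exact min_le_left _ _

end Chain

/-! ### A continuous modification -/

section Modification

variable {q : ℕ}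

/-- The largest dyadic number of level `n` that is at most `t`. -/
def dyadicFloor (n : ℕ) (t : ℝ≥0) : ℚ≥0 := (⌊t * 2 ^ n⌋₊ : ℚ≥0) / 2 ^ n

theorem coe_dyadicFloor (n : ℕ) (t : ℝ≥0) :
    ((dyadicFloor n t : ℚ≥0) : ℝ) = (⌊t * 2 ^ n⌋₊ : ℝ) / 2 ^ n := by
  simp [dyadicFloor]

theorem dyadicFloor_mono (n : ℕ) : Monotone (dyadicFloor n) := fun s t h => by
  unfold dyadicFloor
  gcongr

theorem coe_dyadicFloor_le (n : ℕ) (t : ℝ≥0) : ((dyadicFloor n t : ℚ≥0) : ℝ) ≤ t := by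
  rw [coe_dyadicFloor, div_le_iff₀ (by positivity)]
  exact_mod_cast Nat.floor_le (zero_le (a := t * 2 ^ n))

theorem tendsto_dyadicFloor (t : ℝ≥0) :
    Tendsto (fun n => ((dyadicFloor n t : ℚ≥0) : ℝ)) atTop (𝓝 t) := by
  have h1 : Tendsto (fun n : ℕ => (t : ℝ) - (1 / 2) ^ n) atTop (𝓝 (t - 0)) :=
    tendsto_const_nhds.sub (tendsto_pow_atTop_nhds_zero_of_lt_one (by norm_num) (by norm_num))
  rw [sub_zero] at h1
  refine tendsto_of_tendsto_of_tendsto_of_le_of_le h1 tendsto_const_nhds (fun n => ?_) fun n => ?_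
  · have h2 : (t : ℝ) * 2 ^ n < ⌊t * 2 ^ n⌋₊ + 1 := by
      exact_mod_cast Nat.lt_floor_add_one (t * 2 ^ n)
    rw [coe_dyadicFloor]
    simp only
    rw [le_div_iff₀ (by positivity), sub_mul, ← mul_pow]
    norm_num
    linarith
  · exact coe_dyadicFloor_le n t

/-- The rational paths whose increments between consecutive dyadic numbers of level `n` in `[0, n]`
are at most of the order of `(9/10)^n`. -/
def regularPaths (q : ℕ) : Set (ℚ≥0 → Vec q) :=
  {x | ∃ M : ℕ, ∀ n k : ℕ, k < n * 2 ^ n →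
    ‖x ((k + 1 : ℕ) / 2 ^ n) - x ((k : ℕ) / 2 ^ n)‖ ≤ M * (9 / 10 : ℝ) ^ n}

theorem measurableSet_regularPaths : MeasurableSet (regularPaths q) := by
  have : regularPaths q = ⋃ M : ℕ, ⋂ n : ℕ, ⋂ k : ℕ, ⋂ _ : k < n * 2 ^ n,
      {x | ‖x ((k + 1 : ℕ) / 2 ^ n) - x ((k : ℕ) / 2 ^ n)‖ ≤ M * (9 / 10 : ℝ) ^ n} := by
    ext x; simp [regularPaths]
  rw [this]
  refine MeasurableSet.iUnion fun M => MeasurableSet.iInter fun n => MeasurableSet.iInter fun k =>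
    MeasurableSet.iInter fun _ => (isClosed_le ?_ continuous_const).measurableSet
  fun_prop

variable {ℓ : ℕ} {b : Vec q → Vec q} {σ : Vec q → Vec ℓ →L[ℝ] Vec q}
  {μ : Measure (ℚ≥0 → Vec q)} {C : ℝ}

/-- A Borel–Cantelli argument: if the sums over `k` of the means of `D_{n,k}` are at most `a_n c_n`,
with `∑ c_n < ∞`, then almost surely `D_{n,k} = O(a_n)` uniformly in `k`. -/
theorem ae_exists_forall_le_of_lintegral_sum_le {α : Type*} {mα : MeasurableSpace α}
    {μ : Measure α} {D : ℕ → ℕ → α → ℝ} (hD : ∀ n k, Measurable (D n k)) {K : ℕ → ℕ} {a c : ℕ → ℝ}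
    (ha : ∀ n, 0 < a n) (hc0 : ∀ n, 0 ≤ c n) (hc : Summable c)
    (hinc : ∀ n, ∑ k ∈ Finset.range (K n), ∫⁻ x, ENNReal.ofReal (D n k x) ∂μ
      ≤ ENNReal.ofReal (a n * c n)) :
    ∀ᵐ x ∂μ, ∃ M : ℕ, ∀ n k : ℕ, k < K n → D n k x ≤ M * a n := by
  have hm : ∀ n k : ℕ, Measurable fun x => ENNReal.ofReal (D n k x) := fun n k =>
    (hD n k).ennreal_ofReal
  obtain ⟨S, hS⟩ : ∃ S : ℕ → α → ℝ≥0∞, ∀ n x, S n x = ENNReal.ofReal (a n)⁻¹ *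
    ∑ k ∈ Finset.range (K n), ENNReal.ofReal (D n k x) := ⟨_, fun _ _ => rfl⟩
  have hSm : ∀ n, Measurable (S n) := fun n => by
    rw [funext (hS n)]
    exact (Finset.measurable_sum _ fun k _ => hm n k).const_mul _
  have hSi : ∀ n, ∫⁻ x, S n x ∂μ ≤ ENNReal.ofReal (c n) := by
    intro n
    rw [lintegral_congr (hS n), lintegral_const_mul _ (Finset.measurable_sum _ fun k _ => hm n k),
      lintegral_finsetSum _ fun k _ => hm n k]
    refine (mul_le_mul_right (hinc n) _).trans (le_of_eq ?_)
    rw [← ENNReal.ofReal_mul (inv_nonneg.2 (ha n).le), inv_mul_cancel_left₀ (ha n).ne']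
  have hfin : ∫⁻ x, ∑' n, S n x ∂μ ≠ ∞ := by
    rw [lintegral_tsum fun n => (hSm n).aemeasurable]
    refine ne_top_of_le_ne_top ?_ (ENNReal.tsum_le_tsum hSi)
    rw [← ENNReal.ofReal_tsum_of_nonneg hc0 hc]
    exact ENNReal.ofReal_ne_top
  filter_upwards [ae_lt_top (Measurable.tsum hSm) hfin] with x hx
  obtain ⟨M, hM⟩ := exists_nat_ge (∑' n, S n x).toReal
  refine ⟨M, fun n k hk => ?_⟩
  have h1 : S n x ≤ ENNReal.ofReal M := (ENNReal.le_tsum n).trans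
    ((ENNReal.le_ofReal_iff_toReal_le hx.ne (Nat.cast_nonneg M)).2 hM)
  have h2 : ENNReal.ofReal (a n)⁻¹ * ENNReal.ofReal (D n k x) ≤ ENNReal.ofReal M := by
    refine le_trans ?_ h1
    rw [hS]
    exact mul_le_mul_right (Finset.single_le_sum (f := fun k : ℕ => ENNReal.ofReal (D n k x))
      (fun _ _ => zero_le) (Finset.mem_range.2 hk)) _
  rw [← ENNReal.ofReal_mul (inv_nonneg.2 (ha n).le),
    ENNReal.ofReal_le_ofReal_iff (Nat.cast_nonneg M), inv_mul_le_iff₀ (ha n), mul_comm] at h2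
  exact h2

/-- Kolmogorov's criterion: there are `n 2^n` increments of level `n`, and their moments of order
four are of the order of `4^{-n}`, so that these moments are summable against `(9/10)^{-4n}`. -/
theorem IsRationalSolution.ae_mem_regularPaths (h : IsRationalSolution b σ μ C) :
    ∀ᵐ x ∂μ, x ∈ regularPaths q := by
  -- `5000 / 6561 = 2 (1/4) (10/9)^4`: number of increments, their fourth moment, their allowed size.
  have hr : ‖(5000 / 6561 : ℝ)‖ < 1 := by
    rw [Real.norm_of_nonneg (by norm_num)]
    norm_num
  have hsum : Summable fun n : ℕ => |C| * ((n : ℝ) ^ 1 * (5000 / 6561 : ℝ) ^ n) :=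
    Summable.mul_left |C| (summable_pow_mul_geometric_of_norm_lt_one 1 hr)
  have key := ae_exists_forall_le_of_lintegral_sum_le (μ := μ) (K := fun n => n * 2 ^ n)
    (a := fun n => ((9 / 10 : ℝ) ^ n) ^ 4)
    (D := fun n k (x : ℚ≥0 → Vec q) => ‖x ((k + 1 : ℕ) / 2 ^ n) - x ((k : ℕ) / 2 ^ n)‖ ^ 4)
    (fun n k => ?_) (fun n => by positivity) (fun n => by positivity) hsum fun n => ?_
  · filter_upwards [key] with x hx
    obtain ⟨M, hM⟩ := hx
    rw [regularPaths, Set.mem_ofPred_eq]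
    refine ⟨M + 1, fun n k hk => ?_⟩
    have hM' := hM n k hk
    generalize ‖x ((k + 1 : ℕ) / 2 ^ n) - x ((k : ℕ) / 2 ^ n)‖ = a at hM' ⊢
    refine le_of_pow_le_pow_left₀ (n := 4) (by norm_num) (by positivity) ?_
    have h3 : (M : ℝ) ≤ ((M + 1 : ℕ) : ℝ) ^ 4 := by
      exact_mod_cast M.le_succ.trans (Nat.le_self_pow (by norm_num) _)
    rw [mul_pow]
    exact hM'.trans (mul_le_mul_of_nonneg_right h3 (by positivity))
  · have : Continuous fun x : ℚ≥0 → Vec q =>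
      ‖x ((k + 1 : ℕ) / 2 ^ n) - x ((k : ℕ) / 2 ^ n)‖ ^ 4 := by fun_prop
    exact this.measurable
  · have hinc : ∀ k : ℕ, ∫⁻ x, ENNReal.ofReal
        (‖x ((k + 1 : ℕ) / 2 ^ n) - x ((k : ℕ) / 2 ^ n)‖ ^ 4) ∂μ
        ≤ ENNReal.ofReal (|C| * (1 / 4) ^ n) := by
      intro k
      have h1 : (((k + 1 : ℕ) / 2 ^ n : ℚ≥0) : ℝ) - (((k : ℕ) / 2 ^ n : ℚ≥0) : ℝ)
          = (1 / 2) ^ n := by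
        push_cast
        rw [← sub_div, add_sub_cancel_left, one_div_pow]
      have h2 : ((1 : ℝ) / 2) ^ n ≤ 1 := pow_le_one₀ (by norm_num) (by norm_num)
      have := h.pow_four ((k : ℕ) / 2 ^ n) ((k + 1 : ℕ) / 2 ^ n) (by gcongr; omega) (by linarith)
      rw [h1, ← pow_mul, mul_comm n 2, pow_mul, show ((1 : ℝ) / 2) ^ 2 = 1 / 4 by norm_num] at this
      exact this.trans
        (ENNReal.ofReal_le_ofReal (mul_le_mul_of_nonneg_right (le_abs_self C) (by positivity)))
    refine (Finset.sum_le_sum fun k _ => hinc k).trans (le_of_eq ?_)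
    rw [Finset.sum_const, Finset.card_range, nsmul_eq_mul, ← ENNReal.ofReal_natCast,
      ← ENNReal.ofReal_mul (by positivity)]
    congr 1
    push_cast
    have h5 : (5000 / 6561 : ℝ) ^ n = ((10 / 9) ^ n) ^ 4 * 2 ^ n * (1 / 4) ^ n := by
      rw [← pow_mul, mul_comm n 4, pow_mul, ← mul_pow, ← mul_pow]
      congr 1
      norm_num
    have h4 : ((9 / 10 : ℝ) ^ n) ^ 4 * ((10 / 9) ^ n) ^ 4 = 1 := by
      rw [← mul_pow, ← mul_pow, show (9 / 10 : ℝ) * (10 / 9) = 1 by norm_num, one_pow, one_pow]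
    rw [h5]
    linear_combination (- (n : ℝ) * 2 ^ n * |C| * (1 / 4) ^ n) * h4

/-- The extension to all times of a regular rational path, and zero for the other paths. -/
def extension (t : ℝ≥0) (x : ℚ≥0 → Vec q) : Vec q :=
  limUnder atTop fun n => (regularPaths q).indicator (fun x => x (dyadicFloor n t)) x

/-- Rate of convergence of the dyadic approximations of a regular path, uniform in bounded time. -/
theorem norm_dyadicFloor_succ_sub_le {x : ℚ≥0 → Vec q} {M : ℕ}
    (hx : ∀ n k : ℕ, k < n * 2 ^ n →
      ‖x ((k + 1 : ℕ) / 2 ^ n) - x ((k : ℕ) / 2 ^ n)‖ ≤ M * (9 / 10 : ℝ) ^ n)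
    {t : ℝ≥0} {n : ℕ} (ht : t < n) :
    ‖x (dyadicFloor (n + 1) t) - x (dyadicFloor n t)‖ ≤ M * (9 / 10 : ℝ) ^ n := by
  obtain ⟨k, hk⟩ : ∃ k, k = ⌊t * 2 ^ n⌋₊ := ⟨_, rfl⟩
  have h1 : (k : ℝ≥0) ≤ t * 2 ^ n := hk ▸ Nat.floor_le zero_le
  have h2 : t * 2 ^ n < k + 1 := hk ▸ Nat.lt_floor_add_one _
  have hkn : k < n * 2 ^ n := by
    have : (k : ℝ≥0) < n * 2 ^ n := h1.trans_lt (by gcongr)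
    exact_mod_cast this
  have h3 : 2 * k ≤ ⌊t * 2 ^ (n + 1)⌋₊ := by
    apply Nat.le_floor
    push_cast
    calc (2 : ℝ≥0) * k ≤ 2 * (t * 2 ^ n) := by gcongr
      _ = _ := by ring
  have h4 : ⌊t * 2 ^ (n + 1)⌋₊ < 2 * k + 2 := by
    rw [Nat.floor_lt zero_le]
    push_cast
    calc t * 2 ^ (n + 1) = 2 * (t * 2 ^ n) := by ring
      _ < 2 * (k + 1) := by gcongr
      _ = _ := by ring
  have hmono : M * (9 / 10 : ℝ) ^ (n + 1) ≤ M * (9 / 10 : ℝ) ^ n :=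
    mul_le_mul_of_nonneg_left (pow_le_pow_of_le_one (by norm_num) (by norm_num) n.le_succ)
      (Nat.cast_nonneg M)
  have h5 : dyadicFloor n t = ((2 * k : ℕ) : ℚ≥0) / 2 ^ (n + 1) := by
    rw [dyadicFloor, ← hk, pow_succ]
    push_cast
    field_simp
  rcases (by omega : ⌊t * 2 ^ (n + 1)⌋₊ = 2 * k ∨ ⌊t * 2 ^ (n + 1)⌋₊ = 2 * k + 1) with h | h
  · rw [h5, dyadicFloor, h, sub_self, norm_zero]
    positivity
  · rw [h5, dyadicFloor, h]
    refine (hx (n + 1) (2 * k) ?_).trans hmono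
    calc 2 * k < 2 * (n * 2 ^ n) := by omega
      _ = n * 2 ^ (n + 1) := by ring
      _ ≤ (n + 1) * 2 ^ (n + 1) := by gcongr; omega

/-- Along a regular path the dyadic values below `t` form a Cauchy sequence; the constant `10` is
`∑ (9/10)^k`. -/
theorem exists_limit_dyadicFloor {x : ℚ≥0 → Vec q} {M : ℕ}
    (hx : ∀ n k : ℕ, k < n * 2 ^ n →
      ‖x ((k + 1 : ℕ) / 2 ^ n) - x ((k : ℕ) / 2 ^ n)‖ ≤ M * (9 / 10 : ℝ) ^ n) (t : ℝ≥0) :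
    ∃ a, Tendsto (fun n => x (dyadicFloor n t)) atTop (𝓝 a) ∧
      ∀ n : ℕ, t < n → dist (x (dyadicFloor n t)) a ≤ 10 * M * (9 / 10 : ℝ) ^ n := by
  have key : ∀ n : ℕ, t < n → ∀ j : ℕ,
      dist (x (dyadicFloor (j + n) t)) (x (dyadicFloor (j + 1 + n) t))
        ≤ M * (9 / 10 : ℝ) ^ n * (9 / 10 : ℝ) ^ j := by
    intro n hn j
    have h1 := norm_dyadicFloor_succ_sub_le hx (t := t) (n := j + n)
      (hn.trans_le (by push_cast; exact le_add_self))
    rw [dist_comm, dist_eq_norm, show j + 1 + n = j + n + 1 by ring]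
    refine h1.trans (le_of_eq ?_)
    rw [pow_add]; ring
  obtain ⟨n₀, hn₀⟩ := exists_nat_gt t
  obtain ⟨a, ha⟩ := cauchySeq_tendsto_of_complete
    (cauchySeq_of_le_geometric _ _ (by norm_num) (key n₀ hn₀))
  have ha' : Tendsto (fun n => x (dyadicFloor n t)) atTop (𝓝 a) := (tendsto_add_atTop_iff_nat n₀).1 ha
  refine ⟨a, ha', fun n hn => ?_⟩
  have := dist_le_of_le_geometric_of_tendsto₀ _ _ (by norm_num) (key n hn)
    ((tendsto_add_atTop_iff_nat n).2 ha')
  rw [zero_add] at this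
  refine this.trans (le_of_eq ?_)
  ring

/-- The limit in the definition of the extension exists for every path. -/
theorem tendsto_extension (t : ℝ≥0) (x : ℚ≥0 → Vec q) :
    Tendsto (fun n => (regularPaths q).indicator (fun x => x (dyadicFloor n t)) x) atTop
      (𝓝 (extension t x)) := by
  apply tendsto_nhds_limUnder
  by_cases h : x ∈ regularPaths q
  · obtain ⟨M, hM⟩ := h
    obtain ⟨a, ha, -⟩ := exists_limit_dyadicFloor hM t
    refine ⟨a, ?_⟩
    simpa only [Set.indicator_of_mem (show x ∈ regularPaths q from ⟨M, hM⟩)] using ha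
  · refine ⟨0, ?_⟩
    simpa only [Set.indicator_of_notMem h] using tendsto_const_nhds

theorem measurable_extension (t : ℝ≥0) : Measurable (extension (q := q) t) :=
  measurable_of_tendsto_metrizable
    (fun n => (measurable_pi_apply (dyadicFloor n t)).indicator measurableSet_regularPaths)
    (tendsto_pi_nhds.2 fun x => tendsto_extension t x)

/-- Chaining: two times at distance at most `2^{-n}` have dyadic approximations of level `n` that are
equal or consecutive. -/
theorem continuous_extension (x : ℚ≥0 → Vec q) : Continuous fun t => extension t x := by
  by_cases h : x ∈ regularPaths q
  swap
  · have : ∀ t, extension t x = 0 := fun t => by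
      refine tendsto_nhds_unique (tendsto_extension t x) ?_
      simpa only [Set.indicator_of_notMem h] using tendsto_const_nhds
    simp only [this]
    exact continuous_const
  obtain ⟨M, hM⟩ := h
  have hext : ∀ (t : ℝ≥0) (n : ℕ), t < n →
      dist (x (dyadicFloor n t)) (extension t x) ≤ 10 * M * (9 / 10 : ℝ) ^ n := by
    intro t n hn
    obtain ⟨a, ha, hb⟩ := exists_limit_dyadicFloor hM t
    have h1 := tendsto_extension t x
    simp only [Set.indicator_of_mem (show x ∈ regularPaths q from ⟨M, hM⟩)] at h1
    rw [tendsto_nhds_unique h1 ha]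
    exact hb n hn
  -- `21 = 10 + 1 + 10`: two approximations and one dyadic increment.
  have hinc : ∀ (s t : ℝ≥0) (n : ℕ), s ≤ t → t * 2 ^ n ≤ s * 2 ^ n + 1 → t < n →
      dist (extension s x) (extension t x) ≤ 21 * M * (9 / 10 : ℝ) ^ n := by
    intro s t n hst hts hn
    have h1 := hext s n (hst.trans_lt hn)
    have h2 := hext t n hn
    have h3 : dist (x (dyadicFloor n s)) (x (dyadicFloor n t)) ≤ M * (9 / 10 : ℝ) ^ n := by
      have e1 : ⌊s * 2 ^ n⌋₊ ≤ ⌊t * 2 ^ n⌋₊ := Nat.floor_le_floor (by gcongr)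
      have e2 : ⌊t * 2 ^ n⌋₊ ≤ ⌊s * 2 ^ n⌋₊ + 1 := by
        rw [← Nat.floor_add_one zero_le]
        exact Nat.floor_le_floor hts
      rcases (by omega : ⌊t * 2 ^ n⌋₊ = ⌊s * 2 ^ n⌋₊ ∨ ⌊t * 2 ^ n⌋₊ = ⌊s * 2 ^ n⌋₊ + 1) with e | e
      · rw [dyadicFloor, dyadicFloor, e, dist_self]
        positivity
      · rw [dyadicFloor, dyadicFloor, e, dist_comm, dist_eq_norm]
        refine hM n _ ?_
        have : ((⌊s * 2 ^ n⌋₊ : ℕ) : ℝ≥0) < n * 2 ^ n :=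
          (Nat.floor_le zero_le).trans_lt (by gcongr; exact hst.trans_lt hn)
        exact_mod_cast this
    have h4 := dist_triangle4 (extension s x) (x (dyadicFloor n s)) (x (dyadicFloor n t))
      (extension t x)
    rw [dist_comm (extension s x) (x _)] at h4
    linarith
  rw [Metric.continuous_iff]
  intro t ε hε
  have hlim : Tendsto (fun n : ℕ => 21 * M * (9 / 10 : ℝ) ^ n) atTop (𝓝 (21 * M * 0)) :=
    tendsto_const_nhds.mul (tendsto_pow_atTop_nhds_zero_of_lt_one (by norm_num) (by norm_num))
  rw [mul_zero] at hlim
  obtain ⟨n₀, hn₀⟩ := exists_nat_gt (t + 1)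
  obtain ⟨n, hn, hnn⟩ := ((hlim.eventually (gt_mem_nhds hε)).and (eventually_ge_atTop n₀)).exists
  have hn' : t + 1 < n := hn₀.trans_le (by exact_mod_cast hnn)
  refine ⟨(1 / 2) ^ n, by positivity, fun s hs => ?_⟩
  rw [NNReal.dist_eq] at hs
  have h12 : ((1 : ℝ) / 2) ^ n ≤ 1 := pow_le_one₀ (by norm_num) (by norm_num)
  have h1 : ∀ u v : ℝ≥0, |(u : ℝ) - v| < (1 / 2) ^ n → u * 2 ^ n ≤ v * 2 ^ n + 1 := by
    intro u v huv
    have : (u : ℝ) * 2 ^ n ≤ v * 2 ^ n + 1 := by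
      have e1 : (u : ℝ) - v < (1 / 2) ^ n := (abs_lt.1 huv).2
      have e2 : ((1 : ℝ) / 2) ^ n * 2 ^ n = 1 := by rw [← mul_pow]; norm_num
      have e3 : ((u : ℝ) - v) * 2 ^ n ≤ (1 / 2) ^ n * 2 ^ n := by gcongr
      linarith
    exact_mod_cast this
  rcases le_total s t with hst | hst
  · refine (hinc s t n hst (h1 t s ?_) ((lt_add_one t).trans hn')).trans_lt hn
    rwa [abs_sub_comm]
  · rw [dist_comm]
    refine (hinc t s n hst (h1 s t hs) ?_).trans_lt hn
    refine lt_of_le_of_lt ?_ hn'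
    have : (s : ℝ) ≤ t + 1 := by linarith [(abs_lt.1 hs).2]
    exact_mod_cast this

theorem IsRationalSolution.ae_tendsto_extension (h : IsRationalSolution b σ μ C) :
    ∀ᵐ x ∂μ, ∀ t : ℝ≥0, Tendsto (fun n => x (dyadicFloor n t)) atTop (𝓝 (extension t x)) := by
  filter_upwards [h.ae_mem_regularPaths] with x hx t
  simpa only [Set.indicator_of_mem hx] using tendsto_extension t x

/-- Stationarity passes from rational to real times. -/
theorem IsRationalSolution.map_extension (h : IsRationalSolution b σ μ C) (t : ℝ≥0) :
    μ.map (extension t) = μ.map fun x => x 0 := by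
  have := h.isProbabilityMeasure
  have h0 : Measurable fun x : ℚ≥0 → Vec q => x 0 := measurable_pi_apply 0
  have := Measure.isProbabilityMeasure_map (measurable_extension (q := q) t).aemeasurable (μ := μ)
  have := Measure.isProbabilityMeasure_map h0.aemeasurable (μ := μ)
  refine ext_of_forall_integral_eq_of_IsFiniteMeasure fun f => ?_
  have hfm := f.continuous.measurable
  rw [integral_map (measurable_extension t).aemeasurable hfm.aestronglyMeasurable]
  have h1 : Tendsto (fun n => ∫ x, f (x (dyadicFloor n t)) ∂μ) atTop
      (𝓝 (∫ x, f (extension t x) ∂μ)) := by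
    refine tendsto_integral_of_dominated_convergence (fun _ => ‖f‖)
      (fun n => (hfm.comp (measurable_pi_apply (dyadicFloor n t))).aestronglyMeasurable)
      (integrable_const _)
      (fun n => ae_of_all _ fun x => f.norm_coe_le_norm _) ?_
    filter_upwards [h.ae_tendsto_extension] with x hx
    exact (f.continuous.tendsto _).comp (hx t)
  refine tendsto_nhds_unique h1 (tendsto_const_nhds.congr fun n => ?_)
  rw [← h.stationary (dyadicFloor n t),
    integral_map (measurable_pi_apply (dyadicFloor n t)).aemeasurable hfm.aestronglyMeasurable]

end Modification


/-! ### The martingale problem for a continuous process -/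

section MartingaleProblem

variable {q : ℕ} {α : Type*} {mα : MeasurableSpace α} {μ : Measure α} {X : ℝ≥0 → α → Vec q}
  {g G : Vec q → ℝ} {M M' : ℝ}

/-- Joint measurability of a stopped continuous process. Stopping at `T` keeps all its values
measurable with respect to the past of `T`. -/
theorem stronglyMeasurable_uncurry_comp {m : MeasurableSpace α} (hXm : ∀ t, Measurable[m] (X t))
    (hXc : ∀ ω, Continuous fun t => X t ω) (hG : Continuous G) (T : ℝ≥0) :
    StronglyMeasurable[Prod.instMeasurableSpace (m₂ := m)]
      (Function.uncurry fun (r : ℝ) ω => G (X (min r.toNNReal T) ω)) := by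
  refine stronglyMeasurable_uncurry_of_continuous_of_stronglyMeasurable (fun ω => ?_) fun r => ?_
  · exact hG.comp ((hXc ω).comp (continuous_real_toNNReal.min continuous_const))
  · exact (hG.measurable.comp (hXm _)).stronglyMeasurable

/-- The time integral up to `t` is measurable with respect to the past of `t`. -/
theorem stronglyMeasurable_integral_comp {m : MeasurableSpace α} {s t : ℝ≥0} (hst : s ≤ t)
    (hXm : ∀ r ≤ t, Measurable[m] (X r)) (hXc : ∀ ω, Continuous fun t => X t ω)
    (hG : Continuous G) :
    StronglyMeasurable[m] fun ω => ∫ r in (s : ℝ)..t, G (X r.toNNReal ω) := by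
  have h1 := stronglyMeasurable_uncurry_comp (X := fun r => X (min r t)) (m := m)
    (fun r => hXm _ (min_le_right _ _))
    (fun ω => (hXc ω).comp (continuous_id.min continuous_const)) hG t
  have h2 := h1.integral_prod_left (μ := (volume : Measure ℝ).restrict (Set.Ioc (s : ℝ) t))
  convert h2 using 2 with ω
  rw [intervalIntegral.integral_of_le (by exact_mod_cast hst)]
  refine setIntegral_congr_fun measurableSet_Ioc fun r hr => ?_
  have : r.toNNReal ≤ t := Real.toNNReal_le_iff_le_coe.2 hr.2
  simp only [min_eq_left this]

theorem abs_integral_comp_le {s t : ℝ≥0} (hst : s ≤ t) (hGM : ∀ y, |G y| ≤ M') (ω : α) :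
    |∫ r in (s : ℝ)..t, G (X r.toNNReal ω)| ≤ M' * ((t : ℝ) - s) := by
  have h1 : (s : ℝ) ≤ t := by exact_mod_cast hst
  have := intervalIntegral.norm_integral_le_of_norm_le_const (a := (s : ℝ)) (b := t) (C := M')
    (f := fun r => G (X r.toNNReal ω)) fun r _ => hGM _
  rwa [abs_of_nonneg (sub_nonneg.2 h1)] at this

theorem integral_sub_sub {f₁ f₂ f₃ : α → ℝ} (h₁ : Integrable f₁ μ) (h₂ : Integrable f₂ μ)
    (h₃ : Integrable f₃ μ) :
    ∫ ω, (f₁ ω - f₂ ω - f₃ ω) ∂μ = ∫ ω, f₁ ω ∂μ - ∫ ω, f₂ ω ∂μ - ∫ ω, f₃ ω ∂μ := by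
  have h : Integrable (fun ω => f₁ ω - f₂ ω) μ := h₁.sub h₂
  rw [integral_sub h h₃, integral_sub h₁ h₂]

/-- If the increments of `g (X)` over short intervals are those of a process with drift `G (X)`, up
to an error that is small with respect to the duration, then there is no error: the function
`r ↦ E (g (X r) H)` has the right derivative `E (G (X r) H)`. -/
theorem integral_increment_eq_zero [IsProbabilityMeasure μ] (hXm : ∀ t, Measurable (X t))
    (hXc : ∀ ω, Continuous fun t => X t ω) (hg : Continuous g) (hgM : ∀ y, |g y| ≤ M)
    (hG : Continuous G) (hGM : ∀ y, |G y| ≤ M') {s t : ℝ≥0} (hst : s ≤ t) {H : α → ℝ}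
    (hHm : Measurable H) (hH1 : ∀ ω, |H ω| ≤ 1)
    (hloc : ∀ ε > 0, ∃ r > 0, ∀ s' t' : ℝ≥0, s ≤ s' → s' ≤ t' → (t' : ℝ) < s' + r →
      |∫ ω, (g (X t' ω) - g (X s' ω) - ((t' : ℝ) - s') * G (X s' ω)) * H ω ∂μ|
        ≤ ε * ((t' : ℝ) - s')) :
    ∫ ω, (g (X t ω) - g (X s ω) - ∫ r in (s : ℝ)..t, G (X r.toNNReal ω)) * H ω ∂μ = 0 := by
  have hst' : (s : ℝ) ≤ t := by exact_mod_cast hst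
  have hM'0 : 0 ≤ M' := (abs_nonneg _).trans (hGM 0)
  have hint : ∀ {f : Vec q → ℝ} {K : ℝ}, Continuous f → (∀ y, |f y| ≤ K) → ∀ r,
      Integrable (fun ω => f (X r ω) * H ω) μ := by
    intro f K hf hK r
    refine Integrable.of_bound ((hf.measurable.comp (hXm r)).mul hHm).aestronglyMeasurable K
      (ae_of_all _ fun ω => ?_)
    rw [Real.norm_eq_abs, abs_mul]
    exact (mul_le_of_le_one_right (abs_nonneg _) (hH1 ω)).trans (hK _)
  have hcont : ∀ {f : Vec q → ℝ} {K : ℝ}, Continuous f → (∀ y, |f y| ≤ K) →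
      Continuous fun r : ℝ => ∫ ω, f (X r.toNNReal ω) * H ω ∂μ := by
    intro f K hf hK
    refine continuous_of_dominated (bound := fun _ => K) (fun r => (hint hf hK _).1)
      (fun r => ae_of_all _ fun ω => ?_) (integrable_const _) (ae_of_all _ fun ω => ?_)
    · rw [Real.norm_eq_abs, abs_mul]
      exact (mul_le_of_le_one_right (abs_nonneg _) (hH1 ω)).trans (hK _)
    · exact (hf.comp ((hXc ω).comp continuous_real_toNNReal)).mul continuous_const
  have hlin : ∀ s' t' : ℝ≥0,
      ∫ ω, (g (X t' ω) - g (X s' ω) - ((t' : ℝ) - s') * G (X s' ω)) * H ω ∂μ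
        = ∫ ω, g (X t' ω) * H ω ∂μ - ∫ ω, g (X s' ω) * H ω ∂μ
          - ((t' : ℝ) - s') * ∫ ω, G (X s' ω) * H ω ∂μ := by
    intro s' t'
    rw [← integral_const_mul, ← integral_sub_sub (hint hg hgM t') (hint hg hgM s')
      ((hint hG hGM s').const_mul _)]
    refine integral_congr_ae (ae_of_all _ fun ω => ?_)
    ring
  -- By the local hypothesis, the right derivative of `r ↦ 𝔼[g(X_r) H]` is `𝔼[G(X_r) H]`.
  have hftc := intervalIntegral.integral_eq_sub_of_hasDeriv_right_of_le_real hst'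
    (g := fun r : ℝ => ∫ ω, g (X r.toNNReal ω) * H ω ∂μ)
    (g' := fun r : ℝ => ∫ ω, G (X r.toNNReal ω) * H ω ∂μ)
    (hcont hg hgM).continuousOn (fun r hr => ?_)
    ((hcont hG hGM).continuousOn.integrableOn_Icc)
  · simp only [Real.toNNReal_coe] at hftc
    have hswap : ∫ r in (s : ℝ)..t, ∫ ω, G (X r.toNNReal ω) * H ω ∂μ
        = ∫ ω, (∫ r in (s : ℝ)..t, G (X r.toNNReal ω)) * H ω ∂μ := by
      rw [intervalIntegral.integral_of_le hst']
      have h1 : ∀ r ∈ Set.Ioc (s : ℝ) t, ∫ ω, G (X r.toNNReal ω) * H ω ∂μ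
          = ∫ ω, G (X (min r.toNNReal t) ω) * H ω ∂μ := fun r hr => by
        rw [min_eq_left (Real.toNNReal_le_iff_le_coe.2 hr.2)]
      rw [setIntegral_congr_fun measurableSet_Ioc h1, integral_integral_swap]
      · refine integral_congr_ae (ae_of_all _ fun ω => ?_)
        beta_reduce
        rw [integral_mul_const, intervalIntegral.integral_of_le hst']
        congr 1
        refine setIntegral_congr_fun measurableSet_Ioc fun r hr => ?_
        rw [min_eq_left (Real.toNNReal_le_iff_le_coe.2 hr.2)]
      · have h2 := (stronglyMeasurable_uncurry_comp hXm hXc hG t).measurable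
        refine Integrable.of_bound (C := M')
          (h2.mul (hHm.comp measurable_snd)).aestronglyMeasurable (ae_of_all _ fun z => ?_)
        rw [Real.norm_eq_abs]
        refine (abs_mul _ _).le.trans
          ((mul_le_of_le_one_right (abs_nonneg _) (hH1 _)).trans (hGM _))
    rw [hswap] at hftc
    have hI : Integrable (fun ω => (∫ r in (s : ℝ)..t, G (X r.toNNReal ω)) * H ω) μ := by
      refine Integrable.of_bound (((stronglyMeasurable_integral_comp hst (fun r _ => hXm r) hXc
        hG).measurable.mul hHm).aestronglyMeasurable) (M' * ((t : ℝ) - s))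
        (ae_of_all _ fun ω => ?_)
      rw [Real.norm_eq_abs, abs_mul]
      exact (mul_le_of_le_one_right (abs_nonneg _) (hH1 ω)).trans (abs_integral_comp_le hst hGM ω)
    have e1 : ∫ ω, (g (X t ω) - g (X s ω) - ∫ r in (s : ℝ)..t, G (X r.toNNReal ω)) * H ω ∂μ
        = ∫ ω, g (X t ω) * H ω ∂μ - ∫ ω, g (X s ω) * H ω ∂μ
          - ∫ ω, (∫ r in (s : ℝ)..t, G (X r.toNNReal ω)) * H ω ∂μ := by
      rw [← integral_sub_sub (hint hg hgM t) (hint hg hgM s) hI]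
      refine integral_congr_ae (ae_of_all _ fun ω => ?_)
      ring
    rw [e1, hftc, sub_self]
  · rw [hasDerivWithinAt_iff_isLittleO, isLittleO_iff]
    intro ε hε
    obtain ⟨ρ, hρ, hloc⟩ := hloc ε hε
    have h0 : 0 ≤ r := s.2.trans hr.1.le
    filter_upwards [Ioo_mem_nhdsGT (lt_add_of_pos_right r hρ)] with y hy
    have hy0 : 0 ≤ y := h0.trans hy.1.le
    have h1 := hloc r.toNNReal y.toNNReal (Real.le_toNNReal_iff_coe_le h0 |>.2 hr.1.le)
      (Real.toNNReal_le_toNNReal hy.1.le)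
      (by rw [Real.coe_toNNReal _ h0, Real.coe_toNNReal _ hy0]; exact hy.2)
    rw [hlin, Real.coe_toNNReal _ h0, Real.coe_toNNReal _ hy0] at h1
    rw [smul_eq_mul, Real.norm_eq_abs, Real.norm_of_nonneg (sub_nonneg.2 hy.1.le)]
    exact h1

/-- A bounded function whose integral against every bounded continuous function of `Z` vanishes has
a vanishing integral over every event that `Z` determines. -/
theorem setIntegral_eq_zero_of_forall_continuous [IsProbabilityMeasure μ] {F : Type*}
    [TopologicalSpace F] [MeasurableSpace F] [BorelSpace F] [HasOuterApproxClosed F]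
    {Z : α → F} (hZ : Measurable Z) {D : α → ℝ} (hD : Measurable D) {K : ℝ} (hDK : ∀ ω, |D ω| ≤ K)
    (h : ∀ f : F → ℝ, Continuous f → (∀ z, |f z| ≤ 1) → ∫ ω, D ω * f (Z ω) ∂μ = 0)
    {A : Set F} (hA : MeasurableSet A) : ∫ ω in Z ⁻¹' A, D ω ∂μ = 0 := by
  have hDi : Integrable D μ := Integrable.of_bound hD.aestronglyMeasurable K (ae_of_all _ hDK)
  have hrep : ∀ {d : α → ℝ≥0} (hd : Measurable d) {f : F → ℝ} (hf : Measurable f),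
      ∫ z, f z ∂((μ.withDensity fun ω => (d ω : ℝ≥0∞)).map Z) = ∫ ω, (d ω : ℝ) * f (Z ω) ∂μ := by
    intro d hd f hf
    rw [integral_map hZ.aemeasurable hf.aestronglyMeasurable,
      integral_withDensity_eq_integral_smul hd]
    rfl
  -- `D + K` and `K` are nonnegative densities; the images of the two finite measures under `Z`
  -- have the same integrals of bounded continuous functions.
  have hd1 : Measurable fun ω => (D ω + K).toNNReal := (hD.add_const K).real_toNNReal
  have hd2 : Measurable fun _ : α => K.toNNReal := measurable_const
  have hcoe1 : ∀ ω, ((D ω + K).toNNReal : ℝ) = D ω + K := fun ω =>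
    Real.coe_toNNReal _ (by linarith [(abs_le.1 (hDK ω)).1])
  have hcoe2 : ∀ ω : α, (K.toNNReal : ℝ) = K := fun ω =>
    Real.coe_toNNReal _ ((abs_nonneg _).trans (hDK ω))
  have hfin1 : IsFiniteMeasure (μ.withDensity fun ω => ((D ω + K).toNNReal : ℝ≥0∞)) :=
    isFiniteMeasure_withDensity_ofReal (hDi.add (integrable_const K)).2
  have hfin2 : IsFiniteMeasure (μ.withDensity fun _ => (K.toNNReal : ℝ≥0∞)) :=
    isFiniteMeasure_withDensity_ofReal (integrable_const (μ := μ) K).2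
  have heq : (μ.withDensity fun ω => ((D ω + K).toNNReal : ℝ≥0∞)).map Z
      = (μ.withDensity fun _ => (K.toNNReal : ℝ≥0∞)).map Z := by
    refine ext_of_forall_integral_eq_of_IsFiniteMeasure fun f => ?_
    have hfm := f.continuous.measurable
    rw [hrep hd1 hfm, hrep hd2 hfm]
    have hN : 0 < ‖f‖ + 1 := by positivity
    have h1 := h (fun z => f z / (‖f‖ + 1)) (f.continuous.div_const _) fun z => by
      rw [abs_div, abs_of_pos hN, div_le_one hN]
      exact (f.norm_coe_le_norm z).trans (by linarith)
    have h2 : ∫ ω, D ω * f (Z ω) ∂μ = 0 := by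
      have e : ∀ ω, D ω * (f (Z ω) / (‖f‖ + 1)) = D ω * f (Z ω) / (‖f‖ + 1) := fun ω => by ring
      simp only [e, integral_div] at h1
      exact (div_eq_zero_iff.1 h1).resolve_right hN.ne'
    have hfi : Integrable (fun ω => f (Z ω)) μ :=
      Integrable.of_bound (hfm.comp hZ).aestronglyMeasurable ‖f‖
        (ae_of_all _ fun ω => f.norm_coe_le_norm _)
    have hDf : Integrable (fun ω => D ω * f (Z ω)) μ := hDi.mul_bdd (c := ‖f‖)
      (hfm.comp hZ).aestronglyMeasurable (ae_of_all _ fun ω => f.norm_coe_le_norm _)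
    calc _ = ∫ ω, (D ω * f (Z ω) + K * f (Z ω)) ∂μ := integral_congr_ae (ae_of_all _ fun ω => by
          simp only [hcoe1]; ring)
      _ = ∫ ω, K * f (Z ω) ∂μ := by rw [integral_add hDf (hfi.const_mul K), h2, zero_add]
      _ = _ := integral_congr_ae (ae_of_all _ fun ω => by simp only [hcoe2 ω])
  have hind : Measurable (A.indicator (1 : F → ℝ)) := measurable_one.indicator hA
  have h3 := hrep hd1 hind
  rw [heq, hrep hd2 hind] at h3
  have e2 : ∀ ω, A.indicator (1 : F → ℝ) (Z ω) = (Z ⁻¹' A).indicator (1 : α → ℝ) ω := fun ω => rfl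
  have hAi : Integrable ((Z ⁻¹' A).indicator (1 : α → ℝ)) μ :=
    (integrable_const (1 : ℝ)).indicator (hZ hA)
  have e3 : ∀ ω, D ω * (Z ⁻¹' A).indicator (1 : α → ℝ) ω = (Z ⁻¹' A).indicator D ω := by
    intro ω
    by_cases hω : ω ∈ Z ⁻¹' A <;> simp [hω]
  have h4 : ∫ ω, (((D ω + K).toNNReal : ℝ) * A.indicator (1 : F → ℝ) (Z ω)) ∂μ
      = ∫ ω in Z ⁻¹' A, D ω ∂μ
        + ∫ ω, ((K.toNNReal : ℝ) * A.indicator (1 : F → ℝ) (Z ω)) ∂μ := by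
    simp only [e2]
    rw [← integral_indicator (hZ hA), ← integral_add (hDi.indicator (hZ hA)) (hAi.const_mul _)]
    refine integral_congr_ae (ae_of_all _ fun ω => ?_)
    simp only [hcoe1, hcoe2 ω, ← e3]
    ring
  linarith

/-- The events that a process determines up to time `s` are generated by the events that it
determines through finitely many times. -/
theorem setIntegral_eq_zero_of_forall_finite {D : α → ℝ} (hD : Integrable D μ) {s : ℝ≥0}
    (hXm : ∀ t, StronglyMeasurable (X t))
    (h : ∀ (ι : Type) [Finite ι] (u : ι → ℝ≥0), (∀ i, u i ≤ s) → ∀ A : Set (ι → Vec q),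
      MeasurableSet A → ∫ ω in (fun ω i => X (u i) ω) ⁻¹' A, D ω ∂μ = 0)
    {A : Set α} (hA : MeasurableSet[Filtration.natural X hXm s] A) : ∫ ω in A, D ω ∂μ = 0 := by
  have hle : Filtration.natural X hXm s ≤ mα := (Filtration.natural X hXm).le s
  have huniv : ∫ ω, D ω ∂μ = 0 := by
    have := h Empty (fun i => i.elim) (fun i => i.elim) Set.univ MeasurableSet.univ
    rwa [Set.preimage_univ, setIntegral_univ] at this
  have hgen : Filtration.natural X hXm s = MeasurableSpace.generateFrom
      (piiUnionInter (fun r => {B | MeasurableSet[MeasurableSpace.comap (X r) inferInstance] B})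
        (Set.Iic s)) :=
    (generateFrom_piiUnionInter_measurableSet
      (fun r => MeasurableSpace.comap (X r) inferInstance) (Set.Iic s)).symm
  have hpi := isPiSystem_piiUnionInter
    (fun r => {B | MeasurableSet[MeasurableSpace.comap (X r) inferInstance] B})
    (fun r => (MeasurableSpace.comap (X r) inferInstance).isPiSystem_measurableSet) (Set.Iic s)
  refine MeasurableSpace.induction_on_inter (m := Filtration.natural X hXm s)
    (C := fun A _ => ∫ ω in A, D ω ∂μ = 0) hgen hpi ?_ ?_ ?_ ?_ A hA
  · simp
  · rintro _ ⟨t, ht, f, hf, rfl⟩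
    choose! B hB hBf using hf
    have h1 := h t (fun i => i) (fun i => ht i.2) (Set.univ.pi fun i => B i)
      (MeasurableSet.univ_pi fun i => hB i i.2)
    convert h1 using 3
    ext ω
    simp only [Set.mem_iInter, Set.mem_preimage, Set.mem_univ_pi, Subtype.forall]
    refine forall₂_congr fun i hi => ?_
    rw [← hBf i hi, Set.mem_preimage]
  · intro B hB hB0
    have := integral_add_compl (hle _ hB) hD
    rw [hB0, huniv, zero_add] at this
    exact this
  · intro f hdis hf h0
    rw [integral_iUnion (fun i => hle _ (hf i)) hdis hD.integrableOn]
    simp only [h0, tsum_zero]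

/-- The local form of the martingale problem implies the martingale property. -/
theorem martingale_of_local [IsProbabilityMeasure μ] (hXm : ∀ t, StronglyMeasurable (X t))
    (hXc : ∀ ω, Continuous fun t => X t ω) (hg : Continuous g) (hgM : ∀ y, |g y| ≤ M)
    (hG : Continuous G) (hGM : ∀ y, |G y| ≤ M')
    (hloc : ∀ ε > 0, ∃ r > 0, ∀ s t : ℝ≥0, s ≤ t → (t : ℝ) < s + r →
      ∀ (ι : Type) [Finite ι] (u : ι → ℝ≥0), (∀ i, u i ≤ s) →
      ∀ f : (ι → Vec q) → ℝ, Continuous f → (∀ z, |f z| ≤ 1) →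
        |∫ ω, (g (X t ω) - g (X s ω) - ((t : ℝ) - s) * G (X s ω)) * f (fun i => X (u i) ω) ∂μ|
          ≤ ε * ((t : ℝ) - s)) :
    Martingale (fun (t : ℝ≥0) ω => g (X t ω) - g (X 0 ω)
      - ∫ r in (0 : ℝ)..t, G (X r.toNNReal ω)) (Filtration.natural X hXm) μ := by
  have hXm' : ∀ t, Measurable (X t) := fun t => (hXm t).measurable
  have hXn : ∀ {t r : ℝ≥0}, r ≤ t → Measurable[Filtration.natural X hXm t] (X r) := by
    intro t r hr
    refine measurable_iff_comap_le.2 ?_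
    exact le_iSup₂_of_le (f := fun j (_ : j ≤ t) => MeasurableSpace.comap (X j) inferInstance)
      r hr le_rfl
  have hadapt : ∀ t : ℝ≥0, StronglyMeasurable[Filtration.natural X hXm t]
      (fun ω => g (X t ω) - g (X 0 ω) - ∫ r in (0 : ℝ)..t, G (X r.toNNReal ω)) := by
    intro t
    have h1 := stronglyMeasurable_integral_comp (X := X) (s := 0) (t := t)
      (m := Filtration.natural X hXm t) (zero_le) (fun r hr => hXn hr) hXc hG
    rw [NNReal.coe_zero] at h1
    exact ((hg.measurable.comp (hXn le_rfl)).stronglyMeasurable.sub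
      (hg.measurable.comp (hXn zero_le)).stronglyMeasurable).sub h1
  have hint : ∀ t : ℝ≥0, Integrable
      (fun ω => g (X t ω) - g (X 0 ω) - ∫ r in (0 : ℝ)..t, G (X r.toNNReal ω)) μ := by
    intro t
    refine Integrable.of_bound ((hadapt t).mono ((Filtration.natural X hXm).le t)
      ).aestronglyMeasurable (M + M + M' * ((t : ℝ) - (0 : ℝ≥0))) (ae_of_all _ fun ω => ?_)
    have h1 := abs_integral_comp_le (X := X) (s := 0) (t := t) zero_le hGM ω
    rw [NNReal.coe_zero] at h1 ⊢
    have h2 := abs_sub (g (X t ω) - g (X 0 ω)) (∫ r in (0 : ℝ)..t, G (X r.toNNReal ω))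
    have h3 := abs_sub (g (X t ω)) (g (X 0 ω))
    have h4 := hgM (X t ω)
    have h5 := hgM (X 0 ω)
    rw [Real.norm_eq_abs]
    linarith
  refine ⟨hadapt, fun s t hst => ?_⟩
  have hst' : (s : ℝ) ≤ t := by exact_mod_cast hst
  refine (ae_eq_condExp_of_forall_setIntegral_eq ((Filtration.natural X hXm).le s) (hint t)
    (fun A _ _ => (hint s).integrableOn) (fun A hA _ => ?_)
    (hadapt s).aestronglyMeasurable).symm
  have hDe : ∀ ω, (g (X t ω) - g (X 0 ω) - ∫ r in (0 : ℝ)..t, G (X r.toNNReal ω))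
      - (g (X s ω) - g (X 0 ω) - ∫ r in (0 : ℝ)..s, G (X r.toNNReal ω))
      = g (X t ω) - g (X s ω) - ∫ r in (s : ℝ)..t, G (X r.toNNReal ω) := by
    intro ω
    have hc : Continuous fun r : ℝ => G (X r.toNNReal ω) :=
      hG.comp ((hXc ω).comp continuous_real_toNNReal)
    have := intervalIntegral.integral_add_adjacent_intervals
      (hc.intervalIntegrable 0 s) (hc.intervalIntegrable s t) (μ := volume)
    linarith
  have hDi : Integrable
      (fun ω => g (X t ω) - g (X s ω) - ∫ r in (s : ℝ)..t, G (X r.toNNReal ω)) μ :=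
    ((hint t).sub (hint s)).congr (ae_of_all _ hDe)
  have hDm : Measurable
      fun ω => g (X t ω) - g (X s ω) - ∫ r in (s : ℝ)..t, G (X r.toNNReal ω) :=
    ((hg.measurable.comp (hXm' t)).sub (hg.measurable.comp (hXm' s))).sub
      (stronglyMeasurable_integral_comp hst (fun r _ => hXm' r) hXc hG).measurable
  have hDb : ∀ ω, |g (X t ω) - g (X s ω) - ∫ r in (s : ℝ)..t, G (X r.toNNReal ω)|
      ≤ M + M + M' * ((t : ℝ) - s) := by
    intro ω
    have h1 := abs_integral_comp_le (X := X) hst hGM ω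
    have h2 := abs_sub (g (X t ω) - g (X s ω)) (∫ r in (s : ℝ)..t, G (X r.toNNReal ω))
    have h3 := abs_sub (g (X t ω)) (g (X s ω))
    have h4 := hgM (X t ω)
    have h5 := hgM (X s ω)
    linarith
  have h0 := setIntegral_eq_zero_of_forall_finite hDi hXm (fun ι _ u hu B hB => by
    have hZ : Measurable fun ω (i : ι) => X (u i) ω := measurable_pi_lambda _ fun i => hXm' _
    refine setIntegral_eq_zero_of_forall_continuous hZ hDm hDb (fun f hf hf1 => ?_) hB
    refine integral_increment_eq_zero hXm' hXc hg hgM hG hGM hst (hf.measurable.comp hZ)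
      (fun ω => hf1 _) fun ε hε => ?_
    obtain ⟨r, hr, hl⟩ := hloc ε hε
    exact ⟨r, hr, fun s' t' hs' hst' htr =>
      hl s' t' hst' htr ι u (fun i => (hu i).trans hs') f hf hf1⟩) hA
  have h1 : ∫ ω in A, ((g (X t ω) - g (X 0 ω) - ∫ r in (0 : ℝ)..t, G (X r.toNNReal ω))
      - (g (X s ω) - g (X 0 ω) - ∫ r in (0 : ℝ)..s, G (X r.toNNReal ω))) ∂μ = 0 := by
    simp only [hDe]
    exact h0
  rw [integral_sub (hint t).integrableOn (hint s).integrableOn] at h1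
  exact (sub_eq_zero.1 h1).symm

end MartingaleProblem


/-! ### The limit is the invariant distribution -/

section Invariance

variable {q ℓ : ℕ} {b : Vec q → Vec q} {σ : Vec q → Vec ℓ →L[ℝ] Vec q}
  {μ : Measure (ℚ≥0 → Vec q)} {C : ℝ}

/-- The local form of the martingale problem passes from rational to real times. -/
theorem IsRationalSolution.exists_integral_extension_le (h : IsRationalSolution b σ μ C)
    {g : Vec q → ℝ} (hg : ContDiff ℝ ((⊤ : ℕ∞) : WithTop ℕ∞) g) (hgs : HasCompactSupport g)
    {ε : ℝ} (hε : 0 < ε) :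
    ∃ r > 0, ∀ s t : ℝ≥0, s ≤ t → (t : ℝ) < s + r →
      ∀ (ι : Type) [Finite ι] (u : ι → ℝ≥0), (∀ i, u i ≤ s) →
      ∀ f : (ι → Vec q) → ℝ, Continuous f → (∀ z, |f z| ≤ 1) →
        ∫ x, (g (extension t x) - g (extension s x)
          - ((t : ℝ) - s) * generator b σ g (extension s x)) * f (fun i => extension (u i) x) ∂μ
          ≤ ε * ((t : ℝ) - s) := by
  have hprob := h.isProbabilityMeasure
  obtain ⟨r, hr, hloc⟩ := h.martingale g hg hgs ε hε
  refine ⟨r, hr, fun s t hst htr ι _ u hu f hf hf1 => ?_⟩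
  have hg2 : ContDiff ℝ 2 g := hg.of_le (WithTop.coe_le_coe.2 (le_top : (2 : ℕ∞) ≤ ⊤))
  have hgc := hg.continuous
  have hAc := continuous_generator h.continuous_drift h.continuous_diffusion hg2
  obtain ⟨M, hM⟩ := hgc.bounded_above_of_compact_support hgs
  obtain ⟨M', hM'⟩ := hAc.bounded_above_of_compact_support
    (hasCompactSupport_generator (b := b) (σ := σ) hgs)
  have hdt : Tendsto (fun n => ((dyadicFloor n t : ℚ≥0) : ℝ) - (dyadicFloor n s : ℚ≥0)) atTop
      (𝓝 ((t : ℝ) - s)) := (tendsto_dyadicFloor t).sub (tendsto_dyadicFloor s)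
  -- Dominated convergence along the dyadic approximations from below, which keep the order of the
  -- times.
  have hlim : Tendsto (fun n => ∫ x, (g (x (dyadicFloor n t)) - g (x (dyadicFloor n s))
      - (((dyadicFloor n t : ℚ≥0) : ℝ) - (dyadicFloor n s : ℚ≥0))
        * generator b σ g (x (dyadicFloor n s))) * f (fun i => x (dyadicFloor n (u i))) ∂μ) atTop
      (𝓝 (∫ x, (g (extension t x) - g (extension s x)
        - ((t : ℝ) - s) * generator b σ g (extension s x))
          * f (fun i => extension (u i) x) ∂μ)) := by
    refine tendsto_integral_of_dominated_convergence (fun _ => M + M + t * M')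
      (fun n => ?_) (integrable_const _) (fun n => ae_of_all _ fun x => ?_) ?_
    · have e1 : Continuous fun x : ℚ≥0 → Vec q => g (x (dyadicFloor n t)) :=
        hgc.comp (continuous_apply _)
      have e2 : Continuous fun x : ℚ≥0 → Vec q => g (x (dyadicFloor n s)) :=
        hgc.comp (continuous_apply _)
      have e3 : Continuous fun x : ℚ≥0 → Vec q => generator b σ g (x (dyadicFloor n s)) :=
        hAc.comp (continuous_apply _)
      have e4 : Continuous fun x : ℚ≥0 → Vec q => f (fun i => x (dyadicFloor n (u i))) :=
        hf.comp (continuous_pi fun i => continuous_apply _)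
      exact (((e1.sub e2).sub (continuous_const.mul e3)).mul e4).measurable.aestronglyMeasurable
    · rw [Real.norm_eq_abs, abs_mul]
      refine (mul_le_of_le_one_right (abs_nonneg _) (hf1 _)).trans ?_
      have h1 := abs_sub (g (x (dyadicFloor n t)) - g (x (dyadicFloor n s)))
        ((((dyadicFloor n t : ℚ≥0) : ℝ) - (dyadicFloor n s : ℚ≥0))
          * generator b σ g (x (dyadicFloor n s)))
      have h2 := abs_sub (g (x (dyadicFloor n t))) (g (x (dyadicFloor n s)))
      have h3 : |(((dyadicFloor n t : ℚ≥0) : ℝ) - (dyadicFloor n s : ℚ≥0))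
          * generator b σ g (x (dyadicFloor n s))| ≤ t * M' := by
        have e1 : ((dyadicFloor n s : ℚ≥0) : ℝ) ≤ (dyadicFloor n t : ℚ≥0) := by
          exact_mod_cast dyadicFloor_mono n hst
        have e2 := coe_dyadicFloor_le n t
        have e3 : (0 : ℝ) ≤ (dyadicFloor n s : ℚ≥0) := by positivity
        rw [abs_mul, abs_of_nonneg (sub_nonneg.2 e1)]
        exact mul_le_mul (by linarith) (hM' _) (abs_nonneg _) t.2
      have h4 : |g (x (dyadicFloor n t))| ≤ M := hM _
      have h5 : |g (x (dyadicFloor n s))| ≤ M := hM _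
      linarith
    · filter_upwards [h.ae_tendsto_extension] with x hx
      have e1 := (hgc.tendsto _).comp (hx t)
      have e2 := (hgc.tendsto _).comp (hx s)
      have e3 := (hAc.tendsto _).comp (hx s)
      have e4 := (hf.tendsto _).comp (tendsto_pi_nhds.2 fun i => hx (u i))
      exact ((e1.sub e2).sub (hdt.mul e3)).mul e4
  refine le_of_tendsto_of_tendsto hlim (hdt.const_mul ε) ?_
  filter_upwards [hdt.eventually (gt_mem_nhds (by linarith : (t : ℝ) - s < r))] with n hn
  exact hloc _ _ (dyadicFloor_mono n hst) (by linarith) ι _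
    (fun i => dyadicFloor_mono n (hu i)) f hf hf1

/-- The marginal law of a stationary solution of the martingale problem is invariant. -/
theorem IsRationalSolution.isInvariant (h : IsRationalSolution b σ μ C) :
    IsInvariant b σ (μ.map fun x => x 0) := by
  have hprob := h.isProbabilityMeasure
  refine ⟨Measure.isProbabilityMeasure_map (measurable_pi_apply 0).aemeasurable,
    ℚ≥0 → Vec q, inferInstance, μ, extension, hprob,
    ⟨fun t => (measurable_extension t).stronglyMeasurable, continuous_extension, ?_⟩,
    h.map_extension⟩
  intro g hg hgs
  have hg2 : ContDiff ℝ 2 g := hg.of_le (WithTop.coe_le_coe.2 (le_top : (2 : ℕ∞) ≤ ⊤))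
  have hAc := continuous_generator h.continuous_drift h.continuous_diffusion hg2
  obtain ⟨M, hM⟩ := hg.continuous.bounded_above_of_compact_support hgs
  obtain ⟨M', hM'⟩ := hAc.bounded_above_of_compact_support
    (hasCompactSupport_generator (b := b) (σ := σ) hgs)
  refine martingale_of_local _ continuous_extension hg.continuous hM hAc hM' fun ε hε => ?_
  obtain ⟨r, hr, hloc⟩ := h.exists_integral_extension_le hg hgs hε
  refine ⟨r, hr, fun s t hst htr ι _ u hu f hf hf1 => abs_le.2 ⟨?_, ?_⟩⟩
  · have h1 := hloc s t hst htr ι u hu (fun z => -f z) hf.neg (fun z => by rw [abs_neg]; exact hf1 z)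
    simp only [mul_neg, integral_neg] at h1
    linarith
  · exact hloc s t hst htr ι u hu f hf hf1

variable {Ω : Type*} {mΩ : MeasurableSpace Ω} {P : Measure Ω} {V : Vec q → ℝ} {c : ℝ}
  {γ : ℕ → ℝ} {U : ℕ → Ω → Vec ℓ} {Y : ℕ → Ω → Vec q} {p : ℕ} {W : Vec q → ℝ}

/-- The Lyapunov functions of the scheme are integrable with respect to the invariant distribution,
because they are bounded in mean along the scheme and the scheme has a limit in mean whose law is
invariant. -/
theorem IsSchemeLyapunov.integrable_invariant [IsProbabilityMeasure P]
    (hW : IsSchemeLyapunov P γ Y V p W) (hc : IsEulerChain P b σ γ U Y) (hγ : IsStepSequence γ)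
    (hsum : Tendsto (elapsed γ) atTop atTop) (hγlim : Tendsto γ atTop (𝓝 0))
    (h : HasSqrtGrowth b σ V c) (hVc : Continuous V) (hV1 : ∀ y, 1 ≤ V y)
    (hVt : Tendsto V (cocompact (Vec q)) atTop) (hp : 2 ≤ p) (hu : IsNormalized P (U 1) p)
    {ν : Measure (Vec q)} (hν : ∀ ν', IsInvariant b σ ν' → ν' = ν) : Integrable W ν := by
  obtain ⟨R, hR⟩ := hW.exists_integral_le hc.hist_le (fun n => (hγ.pos n).le) hγlim
  obtain ⟨D, hD0, hD⟩ := hW.dominates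
  have hV2 : ∀ y, V y ^ 2 ≤ D * W y := fun y =>
    (pow_le_pow_right₀ (hV1 y) (by omega)).trans (hD y)
  have hVi : ∀ n, Integrable (fun ω => V (Y n ω) ^ 2) P := fun n =>
    ((hW.integrable n).const_mul D).mono'
      ((hVc.measurable.comp (hc.measurable n)).pow_const 2).aestronglyMeasurable
      (ae_of_all _ fun ω => by
        rw [Real.norm_of_nonneg (by positivity)]
        exact hV2 _)
  have hVB : ∀ n, ∫ ω, V (Y n ω) ^ 2 ∂P ≤ D * R := fun n => by
    refine (integral_mono (hVi n) ((hW.integrable n).const_mul D) fun ω => hV2 _).trans ?_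
    rw [integral_const_mul]
    exact mul_le_mul_of_nonneg_left (hR n) hD0
  obtain ⟨μ, C, hμ, hμW⟩ := hc.exists_isRationalSolution hγ hsum hγlim h hVc hV1 hVt hp hu hVi hVB
  have h1 := hμW W hW.continuous (fun y => zero_le_one.trans (hW.one_le y)) R hW.integrable hR
  rw [← hν _ hμ.isInvariant]
  refine (integrable_map_measure hW.continuous.measurable.aestronglyMeasurable
    (measurable_pi_apply 0).aemeasurable).2 ⟨(hW.continuous.measurable.comp
      (measurable_pi_apply 0)).aestronglyMeasurable, ?_⟩
  refine (hasFiniteIntegral_iff_ofReal (ae_of_all _ fun x =>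
    zero_le_one.trans (hW.one_le _))).2 (h1.trans_lt ENNReal.ofReal_lt_top)

theorem tendsto_elapsed (hγsum : Tendsto (fun n => ∑ k ∈ Finset.Icc 1 n, γ k) atTop atTop) :
    Tendsto (elapsed γ) atTop atTop := by
  refine hγsum.congr fun n => ?_
  rw [elapsed, Finset.range_eq_Ico, Finset.sum_Ico_add' γ 0 n 1, zero_add]
  rfl

end Invariance

end StableEuler

end

theorem mainTheorem6 {q ℓ : ℕ} {Ω : Type*} [MeasurableSpace Ω] (P : Measure Ω)
    [IsProbabilityMeasure P]
    -- the diffusion, its Lyapunov function and its invariant distribution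
    (b : Vec q → Vec q) (σ : Vec q → Vec ℓ →L[ℝ] Vec q)
    (hb : ∃ K, LipschitzWith K b) (hσ : ∃ K, LipschitzWith K σ)
    (V : Vec q → ℝ) (hV : IsStronglyStable b σ V) (hVsub : IsSubquadratic V)
    (hgrowth : ∃ C : ℝ, ∀ y, ‖b y‖ ^ 2 + traceSq (σ y) ≤ C * V y)
    (ν : Measure (Vec q)) (hν : IsInvariant b σ ν)
    (hνunique : ∀ ν' : Measure (Vec q), IsInvariant b σ ν' → ν' = ν)
    -- the innovations and the initial value
    (U : ℕ → Ω → Vec ℓ) (hU : IsWhiteNoise P U)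
    (Y₀ : Ω → Vec q) (hY₀ : Measurable Y₀)
    (hindep : IndepFun Y₀ (fun ω (n : ℕ) => U (n + 1) ω) P)
    -- the steps
    (γ : ℕ → ℝ) (hγ : ∀ n ≥ 1, 0 ≤ γ n) (hγlim : Tendsto γ atTop (𝓝 0))
    (hγsum : Tendsto (fun n => ∑ k ∈ Finset.Icc 1 n, γ k) atTop atTop)
    (hγanti : ∀ n ≥ 1, γ (n + 1) ≤ γ n)
    (havg₁ : IsAveraging γ (fun _ => 1)) (havg₂ : IsAveraging γ (fun n => 1 / γ n)) :
    ∃ lam₀ : ℝ → ℝ, (∀ ζ, 0 < lam₀ ζ) ∧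
      ∀ p : ℕ, 2 ≤ p → MemLp (U 1) (2 * ((p : ENNReal) + 1)) P →
      ∀ W : Vec q → ℝ, IsAdmissible b σ V P γ U Y₀ p lam₀ W →
      ∀ f φ : Vec q → ℝ, φ ∈ poissonClass V W p →
        (∃ K, LipschitzWith K (iteratedFDeriv ℝ p φ)) →
        (∀ y, generator b σ φ y = -(f y - ∫ z, f z ∂ν)) →
      ∀ m : ℕ, m = qStar b σ P (U 1) φ p → m ≤ p →
        StepConditions γ ((m : ℝ) / 2 - 1) →
      ∀ ε : ℕ → ℝ, (∀ n, ε n = stepSum γ ((m : ℝ) / 2 - 1) n / n) →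
        f ∈ rateClass P (eulerScheme b σ γ U Y₀) ν ε 2 ∧ Tendsto ε atTop (𝓝 0) := by
  have hsteps := isStepSequence_of_tendsto hγ hγsum hγanti
  have hpos : ∀ n, 0 ≤ γ (n + 1) ∧ γ (n + 1) ≤ γ 1 := fun n =>
    ⟨hγ _ n.succ_pos, by
      induction n with
      | zero => exact le_rfl
      | succ n ih => exact (hγanti _ n.succ_pos).trans ih⟩
  obtain ⟨_, hb⟩ := hb
  obtain ⟨_, hσ⟩ := hσ
  have hc := isEulerChain_eulerScheme (γ := γ) hb.continuous hσ.continuous hU hY₀ hindep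
  obtain ⟨α, K, hLyap⟩ := exists_isLyapunovBound hV hVsub hgrowth
  obtain ⟨c, hsqrt⟩ := exists_hasSqrtGrowth hV.one_le hgrowth
  obtain ⟨lam₀, hlam₀, hthr⟩ := exists_threshold hLyap hc hpos hγlim
  refine ⟨lam₀, hlam₀, fun p hp hUp W hW f φ hφ hφL hpois m hm hmp hstep ε hε => ?_⟩
  have hu := isNormalized_of_isWhiteNoise hU hUp
  have hWL := hthr p (by omega) hu W hW
  have hVc := hV.contDiff.continuous
  have hprob := hν.1
  have hWν := hWL.integrable_invariant hc hsteps (tendsto_elapsed hγsum) hγlim hsqrt hVc hV.one_le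
    hV.tendsto hp hu hνunique
  exact mem_rateClass hWL hc hsteps hγlim hsqrt hVc hu hφ hφL hWν hpois hm hmp hstep hε
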